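/- **Setting.** Let $(\mathfrak g,K)$ be a reductive pair: $K$ is a compact Lie group whose Lie algebra $\mathfrak k_0$ is a subalgebra of a finite-dimensional reductive real Lie algebra $\mathfrak g_0$, $\mathfrak g=\mathfrak g_0\otimes_{\mathbf R}\mathbf C$, the group $K$ acts on $\mathfrak g_0$ by automorphisms $\mathrm{Ad}(k)$ which extend the adjoint action on $\mathfrak k_0$ and whose derivative is $\mathrm{ad}$; moreover there are given an involution $\theta$ of $\mathfrak g_0$ with fixed points $\mathfrak k_0$ and a symmetric bilinear form on $\mathfrak g_0$, invariant under $\mathrm{ad}$, $\mathrm{Ad}(K)$ and $\theta$, which is negative definite on the $1$-eigenspace and positive definite on the $(-1)$-eigenspace of $\theta$. A parabolic subalgebra $\mathfrak q\subseteq\mathfrak g$ (a subalgebra containing a Borel subalgebra) with nilpotent radical $\mathfrak u=[\mathfrak q,\mathrm{rad}\,\mathfrak q]$ is *germane* if it has a Levi factor $\mathfrak l$ (a complement of $\mathfrak u$ in $\mathfrak q$) which is the complexification of a $\theta$-stable real subalgebra $\mathfrak l_0\subseteq\mathfrak g_0$. Then $\mathfrak l_0=\mathfrak g_0\cap\mathfrak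 q\cap\theta(\mathfrak q)$; we write $L\cap K$ for the group of all $k\in K$ which normalize both $\mathfrak q$ and $\theta(\mathfrak q)$, and call $(\mathfrak q,L\cap K)$ a germane parabolic pair with Levi pair $(\mathfrak l,L\cap K)$. A $(\mathfrak g,K)$-module is a complex vector space with compatible actions of $\mathfrak g$ and of $K$, the latter locally finite and continuous with the action of $\mathfrak k_0$ as its derivative. For such a module $V$, the cohomology $H^q(\mathfrak u;V)$ of the standard complex $\mathrm{Hom}(\bigwedge^\bullet\mathfrak u,V)$ is an $(\mathfrak l,L\cap K)$-module. **Admissibility.** Let $\mathcal G$, $\mathcal L$ be full abelian subcategories, closed under isomorphisms, of the categories of $(\mathfrak g,K)$- and of $(\mathfrak l,L\cap K)$-modules. The pair $(\mathcal G,\mathcal L)$ is *$\mathfrak u$-admissible* if (i) $\mathcal G$ contains the trivial representation $\mathbf C$ and $\mathcal L$ contains all $\bigwedge^q\mathfrak u^*$; (ii) $\mathcal L$ is closed under tensor products with all $\bigwedge^q\mathfrak u^*$; (iii) $H^q(\mathfrak u;V)\in\mathcal L$ for all $V\in\mathcal G$ and all $q$. Then $[V]\mapsto\sum_q(-1)^q[H^q(\mathfrak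 u;V)]$ defines a homomorphism $H_{\mathfrak q}:K(\mathcal G)\to K(\mathcal L)$ of Grothendieck groups, and one may multiply elements of $K(\mathcal L)$ with the Weyl denominator $W_{\mathfrak q}=\sum_q(-1)^q[\bigwedge^q\mathfrak u^*]$. A quadruple $\mathcal Q=(\mathcal G,\mathcal L,K_{\mathcal G},K_{\mathcal L})$ with subgroups $K_{\mathcal G}\subseteq K(\mathcal G)$, $K_{\mathcal L}\subseteq K(\mathcal L)$ is *$\mathfrak u$-admissible* if $(\mathcal G,\mathcal L)$ is, $H_{\mathfrak q}(K_{\mathcal G})\subseteq K_{\mathcal L}$ and $W_{\mathfrak q}\cdot K_{\mathcal L}\subseteq K_{\mathcal L}$. In that case let $C_{\mathfrak q}(\mathcal Q)=K_{\mathcal L}[W_{\mathfrak q}^{-1}]$ and define the algebraic character $$c_{\mathfrak q}:K_{\mathcal G}\to C_{\mathfrak q}(\mathcal Q),\qquad c_{\mathfrak q}(X)=H_{\mathfrak q}(X)/W_{\mathfrak q}.$$ **Proposition 1.6.** Let $(\mathfrak p,M\cap K)\subseteq(\mathfrak q,L\cap K)$ be germane parabolic pairs of $(\mathfrak g,K)$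 (that is, $\mathfrak p\subseteq\mathfrak q$ and $M\cap K\subseteq L\cap K$) with Levi pairs $(\mathfrak m,M\cap K)$, $(\mathfrak l,L\cap K)$ and nilpotent radicals $\mathfrak n$, $\mathfrak u$ respectively. Let $(\mathcal G,\mathcal L)$, $(\mathcal L,\mathcal M)$ and $(\mathcal G,\mathcal M)$ be $\mathfrak u$-, $\mathfrak n\cap\mathfrak l$- and $\mathfrak n$-admissible pairs of categories of $(\mathfrak g,K)$-, $(\mathfrak l,L\cap K)$- and $(\mathfrak m,M\cap K)$-modules, where $\mathfrak n\cap\mathfrak l$ is the nilpotent radical of the parabolic subalgebra $\mathfrak p\cap\mathfrak l$ of $\mathfrak l$, and let the quadruples $\mathcal Q=(\mathcal G,\mathcal L,K_{\mathcal G},K_{\mathcal L})$, $\mathcal Q'=(\mathcal L,\mathcal M,K_{\mathcal L},K_{\mathcal M})$ and $\mathcal Q''=(\mathcal G,\mathcal M,K_{\mathcal G},K_{\mathcal M})$ be $\mathfrak u$-, $\mathfrak n\cap\mathfrak l$- and $\mathfrak n$-admissible respectively. Then the character $c_{\mathfrak p\cap\mathfrak l}:K_{\mathcal L}\to C_{\mathfrak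 p\cap\mathfrak l}(\mathcal Q')$ has a unique natural extension $\hat c_{\mathfrak p\cap\mathfrak l}:C_{\mathfrak q}(\mathcal Q)\to C_{\mathfrak p}(\mathcal Q'')$, and $$c_{\mathfrak p}=\hat c_{\mathfrak p\cap\mathfrak l}\circ c_{\mathfrak q}.$$ Here a homomorphism $\hat c:C_{\mathfrak q}(\mathcal Q)\to C_{\mathfrak p}(\mathcal Q'')$ is called a natural extension of $c_{\mathfrak p\cap\mathfrak l}$ if it * extends $c_{\mathfrak p\cap\mathfrak l}$: if $Y\in K_{\mathcal L}$ and $c_{\mathfrak p\cap\mathfrak l}(Y)=Z/W_{\mathfrak p\cap\mathfrak l}^k$ with $Z\in K_{\mathcal M}$, then $W_{\mathfrak p\cap\mathfrak l}^k\cdot\hat c(Y)=Z$ in $C_{\mathfrak p}(\mathcal Q'')$; * is compatible with the denominators, where $W_{\mathfrak p}=W_{\mathfrak p\cap\mathfrak l}\cdot W_{\mathfrak q}|_{\mathfrak m,M\cap K}$: for all $z\in C_{\mathfrak q}(\mathcal Q)$, $W_{\mathfrak p\cap\mathfrak l}\cdot\hat c(W_{\mathfrak q}\cdot z)=W_{\mathfrak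 p}\cdot\hat c(z)$. -/

import Mathlib

open scoped TensorProduct Manifold
set_option linter.unusedSectionVars false
universe u

noncomputable section
namespace RelChar

/-! ### Alternating cochains -/

section Alternating

variable {U V W : Type*} [AddCommGroup U] [Module ℂ U] [AddCommGroup V] [Module ℂ V]
  [AddCommGroup W] [Module ℂ W] {n : ℕ}

/-- `altDer A ω (x₁, …, xₙ) = ∑ᵢ ω (x₁, …, A xᵢ, …, xₙ)`. -/
def altDer (A : Module.End ℂ U) (ω : U [⋀^Fin n]→ₗ[ℂ] V) : U [⋀^Fin n]→ₗ[ℂ] V where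
  toMultilinearMap := ∑ i : Fin n, ω.toMultilinearMap.compLinearMap
    (fun j => if j = i then A else LinearMap.id)
  map_eq_zero_of_eq' := by
    intro v a b hab hne
    have key : ∀ i : Fin n, (fun j => (if j = i then A else LinearMap.id : U →ₗ[ℂ] U) (v j))
        = Function.update v i (A (v i)) := by
      intro i; funext j
      by_cases h : j = i
      · subst h; simp
      · simp [h]
    simp only [MultilinearMap.toFun_eq_coe, sum_apply,
      MultilinearMap.compLinearMap_apply, key, AlternatingMap.coe_multilinearMap]
    rw [Fintype.sum_eq_add a b hne]
    · have h2 : Function.update v b (A (v b))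
          = Function.update v a (A (v a)) ∘ Equiv.swap a b := by
        funext j
        by_cases hja : j = a
        · subst hja; simp [hne, hne.symm, hab]
        · by_cases hjb : j = b
          · subst hjb; simp [hab]
          · simp [Equiv.swap_apply_of_ne_of_ne hja hjb, hja, hjb]
      rw [h2, ω.map_swap _ hne, add_neg_cancel]
    · rintro i ⟨hia, hib⟩
      exact ω.map_eq_zero_of_eq _ (by simp [Ne.symm hia, Ne.symm hib, hab]) hne

theorem altDer_apply (A : Module.End ℂ U) (ω : U [⋀^Fin n]→ₗ[ℂ] V) (v : Fin n → U) :
    altDer A ω v = ∑ i, ω (Function.update v i (A (v i))) := by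
  have key : ∀ i : Fin n, (fun j => (if j = i then A else LinearMap.id : U →ₗ[ℂ] U) (v j))
      = Function.update v i (A (v i)) := by
    intro i; funext j
    by_cases h : j = i
    · subst h; simp
    · simp [h]
  change (∑ i : Fin n, ω.toMultilinearMap.compLinearMap
    (fun j => if j = i then A else LinearMap.id)) v = _
  simp only [sum_apply, MultilinearMap.compLinearMap_apply, key,
    AlternatingMap.coe_multilinearMap]

theorem altDer_add_left (A B : Module.End ℂ U) (ω : U [⋀^Fin n]→ₗ[ℂ] V) :
    altDer (A + B) ω = altDer A ω + altDer B ω := by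
  ext v
  simp [altDer_apply, Finset.sum_add_distrib]

theorem altDer_smul_left (c : ℂ) (A : Module.End ℂ U) (ω : U [⋀^Fin n]→ₗ[ℂ] V) :
    altDer (c • A) ω = c • altDer A ω := by
  ext v
  simp [altDer_apply, Finset.smul_sum]

theorem altDer_add (A : Module.End ℂ U) (ω η : U [⋀^Fin n]→ₗ[ℂ] V) :
    altDer A (ω + η) = altDer A ω + altDer A η := by
  ext v
  simp [altDer_apply, Finset.sum_add_distrib]

theorem altDer_smul (c : ℂ) (A : Module.End ℂ U) (ω : U [⋀^Fin n]→ₗ[ℂ] V) :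
    altDer A (c • ω) = c • altDer A ω := by
  ext v
  simp [altDer_apply, Finset.smul_sum]

theorem altDer_sub (A : Module.End ℂ U) (ω η : U [⋀^Fin n]→ₗ[ℂ] V) :
    altDer A (ω - η) = altDer A ω - altDer A η := by
  ext v
  simp [altDer_apply]

theorem altDer_comp (T : V →ₗ[ℂ] W) (A : Module.End ℂ U) (ω : U [⋀^Fin n]→ₗ[ℂ] V) :
    altDer A (T.compAlternatingMap ω) = T.compAlternatingMap (altDer A ω) := by
  ext v
  simp [altDer_apply]

theorem altDer_comm (A B : Module.End ℂ U) (ω : U [⋀^Fin n]→ₗ[ℂ] V) :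
    altDer A (altDer B ω) - altDer B (altDer A ω) = altDer (B * A - A * B) ω := by
  have key : ∀ (A B : Module.End ℂ U) (v : Fin n → U), altDer A (altDer B ω) v
      = (∑ i, ω (Function.update v i (B (A (v i)))))
        + ∑ i, ∑ j ∈ Finset.univ.erase i,
          ω (Function.update (Function.update v i (A (v i))) j (B (v j))) := by
    intro A B v
    simp only [altDer_apply]
    rw [← Finset.sum_add_distrib]
    refine Finset.sum_congr rfl fun i _ => ?_
    rw [← Finset.add_sum_erase _ _ (Finset.mem_univ i)]
    congr 1
    · simp
    · refine Finset.sum_congr rfl fun j hj => ?_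
      rw [Function.update_of_ne (Finset.ne_of_mem_erase hj)]
  ext v
  rw [AlternatingMap.sub_apply, key A B, key B A, altDer_apply]
  have hsw : ∑ i, ∑ j ∈ Finset.univ.erase i,
        ω (Function.update (Function.update v i (A (v i))) j (B (v j)))
      = ∑ i, ∑ j ∈ Finset.univ.erase i,
        ω (Function.update (Function.update v i (B (v i))) j (A (v j))) := by
    rw [Finset.sum_comm' (t' := Finset.univ) (s' := fun j => Finset.univ.erase j)]
    · refine Finset.sum_congr rfl fun i _ => Finset.sum_congr rfl fun j hj => ?_
      rw [Function.update_comm (Finset.ne_of_mem_erase hj)]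
    · intro i j
      simp [eq_comm]
  rw [hsw, add_sub_add_right_eq_sub, ← Finset.sum_sub_distrib]
  refine Finset.sum_congr rfl fun i _ => ?_
  rw [← ω.map_update_sub]
  rfl

theorem altDer_alternatize (A : Module.End ℂ U) (f : U →ₗ[ℂ] U [⋀^Fin n]→ₗ[ℂ] V)
    (f' : U →ₗ[ℂ] U [⋀^Fin n]→ₗ[ℂ] V) (hf : ∀ y, f' y = altDer A (f y) + f (A y)) :
    altDer A (AlternatingMap.alternatizeUncurryFin f)
      = AlternatingMap.alternatizeUncurryFin f' := by
  ext v
  simp only [altDer_apply, AlternatingMap.alternatizeUncurryFin_apply, hf,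
    AlternatingMap.add_apply, smul_add, Finset.smul_sum]
  rw [Finset.sum_comm]
  refine Finset.sum_congr rfl fun i _ => ?_
  rw [Fin.sum_univ_succAbove _ i, add_comm]
  congr 1
  · refine Finset.sum_congr rfl fun j _ => ?_
    rw [Function.update_of_ne (Fin.succAbove_ne i j).symm]
    congr 2
    funext k
    simp only [Fin.removeNth]
    by_cases h : k = j
    · subst h; simp
    · rw [Function.update_of_ne h, Function.update_of_ne
        (fun hh => h (Fin.succAbove_right_injective hh))]
      rfl
  · rw [Function.update_self]
    congr 2
    funext k
    simp [Fin.removeNth, Fin.succAbove_ne i k]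

end Alternating

/-! ### The Chevalley–Eilenberg differential -/

section Differential

variable {𝔲 V W : Type*} [LieRing 𝔲] [LieAlgebra ℂ 𝔲] [AddCommGroup V] [Module ℂ V]
  [AddCommGroup W] [Module ℂ W] {n : ℕ}

/-- `adEnd y z = [y, z]`. -/
def adEnd (y : 𝔲) : Module.End ℂ 𝔲 where
  toFun z := ⁅y, z⁆
  map_add' := lie_add y
  map_smul' c z := lie_smul c y z

/-- The integrand of the differential: `y ↦ y · ω - ½ ω([y, -], …) - … - ½ ω(…, [y, -])`. -/
def ceFamily (ρ : 𝔲 →ₗ[ℂ] Module.End ℂ V) (ω : 𝔲 [⋀^Fin n]→ₗ[ℂ] V) :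
    𝔲 →ₗ[ℂ] 𝔲 [⋀^Fin n]→ₗ[ℂ] V where
  toFun y := (ρ y).compAlternatingMap ω - (1 / 2 : ℂ) • altDer (adEnd y) ω
  map_add' y z := by
    have : adEnd (y + z) = adEnd y + adEnd z := by ext; simp [adEnd]
    rw [this, altDer_add_left]
    ext v
    simp
    ring_nf
    module
  map_smul' c y := by
    have : adEnd (c • y) = c • adEnd y := by ext; simp [adEnd]
    rw [this, altDer_smul_left]
    ext v
    simp [smul_sub, smul_smul, mul_comm]

/-- The Chevalley–Eilenberg differential
`dω (x₀, …, xₙ) = ∑ᵢ (-1)ⁱ xᵢ ω(…, x̂ᵢ, …) + ∑_{i < j} (-1)^{i + j} ω([xᵢ, xⱼ], …, x̂ᵢ, …, x̂ⱼ, …)`.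
The second sum is written as `-½ ∑ᵢ (-1)ⁱ ∑_{j ≠ i} ω(x₀, …, x̂ᵢ, …, [xᵢ, xⱼ], …)`, with `[xᵢ, xⱼ]` in
the place of `xⱼ`, in which every pair of indices occurs twice. -/
def ceD (ρ : 𝔲 →ₗ[ℂ] Module.End ℂ V) (n : ℕ) :
    (𝔲 [⋀^Fin n]→ₗ[ℂ] V) →ₗ[ℂ] (𝔲 [⋀^Fin (n + 1)]→ₗ[ℂ] V) where
  toFun ω := AlternatingMap.alternatizeUncurryFin (ceFamily ρ ω)
  map_add' ω η := by
    rw [← AlternatingMap.alternatizeUncurryFin_add]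
    congr 1
    ext y v
    simp [ceFamily, altDer_add]
    module
  map_smul' c ω := by
    rw [RingHom.id_apply, ← AlternatingMap.alternatizeUncurryFin_smul]
    congr 1
    ext y v
    simp [ceFamily, altDer_smul]
    module

theorem ceD_apply (ρ : 𝔲 →ₗ[ℂ] Module.End ℂ V) (ω : 𝔲 [⋀^Fin n]→ₗ[ℂ] V) (x : Fin (n + 1) → 𝔲) :
    ceD ρ n ω x = ∑ i : Fin (n + 1), (-1 : ℤ) ^ (i : ℕ) • (ρ (x i) (ω (i.removeNth x))
      - (1 / 2 : ℂ) • ∑ j : Fin n, ω (Function.update (i.removeNth x) j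
          ⁅x i, i.removeNth x j⁆)) := by
  simp only [ceD, LinearMap.coe_mk, AddHom.coe_mk, AlternatingMap.alternatizeUncurryFin_apply]
  refine Finset.sum_congr rfl fun i _ => ?_
  simp [ceFamily, altDer_apply, adEnd]

/-- Naturality in the coefficients and in the Lie algebra. -/
theorem ceD_natural {𝔲' : Type*} [LieRing 𝔲'] [LieAlgebra ℂ 𝔲'] (ρ : 𝔲 →ₗ[ℂ] Module.End ℂ V)
    (ρ' : 𝔲' →ₗ[ℂ] Module.End ℂ W) (T : V →ₗ[ℂ] W) (A : 𝔲' →ₗ[ℂ] 𝔲)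
    (hA : ∀ x y, A ⁅x, y⁆ = ⁅A x, A y⁆) (hT : ∀ x v, T (ρ (A x) v) = ρ' x (T v))
    (ω : 𝔲 [⋀^Fin n]→ₗ[ℂ] V) :
    ceD ρ' n (T.compAlternatingMap (ω.compLinearMap A))
      = T.compAlternatingMap ((ceD ρ n ω).compLinearMap A) := by
  ext x
  simp only [LinearMap.compAlternatingMap_apply, AlternatingMap.compLinearMap_apply, ceD_apply,
    map_sum, map_zsmul, map_sub, map_smul, hT]
  refine Finset.sum_congr rfl fun i _ => ?_
  congr 2
  congr 1
  refine Finset.sum_congr rfl fun j _ => ?_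
  congr 2
  funext k
  by_cases h : k = j
  · subst h; simp [hA, Fin.removeNth]
  · simp [h, Fin.removeNth]

/-- Infinitesimal naturality. -/
theorem ceD_derivation (ρ : 𝔲 →ₗ[ℂ] Module.End ℂ V) (T : Module.End ℂ V) (A : Module.End ℂ 𝔲)
    (hA : ∀ x y, A ⁅x, y⁆ = ⁅A x, y⁆ + ⁅x, A y⁆)
    (hT : ∀ x v, T (ρ x v) = ρ x (T v) + ρ (A x) v) (ω : 𝔲 [⋀^Fin n]→ₗ[ℂ] V) :
    ceD ρ n (T.compAlternatingMap ω - altDer A ω)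
      = T.compAlternatingMap (ceD ρ n ω) - altDer A (ceD ρ n ω) := by
  have h1 : altDer A (ceD ρ n ω) = AlternatingMap.alternatizeUncurryFin
      (T.compAlternatingMapₗ ℂ ∘ₗ ceFamily ρ ω
        - ceFamily ρ (T.compAlternatingMap ω - altDer A ω)) := by
    refine altDer_alternatize A _ _ fun y => ?_
    have h2 := altDer_comm A (adEnd y) ω
    have h3 : adEnd y * A - A * adEnd y = - adEnd (A y) := by
      ext z
      simp [adEnd, hA]
    have h4 : altDer (-adEnd (A y)) ω = - altDer (adEnd (A y)) ω := by
      ext v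
      simp [altDer_apply]
    rw [h3, h4] at h2
    have h5 : T.compAlternatingMap ((ρ y).compAlternatingMap ω)
        = (ρ y).compAlternatingMap (T.compAlternatingMap ω)
          + (ρ (A y)).compAlternatingMap ω := by
      ext v; simp [hT]
    have h6 : ∀ (S : Module.End ℂ V) (a b : 𝔲 [⋀^Fin n]→ₗ[ℂ] V),
        S.compAlternatingMap (a - b) = S.compAlternatingMap a - S.compAlternatingMap b := by
      intro S a b; ext v; simp
    have h7 : ∀ (S : Module.End ℂ V) (c : ℂ) (a : 𝔲 [⋀^Fin n]→ₗ[ℂ] V),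
        S.compAlternatingMap (c • a) = c • S.compAlternatingMap a := by
      intro S c a; ext v; simp
    have h2' := sub_eq_iff_eq_add.1 h2
    simp only [LinearMap.sub_apply, LinearMap.comp_apply, LinearMap.compAlternatingMapₗ_apply,
      ceFamily, LinearMap.coe_mk, AddHom.coe_mk, h6, h7, altDer_sub, altDer_smul, altDer_comp,
      h5, h2']
    module
  have h8 : T.compAlternatingMap (ceD ρ n ω) = AlternatingMap.alternatizeUncurryFin
      (T.compAlternatingMapₗ ℂ ∘ₗ ceFamily ρ ω) := by
    ext v
    simp [ceD, AlternatingMap.alternatizeUncurryFin_apply]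
  rw [h1, h8]
  ext v
  simp [ceD, AlternatingMap.alternatizeUncurryFin_apply, smul_sub]

/-- Cartan's formula. -/
theorem ceD_cartan (ρ : 𝔲 →ₗ[ℂ] Module.End ℂ V) (x : 𝔲) (ω : 𝔲 [⋀^Fin (n + 1)]→ₗ[ℂ] V) :
    (ceD ρ (n + 1) ω).curryLeft x + ceD ρ n (ω.curryLeft x)
      = (ρ x).compAlternatingMap ω - altDer (adEnd x) ω := by
  have hι : ∀ (y : 𝔲) (v : Fin n → 𝔲), altDer (adEnd y) ω (Matrix.vecCons x v)
      = ω (Matrix.vecCons ⁅y, x⁆ v) + altDer (adEnd y) (ω.curryLeft x) v := by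
    intro y v
    rw [altDer_apply, altDer_apply, Fin.sum_univ_succ]
    congr 1
    · congr 1
      funext k
      refine Fin.cases ?_ (fun k => ?_) k <;> simp [adEnd]
    · refine Finset.sum_congr rfl fun j _ => ?_
      rw [AlternatingMap.curryLeft_apply_apply]
      congr 1
      funext k
      refine Fin.cases ?_ (fun k => ?_) k
      · simp [(Fin.succ_ne_zero j).symm]
      · by_cases h : k = j
        · subst h; simp
        · simp [h]
  have hsum : ∀ v : Fin (n + 1) → 𝔲, ∑ i : Fin (n + 1), (-1 : ℤ) ^ (i : ℕ) •
      ω (Matrix.vecCons ⁅v i, x⁆ (i.removeNth v)) = - altDer (adEnd x) ω v := by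
    intro v
    rw [altDer_apply, ← Finset.sum_neg_distrib]
    refine Finset.sum_congr rfl fun i _ => ?_
    rw [← AlternatingMap.map_insertNth, ← lie_skew, Fin.insertNth_removeNth,
      AlternatingMap.map_update_neg]
    rfl
  ext v
  have hr : ∀ i : Fin (n + 1), Fin.removeNth i.succ (Matrix.vecCons x v)
      = Matrix.vecCons x (i.removeNth v) := by
    intro i
    funext k
    refine Fin.cases ?_ (fun k => ?_) k <;> simp [Fin.removeNth]
  have e1 : (ceD ρ (n + 1) ω).curryLeft x v = ρ x (ω v) - (1 / 2 : ℂ) • altDer (adEnd x) ω v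
      - ∑ i : Fin (n + 1), (-1 : ℤ) ^ (i : ℕ) • (ρ (v i) (ω (Matrix.vecCons x (i.removeNth v)))
        - (1 / 2 : ℂ) • (ω (Matrix.vecCons ⁅v i, x⁆ (i.removeNth v))
          + altDer (adEnd (v i)) (ω.curryLeft x) (i.removeNth v))) := by
    simp only [AlternatingMap.curryLeft_apply_apply, ceD, LinearMap.coe_mk, AddHom.coe_mk,
      AlternatingMap.alternatizeUncurryFin_apply]
    rw [Fin.sum_univ_succ, sub_eq_add_neg _ (Finset.sum _ _), ← Finset.sum_neg_distrib]
    congr 1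
    · simp [ceFamily]
    · refine Finset.sum_congr rfl fun i _ => ?_
      rw [hr]
      simp [ceFamily, hι, pow_succ]
  have e2 : ceD ρ n (ω.curryLeft x) v = ∑ i : Fin (n + 1), (-1 : ℤ) ^ (i : ℕ) •
      (ρ (v i) (ω (Matrix.vecCons x (i.removeNth v)))
        - (1 / 2 : ℂ) • altDer (adEnd (v i)) (ω.curryLeft x) (i.removeNth v)) := by
    simp only [ceD, LinearMap.coe_mk, AddHom.coe_mk,
      AlternatingMap.alternatizeUncurryFin_apply, ceFamily]
    rfl
  have e3 : ∑ i : Fin (n + 1), (-1 : ℤ) ^ (i : ℕ) • (ρ (v i) (ω (Matrix.vecCons x (i.removeNth v)))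
        - (1 / 2 : ℂ) • (ω (Matrix.vecCons ⁅v i, x⁆ (i.removeNth v))
          + altDer (adEnd (v i)) (ω.curryLeft x) (i.removeNth v)))
      = ceD ρ n (ω.curryLeft x) v + (1 / 2 : ℂ) • altDer (adEnd x) ω v := by
    rw [← neg_neg (altDer (adEnd x) ω v), ← hsum, e2, smul_neg, Finset.smul_sum,
      ← sub_eq_add_neg, ← Finset.sum_sub_distrib]
    refine Finset.sum_congr rfl fun i _ => ?_
    module
  rw [AlternatingMap.add_apply, e1, e3, AlternatingMap.sub_apply,
    LinearMap.compAlternatingMap_apply]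
  module

theorem alt_ext_curry {ω η : 𝔲 [⋀^Fin (n + 1)]→ₗ[ℂ] V}
    (h : ∀ x, ω.curryLeft x = η.curryLeft x) : ω = η := by
  ext v
  have := congrArg (fun f => f (Fin.tail v)) (h (v 0))
  simpa [AlternatingMap.curryLeft_apply_apply, Matrix.vecCons, Fin.cons_self_tail] using this

theorem ceD_ceD (ρ : 𝔲 →ₗ[ℂ] Module.End ℂ V)
    (hρ : ∀ x y v, ρ ⁅x, y⁆ v = ρ x (ρ y v) - ρ y (ρ x v)) (ω : 𝔲 [⋀^Fin n]→ₗ[ℂ] V) :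
    ceD ρ (n + 1) (ceD ρ n ω) = 0 := by
  have comm : ∀ (m : ℕ) (x : 𝔲) (ω : 𝔲 [⋀^Fin m]→ₗ[ℂ] V),
      ceD ρ m ((ρ x).compAlternatingMap ω - altDer (adEnd x) ω)
        = (ρ x).compAlternatingMap (ceD ρ m ω) - altDer (adEnd x) (ceD ρ m ω) := by
    intro m x ω
    refine ceD_derivation ρ (ρ x) (adEnd x) (fun y z => ?_) (fun y v => ?_) ω
    · simp [adEnd]
    · simp [adEnd, hρ]
  induction n with
  | zero =>
    refine alt_ext_curry fun x => ?_
    have h1 := ceD_cartan ρ x (ceD ρ 0 ω)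
    have h2 : (ceD ρ 0 ω).curryLeft x = (ρ x).compAlternatingMap ω - altDer (adEnd x) ω := by
      ext v
      rw [AlternatingMap.curryLeft_apply_apply, ceD_apply]
      simp [altDer_apply, Fin.removeNth]
    rw [h2, comm] at h1
    simpa using h1
  | succ n ih =>
    refine alt_ext_curry fun x => ?_
    have h1 := ceD_cartan ρ x (ceD ρ (n + 1) ω)
    have h2 := ceD_cartan ρ x ω
    rw [← eq_sub_iff_add_eq] at h2
    rw [h2, map_sub, ih, comm] at h1
    simpa using h1

end Differential
/-! ### Pairs and Harish-Chandra modules -/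

/-- A pair `(𝔤, K)`: a complex Lie algebra `𝔤` and a topological group `K` acting on `𝔤` through
`Ad`; `IsTangent γ X` says that `X ∈ 𝔤` is (the image in `𝔤` of) the tangent vector `γ'(0)` of the
continuous one-parameter subgroup `γ` of `K`. The derivative of `Ad` along `γ` is `ad X`. -/
structure LiePair (𝔤 K : Type*) [LieRing 𝔤] [LieAlgebra ℂ 𝔤] [Group K] [TopologicalSpace K]
    [IsTopologicalGroup K] where
  Ad : Representation ℂ K 𝔤
  Ad_lie : ∀ k x y, Ad k ⁅x, y⁆ = ⁅Ad k x, Ad k y⁆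
  IsTangent : (Multiplicative ℝ →ₜ* K) → 𝔤 → Prop
  continuous_Ad : ∀ (x : 𝔤) (f : Module.Dual ℂ 𝔤), Continuous fun k => f (Ad k x)
  hasDerivAt_Ad : ∀ γ X, IsTangent γ X → ∀ (y : 𝔤) (f : Module.Dual ℂ 𝔤),
    HasDerivAt (fun t : ℝ => f (Ad (γ (.ofAdd t)) y)) (f ⁅X, y⁆) 0

section HCAction

variable {𝔤 K : Type*} [LieRing 𝔤] [LieAlgebra ℂ 𝔤] [Group K] [TopologicalSpace K]
  [IsTopologicalGroup K]

/-- The axioms of a `(𝔤, K)`-module for a `𝔤`-action `rep` and a `K`-action `act`: the actions are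
compatible through `Ad`, `K` acts locally finitely and continuously, and the derivative of the
action of `K` is the action of its Lie algebra. As the action is locally finite, the last two
conditions may be expressed through matrix coefficients. -/
structure IsHCAction (P : LiePair 𝔤 K) {V : Type*} [AddCommGroup V] [Module ℂ V]
    (rep : 𝔤 →ₗ[ℂ] Module.End ℂ V) (act : Representation ℂ K V) : Prop where
  rep_lie : ∀ x y v, rep ⁅x, y⁆ v = rep x (rep y v) - rep y (rep x v)
  act_rep : ∀ k x v, act k (rep x v) = rep (P.Ad k x) (act k v)
  locallyFinite : ∀ v, FiniteDimensional ℂ (Submodule.span ℂ (Set.range fun k => act k v))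
  continuous : ∀ (v : V) (f : Module.Dual ℂ V), Continuous fun k => f (act k v)
  hasDerivAt : ∀ γ X, P.IsTangent γ X → ∀ (v : V) (f : Module.Dual ℂ V),
    HasDerivAt (fun t : ℝ => f (act (γ (.ofAdd t)) v)) (f (rep X v)) 0

variable {P : LiePair 𝔤 K} {V W : Type*} [AddCommGroup V] [Module ℂ V] [AddCommGroup W] [Module ℂ W]
  {repV : 𝔤 →ₗ[ℂ] Module.End ℂ V} {actV : Representation ℂ K V}
  {repW : 𝔤 →ₗ[ℂ] Module.End ℂ W} {actW : Representation ℂ K W}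

theorem IsHCAction.of_injective (hW : IsHCAction P repW actW) (i : V →ₗ[ℂ] W)
    (hi : Function.Injective i) (hrep : ∀ x v, i (repV x v) = repW x (i v))
    (hact : ∀ k v, i (actV k v) = actW k (i v)) : IsHCAction P repV actV where
  rep_lie x y v := hi (by simp [hrep, hW.rep_lie])
  act_rep k x v := hi (by simp [hrep, hact, hW.act_rep])
  locallyFinite v := by
    have := hW.locallyFinite (i v)
    have h : (Submodule.span ℂ (Set.range fun k => actV k v)).map i
        = Submodule.span ℂ (Set.range fun k => actW k (i v)) := by
      rw [Submodule.map_span, ← Set.range_comp]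
      congr 2
      funext k
      exact hact k v
    have e := Submodule.equivMapOfInjective i hi (Submodule.span ℂ (Set.range fun k => actV k v))
    rw [h] at e
    exact Module.Finite.equiv e.symm
  continuous v f := by
    obtain ⟨r, hr⟩ := i.exists_leftInverse_of_injective (LinearMap.ker_eq_bot.2 hi)
    have hr' : ∀ v, r (i v) = v := fun v => LinearMap.congr_fun hr v
    have := hW.continuous (i v) (f ∘ₗ r)
    simpa [← hact, hr'] using this
  hasDerivAt γ X h v f := by
    obtain ⟨r, hr⟩ := i.exists_leftInverse_of_injective (LinearMap.ker_eq_bot.2 hi)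
    have hr' : ∀ v, r (i v) = v := fun v => LinearMap.congr_fun hr v
    have := hW.hasDerivAt γ X h (i v) (f ∘ₗ r)
    simpa [← hact, ← hrep, hr'] using this

theorem IsHCAction.of_surjective (hV : IsHCAction P repV actV) (p : V →ₗ[ℂ] W)
    (hp : Function.Surjective p) (hrep : ∀ x v, p (repV x v) = repW x (p v))
    (hact : ∀ k v, p (actV k v) = actW k (p v)) : IsHCAction P repW actW where
  rep_lie x y w := by
    obtain ⟨v, rfl⟩ := hp w
    simp [← hrep, hV.rep_lie]
  act_rep k x w := by
    obtain ⟨v, rfl⟩ := hp w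
    simp [← hrep, ← hact, hV.act_rep]
  locallyFinite w := by
    obtain ⟨v, rfl⟩ := hp w
    have := hV.locallyFinite v
    have h : (Submodule.span ℂ (Set.range fun k => actV k v)).map p
        = Submodule.span ℂ (Set.range fun k => actW k (p v)) := by
      rw [Submodule.map_span, ← Set.range_comp]
      congr 2
      funext k
      exact hact k v
    rw [← h]
    infer_instance
  continuous w f := by
    obtain ⟨v, rfl⟩ := hp w
    simpa [← hact] using hV.continuous v (f ∘ₗ p)
  hasDerivAt γ X h w f := by
    obtain ⟨v, rfl⟩ := hp w
    simpa [← hact, ← hrep] using hV.hasDerivAt γ X h v (f ∘ₗ p)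

/-- The span of the orbit of `v` is stable under the Lie algebra of `K`. -/
theorem IsHCAction.rep_mem_span (hV : IsHCAction P repV actV) {γ X} (h : P.IsTangent γ X) (v : V) :
    repV X v ∈ Submodule.span ℂ (Set.range fun k => actV k v) := by
  by_contra hv
  obtain ⟨f, hf, hf'⟩ := Submodule.exists_le_ker_of_notMem hv
  refine hf ?_
  have h1 := hV.hasDerivAt γ X h v f
  have h2 : (fun t : ℝ => f (actV (γ (.ofAdd t)) v)) = fun _ => 0 := by
    funext t
    exact hf' (Submodule.subset_span ⟨_, rfl⟩)
  rw [h2] at h1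
  exact h1.unique (hasDerivAt_const _ _)

/-- The action of `𝔤` on `Hom(V, W)`. -/
def homRep (repV : 𝔤 →ₗ[ℂ] Module.End ℂ V) (repW : 𝔤 →ₗ[ℂ] Module.End ℂ W) :
    𝔤 →ₗ[ℂ] Module.End ℂ (V →ₗ[ℂ] W) where
  toFun x :=
    { toFun := fun f => repW x ∘ₗ f - f ∘ₗ repV x
      map_add' := fun f g => by ext v; simp; abel
      map_smul' := fun c f => by ext v; simp [smul_sub] }
  map_add' x y := by ext f v; simp; abel
  map_smul' c x := by ext f v; simp [smul_sub]

/-- The action of `K` on `Hom(V, W)`. -/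
def homAct (actV : Representation ℂ K V) (actW : Representation ℂ K W) :
    Representation ℂ K (V →ₗ[ℂ] W) where
  toFun k :=
    { toFun := fun f => actW k ∘ₗ f ∘ₗ actV k⁻¹
      map_add' := fun f g => by ext v; simp
      map_smul' := fun c f => by ext v; simp }
  map_one' := by ext f v; simp
  map_mul' k l := by ext f v; simp

theorem IsHCAction.hom [FiniteDimensional ℂ V]
    (hV : IsHCAction P repV actV) (hW : IsHCAction P repW actW) :
    IsHCAction P (homRep repV repW) (homAct actV actW) := by
  classical
  let b := Module.finBasis ℂ V
  -- expansion of `k f` in matrix coefficients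
  have expand : ∀ (k : K) (f : V →ₗ[ℂ] W), homAct actV actW k f
      = ∑ i, ∑ j, (b.coord j (actV k⁻¹ (b i))) • (b.coord i).smulRight (actW k (f (b j))) := by
    intro k f
    refine b.ext fun i₀ => ?_
    have h1 : ∀ w : V, actW k (f w) = ∑ j, b.coord j w • actW k (f (b j)) := by
      intro w
      conv_lhs => rw [← b.sum_repr w]
      simp only [map_sum, map_smul, Module.Basis.coord_apply]
    simp only [homAct, MonoidHom.coe_mk, OneHom.coe_mk, LinearMap.coe_mk, AddHom.coe_mk,
      LinearMap.comp_apply, LinearMap.sum_apply, LinearMap.smul_apply,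
      LinearMap.smulRight_apply]
    rw [Finset.sum_eq_single i₀]
    · rw [h1]
      simp
    · intro i _ hi
      simp [Finsupp.single_eq_of_ne hi]
    · simp
  refine ⟨?_, ?_, ?_, ?_, ?_⟩
  · intro x y f
    ext v
    simp [homRep, hV.rep_lie, hW.rep_lie]
    abel
  · intro k x f
    ext v
    have h1 : actV k⁻¹ (repV (P.Ad k x) v) = repV x (actV k⁻¹ v) := by
      rw [hV.act_rep, ← Module.End.mul_apply (P.Ad k⁻¹), ← map_mul]
      simp
    simp [homRep, homAct, hW.act_rep, h1]
  · intro f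
    let E : Submodule ℂ W := ⨆ j, Submodule.span ℂ (Set.range fun k => actW k (f (b j)))
    have hE : FiniteDimensional ℂ E := by
      have := fun j => hW.locallyFinite (f (b j))
      exact Submodule.finiteDimensional_iSup _
    have hle : Submodule.span ℂ (Set.range fun k => homAct actV actW k f)
        ≤ LinearMap.range (E.subtype.compRight ℂ (M := V)) := by
      rw [Submodule.span_le]
      rintro _ ⟨k, rfl⟩
      refine ⟨LinearMap.codRestrict E (homAct actV actW k f) fun v => ?_, ?_⟩
      · rw [expand]
        simp only [LinearMap.sum_apply, LinearMap.smul_apply, LinearMap.smulRight_apply]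
        refine Submodule.sum_mem _ fun i _ => Submodule.sum_mem _ fun j _ =>
          Submodule.smul_mem _ _ (Submodule.smul_mem _ _ ?_)
        exact Submodule.mem_iSup_of_mem j (Submodule.subset_span ⟨k, rfl⟩)
      · ext v
        rfl
    exact Submodule.finiteDimensional_of_le hle
  · intro f F
    have h1 : (fun k => F (homAct actV actW k f)) = fun k => ∑ i, ∑ j,
        (b.coord j (actV k⁻¹ (b i))) *
          (F ∘ₗ (LinearMap.smulRightₗ (b.coord i) : W →ₗ[ℂ] V →ₗ[ℂ] W)) (actW k (f (b j))) := by
      funext k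
      rw [expand]
      simp
    rw [h1]
    refine continuous_finsetSum _ fun i _ => continuous_finsetSum _ fun j _ => ?_
    exact ((hV.continuous (b i) (b.coord j)).comp continuous_inv).mul (hW.continuous _ _)
  · intro γ X h f F
    have h1 : (fun t : ℝ => F (homAct actV actW (γ (.ofAdd t)) f)) = fun t => ∑ i, ∑ j,
        (b.coord j (actV (γ (.ofAdd (-t))) (b i))) *
          (F ∘ₗ (LinearMap.smulRightₗ (b.coord i) : W →ₗ[ℂ] V →ₗ[ℂ] W))
            (actW (γ (.ofAdd t)) (f (b j))) := by
      funext t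
      rw [expand]
      simp
    have hd : ∀ i j, HasDerivAt (fun t : ℝ => (b.coord j (actV (γ (.ofAdd (-t))) (b i))) *
          (F ∘ₗ (LinearMap.smulRightₗ (b.coord i) : W →ₗ[ℂ] V →ₗ[ℂ] W))
            (actW (γ (.ofAdd t)) (f (b j))))
        (-(b.coord j (repV X (b i))) *
          (F ∘ₗ (LinearMap.smulRightₗ (b.coord i) : W →ₗ[ℂ] V →ₗ[ℂ] W)) (f (b j)) +
          (b.coord j (b i)) *
          (F ∘ₗ (LinearMap.smulRightₗ (b.coord i) : W →ₗ[ℂ] V →ₗ[ℂ] W)) (repW X (f (b j)))) 0 := by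
      intro i j
      have d1 : HasDerivAt (fun t : ℝ => b.coord j (actV (γ (.ofAdd t)) (b i)))
          (b.coord j (repV X (b i))) (-0) := by
        rw [neg_zero]
        exact hV.hasDerivAt γ X h (b i) (b.coord j)
      have d1' := d1.scomp (0 : ℝ) (hasDerivAt_neg (0 : ℝ))
      have d2 := hW.hasDerivAt γ X h (f (b j))
        (F ∘ₗ (LinearMap.smulRightₗ (b.coord i) : W →ₗ[ℂ] V →ₗ[ℂ] W))
      refine HasDerivAt.congr_deriv (d1'.fun_mul d2) ?_
      simp
    rw [h1]
    have h2 := HasDerivAt.fun_sum (u := Finset.univ) fun i _ =>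
      HasDerivAt.fun_sum (u := Finset.univ) fun j _ => hd i j
    refine HasDerivAt.congr_deriv h2 ?_
    have h3 : homRep repV repW X f = ∑ i, ∑ j,
        ((-(b.coord j (repV X (b i)))) • (b.coord i).smulRight (f (b j))
          + (b.coord j (b i)) • (b.coord i).smulRight (repW X (f (b j)))) := by
      refine b.ext fun i₀ => ?_
      simp only [LinearMap.sum_apply, LinearMap.add_apply, LinearMap.smul_apply,
        LinearMap.smulRight_apply]
      rw [Finset.sum_eq_single i₀]
      · simp only [homRep, LinearMap.coe_mk, AddHom.coe_mk, LinearMap.sub_apply,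
          LinearMap.comp_apply]
        have h4 : f (repV X (b i₀)) = ∑ j, b.coord j (repV X (b i₀)) • f (b j) := by
          conv_lhs => rw [← b.sum_repr (repV X (b i₀))]
          simp only [map_sum, map_smul, Module.Basis.coord_apply]
        rw [h4, Finset.sum_add_distrib]
        simp [Finsupp.single_apply]
        abel
      · intro i _ hi
        simp [Finsupp.single_eq_of_ne hi]
      · simp
    rw [h3]
    simp

end HCAction

section AltAction

variable {𝔤 K : Type*} [LieRing 𝔤] [LieAlgebra ℂ 𝔤] [Group K] [TopologicalSpace K]
  [IsTopologicalGroup K]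
  {P : LiePair 𝔤 K} {U V : Type*} [AddCommGroup U] [Module ℂ U] [AddCommGroup V] [Module ℂ V]

/-- The action of `𝔤` on alternating maps:
`(x ω)(u₁, …) = x ω(u₁, …) - ∑ᵢ ω(u₁, …, x uᵢ, …)`. -/
def altRep (n : ℕ) (repU : 𝔤 →ₗ[ℂ] Module.End ℂ U) (repV : 𝔤 →ₗ[ℂ] Module.End ℂ V) :
    𝔤 →ₗ[ℂ] Module.End ℂ (U [⋀^Fin n]→ₗ[ℂ] V) where
  toFun x :=
    { toFun := fun ω => (repV x).compAlternatingMap ω - altDer (repU x) ω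
      map_add' := fun ω η => by ext v; simp [altDer_add]; abel
      map_smul' := fun c ω => by ext v; simp [altDer_smul, smul_sub] }
  map_add' x y := by ext ω v; simp [altDer_add_left]; abel
  map_smul' c x := by ext ω v; simp [altDer_smul_left, smul_sub]

/-- The action of `K` on alternating maps: `(k ω)(u₁, …) = k ω(k⁻¹ u₁, …)`. -/
def altAct (n : ℕ) (actU : Representation ℂ K U) (actV : Representation ℂ K V) :
    Representation ℂ K (U [⋀^Fin n]→ₗ[ℂ] V) where
  toFun k :=
    { toFun := fun ω => (actV k).compAlternatingMap (ω.compLinearMap (actU k⁻¹))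
      map_add' := fun ω η => by ext v; simp
      map_smul' := fun c ω => by ext v; simp }
  map_one' := by ext ω v; simp
  map_mul' k l := by ext ω v; simp

variable {repU : 𝔤 →ₗ[ℂ] Module.End ℂ U} {actU : Representation ℂ K U}
  {repV : 𝔤 →ₗ[ℂ] Module.End ℂ V} {actV : Representation ℂ K V}

theorem altRep_curryLeft (n : ℕ) (x : 𝔤) (ω : U [⋀^Fin (n + 1)]→ₗ[ℂ] V) :
    (altRep (n + 1) repU repV x ω).curryLeft
      = homRep repU (altRep n repU repV) x ω.curryLeft := by
  ext y v
  simp only [altRep, homRep, LinearMap.coe_mk, AddHom.coe_mk,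
    AlternatingMap.curryLeft_apply_apply, AlternatingMap.sub_apply,
    LinearMap.compAlternatingMap_apply, LinearMap.sub_apply, LinearMap.comp_apply,
    altDer_apply, Fin.sum_univ_succ]
  rw [sub_add_eq_sub_sub, sub_right_comm]
  congr 1
  · congr 1
    refine Finset.sum_congr rfl fun j _ => ?_
    congr 1
    funext k
    refine Fin.cases ?_ (fun k => ?_) k
    · simp [(Fin.succ_ne_zero j).symm]
    · by_cases h : k = j
      · subst h; simp
      · simp [h]
  · congr 1
    funext k
    refine Fin.cases ?_ (fun k => ?_) k <;> simp

theorem altAct_curryLeft (n : ℕ) (k : K) (ω : U [⋀^Fin (n + 1)]→ₗ[ℂ] V) :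
    (altAct (n + 1) actU actV k ω).curryLeft
      = homAct actU (altAct n actU actV) k ω.curryLeft := by
  ext y v
  simp only [altAct, homAct, MonoidHom.coe_mk, OneHom.coe_mk, LinearMap.coe_mk, AddHom.coe_mk,
    AlternatingMap.curryLeft_apply_apply, LinearMap.compAlternatingMap_apply,
    LinearMap.comp_apply, AlternatingMap.compLinearMap_apply]
  congr 2
  funext k
  refine Fin.cases ?_ (fun k => ?_) k <;> simp

theorem IsHCAction.alt [FiniteDimensional ℂ U] (hU : IsHCAction P repU actU)
    (hV : IsHCAction P repV actV) (n : ℕ) :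
    IsHCAction P (altRep n repU repV) (altAct n actU actV) := by
  induction n with
  | zero =>
    refine hV.of_injective
      { toFun := fun ω => ω ![], map_add' := fun _ _ => rfl, map_smul' := fun _ _ => rfl }
      (fun ω η h => ?_) (fun x ω => ?_) (fun k ω => ?_)
    · ext v
      rw [Subsingleton.elim v ![]]
      exact h
    · simp [altRep, altDer_apply]
    · simp only [altAct, MonoidHom.coe_mk, OneHom.coe_mk, LinearMap.coe_mk, AddHom.coe_mk,
        LinearMap.compAlternatingMap_apply, AlternatingMap.compLinearMap_apply]
      congr 2
      exact Subsingleton.elim _ _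
  | succ n ih =>
    refine (hU.hom ih).of_injective AlternatingMap.curryLeftLinearMap
      (fun ω η h => ?_) (fun x ω => altRep_curryLeft n x ω) (fun k ω => altAct_curryLeft n k ω)
    ext v
    have := congrArg (fun f : U →ₗ[ℂ] U [⋀^Fin n]→ₗ[ℂ] V => f (v 0) (Fin.tail v)) h
    simpa [AlternatingMap.curryLeft_apply_apply, Matrix.vecCons, Fin.cons_self_tail] using this

end AltAction

section HCModule

variable {𝔤 K : Type*} [LieRing 𝔤] [LieAlgebra ℂ 𝔤] [Group K] [TopologicalSpace K]
  [IsTopologicalGroup K]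

/-- A `(𝔤, K)`-module. -/
structure HCModule (P : LiePair 𝔤 K) where
  carrier : Type u
  [addCommGroup : AddCommGroup carrier]
  [module : Module ℂ carrier]
  rep : 𝔤 →ₗ[ℂ] Module.End ℂ carrier
  act : Representation ℂ K carrier
  isHC : IsHCAction P rep act

attribute [instance] HCModule.addCommGroup HCModule.module

variable {P : LiePair 𝔤 K}

instance : CoeSort (HCModule.{u} P) (Type u) := ⟨HCModule.carrier⟩

/-- A homomorphism of `(𝔤, K)`-modules. -/
structure HCHom (V W : HCModule.{u} P) extends V →ₗ[ℂ] W where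
  map_rep : ∀ x v, toFun (V.rep x v) = W.rep x (toFun v)
  map_act : ∀ k v, toFun (V.act k v) = W.act k (toFun v)

namespace HCModule

/-- The trivial representation on `ℂ`. -/
def trivial (P : LiePair 𝔤 K) : HCModule.{u} P where
  carrier := ULift.{u} ℂ
  rep := 0
  act := 1
  isHC :=
    { rep_lie := by simp
      act_rep := by simp
      locallyFinite := fun _ => inferInstance
      continuous := by simp [continuous_const]
      hasDerivAt := fun γ X _ v f => by simpa using hasDerivAt_const _ _ }

/-- A submodule. -/
def sub (V : HCModule.{u} P) (W : Submodule ℂ V) (hrep : ∀ x, ∀ w ∈ W, V.rep x w ∈ W)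
    (hact : ∀ k, ∀ w ∈ W, V.act k w ∈ W) : HCModule.{u} P where
  carrier := W
  rep :=
    { toFun := fun x => (V.rep x).restrict (hrep x)
      map_add' := fun x y => by ext; simp
      map_smul' := fun c x => by ext; simp }
  act :=
    { toFun := fun k => (V.act k).restrict (hact k)
      map_one' := by ext; simp
      map_mul' := fun k l => by ext; simp }
  isHC := V.isHC.of_injective W.subtype W.subtype_injective (fun _ _ => rfl) (fun _ _ => rfl)

/-- A quotient module. -/
def quot (V : HCModule.{u} P) (W : Submodule ℂ V) (hrep : ∀ x, ∀ w ∈ W, V.rep x w ∈ W)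
    (hact : ∀ k, ∀ w ∈ W, V.act k w ∈ W) : HCModule.{u} P where
  carrier := V ⧸ W
  rep :=
    { toFun := fun x => W.mapQ W (V.rep x) (hrep x)
      map_add' := fun x y => by ext; simp
      map_smul' := fun c x => by ext; simp }
  act :=
    { toFun := fun k => W.mapQ W (V.act k) (hact k)
      map_one' := by ext; simp
      map_mul' := fun k l => by ext; simp }
  isHC := V.isHC.of_surjective W.mkQ W.mkQ_surjective (fun _ _ => rfl) (fun _ _ => rfl)

/-- The `(𝔤, K)`-module of alternating `n`-linear maps `U × ⋯ × U → V`. As `U` is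
finite-dimensional, this is the module `⋀ⁿ U* ⊗ V`. -/
def alt (n : ℕ) (U V : HCModule.{u} P) [FiniteDimensional ℂ U] : HCModule.{u} P where
  carrier := U [⋀^Fin n]→ₗ[ℂ] V
  rep := altRep n U.rep V.rep
  act := altAct n U.act V.act
  isHC := U.isHC.alt V.isHC n

end HCModule

end HCModule

/-! ### Cohomology of nilpotent radicals -/

section Cohomology

variable {𝔩 M 𝔤 K : Type*} [LieRing 𝔩] [LieAlgebra ℂ 𝔩] [Group M] [TopologicalSpace M]
  [IsTopologicalGroup M] [LieRing 𝔤] [LieAlgebra ℂ 𝔤] [Group K] [TopologicalSpace K]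
  [IsTopologicalGroup K]

/-- A morphism of pairs `(𝔩, M) → (𝔤, K)` together with a subalgebra `𝔲` of `𝔤` which is
normalized by the images of `𝔩` and of `M`. -/
structure CohDatum (P' : LiePair 𝔩 M) (P : LiePair 𝔤 K) where
  φ : 𝔩 →ₗ⁅ℂ⁆ 𝔤
  ψ : M →ₜ* K
  φ_Ad : ∀ m x, φ (P'.Ad m x) = P.Ad (ψ m) (φ x)
  isTangent : ∀ γ X, P'.IsTangent γ X → P.IsTangent (ψ.comp γ) (φ X)
  𝔲 : LieSubalgebra ℂ 𝔤
  lie_mem : ∀ x, ∀ y ∈ 𝔲, ⁅φ x, y⁆ ∈ 𝔲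
  Ad_mem : ∀ m, ∀ y ∈ 𝔲, P.Ad (ψ m) y ∈ 𝔲

namespace CohDatum

variable {P' : LiePair 𝔩 M} {P : LiePair 𝔤 K} (D : CohDatum P' P)

/-- A `(𝔤, K)`-module, considered as an `(𝔩, M)`-module. -/
def restrict (V : HCModule.{u} P) : HCModule.{u} P' where
  carrier := V
  rep := V.rep ∘ₗ (D.φ : 𝔩 →ₗ[ℂ] 𝔤)
  act := V.act.comp D.ψ.toMonoidHom
  isHC :=
    { rep_lie := fun x y v => by simp [V.isHC.rep_lie]
      act_rep := fun m x v => by simp [V.isHC.act_rep, D.φ_Ad]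
      locallyFinite := fun v => by
        have := V.isHC.locallyFinite v
        refine Submodule.finiteDimensional_of_le (Submodule.span_mono ?_)
          (S₂ := Submodule.span ℂ (Set.range fun k => V.act k v))
        rintro _ ⟨m, rfl⟩
        exact ⟨D.ψ m, rfl⟩
      continuous := fun v f => (V.isHC.continuous v f).comp D.ψ.continuous_toFun
      hasDerivAt := fun γ X h v f => V.isHC.hasDerivAt _ _ (D.isTangent γ X h) v f }

end CohDatum
end Cohomology

section Cohomology

variable {𝔩 M : Type*} {𝔤 : Type u} {K : Type*} [LieRing 𝔩] [LieAlgebra ℂ 𝔩] [Group M]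
  [TopologicalSpace M] [IsTopologicalGroup M] [LieRing 𝔤] [LieAlgebra ℂ 𝔤] [Group K]
  [TopologicalSpace K] [IsTopologicalGroup K] [FiniteDimensional ℂ 𝔤]

namespace CohDatum

variable {P' : LiePair 𝔩 M} {P : LiePair 𝔤 K} (D : CohDatum P' P)

/-- The adjoint action of `𝔩` on `𝔲`. -/
def adRep : 𝔩 →ₗ[ℂ] Module.End ℂ D.𝔲 where
  toFun x :=
    { toFun := fun y => ⟨⁅D.φ x, (y : 𝔤)⁆, D.lie_mem x y y.2⟩
      map_add' := fun y z => by ext; simp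
      map_smul' := fun c y => by ext; simp }
  map_add' x y := by ext; simp
  map_smul' c x := by ext; simp

/-- The adjoint action of `M` on `𝔲`. -/
def adAct : Representation ℂ M D.𝔲 where
  toFun m := (P.Ad (D.ψ m)).restrict (D.Ad_mem m)
  map_one' := by ext; simp
  map_mul' k l := by ext; simp

theorem coe_adRep (x : 𝔩) (y : D.𝔲) : (D.adRep x y : 𝔤) = ⁅D.φ x, (y : 𝔤)⁆ := rfl

theorem coe_adAct (m : M) (y : D.𝔲) : (D.adAct m y : 𝔤) = P.Ad (D.ψ m) y := rfl

/-- The adjoint `(𝔩, M)`-module `𝔲`. -/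
def nil : HCModule.{u} P' where
  carrier := D.𝔲
  rep := D.adRep
  act := D.adAct
  isHC :=
    { rep_lie := fun x y v => Subtype.ext (by simp [coe_adRep])
      act_rep := fun m x v => Subtype.ext (by
        simp [coe_adRep, coe_adAct, P.Ad_lie, D.φ_Ad])
      locallyFinite := fun v => by infer_instance
      continuous := fun v f => by
        obtain ⟨F, hF⟩ := LinearMap.exists_extend f
        have := (P.continuous_Ad v F).comp D.ψ.continuous_toFun
        refine this.congr fun m => ?_
        rw [← hF]
        rfl
      hasDerivAt := fun γ X h v f => by
        obtain ⟨F, hF⟩ := LinearMap.exists_extend f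
        have := P.hasDerivAt_Ad _ _ (D.isTangent γ X h) v F
        rw [← hF]
        exact this }

instance : FiniteDimensional ℂ D.nil := inferInstanceAs (FiniteDimensional ℂ D.𝔲)

/-- The cochain module `Hom(⋀ⁿ 𝔲, V)`. -/
def cochain (n : ℕ) (V : HCModule.{u} P) : HCModule.{u} P' := HCModule.alt n D.nil (D.restrict V)

/-- The action of `𝔲` on `V`. -/
def nilRep (V : HCModule.{u} P) : D.𝔲 →ₗ[ℂ] Module.End ℂ V :=
  V.rep ∘ₗ D.𝔲.toSubmodule.subtype

/-- The differential of the standard complex. -/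
def d (n : ℕ) (V : HCModule.{u} P) : HCHom (D.cochain n V) (D.cochain (n + 1) V) where
  toLinearMap := ceD (D.nilRep V) n
  map_rep x ω := by
    refine ceD_derivation (D.nilRep V) (V.rep (D.φ x)) (D.adRep x) ?_ ?_ ω
    · intro y z
      exact Subtype.ext (by simp [coe_adRep])
    · intro y v
      change V.rep (D.φ x) (V.rep (y : 𝔤) v)
        = V.rep (y : 𝔤) (V.rep (D.φ x) v) + V.rep ⁅D.φ x, (y : 𝔤)⁆ v
      rw [V.isHC.rep_lie]
      abel
  map_act m ω := by
    refine ceD_natural (D.nilRep V) (D.nilRep V) (V.act (D.ψ m)) (D.adAct m⁻¹) ?_ ?_ ω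
    · intro y z
      exact Subtype.ext (by simp [coe_adAct, P.Ad_lie])
    · intro y v
      have h : P.Ad (D.ψ m) (P.Ad (D.ψ m⁻¹) y) = y := by
        rw [← Module.End.mul_apply, ← map_mul, ← map_mul]
        simp
      have h' : D.nilRep V (D.adAct m⁻¹ y) = V.rep (P.Ad (D.ψ m⁻¹) y) := rfl
      rw [h', V.isHC.act_rep, h]
      rfl

/-- The submodule of coboundaries. -/
def coboundary (V : HCModule.{u} P) : (n : ℕ) → Submodule ℂ (D.cochain n V)
  | 0 => ⊥
  | n + 1 => LinearMap.range (D.d n V).toLinearMap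

/-- The module of cocycles. -/
def cocycle (n : ℕ) (V : HCModule.{u} P) : HCModule.{u} P' :=
  (D.cochain n V).sub (LinearMap.ker (D.d n V).toLinearMap)
    (fun x ω hω => by
      have := (D.d n V).map_rep x ω
      rw [LinearMap.mem_ker] at hω ⊢
      change (D.d n V).toLinearMap _ = _ at this
      rw [this]
      change (D.cochain (n + 1) V).rep x ((D.d n V).toLinearMap ω) = 0
      rw [hω, map_zero])
    (fun k ω hω => by
      have := (D.d n V).map_act k ω
      rw [LinearMap.mem_ker] at hω ⊢
      change (D.d n V).toLinearMap _ = _ at this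
      rw [this]
      change (D.cochain (n + 1) V).act k ((D.d n V).toLinearMap ω) = 0
      rw [hω, map_zero])

/-- The `(𝔩, M)`-module `Hⁿ(𝔲; V)`: cocycles modulo coboundaries. -/
def cohomology (n : ℕ) (V : HCModule.{u} P) : HCModule.{u} P' :=
  (D.cocycle n V).quot
    ((D.coboundary V n).comap (LinearMap.ker (D.d n V).toLinearMap).subtype)
    (fun x ω hω => by
      cases n with
      | zero =>
        have h0 : ω = 0 := Subtype.ext hω
        subst h0
        rw [map_zero]
        exact Submodule.zero_mem _
      | succ n =>
        obtain ⟨η, hη⟩ := hω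
        refine ⟨(D.cochain n V).rep x η, ((D.d n V).map_rep x η).trans ?_⟩
        exact congrArg ((D.cochain (n + 1) V).rep x) hη)
    (fun k ω hω => by
      cases n with
      | zero =>
        have h0 : ω = 0 := Subtype.ext hω
        subst h0
        rw [map_zero]
        exact Submodule.zero_mem _
      | succ n =>
        obtain ⟨η, hη⟩ := hω
        refine ⟨(D.cochain n V).act k η, ((D.d n V).map_act k η).trans ?_⟩
        exact congrArg ((D.cochain (n + 1) V).act k) hη)

end CohDatum
end Cohomology

/-! ### Abelian subcategories and Grothendieck groups -/

section Grothendieck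

variable {𝔤 K : Type*} [LieRing 𝔤] [LieAlgebra ℂ 𝔤] [Group K] [TopologicalSpace K]
  [IsTopologicalGroup K] {P : LiePair 𝔤 K}

/-- The sequence `0 → A → B → C → 0` is exact. -/
structure IsShortExact {A B C : HCModule.{u} P} (i : HCHom A B) (p : HCHom B C) : Prop where
  injective : Function.Injective i.toLinearMap
  surjective : Function.Surjective p.toLinearMap
  exact : Function.Exact i.toLinearMap p.toLinearMap

/-- The full subcategory of `(𝔤, K)`-modules given by the predicate `S` is an abelian subcategory:
it is closed under isomorphisms and contains the zero modules, the direct sums of two of its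
objects, and the kernels and cokernels of morphisms between its objects. -/
structure IsAbelianSubcategory (S : HCModule.{u} P → Prop) : Prop where
  iso : ∀ {V W : HCModule.{u} P} (f : HCHom V W), Function.Bijective f.toLinearMap → S V → S W
  zero : ∀ V : HCModule.{u} P, Subsingleton V → S V
  directSum : ∀ {V W U : HCModule.{u} P} (f : HCHom V U) (g : HCHom W U),
    Function.Bijective (f.toLinearMap.coprod g.toLinearMap) → S V → S W → S U
  kernel : ∀ {V W N : HCModule.{u} P} (f : HCHom V W) (i : HCHom N V),
    Function.Injective i.toLinearMap → Function.Exact i.toLinearMap f.toLinearMap →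
      S V → S W → S N
  cokernel : ∀ {V W C : HCModule.{u} P} (f : HCHom V W) (p : HCHom W C),
    Function.Surjective p.toLinearMap → Function.Exact f.toLinearMap p.toLinearMap →
      S V → S W → S C

/-- The relations `[B] = [A] + [C]` for short exact sequences `0 → A → B → C → 0` in `S`. -/
def exactRelations (S : HCModule.{u} P → Prop) : AddSubgroup (FreeAbelianGroup {V // S V}) :=
  AddSubgroup.closure {r | ∃ (A B C : {V // S V}) (i : HCHom A.1 B.1) (p : HCHom B.1 C.1),
    IsShortExact i p ∧
      r = FreeAbelianGroup.of B - FreeAbelianGroup.of A - FreeAbelianGroup.of C}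

/-- The Grothendieck group of the category `S`. -/
def GrothendieckGroup (S : HCModule.{u} P → Prop) :=
  FreeAbelianGroup {V // S V} ⧸ exactRelations S

instance (S : HCModule.{u} P → Prop) : AddCommGroup (GrothendieckGroup S) :=
  inferInstanceAs (AddCommGroup (FreeAbelianGroup {V // S V} ⧸ exactRelations S))

namespace GrothendieckGroup

variable {S : HCModule.{u} P → Prop}

/-- The class `[V]`. -/
def cls (V : HCModule.{u} P) (hV : S V) : GrothendieckGroup S :=
  QuotientAddGroup.mk' (exactRelations S) (FreeAbelianGroup.of ⟨V, hV⟩)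

theorem cls_eq_add {A B C : HCModule.{u} P} (i : HCHom A B) (p : HCHom B C)
    (h : IsShortExact i p) (hA : S A) (hB : S B) (hC : S C) : cls B hB = cls A hA + cls C hC := by
  have : QuotientAddGroup.mk' (exactRelations S) (FreeAbelianGroup.of ⟨B, hB⟩
      - FreeAbelianGroup.of ⟨A, hA⟩ - FreeAbelianGroup.of ⟨C, hC⟩) = 0 :=
    (QuotientAddGroup.eq_zero_iff _).2
      (AddSubgroup.subset_closure ⟨⟨A, hA⟩, ⟨B, hB⟩, ⟨C, hC⟩, i, p, h, rfl⟩)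
  rw [map_sub, map_sub, sub_sub, sub_eq_zero] at this
  exact this

/-- The homomorphism out of the Grothendieck group defined by an additive function. -/
def lift {A : Type*} [AddCommGroup A] (f : ∀ V : HCModule.{u} P, S V → A)
    (hf : ∀ {A B C : HCModule.{u} P} (i : HCHom A B) (p : HCHom B C), IsShortExact i p →
      ∀ (hA : S A) (hB : S B) (hC : S C), f B hB = f A hA + f C hC) :
    GrothendieckGroup S →+ A :=
  QuotientAddGroup.lift (exactRelations S) (FreeAbelianGroup.lift fun V => f V.1 V.2) (by
    rw [exactRelations, AddSubgroup.closure_le]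
    rintro _ ⟨A, B, C, i, p, h, rfl⟩
    simp [hf i p h A.2 B.2 C.2])

theorem lift_cls {A : Type*} [AddCommGroup A] (f : ∀ V : HCModule.{u} P, S V → A)
    (hf : ∀ {A B C : HCModule.{u} P} (i : HCHom A B) (p : HCHom B C), IsShortExact i p →
      ∀ (hA : S A) (hB : S B) (hC : S C), f B hB = f A hA + f C hC) (V) (hV : S V) :
    lift f hf (cls V hV) = f V hV := by
  exact FreeAbelianGroup.lift_apply_of _ _

theorem hom_ext {A : Type*} [AddCommGroup A] {f g : GrothendieckGroup S →+ A}
    (h : ∀ V hV, f (cls V hV) = g (cls V hV)) : f = g := by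
  refine QuotientAddGroup.addMonoidHom_ext _ (FreeAbelianGroup.lift_ext _ _ ?_)
  rintro ⟨V, hV⟩
  exact h V hV

end GrothendieckGroup

/-! Kernels and images. -/

namespace HCHom

variable {V W : HCModule.{u} P}

/-- The kernel of a homomorphism. -/
def ker (f : HCHom V W) : HCModule.{u} P :=
  V.sub (LinearMap.ker f.toLinearMap)
    (fun x v hv => by
      have h : f.toLinearMap v = 0 := hv
      exact (f.map_rep x v).trans ((congrArg (W.rep x) h).trans (map_zero _)))
    (fun k v hv => by
      have h : f.toLinearMap v = 0 := hv
      exact (f.map_act k v).trans ((congrArg (W.act k) h).trans (map_zero _)))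

/-- The image of a homomorphism. -/
def im (f : HCHom V W) : HCModule.{u} P :=
  W.sub (LinearMap.range f.toLinearMap)
    (fun x w hw => by
      obtain ⟨v, rfl⟩ := hw
      exact ⟨V.rep x v, f.map_rep x v⟩)
    (fun k w hw => by
      obtain ⟨v, rfl⟩ := hw
      exact ⟨V.act k v, f.map_act k v⟩)

/-- The inclusion of the kernel. -/
def kerι (f : HCHom V W) : HCHom f.ker V where
  toLinearMap := (LinearMap.ker f.toLinearMap).subtype
  map_rep _ _ := rfl
  map_act _ _ := rfl

/-- The inclusion of the image. -/
def imι (f : HCHom V W) : HCHom f.im W where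
  toLinearMap := (LinearMap.range f.toLinearMap).subtype
  map_rep _ _ := rfl
  map_act _ _ := rfl

/-- The projection to the image. -/
def imπ (f : HCHom V W) : HCHom V f.im where
  toLinearMap := f.toLinearMap.rangeRestrict
  map_rep x v := Subtype.ext (f.map_rep x v)
  map_act k v := Subtype.ext (f.map_act k v)

theorem shortExact_ker (f : HCHom V W) : IsShortExact f.kerι f.imπ where
  injective := Subtype.val_injective
  surjective := LinearMap.surjective_rangeRestrict _
  exact v := by
    change f.toLinearMap.rangeRestrict v = 0 ↔ v ∈ Set.range Subtype.val
    rw [Subtype.range_coe_subtype]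
    simp only [Set.mem_ofPred_eq, LinearMap.mem_ker]
    exact Subtype.ext_iff

theorem ker_mem {S : HCModule.{u} P → Prop} (hS : IsAbelianSubcategory S) (f : HCHom V W)
    (hV : S V) (hW : S W) : S f.ker := by
  refine hS.kernel f f.kerι Subtype.val_injective (fun v => ?_) hV hW
  change _ ↔ v ∈ Set.range Subtype.val
  rw [Subtype.range_coe_subtype]
  rfl

theorem im_mem {S : HCModule.{u} P → Prop} (hS : IsAbelianSubcategory S) (f : HCHom V W)
    (hV : S V) (hW : S W) : S f.im :=
  hS.cokernel f.kerι f.imπ f.shortExact_ker.surjective f.shortExact_ker.exact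
    (f.ker_mem hS hV hW) hV

end HCHom

/-- The identity. -/
def HCHom.id (V : HCModule.{u} P) : HCHom V V where
  toLinearMap := LinearMap.id
  map_rep _ _ := rfl
  map_act _ _ := rfl

theorem GrothendieckGroup.cls_eq_zero {S : HCModule.{u} P → Prop} (V : HCModule.{u} P)
    [Subsingleton V] (hV : S V) : cls V hV = 0 := by
  have h := cls_eq_add (HCHom.id V) (HCHom.id V)
    ⟨Function.injective_id, Function.surjective_id, fun v =>
      ⟨fun _ => ⟨v, rfl⟩, fun _ => Subsingleton.elim _ _⟩⟩ hV hV hV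
  simpa using h

/-- An isomorphism gives the same class. -/
theorem GrothendieckGroup.cls_eq_of_bijective {S : HCModule.{u} P → Prop}
    (hS : IsAbelianSubcategory S) {V W : HCModule.{u} P} (f : HCHom V W)
    (hf : Function.Bijective f.toLinearMap) (hV : S V) (hW : S W) : cls V hV = cls W hW := by
  have h0 : Subsingleton f.ker :=
    ⟨fun a b => Subtype.ext (hf.1 ((LinearMap.mem_ker.1 a.2).trans (LinearMap.mem_ker.1 b.2).symm))⟩
  have hz : S f.ker := hS.zero _ h0
  have h1 : IsShortExact f.kerι f := by
    refine ⟨Subtype.val_injective, hf.2, fun v => ?_⟩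
    change _ ↔ v ∈ Set.range Subtype.val
    rw [Subtype.range_coe_subtype]
    rfl
  rw [cls_eq_add _ _ h1 hz hV hW, cls_eq_zero f.ker hz, zero_add]

/-- If `X → Y → Z` is exact, `[Y]` is the sum of the classes of the two images. -/
theorem GrothendieckGroup.cls_eq_of_exact {S : HCModule.{u} P → Prop} {X Y Z : HCModule.{u} P}
    (f : HCHom X Y) (g : HCHom Y Z) (h : Function.Exact f.toLinearMap g.toLinearMap)
    (hf : S f.im) (hY : S Y) (hg : S g.im) : cls Y hY = cls f.im hf + cls g.im hg := by
  refine cls_eq_add f.imι g.imπ ⟨Subtype.val_injective, LinearMap.surjective_rangeRestrict _, ?_⟩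
    hf hY hg
  intro y
  change g.toLinearMap.rangeRestrict y = 0 ↔ y ∈ Set.range Subtype.val
  rw [Subtype.range_coe_subtype]
  exact Subtype.ext_iff.trans (h y)

end Grothendieck

/-! ### Euler characteristics -/

section Euler

variable {𝔩 M : Type*} {𝔤 : Type u} {K : Type*} [LieRing 𝔩] [LieAlgebra ℂ 𝔩] [Group M]
  [TopologicalSpace M] [IsTopologicalGroup M] [LieRing 𝔤] [LieAlgebra ℂ 𝔤] [Group K]
  [TopologicalSpace K] [IsTopologicalGroup K] [FiniteDimensional ℂ 𝔤]

namespace CohDatum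

variable {P' : LiePair 𝔩 M} {P : LiePair 𝔤 K} (D : CohDatum P' P)

/-- The map induced by `f` on cochains. -/
def cochainMap (n : ℕ) {V W : HCModule.{u} P} (f : HCHom V W) :
    HCHom (D.cochain n V) (D.cochain n W) where
  toLinearMap := (f.toLinearMap.compAlternatingMapₗ ℂ :
    (D.𝔲 [⋀^Fin n]→ₗ[ℂ] V) →ₗ[ℂ] (D.𝔲 [⋀^Fin n]→ₗ[ℂ] W))
  map_rep x := by
    intro (ω : D.𝔲 [⋀^Fin n]→ₗ[ℂ] V)
    refine AlternatingMap.ext fun v => ?_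
    have h : ∀ v, f.toLinearMap (V.rep (D.φ x) v) = W.rep (D.φ x) (f.toLinearMap v) :=
      f.map_rep (D.φ x)
    change f.toLinearMap (V.rep (D.φ x) (ω v) - altDer (D.adRep x) ω v)
      = W.rep (D.φ x) (f.toLinearMap (ω v)) - altDer (D.adRep x) _ v
    rw [map_sub, h]
    exact congrArg _ (congrArg (fun η => η v)
      (altDer_comp (V := V.carrier) f.toLinearMap (D.adRep x) ω).symm)
  map_act m ω := by
    refine AlternatingMap.ext fun v => ?_
    exact f.map_act (D.ψ m) _

theorem d_cochainMap (n : ℕ) {V W : HCModule.{u} P} (f : HCHom V W) (ω : D.cochain n V) :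
    (D.d n W).toLinearMap ((D.cochainMap n f).toLinearMap ω)
      = (D.cochainMap (n + 1) f).toLinearMap ((D.d n V).toLinearMap ω) :=
  ceD_natural (D.nilRep V) (D.nilRep W) f.toLinearMap LinearMap.id (fun _ _ => rfl)
    (fun x v => f.map_rep x v) ω

theorem d_d (n : ℕ) (V : HCModule.{u} P) (ω : D.cochain n V) :
    (D.d (n + 1) V).toLinearMap ((D.d n V).toLinearMap ω) = 0 :=
  ceD_ceD (D.nilRep V) (fun x y v => V.isHC.rep_lie x y v) ω

theorem coboundary_le (n : ℕ) (V : HCModule.{u} P) {ω : D.cochain n V}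
    (h : ω ∈ D.coboundary V n) : (D.d n V).toLinearMap ω = 0 := by
  cases n with
  | zero =>
    have h : ω = 0 := h
    rw [h, map_zero]
  | succ n =>
    obtain ⟨η, rfl⟩ := h
    exact D.d_d n V η

theorem cochainMap_coboundary (n : ℕ) {V W : HCModule.{u} P} (f : HCHom V W) {ω : D.cochain n V}
    (h : ω ∈ D.coboundary V n) : (D.cochainMap n f).toLinearMap ω ∈ D.coboundary W n := by
  cases n with
  | zero =>
    have h : ω = 0 := h
    rw [h, map_zero]
    exact Submodule.zero_mem _
  | succ n =>
    obtain ⟨η, rfl⟩ := h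
    exact ⟨(D.cochainMap n f).toLinearMap η, D.d_cochainMap n f η⟩

/-- The class of a cocycle. -/
def classOf (n : ℕ) (V : HCModule.{u} P) :
    LinearMap.ker (D.d n V).toLinearMap →ₗ[ℂ] D.cohomology n V :=
  Submodule.mkQ ((D.coboundary V n).comap (LinearMap.ker (D.d n V).toLinearMap).subtype)

theorem classOf_surjective (n : ℕ) (V : HCModule.{u} P) : Function.Surjective (D.classOf n V) :=
  Submodule.mkQ_surjective _

theorem classOf_eq_zero {n : ℕ} {V : HCModule.{u} P} {ω : LinearMap.ker (D.d n V).toLinearMap} :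
    D.classOf n V ω = 0 ↔ (ω : D.cochain n V) ∈ D.coboundary V n :=
  Submodule.Quotient.mk_eq_zero _

/-- The map induced by `f` on cohomology. -/
def cohomologyMap (n : ℕ) {V W : HCModule.{u} P} (f : HCHom V W) :
    HCHom (D.cohomology n V) (D.cohomology n W) where
  toLinearMap := Submodule.mapQ _ _ ((D.cochainMap n f).toLinearMap.restrict
      (p := LinearMap.ker (D.d n V).toLinearMap) (q := LinearMap.ker (D.d n W).toLinearMap)
      (fun ω hω => by
        rw [LinearMap.mem_ker] at hω ⊢
        rw [d_cochainMap, hω, map_zero]))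
    (fun ω hω => D.cochainMap_coboundary n f hω)
  map_rep x ω := by
    obtain ⟨ω, rfl⟩ := D.classOf_surjective n V ω
    exact congrArg (D.classOf n W) (Subtype.ext ((D.cochainMap n f).map_rep x ω))
  map_act x ω := by
    obtain ⟨ω, rfl⟩ := D.classOf_surjective n V ω
    exact congrArg (D.classOf n W) (Subtype.ext ((D.cochainMap n f).map_act x ω))

theorem cohomologyMap_classOf (n : ℕ) {V W : HCModule.{u} P} (f : HCHom V W)
    (ω : LinearMap.ker (D.d n V).toLinearMap) (η : LinearMap.ker (D.d n W).toLinearMap)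
    (h : (η : D.cochain n W) = (D.cochainMap n f).toLinearMap ω) :
    (D.cohomologyMap n f).toLinearMap (D.classOf n V ω) = D.classOf n W η :=
  congrArg (D.classOf n W) (Subtype.ext h.symm)

/-! The long exact sequence. -/

variable {A B C : HCModule.{u} P} {i : HCHom A B} {p : HCHom B C}

theorem cochainMap_injective (h : IsShortExact i p) (n : ℕ) :
    Function.Injective (D.cochainMap n i).toLinearMap := by
  intro ω η hω
  refine AlternatingMap.ext fun v => h.injective ?_
  exact congrArg (fun f : D.𝔲 [⋀^Fin n]→ₗ[ℂ] B => f v) hω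

theorem exists_section (h : IsShortExact i p) (n : ℕ) :
    ∃ s : D.cochain n C →ₗ[ℂ] D.cochain n B, ∀ ω, (D.cochainMap n p).toLinearMap (s ω) = ω := by
  obtain ⟨s, hs⟩ := p.toLinearMap.exists_rightInverse_of_surjective
    (LinearMap.range_eq_top.2 h.surjective)
  refine ⟨(s.compAlternatingMapₗ ℂ : (D.𝔲 [⋀^Fin n]→ₗ[ℂ] C) →ₗ[ℂ] (D.𝔲 [⋀^Fin n]→ₗ[ℂ] B)),
    fun ω => AlternatingMap.ext fun v => ?_⟩
  exact LinearMap.congr_fun hs _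

theorem exists_retraction (h : IsShortExact i p) (n : ℕ) :
    ∃ r : D.cochain n B →ₗ[ℂ] D.cochain n A, ∀ ω, (D.cochainMap n p).toLinearMap ω = 0 →
      (D.cochainMap n i).toLinearMap (r ω) = ω := by
  obtain ⟨r, hr⟩ := i.toLinearMap.exists_leftInverse_of_injective
    (LinearMap.ker_eq_bot.2 h.injective)
  refine ⟨(r.compAlternatingMapₗ ℂ : (D.𝔲 [⋀^Fin n]→ₗ[ℂ] B) →ₗ[ℂ] (D.𝔲 [⋀^Fin n]→ₗ[ℂ] A)),
    fun (ω : D.𝔲 [⋀^Fin n]→ₗ[ℂ] B) hω => AlternatingMap.ext fun v => ?_⟩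
  obtain ⟨a, ha⟩ := (h.exact (ω v)).1 (congrArg (fun f : D.𝔲 [⋀^Fin n]→ₗ[ℂ] C => f v) hω)
  have h1 : r (i.toLinearMap a) = a := LinearMap.congr_fun hr a
  change i.toLinearMap (r (ω v)) = ω v
  rw [← ha, h1]

theorem cochainMap_comp (h : IsShortExact i p) (n : ℕ) (ω : D.cochain n A) :
    (D.cochainMap n p).toLinearMap ((D.cochainMap n i).toLinearMap ω) = 0 := by
  refine AlternatingMap.ext fun v => ?_
  exact (h.exact _).2 ⟨_, rfl⟩

/-- The connecting homomorphism exists. -/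
theorem exists_connecting (h : IsShortExact i p) (n : ℕ) :
    ∃ δ : HCHom (D.cohomology n C) (D.cohomology (n + 1) A),
      ∀ (b : D.cochain n B) (z : LinearMap.ker (D.d n C).toLinearMap)
        (a : LinearMap.ker (D.d (n + 1) A).toLinearMap),
        (D.cochainMap n p).toLinearMap b = z →
        (D.d n B).toLinearMap b = (D.cochainMap (n + 1) i).toLinearMap a →
        δ.toLinearMap (D.classOf n C z) = D.classOf (n + 1) A a := by
  obtain ⟨s, hs⟩ := D.exists_section h n
  obtain ⟨r, hr⟩ := D.exists_retraction h (n + 1)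
  have hζ : ∀ z : LinearMap.ker (D.d n C).toLinearMap,
      (D.cochainMap (n + 1) i).toLinearMap (r ((D.d n B).toLinearMap (s z)))
        = (D.d n B).toLinearMap (s z) := by
    intro z
    refine hr _ ?_
    rw [← d_cochainMap, hs]
    exact z.2
  let ζ : LinearMap.ker (D.d n C).toLinearMap →ₗ[ℂ] LinearMap.ker (D.d (n + 1) A).toLinearMap :=
    LinearMap.codRestrict _ (r ∘ₗ (D.d n B).toLinearMap ∘ₗ s ∘ₗ Submodule.subtype _) (fun z => by
      rw [LinearMap.mem_ker]
      refine D.cochainMap_injective h (n + 1 + 1) ?_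
      rw [← d_cochainMap, map_zero]
      exact (congrArg _ (hζ z)).trans (D.d_d n B _))
  have key : ∀ (b : D.cochain n B) (z : LinearMap.ker (D.d n C).toLinearMap)
        (a : LinearMap.ker (D.d (n + 1) A).toLinearMap),
        (D.cochainMap n p).toLinearMap b = z →
        (D.d n B).toLinearMap b = (D.cochainMap (n + 1) i).toLinearMap a →
        D.classOf (n + 1) A (ζ z) = D.classOf (n + 1) A a := by
    intro b z a hb ha
    rw [← sub_eq_zero, ← map_sub, classOf_eq_zero]
    obtain ⟨r', hr'⟩ := D.exists_retraction h n
    have h1 := hr' (s z - b) (by rw [map_sub, hs, hb, sub_self])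
    refine ⟨r' (s z - b), D.cochainMap_injective h (n + 1) ?_⟩
    rw [← d_cochainMap, h1, map_sub, ha, Submodule.coe_sub, map_sub]
    exact congrArg (· - _) (hζ z).symm
  have hker : (D.coboundary C n).comap (LinearMap.ker (D.d n C).toLinearMap).subtype
      ≤ LinearMap.ker (D.classOf (n + 1) A ∘ₗ ζ) := by
    intro z hz
    rw [LinearMap.mem_ker, LinearMap.comp_apply]
    have h0 : ∃ b : D.cochain n B, (D.cochainMap n p).toLinearMap b = z
        ∧ (D.d n B).toLinearMap b = 0 := by
      cases n with
      | zero =>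
        have hz : (z : D.cochain 0 C) = 0 := hz
        exact ⟨0, by rw [map_zero, hz], map_zero _⟩
      | succ n =>
        obtain ⟨η, hη⟩ := hz
        obtain ⟨s', hs'⟩ := D.exists_section h n
        refine ⟨(D.d n B).toLinearMap (s' η), ?_, D.d_d n B _⟩
        rw [← d_cochainMap, hs']
        exact hη
    obtain ⟨b, hb, hb'⟩ := h0
    rw [key b z 0 hb (by rw [hb', Submodule.coe_zero, map_zero]), map_zero]
  refine ⟨⟨Submodule.liftQ _ (D.classOf (n + 1) A ∘ₗ ζ) hker, ?_, ?_⟩, key⟩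
  · intro x z
    obtain ⟨z, rfl⟩ := D.classOf_surjective n C z
    refine (key ((D.cochain n B).rep x (s z)) ((D.cocycle n C).rep x z)
      ((D.cocycle (n + 1) A).rep x (ζ z)) ?_ ?_)
    · refine ((D.cochainMap n p).map_rep x (s z)).trans ?_
      exact congrArg ((D.cochain n C).rep x) (hs z)
    · refine ((D.d n B).map_rep x (s z)).trans ?_
      refine Eq.trans ?_ ((D.cochainMap (n + 1) i).map_rep x (ζ z)).symm
      exact congrArg ((D.cochain (n + 1) B).rep x) (hζ z).symm
  · intro x z
    obtain ⟨z, rfl⟩ := D.classOf_surjective n C z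
    refine (key ((D.cochain n B).act x (s z)) ((D.cocycle n C).act x z)
      ((D.cocycle (n + 1) A).act x (ζ z)) ?_ ?_)
    · refine ((D.cochainMap n p).map_act x (s z)).trans ?_
      exact congrArg ((D.cochain n C).act x) (hs z)
    · refine ((D.d n B).map_act x (s z)).trans ?_
      refine Eq.trans ?_ ((D.cochainMap (n + 1) i).map_act x (ζ z)).symm
      exact congrArg ((D.cochain (n + 1) B).act x) (hζ z).symm

theorem injective_zero (h : IsShortExact i p) :
    Function.Injective (D.cohomologyMap 0 i).toLinearMap := by
  rw [injective_iff_map_eq_zero]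
  intro a ha
  obtain ⟨a, rfl⟩ := D.classOf_surjective 0 A a
  have h1 := (D.classOf_eq_zero).1 ha
  have h2 : (D.cochainMap 0 i).toLinearMap a = 0 := h1
  rw [classOf_eq_zero]
  change (a : D.cochain 0 A) = 0
  exact D.cochainMap_injective h 0 (h2.trans (map_zero _).symm)

theorem exact_middle (h : IsShortExact i p) (n : ℕ) :
    Function.Exact (D.cohomologyMap n i).toLinearMap (D.cohomologyMap n p).toLinearMap := by
  intro b
  obtain ⟨b, rfl⟩ := D.classOf_surjective n B b
  constructor
  · intro hb
    have h1 : (D.cochainMap n p).toLinearMap b ∈ D.coboundary C n := (D.classOf_eq_zero).1 hb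
    have h2 : ∃ b' ∈ D.coboundary B n, (D.cochainMap n p).toLinearMap b'
        = (D.cochainMap n p).toLinearMap b := by
      cases n with
      | zero =>
        have h1 : (D.cochainMap 0 p).toLinearMap b = 0 := h1
        exact ⟨0, Submodule.zero_mem _, by rw [h1, map_zero]⟩
      | succ n =>
        obtain ⟨η, hη⟩ := h1
        obtain ⟨s, hs⟩ := D.exists_section h n
        refine ⟨(D.d n B).toLinearMap (s η), ⟨_, rfl⟩, ?_⟩
        rw [← d_cochainMap, hs, hη]
    obtain ⟨b', hb', hp⟩ := h2
    obtain ⟨r, hr⟩ := D.exists_retraction h n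
    have h3 := hr (b - b') (by rw [map_sub, hp, sub_self])
    have h4 : (D.d n A).toLinearMap (r (b - b')) = 0 := by
      refine D.cochainMap_injective h (n + 1) ?_
      rw [← d_cochainMap, h3, map_sub, D.coboundary_le n B hb', map_zero, sub_zero]
      exact b.2
    have hb0 : (b : D.cochain n B) - b' ∈ LinearMap.ker (D.d n B).toLinearMap := by
      rw [LinearMap.mem_ker, map_sub, D.coboundary_le n B hb', sub_zero]
      exact b.2
    refine ⟨D.classOf n A ⟨r (b - b'), h4⟩, ?_⟩
    rw [D.cohomologyMap_classOf n i _ ⟨b - b', hb0⟩ h3.symm, ← sub_eq_zero, ← map_sub,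
      classOf_eq_zero]
    have : ((⟨(b : D.cochain n B) - b', hb0⟩ - b : LinearMap.ker (D.d n B).toLinearMap) :
        D.cochain n B) = - b' := by
      exact sub_sub_cancel_left _ _
    rw [this]
    exact Submodule.neg_mem _ hb'
  · rintro ⟨a, ha⟩
    obtain ⟨a, rfl⟩ := D.classOf_surjective n A a
    rw [← ha]
    refine (D.classOf_eq_zero).2 ?_
    change (D.cochainMap n p).toLinearMap ((D.cochainMap n i).toLinearMap a) ∈ _
    rw [D.cochainMap_comp h]
    exact Submodule.zero_mem _

theorem exact_connecting (h : IsShortExact i p) (n : ℕ) :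
    ∃ δ : HCHom (D.cohomology n C) (D.cohomology (n + 1) A),
      Function.Exact (D.cohomologyMap n p).toLinearMap δ.toLinearMap ∧
      Function.Exact δ.toLinearMap (D.cohomologyMap (n + 1) i).toLinearMap := by
  obtain ⟨δ, key⟩ := D.exists_connecting h n
  obtain ⟨s, hs⟩ := D.exists_section h n
  obtain ⟨r, hr⟩ := D.exists_retraction h (n + 1)
  have lift : ∀ z : LinearMap.ker (D.d n C).toLinearMap,
      ∃ a : LinearMap.ker (D.d (n + 1) A).toLinearMap,
        (D.d n B).toLinearMap (s z) = (D.cochainMap (n + 1) i).toLinearMap a := by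
    intro z
    have h1 := hr ((D.d n B).toLinearMap (s z)) (by
      rw [← d_cochainMap, hs]
      exact z.2)
    refine ⟨⟨r ((D.d n B).toLinearMap (s z)), ?_⟩, h1.symm⟩
    rw [LinearMap.mem_ker]
    refine D.cochainMap_injective h (n + 1 + 1) ?_
    rw [← d_cochainMap, h1, map_zero]
    exact D.d_d n B _
  refine ⟨δ, fun z => ?_, fun a => ?_⟩
  · obtain ⟨z, rfl⟩ := D.classOf_surjective n C z
    obtain ⟨a, ha⟩ := lift z
    constructor
    · intro hz
      rw [key (s z) z a (hs z) ha, classOf_eq_zero] at hz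
      obtain ⟨η, hη⟩ := hz
      have hb : s z - (D.cochainMap n i).toLinearMap η ∈ LinearMap.ker (D.d n B).toLinearMap := by
        rw [LinearMap.mem_ker, map_sub, d_cochainMap, hη, ha, sub_self]
      refine ⟨D.classOf n B ⟨_, hb⟩, D.cohomologyMap_classOf n p _ z ?_⟩
      rw [map_sub, hs, D.cochainMap_comp h, sub_zero]
    · rintro ⟨b, hb⟩
      obtain ⟨b, rfl⟩ := D.classOf_surjective n B b
      rw [← hb, D.cohomologyMap_classOf n p b ⟨(D.cochainMap n p).toLinearMap b, by
        rw [LinearMap.mem_ker, d_cochainMap]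
        exact (congrArg _ b.2).trans (map_zero _)⟩ rfl]
      rw [key b _ 0 rfl (by rw [Submodule.coe_zero, map_zero]; exact b.2), map_zero]
  · obtain ⟨a, rfl⟩ := D.classOf_surjective (n + 1) A a
    constructor
    · intro ha
      obtain ⟨b, hb⟩ := (D.classOf_eq_zero).1 ha
      have hb : (D.d n B).toLinearMap b = (D.cochainMap (n + 1) i).toLinearMap a := hb
      have hz : (D.cochainMap n p).toLinearMap b ∈ LinearMap.ker (D.d n C).toLinearMap := by
        rw [LinearMap.mem_ker, d_cochainMap, hb, D.cochainMap_comp h]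
      exact ⟨D.classOf n C ⟨_, hz⟩, key b ⟨_, hz⟩ a rfl hb⟩
    · rintro ⟨z, hz⟩
      obtain ⟨z, rfl⟩ := D.classOf_surjective n C z
      obtain ⟨a', ha'⟩ := lift z
      rw [← hz, key (s z) z a' (hs z) ha']
      refine (D.classOf_eq_zero).2 ?_
      exact ⟨s z, ha'⟩

theorem subsingleton_cohomology (n : ℕ) (hn : Module.finrank ℂ D.𝔲 < n) (V : HCModule.{u} P) :
    Subsingleton (D.cohomology n V) := by
  have h0 : ∀ ω : D.𝔲 [⋀^Fin n]→ₗ[ℂ] V, ω = 0 := by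
    intro ω
    ext v
    refine ω.map_linearDependent v fun hv => ?_
    have := hv.fintype_card_le_finrank
    simp at this
    omega
  refine ⟨fun a b => ?_⟩
  obtain ⟨a, rfl⟩ := D.classOf_surjective n V a
  obtain ⟨b, rfl⟩ := D.classOf_surjective n V b
  congr 1
  exact Subtype.ext ((h0 (a : D.cochain n V)).trans (h0 (b : D.cochain n V)).symm)

end CohDatum
end Euler

/-! ### Admissible pairs, Weyl denominators -/

section Weyl

variable {𝔤 K : Type*} [LieRing 𝔤] [LieAlgebra ℂ 𝔤] [Group K] [TopologicalSpace K]
  [IsTopologicalGroup K] {P : LiePair 𝔤 K}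

/-- The map induced by `f` on alternating maps. -/
def HCModule.altMap (n : ℕ) (U : HCModule.{u} P) [FiniteDimensional ℂ U] {V W : HCModule.{u} P}
    (f : HCHom V W) : HCHom (HCModule.alt n U V) (HCModule.alt n U W) where
  toLinearMap := (f.toLinearMap.compAlternatingMapₗ ℂ :
    (U [⋀^Fin n]→ₗ[ℂ] V) →ₗ[ℂ] (U [⋀^Fin n]→ₗ[ℂ] W))
  map_rep x := by
    intro (ω : U [⋀^Fin n]→ₗ[ℂ] V)
    refine AlternatingMap.ext fun v => ?_
    have h : ∀ v, f.toLinearMap (V.rep x v) = W.rep x (f.toLinearMap v) := f.map_rep x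
    change f.toLinearMap (V.rep x (ω v) - altDer (U.rep x) ω v)
      = W.rep x (f.toLinearMap (ω v)) - altDer (U.rep x) _ v
    rw [map_sub, h]
    exact congrArg _ (congrArg (fun η => η v)
      (altDer_comp (V := V.carrier) f.toLinearMap (U.rep x) ω).symm)
  map_act m ω := by
    refine AlternatingMap.ext fun v => ?_
    exact f.map_act m _

theorem IsShortExact.altMap (n : ℕ) (U : HCModule.{u} P) [FiniteDimensional ℂ U]
    {A B C : HCModule.{u} P} {i : HCHom A B} {p : HCHom B C} (h : IsShortExact i p) :
    IsShortExact (HCModule.altMap n U i) (HCModule.altMap n U p) where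
  injective := by
    intro (ω : U [⋀^Fin n]→ₗ[ℂ] A) (η : U [⋀^Fin n]→ₗ[ℂ] A) hωη
    refine AlternatingMap.ext fun v => h.injective ?_
    exact congrArg (fun ζ : U [⋀^Fin n]→ₗ[ℂ] B => ζ v) hωη
  surjective := by
    intro (ω : U [⋀^Fin n]→ₗ[ℂ] C)
    obtain ⟨s, hs⟩ := p.toLinearMap.exists_rightInverse_of_surjective
      (LinearMap.range_eq_top.2 h.surjective)
    refine ⟨s.compAlternatingMap ω, AlternatingMap.ext fun v => ?_⟩
    exact LinearMap.congr_fun hs (ω v)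
  exact := by
    intro (ω : U [⋀^Fin n]→ₗ[ℂ] B)
    constructor
    · intro hω
      have hω' : ∀ v, p.toLinearMap (ω v) = 0 := fun v =>
        congrArg (fun ζ : U [⋀^Fin n]→ₗ[ℂ] C => ζ v) hω
      obtain ⟨r, hr⟩ := i.toLinearMap.exists_leftInverse_of_injective
        (LinearMap.ker_eq_bot.2 h.injective)
      refine ⟨r.compAlternatingMap ω, AlternatingMap.ext fun v => ?_⟩
      obtain ⟨a, ha⟩ := (h.exact _).1 (hω' v)
      change i.toLinearMap (r (ω v)) = ω v
      rw [← ha]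
      exact congrArg _ (LinearMap.congr_fun hr a)
    · rintro ⟨ζ, rfl⟩
      refine AlternatingMap.ext fun v => ?_
      exact (h.exact _).2 ⟨(show U [⋀^Fin n]→ₗ[ℂ] A from ζ) v, rfl⟩

variable {S : HCModule.{u} P → Prop}

theorem weylMul_aux (U : HCModule.{u} P) [FiniteDimensional ℂ U]
    (h : ∀ n V, S V → S (HCModule.alt n U V)) {A B C : HCModule.{u} P} (i : HCHom A B)
    (p : HCHom B C) (hip : IsShortExact i p) (hA : S A) (hB : S B) (hC : S C) :
    ∑ n ∈ Finset.range (Module.finrank ℂ U + 1),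
        (-1 : ℤ) ^ n • GrothendieckGroup.cls (HCModule.alt n U B) (h n B hB)
      = (∑ n ∈ Finset.range (Module.finrank ℂ U + 1),
          (-1 : ℤ) ^ n • GrothendieckGroup.cls (HCModule.alt n U A) (h n A hA))
        + ∑ n ∈ Finset.range (Module.finrank ℂ U + 1),
          (-1 : ℤ) ^ n • GrothendieckGroup.cls (HCModule.alt n U C) (h n C hC) := by
  rw [← Finset.sum_add_distrib]
  refine Finset.sum_congr rfl fun n _ => ?_
  rw [GrothendieckGroup.cls_eq_add _ _ (hip.altMap n U) (h n _ hA) (h n _ hB) (h n _ hC),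
    smul_add]

/-- Multiplication by `∑ₙ (-1)ⁿ [⋀ⁿ U*]` on the Grothendieck group of a category which is closed
under tensor products with the modules `⋀ⁿ U*`. -/
def weylMul (U : HCModule.{u} P) [FiniteDimensional ℂ U]
    (h : ∀ n V, S V → S (HCModule.alt n U V)) : GrothendieckGroup S →+ GrothendieckGroup S :=
  GrothendieckGroup.lift
    (fun V hV => ∑ n ∈ Finset.range (Module.finrank ℂ U + 1),
      (-1 : ℤ) ^ n • GrothendieckGroup.cls (HCModule.alt n U V) (h n V hV))
    (weylMul_aux U h)

theorem weylMul_cls (U : HCModule.{u} P) [FiniteDimensional ℂ U]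
    (h : ∀ n V, S V → S (HCModule.alt n U V)) (V : HCModule.{u} P) (hV : S V) :
    weylMul U h (GrothendieckGroup.cls V hV)
      = ∑ n ∈ Finset.range (Module.finrank ℂ U + 1),
        (-1 : ℤ) ^ n • GrothendieckGroup.cls (HCModule.alt n U V) (h n V hV) :=
  GrothendieckGroup.lift_cls _ (weylMul_aux U h) V hV

/-- Exchanging the arguments of an alternating map with values in alternating maps. -/
def altSwapFun {U₁ U₂ V : Type*} [AddCommGroup U₁] [Module ℂ U₁] [AddCommGroup U₂] [Module ℂ U₂]
    [AddCommGroup V] [Module ℂ V] {a b : ℕ} (ω : U₁ [⋀^Fin a]→ₗ[ℂ] U₂ [⋀^Fin b]→ₗ[ℂ] V) :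
    U₂ [⋀^Fin b]→ₗ[ℂ] U₁ [⋀^Fin a]→ₗ[ℂ] V where
  toFun w :=
    { toFun := fun v => ω v w
      map_update_add' := fun v i x y => by simp
      map_update_smul' := fun v i c x => by simp
      map_eq_zero_of_eq' := fun v i j h hij => by
        change ω v w = 0
        rw [ω.map_eq_zero_of_eq v h hij, AlternatingMap.zero_apply] }
  map_update_add' w i x y := by
    ext v
    exact (ω v).map_update_add w i x y
  map_update_smul' w i c x := by
    ext v
    exact (ω v).map_update_smul w i c x
  map_eq_zero_of_eq' w i j h hij := by
    ext v
    exact (ω v).map_eq_zero_of_eq w h hij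

/-- Evaluation of alternating maps. -/
def altEval {U V : Type*} [AddCommGroup U] [Module ℂ U] [AddCommGroup V] [Module ℂ V] {n : ℕ}
    (v : Fin n → U) : (U [⋀^Fin n]→ₗ[ℂ] V) →+ V where
  toFun ω := ω v
  map_zero' := rfl
  map_add' _ _ := rfl

theorem altDer_altSwapFun {U₁ U₂ V : Type*} [AddCommGroup U₁] [Module ℂ U₁] [AddCommGroup U₂]
    [Module ℂ U₂] [AddCommGroup V] [Module ℂ V] {a b : ℕ} (A : Module.End ℂ U₁)
    (ω : U₁ [⋀^Fin a]→ₗ[ℂ] U₂ [⋀^Fin b]→ₗ[ℂ] V) (v : Fin a → U₁) (w : Fin b → U₂) :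
    altDer A (altSwapFun ω w) v = altDer A ω v w := by
  simp only [altDer_apply]
  exact (map_sum (altEval (V := V) w) _ _).symm

theorem altDer_altSwapFun' {U₁ U₂ V : Type*} [AddCommGroup U₁] [Module ℂ U₁] [AddCommGroup U₂]
    [Module ℂ U₂] [AddCommGroup V] [Module ℂ V] {a b : ℕ} (A : Module.End ℂ U₂)
    (ω : U₁ [⋀^Fin a]→ₗ[ℂ] U₂ [⋀^Fin b]→ₗ[ℂ] V) (v : Fin a → U₁) (w : Fin b → U₂) :
    altDer A (altSwapFun ω) w v = altDer A (ω v) w := by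
  simp only [altDer_apply]
  exact map_sum (altEval (V := V) v) _ _

/-- The isomorphism `⋀ᵃ U₁* ⊗ ⋀ᵇ U₂* ⊗ V ≅ ⋀ᵇ U₂* ⊗ ⋀ᵃ U₁* ⊗ V`. -/
def HCModule.altSwap (a b : ℕ) (U₁ U₂ V : HCModule.{u} P) [FiniteDimensional ℂ U₁]
    [FiniteDimensional ℂ U₂] :
    HCHom (HCModule.alt a U₁ (HCModule.alt b U₂ V)) (HCModule.alt b U₂ (HCModule.alt a U₁ V)) where
  toFun := fun ω : U₁ [⋀^Fin a]→ₗ[ℂ] U₂ [⋀^Fin b]→ₗ[ℂ] V => altSwapFun ω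
  map_add' _ _ := rfl
  map_smul' _ _ := rfl
  map_rep x := by
    intro (ω : U₁ [⋀^Fin a]→ₗ[ℂ] U₂ [⋀^Fin b]→ₗ[ℂ] V)
    refine AlternatingMap.ext fun w => AlternatingMap.ext fun v => ?_
    change (V.rep x (ω v w) - altDer (U₂.rep x) (ω v) w) - (altDer (U₁.rep x) ω v) w
      = (V.rep x (ω v w) - altDer (U₁.rep x) (altSwapFun ω w) v)
        - (altDer (U₂.rep x) (altSwapFun ω) w) v
    rw [sub_right_comm]
    rw [altDer_altSwapFun, altDer_altSwapFun']
  map_act k ω := rfl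

theorem HCModule.altSwap_bijective (a b : ℕ) (U₁ U₂ V : HCModule.{u} P) [FiniteDimensional ℂ U₁]
    [FiniteDimensional ℂ U₂] :
    Function.Bijective (HCModule.altSwap a b U₁ U₂ V).toLinearMap :=
  Function.bijective_iff_has_inverse.2
    ⟨(HCModule.altSwap b a U₂ U₁ V).toLinearMap, fun _ => rfl, fun _ => rfl⟩

theorem weylMul_comm (hS : IsAbelianSubcategory S) (U₁ U₂ : HCModule.{u} P)
    [FiniteDimensional ℂ U₁] [FiniteDimensional ℂ U₂]
    (h₁ : ∀ n V, S V → S (HCModule.alt n U₁ V)) (h₂ : ∀ n V, S V → S (HCModule.alt n U₂ V))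
    (x : GrothendieckGroup S) :
    weylMul U₁ h₁ (weylMul U₂ h₂ x) = weylMul U₂ h₂ (weylMul U₁ h₁ x) := by
  have key : (weylMul U₁ h₁).comp (weylMul U₂ h₂) = (weylMul U₂ h₂).comp (weylMul U₁ h₁) := by
    refine GrothendieckGroup.hom_ext fun V hV => ?_
    simp only [AddMonoidHom.comp_apply, weylMul_cls, map_sum, map_zsmul, Finset.smul_sum]
    rw [Finset.sum_comm]
    refine Finset.sum_congr rfl fun a _ => Finset.sum_congr rfl fun b _ => ?_
    rw [smul_comm, GrothendieckGroup.cls_eq_of_bijective hS (HCModule.altSwap a b U₁ U₂ V)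
      (HCModule.altSwap_bijective a b U₁ U₂ V)]
  exact DFunLike.congr_fun key x

end Weyl

section Admissible

variable {𝔩 M : Type*} {𝔤 : Type u} {K : Type*} [LieRing 𝔩] [LieAlgebra ℂ 𝔩] [Group M]
  [TopologicalSpace M] [IsTopologicalGroup M] [LieRing 𝔤] [LieAlgebra ℂ 𝔤] [Group K]
  [TopologicalSpace K] [IsTopologicalGroup K] [FiniteDimensional ℂ 𝔤]
  {P' : LiePair 𝔩 M} {P : LiePair 𝔤 K}

/-- The pair `(𝒢, ℒ)` of full subcategories of the categories of `(𝔤, K)`- and `(𝔩, M)`-modules is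
`𝔲`-admissible. -/
structure IsAdmissiblePair (D : CohDatum P' P) (G : HCModule.{u} P → Prop)
    (L : HCModule.{u} P' → Prop) : Prop where
  abelian_left : IsAbelianSubcategory G
  abelian_right : IsAbelianSubcategory L
  trivial_mem : G (HCModule.trivial P)
  ext_mem : ∀ n, L (HCModule.alt n D.nil (HCModule.trivial P'))
  tensor_mem : ∀ n V, L V → L (HCModule.alt n D.nil V)
  cohomology_mem : ∀ n V, G V → L (D.cohomology n V)

variable {D : CohDatum P' P} {G : HCModule.{u} P → Prop} {L : HCModule.{u} P' → Prop}

namespace IsAdmissiblePair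

/-- The Euler characteristic of the `𝔲`-cohomology is additive. -/
theorem euler_additive (h : IsAdmissiblePair D G L) {A B C : HCModule.{u} P} (i : HCHom A B)
    (p : HCHom B C) (hip : IsShortExact i p) (hA : G A) (hB : G B) (hC : G C) :
    ∑ n ∈ Finset.range (Module.finrank ℂ D.𝔲 + 1),
        (-1 : ℤ) ^ n • GrothendieckGroup.cls (D.cohomology n B) (h.cohomology_mem n B hB)
      = (∑ n ∈ Finset.range (Module.finrank ℂ D.𝔲 + 1),
          (-1 : ℤ) ^ n • GrothendieckGroup.cls (D.cohomology n A) (h.cohomology_mem n A hA))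
        + ∑ n ∈ Finset.range (Module.finrank ℂ D.𝔲 + 1),
          (-1 : ℤ) ^ n • GrothendieckGroup.cls (D.cohomology n C) (h.cohomology_mem n C hC) := by
  choose δ hδ₁ hδ₂ using D.exact_connecting hip
  have mA := fun n => h.cohomology_mem n A hA
  have mB := fun n => h.cohomology_mem n B hB
  have mC := fun n => h.cohomology_mem n C hC
  have hδ : ∀ n, L (δ n).im := fun n => (δ n).im_mem h.abelian_right (mC n) (mA (n + 1))
  have hi : ∀ n, L (D.cohomologyMap n i).im :=
    fun n => HCHom.im_mem h.abelian_right _ (mA n) (mB n)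
  have hp : ∀ n, L (D.cohomologyMap n p).im :=
    fun n => HCHom.im_mem h.abelian_right _ (mB n) (mC n)
  have eB : ∀ n, GrothendieckGroup.cls _ (mB n)
      = GrothendieckGroup.cls _ (hi n) + GrothendieckGroup.cls _ (hp n) := fun n =>
    GrothendieckGroup.cls_eq_of_exact _ _ (D.exact_middle hip n) (hi n) (mB n) (hp n)
  have eC : ∀ n, GrothendieckGroup.cls _ (mC n)
      = GrothendieckGroup.cls _ (hp n) + GrothendieckGroup.cls _ (hδ n) := fun n =>
    GrothendieckGroup.cls_eq_of_exact _ _ (hδ₁ n) (hp n) (mC n) (hδ n)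
  have eA : ∀ n, GrothendieckGroup.cls _ (mA (n + 1))
      = GrothendieckGroup.cls _ (hδ n) + GrothendieckGroup.cls _ (hi (n + 1)) := fun n =>
    GrothendieckGroup.cls_eq_of_exact _ _ (hδ₂ n) (hδ n) (mA (n + 1)) (hi (n + 1))
  have eA0 : GrothendieckGroup.cls _ (mA 0) = GrothendieckGroup.cls _ (hi 0) := by
    refine GrothendieckGroup.cls_eq_of_bijective h.abelian_right (D.cohomologyMap 0 i).imπ
      ⟨fun a b hab => D.injective_zero hip ?_, LinearMap.surjective_rangeRestrict _⟩ _ _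
    exact congrArg Subtype.val hab
  have key : ∀ m, ∑ n ∈ Finset.range (m + 1), (-1 : ℤ) ^ n •
      (GrothendieckGroup.cls _ (mA n) + GrothendieckGroup.cls _ (mC n)
        - GrothendieckGroup.cls _ (mB n)) = (-1 : ℤ) ^ m • GrothendieckGroup.cls _ (hδ m) := by
    intro m
    induction m with
    | zero =>
      simp only [zero_add, Finset.sum_range_one, pow_zero, one_smul]
      rw [eA0, eB, eC]
      abel
    | succ m ih =>
      rw [Finset.sum_range_succ, ih, eA, eB, eC, pow_succ]
      rw [mul_neg_one, neg_smul, neg_smul, ← sub_eq_add_neg, ← smul_sub, ← smul_neg]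
      congr 1
      abel
  have hz : GrothendieckGroup.cls _ (hδ (Module.finrank ℂ D.𝔲)) = 0 := by
    have := D.subsingleton_cohomology (Module.finrank ℂ D.𝔲 + 1) (Nat.lt_succ_self _) A
    have : Subsingleton (δ (Module.finrank ℂ D.𝔲)).im :=
      ⟨fun a b => Subtype.ext (Subsingleton.elim (α := D.cohomology _ A) _ _)⟩
    exact GrothendieckGroup.cls_eq_zero _ _
  have := key (Module.finrank ℂ D.𝔲)
  rw [hz, smul_zero] at this
  simp only [smul_sub, smul_add, Finset.sum_sub_distrib, Finset.sum_add_distrib] at this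
  exact (sub_eq_zero.1 this).symm

/-- The homomorphism `H : K(𝒢) → K(ℒ)`, `[V] ↦ ∑ₙ (-1)ⁿ [Hⁿ(𝔲; V)]`. -/
def euler (h : IsAdmissiblePair D G L) : GrothendieckGroup G →+ GrothendieckGroup L :=
  GrothendieckGroup.lift
    (fun V hV => ∑ n ∈ Finset.range (Module.finrank ℂ D.𝔲 + 1),
      (-1 : ℤ) ^ n • GrothendieckGroup.cls (D.cohomology n V) (h.cohomology_mem n V hV))
    h.euler_additive

/-- Multiplication by the Weyl denominator `W = ∑ₙ (-1)ⁿ [⋀ⁿ 𝔲*]` on `K(ℒ)`. -/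
def weyl (h : IsAdmissiblePair D G L) : GrothendieckGroup L →+ GrothendieckGroup L :=
  weylMul D.nil h.tensor_mem

end IsAdmissiblePair

/-- The quadruple `(𝒢, ℒ, K_𝒢, K_ℒ)` is `𝔲`-admissible. -/
structure IsAdmissibleQuadruple (h : IsAdmissiblePair D G L)
    (KG : AddSubgroup (GrothendieckGroup G)) (KL : AddSubgroup (GrothendieckGroup L)) : Prop where
  euler_mem : ∀ x ∈ KG, h.euler x ∈ KL
  weyl_mem : ∀ x ∈ KL, h.weyl x ∈ KL

end Admissible

/-! ### Localization and characters -/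

section Localized

open Polynomial

variable {A B : Type*} [AddCommGroup A] [AddCommGroup B]

/-- The localization `A[w⁻¹]` of an abelian group `A` at an endomorphism `w`: consider `A` as a
module over `ℤ[X]` with `X` acting as `w`, and localize at the powers of `X`. -/
abbrev Localized (w : A →+ A) : Type _ :=
  LocalizedModule (Submonoid.powers (X : ℤ[X])) (Module.AEval' w.toIntLinearMap)

/-- The fraction `a / wᵏ`. -/
def Localized.frac (w : A →+ A) (a : A) (k : ℕ) : Localized w :=
  LocalizedModule.mk (Module.AEval'.of w.toIntLinearMap a) ⟨X ^ k, k, rfl⟩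

/-- The homomorphism `a ↦ a / wᵏ`. -/
def Localized.fracHom (w : A →+ A) (k : ℕ) : A →+ Localized w where
  toFun a := frac w a k
  map_zero' := by
    unfold frac
    rw [map_zero, LocalizedModule.zero_mk]
  map_add' x y := by
    unfold frac
    rw [map_add, LocalizedModule.mk_add_mk, ← smul_add]
    exact (LocalizedModule.mk_cancel_common_left _ _ _).symm

/-- Multiplication by `w` on `A[w⁻¹]`. -/
def Localized.mul (w : A →+ A) : Localized w →+ Localized w :=
  DistribSMul.toAddMonoidHom (Localized w) (X : ℤ[X])

/-- The map `A[w⁻¹] → B[w'⁻¹]`, `a / wᵏ ↦ f a / w'ᵏ`, induced by a map `f` with `f w = w' f`. -/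
def Localized.map (w : A →+ A) (w' : B →+ B) (f : A →+ B) (h : ∀ a, f (w a) = w' (f a)) :
    Localized w →+ Localized w' :=
  (IsLocalizedModule.map (Submonoid.powers (X : ℤ[X]))
    (LocalizedModule.mkLinearMap _ _) (LocalizedModule.mkLinearMap _ _)
    (LinearMap.ofAEval w.toIntLinearMap
      ((Module.AEval'.of w'.toIntLinearMap).toLinearMap ∘ₗ f.toIntLinearMap) (fun a => by
        have := Module.AEval'.X_smul_of w'.toIntLinearMap (f a)
        simp only [LinearMap.comp_apply, LinearEquiv.coe_coe, AddMonoidHom.coe_toIntLinearMap]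
        rw [this]
        exact congrArg _ (h a)))).toAddMonoidHom

end Localized

section Character

variable {𝔩 M : Type*} {𝔤 : Type u} {K : Type*} [LieRing 𝔩] [LieAlgebra ℂ 𝔩] [Group M]
  [TopologicalSpace M] [IsTopologicalGroup M] [LieRing 𝔤] [LieAlgebra ℂ 𝔤] [Group K]
  [TopologicalSpace K] [IsTopologicalGroup K] [FiniteDimensional ℂ 𝔤]
  {P' : LiePair 𝔩 M} {P : LiePair 𝔤 K} {D : CohDatum P' P} {G : HCModule.{u} P → Prop}
  {L : HCModule.{u} P' → Prop} {h : IsAdmissiblePair D G L}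
  {KG : AddSubgroup (GrothendieckGroup G)} {KL : AddSubgroup (GrothendieckGroup L)}

namespace IsAdmissibleQuadruple

/-- The restriction `H : K_𝒢 → K_ℒ`. -/
def euler (Q : IsAdmissibleQuadruple h KG KL) : KG →+ KL :=
  (h.euler.comp KG.subtype).codRestrict KL fun x => Q.euler_mem x x.2

/-- Multiplication by the Weyl denominator on `K_ℒ`. -/
def weyl (Q : IsAdmissibleQuadruple h KG KL) : KL →+ KL :=
  (h.weyl.comp KL.subtype).codRestrict KL fun x => Q.weyl_mem x x.2

/-- The group `C(Q) = K_ℒ[W⁻¹]` in which the characters take their values. -/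
abbrev CharGroup (Q : IsAdmissibleQuadruple h KG KL) : Type _ := Localized Q.weyl

/-- The algebraic character `c(X) = H(X) / W`. -/
def char (Q : IsAdmissibleQuadruple h KG KL) : KG →+ Q.CharGroup :=
  (Localized.fracHom Q.weyl 1).comp Q.euler

end IsAdmissibleQuadruple

end Character

section Transitivity

variable {𝔪 N : Type*} {𝔩 : Type u} {M : Type*} {𝔤 : Type u} {K : Type*} [LieRing 𝔪]
  [LieAlgebra ℂ 𝔪] [Group N] [TopologicalSpace N] [IsTopologicalGroup N] [LieRing 𝔩]
  [LieAlgebra ℂ 𝔩] [FiniteDimensional ℂ 𝔩] [Group M] [TopologicalSpace M] [IsTopologicalGroup M]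
  [LieRing 𝔤] [LieAlgebra ℂ 𝔤] [FiniteDimensional ℂ 𝔤] [Group K] [TopologicalSpace K]
  [IsTopologicalGroup K] {P₂ : LiePair 𝔪 N} {P₁ : LiePair 𝔩 M} {P : LiePair 𝔤 K}
  {D : CohDatum P₁ P} {D' : CohDatum P₂ P₁} {D'' : CohDatum P₂ P}
  {catG : HCModule.{u} P → Prop} {catL : HCModule.{u} P₁ → Prop} {catM : HCModule.{u} P₂ → Prop}
  {h : IsAdmissiblePair D catG catL} {h' : IsAdmissiblePair D' catL catM}
  {h'' : IsAdmissiblePair D'' catG catM} {KG : AddSubgroup (GrothendieckGroup catG)}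
  {KL : AddSubgroup (GrothendieckGroup catL)} {KM : AddSubgroup (GrothendieckGroup catM)}

theorem weyl_comm (Q' : IsAdmissibleQuadruple h' KL KM) (Q'' : IsAdmissibleQuadruple h'' KG KM)
    (z : KM) : Q'.weyl (Q''.weyl z) = Q''.weyl (Q'.weyl z) :=
  Subtype.ext (weylMul_comm h'.abelian_right D'.nil D''.nil h'.tensor_mem h''.tensor_mem z)

/-- Multiplication by the Weyl denominator `W'` of `Q' = (ℒ, ℳ, K_ℒ, K_ℳ)` on the group
`C(Q'') = K_ℳ[W''⁻¹]` of `Q'' = (𝒢, ℳ, K_𝒢, K_ℳ)`. -/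
def weylOn (Q' : IsAdmissibleQuadruple h' KL KM) (Q'' : IsAdmissibleQuadruple h'' KG KM) :
    Q''.CharGroup →+ Q''.CharGroup :=
  Localized.map Q''.weyl Q''.weyl Q'.weyl (weyl_comm Q' Q'')

/-- Let `Q = (𝒢, ℒ, K_𝒢, K_ℒ)`, `Q' = (ℒ, ℳ, K_ℒ, K_ℳ)`, `Q'' = (𝒢, ℳ, K_𝒢, K_ℳ)` have the
Weyl denominators `W`, `W'`, `W''`, so that `W'' = W' · W` after restriction. The homomorphism
`e : C(Q) = K_ℒ[W⁻¹] → C(Q'') = K_ℳ[W''⁻¹]` is the natural extension of the character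
`c' : K_ℒ → C(Q') = K_ℳ[W'⁻¹]` of `Q'` if it

* extends `c'`: if `c'(Y) = Z / W'ᵏ` in `C(Q')`, then `e(Y) = Z / W'ᵏ`, that is,
  `W'ᵏ · e(Y) = Z` in `C(Q'')`;
* is linear over `W`: `e(W · z) = W · e(z)`. Since multiplication by `W` itself need not be defined
  on `K_ℳ`, this is multiplied by `W'`: it reads `W' · e(W · z) = W'' · e(z)`. -/
structure IsNaturalExtension (Q : IsAdmissibleQuadruple h KG KL)
    (Q' : IsAdmissibleQuadruple h' KL KM) (Q'' : IsAdmissibleQuadruple h'' KG KM)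
    (e : Q.CharGroup →+ Q''.CharGroup) : Prop where
  extends_char : ∀ (Y : KL) (Z : KM) (k : ℕ), Q'.char Y = Localized.frac Q'.weyl Z k →
    (weylOn Q' Q'')^[k] (e (Localized.frac Q.weyl Y 0)) = Localized.frac Q''.weyl Z 0
  map_weyl : ∀ z : Q.CharGroup,
    weylOn Q' Q'' (e (Localized.mul Q.weyl z)) = Localized.mul Q''.weyl (e z)

end Transitivity

/-! ### Reductive pairs -/

section Subpair

variable {𝔤 K : Type*} [LieRing 𝔤] [LieAlgebra ℂ 𝔤] [Group K] [TopologicalSpace K]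
  [IsTopologicalGroup K]

/-- The inclusion of a subgroup as a continuous homomorphism. -/
def subgroupIncl (H : Subgroup K) : H →ₜ* K := ⟨H.subtype, continuous_subtype_val⟩

/-- The pair `(𝔩, H)` for a subgroup `H` of `K` and an `H`-stable subalgebra `𝔩` of `𝔤`. -/
def LiePair.sub (P : LiePair 𝔤 K) (𝔩 : LieSubalgebra ℂ 𝔤) (H : Subgroup K)
    (h : ∀ k ∈ H, ∀ x ∈ 𝔩, P.Ad k x ∈ 𝔩) : LiePair 𝔩 H where
  Ad :=
    { toFun := fun k => (P.Ad k).restrict (q := 𝔩.toSubmodule) (p := 𝔩.toSubmodule) (h k k.2)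
      map_one' := LinearMap.ext fun x => Subtype.ext (by simp)
      map_mul' := fun k l => LinearMap.ext fun x => Subtype.ext (by simp) }
  Ad_lie k x y := Subtype.ext (P.Ad_lie k x y)
  IsTangent γ X := P.IsTangent ((subgroupIncl H).comp γ) X
  continuous_Ad x f := by
    obtain ⟨F, hF⟩ := LinearMap.exists_extend (p := 𝔩.toSubmodule) f
    refine ((P.continuous_Ad x F).comp continuous_subtype_val).congr fun k => ?_
    rw [← hF]
    rfl
  hasDerivAt_Ad γ X hX y f := by
    obtain ⟨F, hF⟩ := LinearMap.exists_extend (p := 𝔩.toSubmodule) f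
    rw [← hF]
    exact P.hasDerivAt_Ad _ _ hX y F

end Subpair

section Reductive

/-- The complexification of a real Lie algebra. -/
abbrev Complexification (𝔤₀ : Type u) [LieRing 𝔤₀] [LieAlgebra ℝ 𝔤₀] : Type u := ℂ ⊗[ℝ] 𝔤₀

/-- The complexification of a real subalgebra. -/
def complexify {𝔤₀ : Type u} [LieRing 𝔤₀] [LieAlgebra ℝ 𝔤₀] (𝔩₀ : LieSubalgebra ℝ 𝔤₀) :
    LieSubalgebra ℂ (Complexification 𝔤₀) where
  toSubmodule := 𝔩₀.toSubmodule.baseChange ℂ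
  lie_mem' := by
    suffices h : ∀ x ∈ 𝔩₀.toSubmodule.baseChange ℂ, ∀ y ∈ 𝔩₀.toSubmodule.baseChange ℂ,
        ⁅x, y⁆ ∈ 𝔩₀.toSubmodule.baseChange ℂ from fun {x y} hx hy => h x hx y hy
    intro x hx y hy
    rw [Submodule.baseChange_eq_span] at hx hy
    induction hx using Submodule.span_induction with
    | mem x hx =>
      obtain ⟨x, hx, rfl⟩ := hx
      induction hy using Submodule.span_induction with
      | mem y hy =>
        obtain ⟨y, hy, rfl⟩ := hy
        exact Submodule.tmul_mem_baseChange_of_mem _ (𝔩₀.lie_mem hx hy)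
      | zero => rw [lie_zero]; exact Submodule.zero_mem _
      | add y z _ _ h₁ h₂ => rw [lie_add]; exact Submodule.add_mem _ h₁ h₂
      | smul c y _ h₁ => rw [lie_smul]; exact Submodule.smul_mem _ c h₁
    | zero => rw [zero_lie]; exact Submodule.zero_mem _
    | add x z _ _ h₁ h₂ => rw [add_lie]; exact Submodule.add_mem _ h₁ h₂
    | smul c x _ h₁ => rw [smul_lie]; exact Submodule.smul_mem _ c h₁

theorem tmul_mem_complexify {𝔤₀ : Type u} [LieRing 𝔤₀] [LieAlgebra ℝ 𝔤₀]
    {𝔩₀ : LieSubalgebra ℝ 𝔤₀} {x : 𝔤₀} (hx : x ∈ 𝔩₀) :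
    (1 : ℂ) ⊗ₜ[ℝ] x ∈ complexify 𝔩₀ :=
  Submodule.tmul_mem_baseChange_of_mem _ hx

theorem complexify_le {𝔤₀ : Type u} [LieRing 𝔤₀] [LieAlgebra ℝ 𝔤₀]
    {𝔩₀ : LieSubalgebra ℝ 𝔤₀} {S : Submodule ℂ (Complexification 𝔤₀)}
    (h : ∀ x ∈ 𝔩₀, (1 : ℂ) ⊗ₜ[ℝ] x ∈ S) {z : Complexification 𝔤₀} (hz : z ∈ complexify 𝔩₀) :
    z ∈ S := by
  have hz : z ∈ 𝔩₀.toSubmodule.baseChange ℂ := hz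
  rw [Submodule.baseChange_eq_span] at hz
  refine Submodule.span_le.2 ?_ hz
  rintro _ ⟨x, hx, rfl⟩
  exact h x hx

section Parabolic

variable {𝔤 : Type u} [LieRing 𝔤] [LieAlgebra ℂ 𝔤]

/-- A parabolic subalgebra is a subalgebra which contains a Borel subalgebra, that is, a maximal
solvable subalgebra. -/
def IsParabolic (𝔮 : LieSubalgebra ℂ 𝔤) : Prop :=
  ∃ 𝔟 ≤ 𝔮, Maximal (fun 𝔟 : LieSubalgebra ℂ 𝔤 => LieAlgebra.IsSolvable 𝔟) 𝔟

/-- The nilpotent radical `[𝔮, rad 𝔮]` of `𝔮`, as a subalgebra of `𝔤`. -/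
def nilRadical (𝔮 : LieSubalgebra ℂ 𝔤) : LieSubalgebra ℂ 𝔤 :=
  (⁅(⊤ : LieIdeal ℂ 𝔮), LieAlgebra.radical ℂ 𝔮⁆ : LieIdeal ℂ 𝔮).toLieSubalgebra.map 𝔮.incl

theorem mem_nilRadical {𝔮 : LieSubalgebra ℂ 𝔤} {x : 𝔤} : x ∈ nilRadical 𝔮 ↔
    ∃ h : x ∈ 𝔮, (⟨x, h⟩ : 𝔮) ∈ ⁅(⊤ : LieIdeal ℂ 𝔮), LieAlgebra.radical ℂ 𝔮⁆ := by
  constructor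
  · rintro ⟨y, hy, rfl⟩
    exact ⟨y.2, hy⟩
  · rintro ⟨h, hx⟩
    exact ⟨⟨x, h⟩, hx, rfl⟩

theorem lie_mem_nilRadical {𝔮 : LieSubalgebra ℂ 𝔤} {x y : 𝔤} (hx : x ∈ 𝔮)
    (hy : y ∈ nilRadical 𝔮) : ⁅x, y⁆ ∈ nilRadical 𝔮 := by
  obtain ⟨h, hy⟩ := mem_nilRadical.1 hy
  exact mem_nilRadical.2 ⟨𝔮.lie_mem hx h, lie_mem_right ℂ 𝔮 _ ⟨x, hx⟩ ⟨y, h⟩ hy⟩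

/-- The radical is stable under automorphisms. -/
theorem map_mem_radical {L : Type*} [LieRing L] [LieAlgebra ℂ L] [FiniteDimensional ℂ L]
    (e f : L →ₗ⁅ℂ⁆ L) (hef : ∀ x, e (f x) = x) (hfe : ∀ x, f (e x) = x) {x : L}
    (hx : x ∈ LieAlgebra.radical ℂ L) : e x ∈ LieAlgebra.radical ℂ L := by
  let I : LieIdeal ℂ L := (LieAlgebra.radical ℂ L).comap f
  let g : I →ₗ⁅ℂ⁆ LieAlgebra.radical ℂ L :=
    { toFun := fun y => ⟨f (y : L), y.2⟩
      map_add' := fun y z => Subtype.ext (map_add f _ _)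
      map_smul' := fun c y => Subtype.ext (map_smul f _ _)
      map_lie' := Subtype.ext (LieHom.map_lie f _ _) }
  have hg : Function.Injective g := by
    intro y z hyz
    have h : f y = f z := congrArg Subtype.val hyz
    exact Subtype.ext (by rw [← hef y, h, hef])
  have hI : LieAlgebra.IsSolvable I := hg.lieAlgebra_isSolvable
  have hx' : e x ∈ I := by
    change f (e x) ∈ LieAlgebra.radical ℂ L
    rwa [hfe]
  exact (LieAlgebra.LieIdeal.solvable_iff_le_radical ℂ L I).1 hI hx'

/-- The nilpotent radical of `𝔮` is stable under automorphisms of `𝔤` preserving `𝔮`. -/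
theorem map_mem_nilRadical [FiniteDimensional ℂ 𝔤] {𝔮 : LieSubalgebra ℂ 𝔤} (e f : 𝔤 →ₗ[ℂ] 𝔤)
    (he : ∀ x y, e ⁅x, y⁆ = ⁅e x, e y⁆) (hf : ∀ x y, f ⁅x, y⁆ = ⁅f x, f y⁆)
    (hef : ∀ x, e (f x) = x) (hfe : ∀ x, f (e x) = x) (heq : ∀ x ∈ 𝔮, e x ∈ 𝔮)
    (hfq : ∀ x ∈ 𝔮, f x ∈ 𝔮) {x : 𝔤} (hx : x ∈ nilRadical 𝔮) : e x ∈ nilRadical 𝔮 := by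
  obtain ⟨h, hx⟩ := mem_nilRadical.1 hx
  let e' : 𝔮 →ₗ⁅ℂ⁆ 𝔮 :=
    { toFun := fun y => ⟨e y, heq y y.2⟩
      map_add' := fun y z => Subtype.ext (map_add e _ _)
      map_smul' := fun c y => Subtype.ext (map_smul e _ _)
      map_lie' := Subtype.ext (he _ _) }
  let f' : 𝔮 →ₗ⁅ℂ⁆ 𝔮 :=
    { toFun := fun y => ⟨f y, hfq y y.2⟩
      map_add' := fun y z => Subtype.ext (map_add f _ _)
      map_smul' := fun c y => Subtype.ext (map_smul f _ _)
      map_lie' := Subtype.ext (hf _ _) }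
  refine mem_nilRadical.2 ⟨heq x h, ?_⟩
  have hrad : (LieAlgebra.radical ℂ 𝔮).map e' ≤ LieAlgebra.radical ℂ 𝔮 := by
    rw [LieIdeal.map_le]
    rintro _ ⟨y, hy, rfl⟩
    exact map_mem_radical e' f' (fun y => Subtype.ext (hef y)) (fun y => Subtype.ext (hfe y)) hy
  have h1 := LieIdeal.mem_map (f := e') hx
  exact LieSubmodule.mono_lie le_top hrad (LieIdeal.map_bracket_le e' h1)

end Parabolic

variable {E : Type*} [NormedAddCommGroup E] [NormedSpace ℝ E] [FiniteDimensional ℝ E]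
  {K : Type*} [TopologicalSpace K] [ChartedSpace E K] [Group K]

instance [LieGroup 𝓘(ℝ, E) ((⊤ : ℕ∞) : WithTop ℕ∞) K] :
    LieGroup 𝓘(ℝ, E) (minSmoothness ℝ 3) K :=
  LieGroup.of_le (n := ((⊤ : ℕ∞) : WithTop ℕ∞)) (by
    rw [minSmoothness_of_isRCLikeNormedField]
    exact WithTop.coe_le_coe.2 (le_top : (3 : ℕ∞) ≤ ⊤))

/-- `v` is the tangent vector at `0` of the one-parameter subgroup `γ`. -/
def IsTangentVector (γ : Multiplicative ℝ →ₜ* K) (v : GroupLieAlgebra 𝓘(ℝ, E) K) : Prop :=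
  HasMFDerivAt 𝓘(ℝ, ℝ) 𝓘(ℝ, E) (fun t : ℝ => γ (.ofAdd t)) 0
    (ContinuousLinearMap.toSpanSingleton ℝ (show E from v))

/-- A reductive pair `(𝔤, K)`, where `𝔤` is the complexification of the real Lie algebra `𝔤₀`:

* `K` is a compact Lie group, whose Lie algebra is a subalgebra of `𝔤₀` through `ι`, and `Ad` is an
  action of `K` on `𝔤₀` by automorphisms, which extends the adjoint action of `K` on its Lie algebra
  and has the derivative `ad`;
* `𝔤₀` is reductive, and `θ` is an involution of `𝔤₀` whose fixed points are the Lie algebra of `K`;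
* `B` is a symmetric bilinear form on `𝔤₀`, invariant under `ad`, `Ad` and `θ`, which is negative
  definite on the `1`-eigenspace and positive definite on the `-1`-eigenspace of `θ`. -/
structure ReductivePair (E 𝔤₀ K : Type*) [NormedAddCommGroup E] [NormedSpace ℝ E]
    [FiniteDimensional ℝ E] [TopologicalSpace K] [ChartedSpace E K] [Group K]
    [LieGroup 𝓘(ℝ, E) ((⊤ : ℕ∞) : WithTop ℕ∞) K] [CompactSpace K] [T2Space K] [LieRing 𝔤₀]
    [LieAlgebra ℝ 𝔤₀] where
  ι : GroupLieAlgebra 𝓘(ℝ, E) K →ₗ⁅ℝ⁆ 𝔤₀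
  ι_injective : Function.Injective ι
  Ad : Representation ℝ K 𝔤₀
  Ad_lie : ∀ (k : K) (x y : 𝔤₀), Ad k ⁅x, y⁆ = ⁅Ad k x, Ad k y⁆
  Ad_ι : ∀ (k : K) (v : GroupLieAlgebra 𝓘(ℝ, E) K),
    Ad k (ι v) = ι (mfderiv 𝓘(ℝ, E) 𝓘(ℝ, E) (fun g : K => k * g * k⁻¹) 1 v)
  continuous_Ad : ∀ (x : 𝔤₀) (f : Module.Dual ℝ 𝔤₀), Continuous fun k => f (Ad k x)
  hasDerivAt_Ad : ∀ (γ : Multiplicative ℝ →ₜ* K) (v : GroupLieAlgebra 𝓘(ℝ, E) K),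
    IsTangentVector γ v → ∀ (y : 𝔤₀) (f : Module.Dual ℝ 𝔤₀),
      HasDerivAt (fun t : ℝ => f (Ad (γ (.ofAdd t)) y)) (f ⁅(ι v : 𝔤₀), y⁆) 0
  reductive : LieAlgebra.radical ℝ 𝔤₀ = LieAlgebra.center ℝ 𝔤₀
  θ : 𝔤₀ →ₗ⁅ℝ⁆ 𝔤₀
  θ_θ : ∀ x, θ (θ x) = x
  θ_eq_iff : ∀ x, θ x = x ↔ ∃ v, ι v = x
  B : LinearMap.BilinForm ℝ 𝔤₀
  B_symm : ∀ x y, B x y = B y x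
  B_lie : ∀ x y z : 𝔤₀, B ⁅x, y⁆ z = - B y ⁅x, z⁆
  B_Ad : ∀ k x y, B (Ad k x) (Ad k y) = B x y
  B_θ : ∀ x y, B (θ x) (θ y) = B x y
  B_neg : ∀ x, θ x = x → x ≠ 0 → B x x < 0
  B_pos : ∀ x, θ x = -x → x ≠ 0 → 0 < B x x

namespace ReductivePair

variable [LieGroup 𝓘(ℝ, E) ((⊤ : ℕ∞) : WithTop ℕ∞) K] [IsTopologicalGroup K] [CompactSpace K]
  [T2Space K] {𝔤₀ : Type u} [LieRing 𝔤₀] [LieAlgebra ℝ 𝔤₀] (R : ReductivePair E 𝔤₀ K)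

/-- The action of `K` on the complexification. -/
def AdC : Representation ℂ K (Complexification 𝔤₀) where
  toFun k := (R.Ad k).baseChange ℂ
  map_one' := by rw [map_one]; exact LinearMap.baseChange_one ℝ 𝔤₀
  map_mul' k l := by rw [map_mul]; exact LinearMap.baseChange_mul _ _

theorem AdC_tmul (k : K) (c : ℂ) (x : 𝔤₀) : R.AdC k (c ⊗ₜ x) = c ⊗ₜ[ℝ] R.Ad k x := rfl

/-- The complex linear extension of `θ`. -/
def θC : Module.End ℂ (Complexification 𝔤₀) := (R.θ : 𝔤₀ →ₗ[ℝ] 𝔤₀).baseChange ℂ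

theorem θC_tmul (c : ℂ) (x : 𝔤₀) : R.θC (c ⊗ₜ x) = c ⊗ₜ[ℝ] R.θ x := rfl

/-- The underlying pair `(𝔤, K)`. -/
def pair : LiePair (Complexification 𝔤₀) K where
  Ad := R.AdC
  Ad_lie k x y := by
    induction x using TensorProduct.induction_on with
    | zero => simp
    | add x z h₁ h₂ => rw [add_lie, map_add, h₁, h₂, map_add, add_lie]
    | tmul c x =>
      induction y using TensorProduct.induction_on with
      | zero => simp
      | add y z h₁ h₂ => rw [lie_add, map_add, h₁, h₂, map_add, lie_add]
      | tmul d y =>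
        simp only [AdC_tmul, LieAlgebra.ExtendScalars.bracket_tmul, R.Ad_lie]
  IsTangent γ X := ∃ v : GroupLieAlgebra 𝓘(ℝ, E) K,
    IsTangentVector γ v ∧ X = (1 : ℂ) ⊗ₜ[ℝ] (R.ι v : 𝔤₀)
  continuous_Ad x f := by
    induction x using TensorProduct.induction_on with
    | zero => simpa using continuous_const
    | add x z h₁ h₂ =>
      simp only [map_add]
      exact h₁.add h₂
    | tmul c x =>
      let F : 𝔤₀ →ₗ[ℝ] ℂ := (f.restrictScalars ℝ) ∘ₗ TensorProduct.mk ℝ ℂ 𝔤₀ c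
      have h₁ := R.continuous_Ad x (Complex.reLm ∘ₗ F)
      have h₂ := R.continuous_Ad x (Complex.imLm ∘ₗ F)
      refine ((Complex.continuous_ofReal.comp h₁).add
        ((Complex.continuous_ofReal.comp h₂).mul (continuous_const (y := Complex.I)))).congr fun k => ?_
      exact Complex.re_add_im (F (R.Ad k x))
  hasDerivAt_Ad γ X hX y f := by
    obtain ⟨v, hv, rfl⟩ := hX
    induction y using TensorProduct.induction_on with
    | zero => simpa using hasDerivAt_const _ _
    | add x z h₁ h₂ => simpa using h₁.fun_add h₂
    | tmul c x =>
      let F : 𝔤₀ →ₗ[ℝ] ℂ := (f.restrictScalars ℝ) ∘ₗ TensorProduct.mk ℝ ℂ 𝔤₀ c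
      have h₁ := R.hasDerivAt_Ad γ v hv x (Complex.reLm ∘ₗ F)
      have h₂ := R.hasDerivAt_Ad γ v hv x (Complex.imLm ∘ₗ F)
      have h₃ := h₁.ofReal_comp.add (h₂.ofReal_comp.mul_const Complex.I)
      have h₄ : f ⁅(1 : ℂ) ⊗ₜ[ℝ] (R.ι v : 𝔤₀), c ⊗ₜ[ℝ] x⁆ = F ⁅(R.ι v : 𝔤₀), x⁆ := by
        rw [LieAlgebra.ExtendScalars.bracket_tmul, one_mul]
        rfl
      rw [h₄, ← Complex.re_add_im (F _)]
      refine h₃.congr_of_eventuallyEq (Filter.Eventually.of_forall fun t => ?_)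
      exact (Complex.re_add_im (F (R.Ad (γ (.ofAdd t)) x))).symm

/-- A parabolic subalgebra `𝔮` of `𝔤` is germane if it has a Levi factor, that is, a complement of
its nilpotent radical, which is the complexification of a `θ`-stable real subalgebra of `𝔤₀`. -/
def IsGermane (𝔮 : LieSubalgebra ℂ (Complexification 𝔤₀)) : Prop :=
  IsParabolic 𝔮 ∧ ∃ 𝔩₀ : LieSubalgebra ℝ 𝔤₀, (∀ x ∈ 𝔩₀, R.θ x ∈ 𝔩₀) ∧
    (complexify 𝔩₀).toSubmodule ⊓ (nilRadical 𝔮).toSubmodule = ⊥ ∧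
    (complexify 𝔩₀).toSubmodule ⊔ (nilRadical 𝔮).toSubmodule = 𝔮.toSubmodule

variable (𝔮 : LieSubalgebra ℂ (Complexification 𝔤₀))

/-- The real Levi factor `𝔩₀ = 𝔤₀ ∩ 𝔮 ∩ θ(𝔮)` of a germane parabolic subalgebra `𝔮`: the Lie algebra
of the intersection `L` of the normalizers of `𝔮` and `θ(𝔮)`. -/
def levi₀ : LieSubalgebra ℝ 𝔤₀ where
  carrier := {x | (1 : ℂ) ⊗ₜ[ℝ] x ∈ 𝔮 ∧ (1 : ℂ) ⊗ₜ[ℝ] R.θ x ∈ 𝔮}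
  add_mem' := by
    rintro x y ⟨h₁, h₂⟩ ⟨h₃, h₄⟩
    refine ⟨?_, ?_⟩
    · rw [TensorProduct.tmul_add]
      exact 𝔮.add_mem h₁ h₃
    · rw [map_add, TensorProduct.tmul_add]
      exact 𝔮.add_mem h₂ h₄
  zero_mem' := by simp
  smul_mem' := by
    rintro c x ⟨h₁, h₂⟩
    refine ⟨?_, ?_⟩
    · rw [TensorProduct.tmul_smul, ← algebraMap_smul ℂ c]
      exact 𝔮.smul_mem _ h₁
    · rw [map_smul, TensorProduct.tmul_smul, ← algebraMap_smul ℂ c]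
      exact 𝔮.smul_mem _ h₂
  lie_mem' := by
    rintro x y ⟨h₁, h₂⟩ ⟨h₃, h₄⟩
    have h : ∀ x y : 𝔤₀, (1 : ℂ) ⊗ₜ[ℝ] ⁅x, y⁆ = ⁅(1 : ℂ) ⊗ₜ[ℝ] x, (1 : ℂ) ⊗ₜ[ℝ] y⁆ := fun x y => by
      rw [LieAlgebra.ExtendScalars.bracket_tmul, one_mul]
    refine ⟨?_, ?_⟩
    · rw [h]
      exact 𝔮.lie_mem h₁ h₃
    · rw [LieHom.map_lie, h]
      exact 𝔮.lie_mem h₂ h₄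

/-- The Levi factor `𝔩` of a germane parabolic subalgebra `𝔮`. -/
def levi : LieSubalgebra ℂ (Complexification 𝔤₀) := complexify (R.levi₀ 𝔮)

/-- The subgroup `L ∩ K` of the elements of `K` which normalize `𝔮` and `θ(𝔮)`. -/
def leviGroup : Subgroup K where
  carrier := {k | (∀ x, R.AdC k x ∈ 𝔮 ↔ x ∈ 𝔮) ∧ ∀ x, R.θC (R.AdC k x) ∈ 𝔮 ↔ R.θC x ∈ 𝔮}
  one_mem' := by simp
  mul_mem' := by
    rintro k l ⟨h₁, h₂⟩ ⟨h₃, h₄⟩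
    refine ⟨fun x => ?_, fun x => ?_⟩
    · rw [map_mul, Module.End.mul_apply, h₁, h₃]
    · rw [map_mul, Module.End.mul_apply, h₂, h₄]
  inv_mem' := by
    rintro k ⟨h₁, h₂⟩
    have h : ∀ x, R.AdC k (R.AdC k⁻¹ x) = x := fun x => by
      rw [← Module.End.mul_apply, ← map_mul, mul_inv_cancel, map_one, Module.End.one_apply]
    refine ⟨fun x => ?_, fun x => ?_⟩
    · rw [← h₁, h]
    · rw [← h₂, h]

variable {𝔮}

theorem levi_le {x : Complexification 𝔤₀} (hx : x ∈ R.levi 𝔮) : x ∈ 𝔮 :=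
  complexify_le (𝔩₀ := R.levi₀ 𝔮) (S := 𝔮.toSubmodule) (fun _ h => h.1) hx

theorem levi_mono {𝔭 : LieSubalgebra ℂ (Complexification 𝔤₀)} (h : 𝔭 ≤ 𝔮)
    {x : Complexification 𝔤₀} (hx : x ∈ R.levi 𝔭) : x ∈ R.levi 𝔮 :=
  complexify_le (𝔩₀ := R.levi₀ 𝔭) (S := (R.levi 𝔮).toSubmodule)
    (fun _ hy => tmul_mem_complexify (show _ ∈ R.levi₀ 𝔮 from ⟨h hy.1, h hy.2⟩)) hx

theorem AdC_mem_levi {k : K} (hk : k ∈ R.leviGroup 𝔮) {x : Complexification 𝔤₀}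
    (hx : x ∈ R.levi 𝔮) : R.AdC k x ∈ R.levi 𝔮 :=
  complexify_le (𝔩₀ := R.levi₀ 𝔮) (S := (R.levi 𝔮).toSubmodule.comap (R.AdC k))
    (fun y hy => tmul_mem_complexify
      (show R.Ad k y ∈ R.levi₀ 𝔮 from ⟨(hk.1 _).2 hy.1, (hk.2 (1 ⊗ₜ[ℝ] y)).2 hy.2⟩)) hx

theorem AdC_mem_nilRadical [FiniteDimensional ℝ 𝔤₀] {k : K} (hk : k ∈ R.leviGroup 𝔮)
    {x : Complexification 𝔤₀} (hx : x ∈ nilRadical 𝔮) : R.AdC k x ∈ nilRadical 𝔮 := by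
  have h : ∀ (k : K) x, R.AdC k (R.AdC k⁻¹ x) = x := fun k x => by
    rw [← Module.End.mul_apply, ← map_mul, mul_inv_cancel, map_one, Module.End.one_apply]
  refine map_mem_nilRadical (R.AdC k) (R.AdC k⁻¹) (R.pair.Ad_lie k) (R.pair.Ad_lie k⁻¹)
    (h k) (fun x => ?_) (fun x hx => (hk.1 x).2 hx)
    (fun x hx => (((R.leviGroup 𝔮).inv_mem hk).1 x).2 hx) hx
  have := h k⁻¹ x
  rwa [inv_inv] at this

variable (𝔮)

/-- The pair `(𝔩, L ∩ K)`. -/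
def leviPair : LiePair (R.levi 𝔮) (R.leviGroup 𝔮) :=
  R.pair.sub (R.levi 𝔮) (R.leviGroup 𝔮) fun _ hk _ hx => R.AdC_mem_levi hk hx

variable [FiniteDimensional ℝ 𝔤₀]

/-- The pair `(𝔩, L ∩ K)` with its map to `(𝔤, K)` and the nilpotent radical `𝔲` of `𝔮`. -/
def datum : CohDatum (R.leviPair 𝔮) R.pair where
  φ := (R.levi 𝔮).incl
  ψ := subgroupIncl (R.leviGroup 𝔮)
  φ_Ad _ _ := rfl
  isTangent _ _ h := h
  𝔲 := nilRadical 𝔮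
  lie_mem x _ hy := lie_mem_nilRadical (R.levi_le x.2) hy
  Ad_mem m _ hy := R.AdC_mem_nilRadical m.2 hy

variable {𝔮} in
/-- For germane parabolic pairs `(𝔭, M ∩ K) ⊆ (𝔮, L ∩ K)`, where `𝔭` has the nilpotent radical `𝔫`:
the pair `(𝔪, M ∩ K)` with its map to `(𝔩, L ∩ K)` and the nilpotent radical `𝔫 ∩ 𝔩` of the
parabolic subalgebra `𝔭 ∩ 𝔩` of `𝔩`. -/
def relDatum {𝔭 : LieSubalgebra ℂ (Complexification 𝔤₀)} (h : 𝔭 ≤ 𝔮)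
    (hK : R.leviGroup 𝔭 ≤ R.leviGroup 𝔮) : CohDatum (R.leviPair 𝔭) (R.leviPair 𝔮) where
  φ :=
    { toFun := fun x => ⟨x, R.levi_mono h x.2⟩
      map_add' := fun _ _ => rfl
      map_smul' := fun _ _ => rfl
      map_lie' := rfl }
  ψ := ⟨Subgroup.inclusion hK, continuous_inclusion hK⟩
  φ_Ad _ _ := rfl
  isTangent _ _ h := h
  𝔲 := (nilRadical 𝔭).comap (R.levi 𝔮).incl
  lie_mem x _ hy := lie_mem_nilRadical (R.levi_le x.2) hy
  Ad_mem m _ hy := R.AdC_mem_nilRadical m.2 hy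

end ReductivePair

end Reductive

end RelChar

end

/-!
Write `H`, `H'`, `H''` for the Euler characteristics of the cohomology of `𝔲`, of `𝔫' = 𝔫 ∩ 𝔩` and of
`𝔫` on the Grothendieck groups, and `W`, `W'`, `W''` for the multiplication with the corresponding Weyl
denominators. On `K(ℳ)` there is also the multiplication `W|ₘ` with the restriction of `W`. As
`𝔫 = 𝔫' ⊕ 𝔲` with the ideal `𝔲`, there are three relations:

* `H'' = H' ∘ H` (`CohDatum.IsTower.euler_euler`), the Hochschild–Serre relation. The complex
  `Hom(⋀ 𝔫, V)` has the components `Hom(⋀ᵃ 𝔫', Hom(⋀ᵇ 𝔲, V))`, and its filtration by `b` has graded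
  pieces with the cohomology `Hᵃ(𝔫'; Hᵇ(𝔲; V))`.
* `W'' = W' ∘ W|ₘ` (`CohDatum.IsTower.weyl_eq`), from the decomposition of `⋀ (𝔫' ⊕ 𝔲)*`.
* `H' (W Y) = W|ₘ (H' Y)` (`IsAdmissiblePair.euler_weylMul`). The algebra `𝔲` has a grading by
  `(𝔪, M ∩ K)`-submodules whose degrees are raised by the action of `𝔫'`. The induced filtration of
  the complex `Hom(⋀ 𝔫', ⋀ᵇ 𝔲* ⊗ Y)` has graded pieces on which `𝔫'` acts trivially on `⋀ᵇ 𝔲*`.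

The categories are abelian, but they need not be closed under extensions, so that the terms of the
complexes, and the cohomology of the steps of a filtration, need not belong to them. The Euler
characteristic of a filtered complex is therefore computed by its spectral sequence, all of whose
pages are subquotients of the first one (`FilteredComplex.sum_cls_cohomology`).

By the second relation, `W'` is injective on the fractions `K_ℳ[1 / W'']`. Hence a natural extension is
unique, and it exists as `Y / Wᵏ ↦ (W' / W'')ᵏ (H' (W Y) / W'')`, which is well-defined since
`W' H' W = W'' H'` (`existsUnique_extension`). The first relation shows that it maps `H X / W` to
`H'' X / W''`.

The structure of `𝔫` is obtained from the positive definite Hermitian form `-B(τ x, y)`, where `τ` is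
the conjugate linear extension of `θ`: the adjoint of `ad x` is `-ad (τ x)`. The nilpotent radical
`[𝔮, rad 𝔮]` is orthogonal to `𝔮` for the trace form of `𝔤`, while `ad z = 0` if
`tr(ad z · ad (τ z)) = 0`. As the Levi factors are stable under `τ`, this yields `𝔩 ∩ 𝔲 = 0`, and the
inclusion `𝔲 ⊆ 𝔫`, because `rad 𝔮` is contained in the Borel subalgebras of `𝔭`. The grading of `𝔲` is
given by orthogonal complements in the filtration of `𝔲` by iterated brackets with `𝔫'`
(`CohDatum.exists_grading`).
-/

noncomputable section

namespace RelChar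

/-! ### Stable subspaces and their classes -/

section Stable

variable {𝔤 K : Type*} [LieRing 𝔤] [LieAlgebra ℂ 𝔤] [Group K] [TopologicalSpace K]
  [IsTopologicalGroup K] {P : LiePair 𝔤 K}

namespace HCHom

variable {U V W : HCModule.{u} P}

theorem apply_rep (f : HCHom V W) (x : 𝔤) (v : V) :
    f.toLinearMap (V.rep x v) = W.rep x (f.toLinearMap v) := f.map_rep x v

theorem apply_act (f : HCHom V W) (k : K) (v : V) :
    f.toLinearMap (V.act k v) = W.act k (f.toLinearMap v) := f.map_act k v

/-- The composition of homomorphisms. -/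
def comp (g : HCHom V W) (f : HCHom U V) : HCHom U W where
  toLinearMap := g.toLinearMap ∘ₗ f.toLinearMap
  map_rep x v := (congrArg g.toLinearMap (f.map_rep x v)).trans (g.map_rep x _)
  map_act k v := (congrArg g.toLinearMap (f.map_act k v)).trans (g.map_act k _)

theorem comp_apply (g : HCHom V W) (f : HCHom U V) (v : U) :
    (g.comp f).toLinearMap v = g.toLinearMap (f.toLinearMap v) := rfl

/-- The homomorphism induced by `g` on the target of a surjection `f` with `ker f ≤ ker g`. -/
theorem exists_lift (f : HCHom U V) (hf : Function.Surjective f.toLinearMap) (g : HCHom U W)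
    (h : ∀ t, f.toLinearMap t = 0 → g.toLinearMap t = 0) :
    ∃ l : HCHom V W, ∀ t, l.toLinearMap (f.toLinearMap t) = g.toLinearMap t := by
  obtain ⟨s, hs⟩ := f.toLinearMap.exists_rightInverse_of_surjective
    (LinearMap.range_eq_top.2 hf)
  have key : ∀ t, (g.toLinearMap ∘ₗ s) (f.toLinearMap t) = g.toLinearMap t := by
    intro t
    rw [LinearMap.comp_apply, ← sub_eq_zero, ← map_sub]
    refine h _ ?_
    rw [map_sub, sub_eq_zero]
    exact LinearMap.congr_fun hs _
  refine ⟨⟨g.toLinearMap ∘ₗ s, fun x v => ?_, fun k v => ?_⟩, key⟩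
  · obtain ⟨t, rfl⟩ := hf v
    rw [← f.apply_rep]
    exact (key _).trans ((g.apply_rep x t).trans (congrArg _ (key t).symm))
  · obtain ⟨t, rfl⟩ := hf v
    rw [← f.apply_act]
    exact (key _).trans ((g.apply_act k t).trans (congrArg _ (key t).symm))

end HCHom

namespace HCModule

variable {V W : HCModule.{u} P}

/-- A subspace which is stable under both actions. -/
def Stable (V : HCModule.{u} P) (A : Submodule ℂ V) : Prop :=
  (∀ x, ∀ w ∈ A, V.rep x w ∈ A) ∧ ∀ k, ∀ w ∈ A, V.act k w ∈ A

theorem stable_bot (V : HCModule.{u} P) : V.Stable ⊥ :=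
  ⟨fun x w hw => by rw [(Submodule.mem_bot ℂ).1 hw, map_zero]; exact Submodule.zero_mem _,
    fun x w hw => by rw [(Submodule.mem_bot ℂ).1 hw, map_zero]; exact Submodule.zero_mem _⟩

theorem stable_top (V : HCModule.{u} P) : V.Stable ⊤ :=
  ⟨fun _ _ _ => Submodule.mem_top, fun _ _ _ => Submodule.mem_top⟩

theorem Stable.inf {A B : Submodule ℂ V} (hA : V.Stable A) (hB : V.Stable B) : V.Stable (A ⊓ B) :=
  ⟨fun x w hw => ⟨hA.1 x w hw.1, hB.1 x w hw.2⟩, fun x w hw => ⟨hA.2 x w hw.1, hB.2 x w hw.2⟩⟩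

theorem Stable.comap (f : HCHom V W) {B : Submodule ℂ W} (hB : W.Stable B) :
    V.Stable (B.comap f.toLinearMap) :=
  ⟨fun x w hw => by rw [Submodule.mem_comap, f.apply_rep]; exact hB.1 x _ hw,
    fun x w hw => by rw [Submodule.mem_comap, f.apply_act]; exact hB.2 x _ hw⟩

theorem Stable.map (f : HCHom V W) {A : Submodule ℂ V} (hA : V.Stable A) :
    W.Stable (A.map f.toLinearMap) := by
  constructor
  · rintro x _ ⟨v, hv, rfl⟩
    exact ⟨V.rep x v, hA.1 x v hv, f.apply_rep x v⟩
  · rintro x _ ⟨v, hv, rfl⟩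
    exact ⟨V.act x v, hA.2 x v hv, f.apply_act x v⟩

theorem stable_ker (f : HCHom V W) : V.Stable (LinearMap.ker f.toLinearMap) :=
  W.stable_bot.comap f

theorem stable_range (f : HCHom V W) : W.Stable (LinearMap.range f.toLinearMap) := by
  rw [← Submodule.map_top]
  exact V.stable_top.map f

/-- A stable subspace as a module. -/
def ofStable {A : Submodule ℂ V} (h : V.Stable A) : HCModule.{u} P := V.sub A h.1 h.2

/-- The quotient by a stable subspace. -/
def modStable {A : Submodule ℂ V} (h : V.Stable A) : HCModule.{u} P := V.quot A h.1 h.2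

/-- The inclusion of a stable subspace. -/
def Stable.incl {A : Submodule ℂ V} (h : V.Stable A) : HCHom (ofStable h) V where
  toLinearMap := A.subtype
  map_rep _ _ := rfl
  map_act _ _ := rfl

theorem Stable.incl_injective {A : Submodule ℂ V} (h : V.Stable A) :
    Function.Injective h.incl.toLinearMap := Subtype.val_injective

theorem Stable.incl_mem {A : Submodule ℂ V} (h : V.Stable A) (a : ofStable h) :
    h.incl.toLinearMap a ∈ A := Subtype.property (p := (· ∈ A)) a

theorem Stable.exists_incl {A : Submodule ℂ V} (h : V.Stable A) {v : V} (hv : v ∈ A) :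
    ∃ a, h.incl.toLinearMap a = v := ⟨⟨v, hv⟩, rfl⟩

theorem Stable.range_incl {A : Submodule ℂ V} (h : V.Stable A) :
    LinearMap.range h.incl.toLinearMap = A := A.range_subtype

/-- A homomorphism with values in a stable subspace. -/
def Stable.cod {A : Submodule ℂ W} (h : W.Stable A) (f : HCHom V W)
    (hf : ∀ v, f.toLinearMap v ∈ A) : HCHom V (ofStable h) where
  toLinearMap := f.toLinearMap.codRestrict A hf
  map_rep x v := Subtype.ext (f.map_rep x v)
  map_act x v := Subtype.ext (f.map_act x v)

theorem Stable.incl_cod {A : Submodule ℂ W} (h : W.Stable A) (f : HCHom V W)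
    (hf : ∀ v, f.toLinearMap v ∈ A) (v : V) :
    h.incl.toLinearMap ((h.cod f hf).toLinearMap v) = f.toLinearMap v := rfl

/-- The projection to the quotient by a stable subspace. -/
def Stable.proj {A : Submodule ℂ V} (h : V.Stable A) : HCHom V (modStable h) where
  toLinearMap := A.mkQ
  map_rep _ _ := rfl
  map_act _ _ := rfl

theorem Stable.proj_surjective {A : Submodule ℂ V} (h : V.Stable A) :
    Function.Surjective h.proj.toLinearMap := A.mkQ_surjective

theorem Stable.proj_eq_zero {A : Submodule ℂ V} (h : V.Stable A) {v : V} :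
    h.proj.toLinearMap v = 0 ↔ v ∈ A := Submodule.Quotient.mk_eq_zero _

end HCModule

variable {S : HCModule.{u} P → Prop}

/-- The subspace `A` of `V` is stable and belongs, as a module, to the category `S`. -/
def SubMem (S : HCModule.{u} P → Prop) (V : HCModule.{u} P) (A : Submodule ℂ V) : Prop :=
  ∃ h : V.Stable A, S (HCModule.ofStable h)

open Classical in
/-- The class of a stable subspace belonging to `S` (and zero for the other subspaces). -/
def subCls (S : HCModule.{u} P → Prop) (V : HCModule.{u} P) (A : Submodule ℂ V) :
    GrothendieckGroup S :=
  if h : SubMem S V A then GrothendieckGroup.cls _ h.2 else 0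

theorem subCls_eq {V : HCModule.{u} P} {A : Submodule ℂ V} (h : V.Stable A)
    (hS : S (HCModule.ofStable h)) : subCls S V A = GrothendieckGroup.cls _ hS := by
  have h' : SubMem S V A := ⟨h, hS⟩
  rw [subCls, dif_pos h']

theorem subMem_ker (hS : IsAbelianSubcategory S) {V W : HCModule.{u} P} (f : HCHom V W)
    (hV : S V) (hW : S W) :
    SubMem S V (LinearMap.ker f.toLinearMap) :=
  ⟨HCModule.stable_ker f, hS.kernel f (HCModule.stable_ker f).incl
    (HCModule.stable_ker f).incl_injective
    (fun v => by
      rw [← LinearMap.coe_range, HCModule.Stable.range_incl]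
      rfl) hV hW⟩

theorem subMem_range (hS : IsAbelianSubcategory S) {V W : HCModule.{u} P} (f : HCHom V W)
    (hV : S V) (hW : S W) :
    SubMem S W (LinearMap.range f.toLinearMap) :=
  ⟨HCModule.stable_range f, f.im_mem hS hV hW⟩

theorem subMem_top (hS : IsAbelianSubcategory S) {V : HCModule.{u} P} (hV : S V) : SubMem S V ⊤ := by
  have := subMem_range hS (HCHom.id V) hV hV
  rwa [LinearMap.range_eq_top.2 (show Function.Surjective (HCHom.id V).toLinearMap from
    Function.surjective_id)] at this

theorem subMem_bot (hS : IsAbelianSubcategory S) (V : HCModule.{u} P) : SubMem S V ⊥ :=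
  ⟨V.stable_bot, hS.zero _ ⟨fun a b => V.stable_bot.incl_injective
    (((Submodule.mem_bot ℂ).1 (V.stable_bot.incl_mem a)).trans
      ((Submodule.mem_bot ℂ).1 (V.stable_bot.incl_mem b)).symm)⟩⟩

theorem subCls_bot (hS : IsAbelianSubcategory S) (V : HCModule.{u} P) : subCls S V ⊥ = 0 := by
  have h := subMem_bot hS V
  rw [subCls_eq h.1 h.2]
  have : Subsingleton (HCModule.ofStable h.1) := ⟨fun a b => V.stable_bot.incl_injective
    (((Submodule.mem_bot ℂ).1 (V.stable_bot.incl_mem a)).trans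
      ((Submodule.mem_bot ℂ).1 (V.stable_bot.incl_mem b)).symm)⟩
  exact GrothendieckGroup.cls_eq_zero _ _

theorem subCls_top (hS : IsAbelianSubcategory S) {V : HCModule.{u} P} (hV : S V) :
    subCls S V ⊤ = GrothendieckGroup.cls V hV := by
  have h := subMem_top hS hV
  rw [subCls_eq h.1 h.2]
  exact GrothendieckGroup.cls_eq_of_bijective hS h.1.incl
    ⟨h.1.incl_injective, fun v => h.1.exists_incl trivial⟩ _ _

theorem modStable_mem (hS : IsAbelianSubcategory S)
    {V : HCModule.{u} P} (hV : S V) {A : Submodule ℂ V} (hA : SubMem S V A) :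
    S (HCModule.modStable hA.1) :=
  hS.cokernel hA.1.incl hA.1.proj hA.1.proj_surjective
    (fun v => by rw [hA.1.proj_eq_zero, ← LinearMap.coe_range, hA.1.range_incl]; rfl) hA.2 hV

/-- `[V] = [A] + [V / A]`. -/
theorem cls_eq_subCls_add (hS : IsAbelianSubcategory S) {V Q : HCModule.{u} P} (f : HCHom V Q)
    (hf : Function.Surjective f.toLinearMap) (hV : S V) (hQ : S Q) :
    GrothendieckGroup.cls V hV
      = subCls S V (LinearMap.ker f.toLinearMap) + GrothendieckGroup.cls Q hQ := by
  have h := subMem_ker hS f hV hQ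
  rw [subCls_eq h.1 h.2]
  refine GrothendieckGroup.cls_eq_add h.1.incl f ⟨h.1.incl_injective, hf, fun v => ?_⟩ _ _ _
  rw [← LinearMap.mem_ker, ← LinearMap.coe_range, h.1.range_incl]
  rfl

/-- The correspondence `A ← T → B` defined by `f` and `g` induces a homomorphism
`f(T) → B / b`. Its kernel is `f(g⁻¹(b))`, its image is `(g(T) + b) / b`. -/
theorem subCls_correspondence (hS : IsAbelianSubcategory S)
    {T A B : HCModule.{u} P} (f : HCHom T A) (g : HCHom T B)
    (hA : SubMem S A (LinearMap.range f.toLinearMap)) (hB : S B) {b : Submodule ℂ B}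
    (hb : SubMem S B b) (h : ∀ t, f.toLinearMap t = 0 → g.toLinearMap t ∈ b) :
    SubMem S A ((b.comap g.toLinearMap).map f.toLinearMap) ∧
    SubMem S B (LinearMap.range g.toLinearMap ⊔ b) ∧
    subCls S A (LinearMap.range f.toLinearMap)
        - subCls S A ((b.comap g.toLinearMap).map f.toLinearMap)
      = subCls S B (LinearMap.range g.toLinearMap ⊔ b) - subCls S B b := by
  have hQ := modStable_mem hS hB hb
  let f' := hA.1.cod f (fun t => ⟨t, rfl⟩)
  have hf' : Function.Surjective f'.toLinearMap := by
    intro a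
    obtain ⟨t, ht⟩ := hA.1.incl_mem a
    exact ⟨t, hA.1.incl_injective ht⟩
  obtain ⟨l, hl⟩ := HCHom.exists_lift f' hf' (hb.1.proj.comp g) (fun t ht => by
    rw [HCHom.comp_apply, hb.1.proj_eq_zero]
    refine h t ?_
    have := congrArg hA.1.incl.toLinearMap ht
    rwa [map_zero] at this)
  have hl' : ∀ t, l.toLinearMap (f'.toLinearMap t) = 0 ↔ g.toLinearMap t ∈ b := fun t => by
    rw [hl, HCHom.comp_apply, hb.1.proj_eq_zero]
  -- the kernel of `l`
  have hst : A.Stable ((b.comap g.toLinearMap).map f.toLinearMap) := (hb.1.comap g).map f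
  let i : HCHom (HCModule.ofStable hst) (HCModule.ofStable hA.1) :=
    hA.1.cod hst.incl (fun a => by
      obtain ⟨t, -, ht⟩ := hst.incl_mem a
      exact ⟨t, ht⟩)
  have hi : Function.Injective i.toLinearMap := fun a a' haa =>
    hst.incl_injective (congrArg hA.1.incl.toLinearMap haa)
  have hil : Function.Exact i.toLinearMap l.toLinearMap := by
    intro a
    obtain ⟨t, rfl⟩ := hf' a
    rw [hl']
    constructor
    · intro ht
      obtain ⟨a, ha⟩ := hst.exists_incl (Submodule.mem_map_of_mem (f := f.toLinearMap)
        (show t ∈ b.comap g.toLinearMap from ht))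
      exact ⟨a, hA.1.incl_injective ha⟩
    · rintro ⟨a, ha⟩
      obtain ⟨t', ht', h1⟩ := hst.incl_mem a
      have h2 : i.toLinearMap a = f'.toLinearMap t' := hA.1.incl_injective h1.symm
      have h3 := (hl' t').2 ht'
      rw [← h2, ha] at h3
      exact (hl' t).1 h3
  have hk : S (HCModule.ofStable hst) := hS.kernel l i hi hil hA.2 hQ
  -- the image of `l`
  have hI : S l.im := l.im_mem hS hA.2 hQ
  have hIQ := subMem_range hS l hA.2 hQ
  have hQ' := modStable_mem hS hQ hIQ
  have hker : LinearMap.ker (hIQ.1.proj.comp hb.1.proj).toLinearMap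
      = LinearMap.range g.toLinearMap ⊔ b := by
    ext y
    rw [LinearMap.mem_ker, HCHom.comp_apply, hIQ.1.proj_eq_zero, Submodule.mem_sup]
    constructor
    · rintro ⟨a, ha⟩
      obtain ⟨t, rfl⟩ := hf' a
      rw [hl, HCHom.comp_apply, ← sub_eq_zero, ← map_sub, hb.1.proj_eq_zero] at ha
      exact ⟨g.toLinearMap t, ⟨t, rfl⟩, -(g.toLinearMap t - y), Submodule.neg_mem _ ha, by abel⟩
    · rintro ⟨_, ⟨t, rfl⟩, z, hz, rfl⟩
      refine ⟨f'.toLinearMap t, ?_⟩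
      rw [hl, map_add, hb.1.proj_eq_zero.2 hz, add_zero]
      rfl
  have hB' : SubMem S B (LinearMap.range g.toLinearMap ⊔ b) := by
    rw [← hker]
    exact subMem_ker hS _ hB hQ'
  refine ⟨⟨hst, hk⟩, hB', ?_⟩
  have e1 : GrothendieckGroup.cls _ hA.2
      = GrothendieckGroup.cls _ hk + GrothendieckGroup.cls _ hI := by
    refine GrothendieckGroup.cls_eq_add i l.imπ
      ⟨hi, LinearMap.surjective_rangeRestrict _, fun a => ?_⟩ _ _ _
    rw [← hil a]
    exact Subtype.ext_iff
  let p : HCHom (HCModule.ofStable hB'.1) l.im := hIQ.1.cod (hb.1.proj.comp hB'.1.incl) (fun y => by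
    exact hIQ.1.proj_eq_zero.1 (hker.ge (hB'.1.incl_mem y)))
  have hp0 : ∀ y, p.toLinearMap y = 0 ↔ hB'.1.incl.toLinearMap y ∈ b := fun y => by
    rw [← hb.1.proj_eq_zero]
    exact Subtype.ext_iff
  have e2 : GrothendieckGroup.cls _ hB'.2
      = GrothendieckGroup.cls _ hb.2 + GrothendieckGroup.cls _ hI := by
    refine GrothendieckGroup.cls_eq_add
      (hB'.1.cod hb.1.incl (fun y => Submodule.mem_sup_right (hb.1.incl_mem y))) p
      ⟨fun a a' haa => hb.1.incl_injective (congrArg hB'.1.incl.toLinearMap haa),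
        fun a => ?_, fun y => ?_⟩ _ _ _
    · obtain ⟨a', ha'⟩ : ∃ a', l.toLinearMap a' = l.imι.toLinearMap a :=
        Subtype.property (p := (· ∈ LinearMap.range l.toLinearMap)) a
      obtain ⟨t, rfl⟩ := hf' a'
      obtain ⟨y, hy⟩ := hB'.1.exists_incl (Submodule.mem_sup_left (T := b)
        (LinearMap.mem_range_self g.toLinearMap t))
      refine ⟨y, Subtype.ext ?_⟩
      refine Eq.trans ?_ ha'
      rw [hl]
      exact congrArg hb.1.proj.toLinearMap hy
    · rw [hp0]
      constructor
      · intro hy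
        obtain ⟨z, hz⟩ := hb.1.exists_incl hy
        exact ⟨z, hB'.1.incl_injective hz⟩
      · rintro ⟨z, rfl⟩
        exact hb.1.incl_mem z
  rw [subCls_eq hA.1 hA.2, subCls_eq hst hk, subCls_eq hB'.1 hB'.2, subCls_eq hb.1 hb.2, e1, e2]
  abel

/-- If the homomorphisms `Φᵢ : X → Yᵢ` for `i < N` identify `X` with the direct sum of the modules
`Yᵢ`, then `[X] = ∑ᵢ [Yᵢ]`. -/
theorem cls_eq_sum (hS : IsAbelianSubcategory S)
    {X : HCModule.{u} P} (hX : S X) (N : ℕ) (Y : ℕ → HCModule.{u} P)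
    (hY : ∀ i, S (Y i)) (Φ : ∀ i, HCHom X (Y i))
    (hinj : ∀ x, (∀ i < N, (Φ i).toLinearMap x = 0) → x = 0)
    (hsurj : ∀ i < N, ∀ y, ∃ x, (Φ i).toLinearMap x = y ∧
      ∀ j < N, j ≠ i → (Φ j).toLinearMap x = 0) :
    GrothendieckGroup.cls X hX = ∑ i ∈ Finset.range N, GrothendieckGroup.cls (Y i) (hY i) := by
  let A : ℕ → Submodule ℂ X := fun k =>
    ⨅ i ∈ Finset.range k, LinearMap.ker (Φ i).toLinearMap
  have hA : ∀ k x, x ∈ A k ↔ ∀ i < k, (Φ i).toLinearMap x = 0 := by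
    intro k x
    simp [A, Submodule.mem_iInf]
  have key : ∀ k ≤ N, SubMem S X (A k) ∧ GrothendieckGroup.cls X hX
      = subCls S X (A k) + ∑ i ∈ Finset.range k, GrothendieckGroup.cls (Y i) (hY i) := by
    intro k
    induction k with
    | zero =>
      intro _
      have : A 0 = ⊤ := by simp [A]
      rw [this]
      exact ⟨subMem_top hS hX, by rw [subCls_top hS hX]; simp⟩
    | succ k ih =>
      intro hk
      obtain ⟨h1, h2⟩ := ih (by omega)
      have hr : LinearMap.range h1.1.incl.toLinearMap = A k := h1.1.range_incl
      have hr' : LinearMap.range ((Φ k).comp h1.1.incl).toLinearMap = ⊤ := by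
        rw [LinearMap.range_eq_top]
        intro y
        obtain ⟨x, hx, hx'⟩ := hsurj k (by omega) y
        obtain ⟨a, rfl⟩ := h1.1.exists_incl ((hA k x).2 fun i hi => hx' i (by omega) (by omega))
        exact ⟨a, hx⟩
      have hm : ((⊥ : Submodule ℂ (Y k)).comap ((Φ k).comp h1.1.incl).toLinearMap).map
          h1.1.incl.toLinearMap = A (k + 1) := by
        ext x
        rw [hA]
        constructor
        · rintro ⟨a, ha, rfl⟩ i hi
          rcases Nat.lt_succ_iff_lt_or_eq.1 hi with hi | rfl
          · exact (hA k _).1 (h1.1.incl_mem a) i hi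
          · exact ha
        · intro hx
          obtain ⟨a, rfl⟩ := h1.1.exists_incl ((hA k x).2 fun i hi => hx i (by omega))
          exact ⟨a, hx k (by omega), rfl⟩
      have := subCls_correspondence hS h1.1.incl ((Φ k).comp h1.1.incl)
        (by rw [hr]; exact h1) (hY k) (subMem_bot hS (Y k)) (fun t ht => by
          rw [h1.1.incl_injective (ht.trans (map_zero _).symm), map_zero]
          exact Submodule.zero_mem _)
      rw [hr, hr', hm, top_sup_eq, subCls_bot hS, subCls_top hS (hY k), sub_zero] at this
      refine ⟨this.1, ?_⟩
      rw [h2, Finset.sum_range_succ, ← this.2.2]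
      abel
  obtain ⟨-, h⟩ := key N le_rfl
  have : A N = ⊥ := by
    rw [eq_bot_iff]
    intro x hx
    exact (Submodule.mem_bot ℂ).2 (hinj x ((hA N x).1 hx))
  rwa [this, subCls_bot hS, zero_add] at h

end Stable

/-! ### Euler characteristics of filtered complexes -/

section Filtered

variable {𝔤 K : Type*} [LieRing 𝔤] [LieAlgebra ℂ 𝔤] [Group K] [TopologicalSpace K]
  [IsTopologicalGroup K] {P : LiePair 𝔤 K} {S : HCModule.{u} P → Prop}

/-- A complex of modules with a finite increasing filtration `0 = F₀ ≤ F₁ ≤ ⋯ ≤ F_N` by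
subcomplexes. -/
structure FilteredComplex (P : LiePair 𝔤 K) where
  C : ℕ → HCModule.{u} P
  d : ∀ n, HCHom (C n) (C (n + 1))
  d_d : ∀ n x, (d (n + 1)).toLinearMap ((d n).toLinearMap x) = 0
  F : ℕ → ∀ n, Submodule ℂ (C n)
  stable : ∀ q n, (C n).Stable (F q n)
  mono : ∀ n, Monotone fun q => F q n
  d_mem : ∀ q n, ∀ x ∈ F q n, (d n).toLinearMap x ∈ F q (n + 1)
  N : ℕ
  zero : ∀ n, F 0 n = ⊥
  top : ∀ n, F N n = ⊤

namespace FilteredComplex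

variable (X : FilteredComplex.{u} P)

/-- The boundaries of the elements of `F_q`. -/
def bd (q : ℕ) : ∀ n, Submodule ℂ (X.C n)
  | 0 => ⊥
  | n + 1 => (X.F q n).map (X.d n).toLinearMap

/-- The elements of `F_{p + 1}` with boundary in `F_q`. -/
def cyc (q p n : ℕ) : Submodule ℂ (X.C n) :=
  X.F (p + 1) n ⊓ (X.F q (n + 1)).comap (X.d n).toLinearMap

theorem mem_cyc {q p n : ℕ} {x : X.C n} :
    x ∈ X.cyc q p n ↔ x ∈ X.F (p + 1) n ∧ (X.d n).toLinearMap x ∈ X.F q (n + 1) := Iff.rfl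

theorem cyc_stable (q p n : ℕ) : (X.C n).Stable (X.cyc q p n) :=
  (X.stable _ _).inf ((X.stable _ _).comap _)

theorem cyc_mono {q q' : ℕ} (h : q ≤ q') (p n : ℕ) : X.cyc q p n ≤ X.cyc q' p n :=
  inf_le_inf_left _ (Submodule.comap_mono (X.mono _ h))

theorem bd_mono {q q' : ℕ} (h : q ≤ q') (n : ℕ) : X.bd q n ≤ X.bd q' n := by
  cases n with
  | zero => exact le_rfl
  | succ n => exact Submodule.map_mono (X.mono _ h)

theorem d_bd {q n : ℕ} {x : X.C n} (hx : x ∈ X.bd q n) : (X.d n).toLinearMap x = 0 := by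
  cases n with
  | zero => rw [(Submodule.mem_bot ℂ).1 hx, map_zero]
  | succ n =>
    obtain ⟨y, -, rfl⟩ := hx
    exact X.d_d n y

theorem bd_le (q n : ℕ) : X.bd q n ≤ X.F q n := by
  cases n with
  | zero => exact bot_le
  | succ n =>
    rintro _ ⟨y, hy, rfl⟩
    exact X.d_mem q n y hy

/-- The module `E` represents the cohomology in degree `n` of the complex `F_{p + 1} / F_p` through
the homomorphism `ε`. -/
structure IsGraded (p n : ℕ) {E : HCModule.{u} P}
    (ε : HCHom (HCModule.ofStable (X.cyc_stable p p n)) E) : Prop where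
  surjective : Function.Surjective ε.toLinearMap
  eq_zero_iff : ∀ x, ε.toLinearMap x = 0 ↔
    ∃ y ∈ X.bd (p + 1) n, (X.cyc_stable p p n).incl.toLinearMap x - y ∈ X.F p n

/-- The module `H` represents the cohomology of the complex in degree `n` through `η`. -/
structure IsCohomology (n : ℕ) {H : HCModule.{u} P}
    (η : HCHom (HCModule.ofStable (HCModule.stable_ker (X.d n))) H) : Prop where
  surjective : Function.Surjective η.toLinearMap
  eq_zero_iff : ∀ x, η.toLinearMap x = 0 ↔
    (HCModule.stable_ker (X.d n)).incl.toLinearMap x ∈ X.bd X.N n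

section Pages

variable {X} {E : ℕ → ℕ → HCModule.{u} P}
  {ε : ∀ p n, HCHom (HCModule.ofStable (X.cyc_stable p p n)) (E p n)}

/-- The image in `E p n` of the elements with boundary in `F_q`. -/
def pageCyc (ε : ∀ p n, HCHom (HCModule.ofStable (X.cyc_stable p p n)) (E p n)) (q p n : ℕ) :
    Submodule ℂ (E p n) :=
  ((X.cyc q p n).comap (X.cyc_stable p p n).incl.toLinearMap).map (ε p n).toLinearMap

/-- The image in `E p n` of the boundaries of the elements of `F_q`. -/
def pageBd (ε : ∀ p n, HCHom (HCModule.ofStable (X.cyc_stable p p n)) (E p n)) (q p n : ℕ) :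
    Submodule ℂ (E p n) :=
  ((X.bd q n).comap (X.cyc_stable p p n).incl.toLinearMap).map (ε p n).toLinearMap

theorem pageCyc_self (hε : ∀ p n, X.IsGraded p n (ε p n)) (p n : ℕ) : pageCyc ε p p n = ⊤ := by
  rw [eq_top_iff]
  intro e _
  obtain ⟨x, rfl⟩ := (hε p n).surjective e
  exact ⟨x, (X.cyc_stable p p n).incl_mem x, rfl⟩

theorem pageBd_succ_self (hε : ∀ p n, X.IsGraded p n (ε p n)) (p n : ℕ) :
    pageBd ε (p + 1) p n = ⊥ := by
  rw [eq_bot_iff]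
  rintro _ ⟨x, hx, rfl⟩
  exact (Submodule.mem_bot ℂ).2 (((hε p n).eq_zero_iff x).2
    ⟨_, hx, by rw [sub_self]; exact Submodule.zero_mem _⟩)

theorem pageBd_zero (q p : ℕ) : pageBd ε q p 0 = ⊥ := by
  rw [eq_bot_iff]
  rintro _ ⟨x, hx, rfl⟩
  have : x = 0 := (X.cyc_stable p p 0).incl_injective (hx.trans (map_zero _).symm)
  rw [this, map_zero]
  exact Submodule.zero_mem _

theorem eq_of_sub_mem (hε : ∀ p n, X.IsGraded p n (ε p n)) {p n : ℕ}
    {x x' : HCModule.ofStable (X.cyc_stable p p n)} {y : X.C n} (hy : y ∈ X.bd (p + 1) n)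
    (h : (X.cyc_stable p p n).incl.toLinearMap x - (X.cyc_stable p p n).incl.toLinearMap x' - y
      ∈ X.F p n) : (ε p n).toLinearMap x = (ε p n).toLinearMap x' := by
  rw [← sub_eq_zero, ← map_sub, (hε p n).eq_zero_iff]
  exact ⟨y, hy, by rwa [map_sub]⟩

/-- The restriction of `ε` to the elements with boundary in `F_q`. -/
def pageMap (ε : ∀ p n, HCHom (HCModule.ofStable (X.cyc_stable p p n)) (E p n)) {q p : ℕ}
    (h : q ≤ p) (n : ℕ) : HCHom (HCModule.ofStable (X.cyc_stable q p n)) (E p n) :=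
  (ε p n).comp ((X.cyc_stable p p n).cod (X.cyc_stable q p n).incl
    fun v => X.cyc_mono h p n ((X.cyc_stable q p n).incl_mem v))

theorem range_pageMap {q p : ℕ} (h : q ≤ p) (n : ℕ) :
    LinearMap.range (pageMap ε h n).toLinearMap = pageCyc ε q p n := by
  ext e
  constructor
  · rintro ⟨t, rfl⟩
    exact ⟨_, (X.cyc_stable q p n).incl_mem t, rfl⟩
  · rintro ⟨x, hx, rfl⟩
    exact ⟨⟨_, hx⟩, rfl⟩

/-- The differentials of the spectral sequence of the filtered complex identify the quotients of
successive cycle spaces in `E p n` with those of successive boundary spaces in `E q (n + 1)`. -/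
theorem subCls_differential (hS : IsAbelianSubcategory S) (hE : ∀ p n, S (E p n))
    (hε : ∀ p n, X.IsGraded p n (ε p n)) {q p : ℕ} (hqp : q < p) (n : ℕ)
    (hz : SubMem S (E p n) (pageCyc ε (q + 1) p n))
    (hb : SubMem S (E q (n + 1)) (pageBd ε p q (n + 1))) :
    SubMem S (E p n) (pageCyc ε q p n) ∧ SubMem S (E q (n + 1)) (pageBd ε (p + 1) q (n + 1)) ∧
    subCls S (E p n) (pageCyc ε (q + 1) p n) - subCls S (E p n) (pageCyc ε q p n)
      = subCls S (E q (n + 1)) (pageBd ε (p + 1) q (n + 1))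
        - subCls S (E q (n + 1)) (pageBd ε p q (n + 1)) := by
  let f := pageMap ε (Nat.succ_le_of_lt hqp) n
  have hd : ∀ t, ((X.d n).comp (X.cyc_stable (q + 1) p n).incl).toLinearMap t
      ∈ X.cyc q q (n + 1) := by
    intro t
    refine X.mem_cyc.2 ⟨((X.cyc_stable (q + 1) p n).incl_mem t).2, ?_⟩
    rw [HCHom.comp_apply, X.d_d]
    exact Submodule.zero_mem _
  let δ : HCHom (HCModule.ofStable (X.cyc_stable (q + 1) p n))
      (HCModule.ofStable (X.cyc_stable q q (n + 1))) :=
    (X.cyc_stable q q (n + 1)).cod ((X.d n).comp (X.cyc_stable (q + 1) p n).incl) hd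
  have hδ : ∀ t, (X.cyc_stable q q (n + 1)).incl.toLinearMap (δ.toLinearMap t)
      = (X.d n).toLinearMap ((X.cyc_stable (q + 1) p n).incl.toLinearMap t) := fun _ => rfl
  let g := (ε q (n + 1)).comp δ
  have hf : LinearMap.range f.toLinearMap = pageCyc ε (q + 1) p n := range_pageMap _ _
  have h0 : ∀ t, f.toLinearMap t = 0 → g.toLinearMap t ∈ pageBd ε p q (n + 1) := by
    intro t ht
    obtain ⟨y, hy, hty⟩ := ((hε p n).eq_zero_iff _).1 ht
    refine ⟨δ.toLinearMap t, ⟨_, hty, ?_⟩, rfl⟩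
    rw [map_sub, X.d_bd hy, sub_zero]
    rfl
  have h1 := subCls_correspondence hS f g (by rw [hf]; exact hz) (hE q (n + 1)) hb h0
  have e1 : ((pageBd ε p q (n + 1)).comap g.toLinearMap).map f.toLinearMap = pageCyc ε q p n := by
    ext e
    constructor
    · rintro ⟨t, ⟨s, hs, hst⟩, rfl⟩
      obtain ⟨y, hy, hys⟩ := hs
      -- `d (t - y)` is a boundary of `F_{q + 1}` modulo `F_q`
      have h2 : (ε q (n + 1)).toLinearMap (δ.toLinearMap t - s) = 0 := by
        rw [map_sub, sub_eq_zero]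
        exact hst.symm
      obtain ⟨_, ⟨y', hy', rfl⟩, h3⟩ := ((hε q (n + 1)).eq_zero_iff _).1 h2
      rw [map_sub, hδ, ← hys, ← map_sub, ← map_sub] at h3
      have hyy : y + y' ∈ X.F p n := Submodule.add_mem _ hy (X.mono n (Nat.succ_le_of_lt hqp) hy')
      have ht := (X.cyc_stable (q + 1) p n).incl_mem t
      have h4 : (X.cyc_stable (q + 1) p n).incl.toLinearMap t - (y + y') ∈ X.cyc q p n :=
        ⟨Submodule.sub_mem _ ht.1 (X.mono n (Nat.le_succ p) hyy), by
          rw [← sub_sub]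
          exact h3⟩
      refine ⟨⟨_, X.cyc_mono hqp.le p n h4⟩, h4, ?_⟩
      refine eq_of_sub_mem hε (y := 0) (Submodule.zero_mem _) ?_
      change ((X.cyc_stable (q + 1) p n).incl.toLinearMap t - (y + y'))
        - (X.cyc_stable (q + 1) p n).incl.toLinearMap t - 0 ∈ _
      rw [sub_zero, sub_sub_cancel_left]
      exact Submodule.neg_mem _ hyy
    · rintro ⟨x, hx, rfl⟩
      refine ⟨⟨_, X.cyc_mono (Nat.le_succ q) p n hx⟩, ?_, rfl⟩
      have : g.toLinearMap ⟨_, X.cyc_mono (Nat.le_succ q) p n hx⟩ = 0 := by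
        refine ((hε q (n + 1)).eq_zero_iff _).2 ⟨0, Submodule.zero_mem _, ?_⟩
        rw [sub_zero]
        exact hx.2
      exact (congrArg (· ∈ pageBd ε p q (n + 1)) this).mpr (Submodule.zero_mem _)
  have e2 : LinearMap.range g.toLinearMap ⊔ pageBd ε p q (n + 1) = pageBd ε (p + 1) q (n + 1) := by
    refine le_antisymm (sup_le ?_ ?_) ?_
    · rintro _ ⟨t, rfl⟩
      exact ⟨δ.toLinearMap t, ⟨_, ((X.cyc_stable (q + 1) p n).incl_mem t).1, rfl⟩, rfl⟩
    · exact Submodule.map_mono (Submodule.comap_mono (X.bd_mono (Nat.le_succ p) _))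
    · rintro _ ⟨x, ⟨y, hy, hyx⟩, rfl⟩
      refine Submodule.mem_sup_left ⟨⟨y, X.mem_cyc.2 ⟨hy, ?_⟩⟩, ?_⟩
      · rw [hyx]
        exact ((X.cyc_stable q q (n + 1)).incl_mem x).1
      · refine congrArg (ε q (n + 1)).toLinearMap ((X.cyc_stable q q (n + 1)).incl_injective ?_)
        exact hyx
  rw [hf, e1, e2] at h1
  exact h1

/-- All cycle and boundary spaces of the pages belong to `S`, by induction on the number of the page:
the differential of a page relates the next cycle space of its source and the next boundary space of
its target. -/
theorem subMem_page (hS : IsAbelianSubcategory S) (hE : ∀ p n, S (E p n))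
    (hε : ∀ p n, X.IsGraded p n (ε p n)) (r : ℕ) : ∀ q n,
    SubMem S (E (q + r) n) (pageCyc ε q (q + r) n) ∧
      SubMem S (E q n) (pageBd ε (q + r + 1) q n) := by
  induction r with
  | zero =>
    intro q n
    rw [add_zero, pageCyc_self hε, pageBd_succ_self hε]
    exact ⟨subMem_top hS (hE q n), subMem_bot hS _⟩
  | succ r ih =>
    intro q n
    have h1 : ∀ n, SubMem S (E (q + (r + 1)) n) (pageCyc ε (q + 1) (q + (r + 1)) n) := by
      intro n
      have := (ih (q + 1) n).1
      rwa [Nat.add_right_comm q 1 r] at this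
    have key := fun n => subCls_differential hS hE hε (q := q) (p := q + (r + 1)) (by omega) n
      (h1 n) (ih q (n + 1)).2
    refine ⟨(key n).1, ?_⟩
    cases n with
    | zero =>
      rw [pageBd_zero]
      exact subMem_bot hS _
    | succ n => exact (key n).2.1

theorem subMem_pageCyc (hS : IsAbelianSubcategory S) (hE : ∀ p n, S (E p n))
    (hε : ∀ p n, X.IsGraded p n (ε p n)) {q p : ℕ} (h : q ≤ p) (n : ℕ) :
    SubMem S (E p n) (pageCyc ε q p n) := by
  obtain ⟨r, rfl⟩ := Nat.exists_eq_add_of_le h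
  exact (subMem_page hS hE hε r q n).1

theorem subMem_pageBd (hS : IsAbelianSubcategory S) (hE : ∀ p n, S (E p n))
    (hε : ∀ p n, X.IsGraded p n (ε p n)) {q p : ℕ} (h : p < q) (n : ℕ) :
    SubMem S (E p n) (pageBd ε q p n) := by
  obtain ⟨r, rfl⟩ := Nat.exists_eq_add_of_le (Nat.succ_le_of_lt h)
  have := (subMem_page hS hE hε r p n).2
  rwa [Nat.add_right_comm] at this

/-- The filtration of the cohomology in degree `n`: its graded pieces are the quotients of the
ultimate cycle spaces by the ultimate boundary spaces. -/
theorem cls_cohomology_eq_sum (hS : IsAbelianSubcategory S) (hE : ∀ p n, S (E p n))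
    (hε : ∀ p n, X.IsGraded p n (ε p n)) (n : ℕ) {H : HCModule.{u} P} (hH : S H)
    {η : HCHom (HCModule.ofStable (HCModule.stable_ker (X.d n))) H} (hη : X.IsCohomology n η) :
    GrothendieckGroup.cls H hH = ∑ p ∈ Finset.range X.N,
      (subCls S (E p n) (pageCyc ε 0 p n) - subCls S (E p n) (pageBd ε X.N p n)) := by
  let hk := HCModule.stable_ker (X.d n)
  -- `Q` is the quotient of `H` by the classes which are represented in `F k`
  have key : ∀ k ≤ X.N, ∃ (Q : HCModule.{u} P) (hQ : S Q) (π : HCHom H Q),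
      Function.Surjective π.toLinearMap ∧
      (∀ x, π.toLinearMap (η.toLinearMap x) = 0 ↔
        ∃ y ∈ X.bd X.N n, hk.incl.toLinearMap x - y ∈ X.F k n) ∧
      GrothendieckGroup.cls H hH = GrothendieckGroup.cls Q hQ + ∑ p ∈ Finset.range k,
        (subCls S (E p n) (pageCyc ε 0 p n) - subCls S (E p n) (pageBd ε X.N p n)) := by
    intro k
    induction k with
    | zero =>
      intro _
      refine ⟨H, hH, HCHom.id H, Function.surjective_id, fun x => ?_, by simp⟩
      refine (hη.eq_zero_iff x).trans ?_
      simp only [X.zero, Submodule.mem_bot, sub_eq_zero]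
      exact ⟨fun h => ⟨_, h, rfl⟩, fun ⟨y, hy, hxy⟩ => by rwa [← hxy] at hy⟩
    | succ k ih =>
      intro hkN
      obtain ⟨Q, hQ, π, hπ, hπ0, hcls⟩ := ih (by omega)
      let f := pageMap ε (Nat.zero_le k) n
      have hd : ∀ t, (X.cyc_stable 0 k n).incl.toLinearMap t
          ∈ LinearMap.ker (X.d n).toLinearMap := by
        intro t
        have := ((X.cyc_stable 0 k n).incl_mem t).2
        rwa [X.zero] at this
      let j : HCHom (HCModule.ofStable (X.cyc_stable 0 k n)) (HCModule.ofStable hk) :=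
        hk.cod (X.cyc_stable 0 k n).incl hd
      let g := π.comp (η.comp j)
      have hg : ∀ t, g.toLinearMap t = 0 ↔
          ∃ y ∈ X.bd X.N n, (X.cyc_stable 0 k n).incl.toLinearMap t - y ∈ X.F k n :=
        fun t => hπ0 (j.toLinearMap t)
      have hf : LinearMap.range f.toLinearMap = pageCyc ε 0 k n := range_pageMap _ _
      have h0 : ∀ t, f.toLinearMap t = 0 → g.toLinearMap t ∈ (⊥ : Submodule ℂ Q) := by
        intro t ht
        obtain ⟨y, hy, hty⟩ := ((hε k n).eq_zero_iff _).1 ht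
        exact (Submodule.mem_bot ℂ).2 ((hg t).2 ⟨y, X.bd_mono hkN n hy, hty⟩)
      have h1 := subCls_correspondence hS f g (by
        rw [hf]; exact subMem_pageCyc hS hE hε (Nat.zero_le k) n) hQ (subMem_bot hS Q) h0
      have e1 : ((⊥ : Submodule ℂ Q).comap g.toLinearMap).map f.toLinearMap
          = pageBd ε X.N k n := by
        ext e
        constructor
        · rintro ⟨t, ht, rfl⟩
          obtain ⟨y, hy, hty⟩ := (hg t).1 ht
          have hy' : y ∈ X.cyc k k n := by
            refine X.mem_cyc.2 ⟨?_, ?_⟩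
            · have := Submodule.sub_mem _ ((X.cyc_stable 0 k n).incl_mem t).1
                (X.mono n (Nat.le_succ k) hty)
              rwa [sub_sub_cancel] at this
            · rw [X.d_bd hy]
              exact Submodule.zero_mem _
          refine ⟨⟨y, hy'⟩, hy, ?_⟩
          refine eq_of_sub_mem hε (y := 0) (Submodule.zero_mem _) ?_
          rw [sub_zero, ← neg_sub]
          exact Submodule.neg_mem _ hty
        · rintro ⟨x, hx, rfl⟩
          have hx' : (X.cyc_stable k k n).incl.toLinearMap x ∈ X.cyc 0 k n := by
            refine X.mem_cyc.2 ⟨((X.cyc_stable k k n).incl_mem x).1, ?_⟩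
            rw [X.d_bd hx]
            exact Submodule.zero_mem _
          refine ⟨⟨_, hx'⟩, (hg _).2 ⟨_, hx, ?_⟩, rfl⟩
          change (X.cyc_stable k k n).incl.toLinearMap x - _ ∈ _
          rw [sub_self]
          exact Submodule.zero_mem _
      rw [hf, e1, sup_bot_eq, subCls_bot hS, sub_zero] at h1
      obtain ⟨-, hr, hcls'⟩ := h1
      have hQ' := modStable_mem hS hQ hr
      refine ⟨_, hQ', hr.1.proj.comp π, hr.1.proj_surjective.comp hπ, fun x => ?_, ?_⟩
      · rw [HCHom.comp_apply, hr.1.proj_eq_zero]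
        constructor
        · rintro ⟨t, ht⟩
          have h2 : π.toLinearMap (η.toLinearMap (x - j.toLinearMap t)) = 0 := by
            rw [map_sub, map_sub, sub_eq_zero]
            exact ht.symm
          obtain ⟨y, hy, hxy⟩ := (hπ0 _).1 h2
          refine ⟨y, hy, ?_⟩
          have h3 := Submodule.add_mem _ (X.mono n (Nat.le_succ k) hxy)
            ((X.cyc_stable 0 k n).incl_mem t).1
          rw [map_sub] at h3
          convert h3 using 1
          change _ = hk.incl.toLinearMap x - (X.cyc_stable 0 k n).incl.toLinearMap t - y
            + (X.cyc_stable 0 k n).incl.toLinearMap t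
          abel
        · rintro ⟨y, hy, hxy⟩
          have ht : hk.incl.toLinearMap x - y ∈ X.cyc 0 k n := by
            refine X.mem_cyc.2 ⟨hxy, ?_⟩
            rw [map_sub, X.d_bd hy, sub_zero,
              LinearMap.mem_ker.1 (hk.incl_mem x)]
            exact Submodule.zero_mem _
          refine ⟨⟨_, ht⟩, ?_⟩
          rw [← sub_eq_zero]
          change π.toLinearMap (η.toLinearMap (j.toLinearMap ⟨_, ht⟩)) - _ = 0
          rw [← map_sub, ← map_sub, hπ0]
          refine ⟨-y, Submodule.neg_mem _ hy, ?_⟩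
          rw [map_sub]
          change hk.incl.toLinearMap x - y - hk.incl.toLinearMap x - -y ∈ _
          rw [sub_sub_cancel_left, sub_neg_eq_add, neg_add_cancel]
          exact Submodule.zero_mem _
      · rw [hcls, cls_eq_subCls_add hS hr.1.proj hr.1.proj_surjective hQ hQ',
          Finset.sum_range_succ, hcls']
        have : LinearMap.ker hr.1.proj.toLinearMap = LinearMap.range g.toLinearMap := by
          ext y
          exact hr.1.proj_eq_zero
        rw [this]
        abel
  obtain ⟨Q, hQ, π, hπ, hπ0, h⟩ := key X.N le_rfl
  have : Subsingleton Q := by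
    refine ⟨fun a b => ?_⟩
    have h0 : ∀ a : Q, a = 0 := by
      intro a
      obtain ⟨a, rfl⟩ := hπ a
      obtain ⟨a, rfl⟩ := hη.surjective a
      exact (hπ0 a).2 ⟨0, Submodule.zero_mem _, by rw [X.top]; exact Submodule.mem_top⟩
    rw [h0 a, h0 b]
  rwa [GrothendieckGroup.cls_eq_zero Q hQ, zero_add] at h

end Pages

/-- The Euler characteristic of a finite complex with a finite filtration is the sum of the Euler
characteristics of the graded pieces. Only the cohomology of the complex and the cohomology of the
graded pieces are required to belong to `S`, which need not be closed under extensions. -/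
theorem sum_cls_cohomology (hS : IsAbelianSubcategory S) (H : ℕ → HCModule.{u} P)
    (hH : ∀ n, S (H n))
    (η : ∀ n, HCHom (HCModule.ofStable (HCModule.stable_ker (X.d n))) (H n))
    (hη : ∀ n, X.IsCohomology n (η n)) (e : ℕ → ℕ → GrothendieckGroup S)
    (he : ∀ p n, ∃ (E : HCModule.{u} P) (hE : S E)
      (ε : HCHom (HCModule.ofStable (X.cyc_stable p p n)) E),
      X.IsGraded p n ε ∧ GrothendieckGroup.cls E hE = e p n)
    (R : ℕ) (hR : Subsingleton (X.C R)) :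
    ∑ n ∈ Finset.range R, (-1 : ℤ) ^ n • GrothendieckGroup.cls (H n) (hH n)
      = ∑ n ∈ Finset.range R, (-1 : ℤ) ^ n • ∑ p ∈ Finset.range X.N, e p n := by
  choose E hE ε hε hcls using he
  let β : ℕ → ℕ → ℕ → GrothendieckGroup S := fun q p n => subCls S (E p n) (pageBd ε q p n)
  let ζ : ℕ → ℕ → ℕ → GrothendieckGroup S := fun q p n => subCls S (E p n) (pageCyc ε q p n)
  -- a differential lowers the class of its source in degree `n` and raises the class of the
  -- boundaries in its target in degree `n + 1` by the same amount
  have hdiff : ∀ q p n, q < p → ζ (q + 1) p n - ζ q p n = β (p + 1) q (n + 1) - β p q (n + 1) :=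
    fun q p n h => (subCls_differential hS hE hε h n
      (subMem_pageCyc hS hE hε h n) (subMem_pageBd hS hE hε h (n + 1))).2.2
  have hζ : ∀ p n, ζ p p n = e p n := by
    intro p n
    simp only [ζ]
    rw [pageCyc_self hε, subCls_top hS (hE p n), hcls]
  have hβ : ∀ p n, β (p + 1) p n = 0 := by
    intro p n
    simp only [β]
    rw [pageBd_succ_self hε, subCls_bot hS]
  let Y : ℕ → GrothendieckGroup S := fun n => ∑ q ∈ Finset.range X.N, β X.N q n
  have hβN : ∀ q < X.N, ∀ n, β X.N q n
      = ∑ p ∈ Finset.Ico (q + 1) X.N, (β (p + 1) q n - β p q n) := by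
    intro q hq n
    rw [Finset.sum_Ico_sub (f := fun p => β p q n) hq, hβ, sub_zero]
  have hX : ∀ n, ∑ p ∈ Finset.range X.N, (e p n - ζ 0 p n) = Y (n + 1) := by
    intro n
    have h1 : ∀ p, e p n - ζ 0 p n
        = ∑ q ∈ Finset.range p, (β (p + 1) q (n + 1) - β p q (n + 1)) := by
      intro p
      rw [← hζ, ← Finset.sum_range_sub (f := fun q => ζ q p n)]
      exact Finset.sum_congr rfl fun q hq => hdiff q p n (Finset.mem_range.1 hq)
    rw [Finset.sum_congr rfl fun p _ => h1 p]
    simp only [Y]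
    rw [Finset.sum_congr rfl fun q hq => hβN q (Finset.mem_range.1 hq) (n + 1)]
    refine Finset.sum_comm' fun p q => ?_
    simp only [Finset.mem_range, Finset.mem_Ico]
    omega
  have hH' : ∀ n, GrothendieckGroup.cls (H n) (hH n)
      = (∑ p ∈ Finset.range X.N, e p n) - (Y (n + 1) + Y n) := by
    intro n
    rw [cls_cohomology_eq_sum hS hE hε n (hH n) (hη n), ← hX]
    simp only [Y, ← Finset.sum_add_distrib, ← Finset.sum_sub_distrib]
    refine Finset.sum_congr rfl fun p _ => ?_
    simp only [ζ, β]
    abel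
  have hY0 : Y 0 = 0 := by
    refine Finset.sum_eq_zero fun q _ => ?_
    simp only [β]
    rw [pageBd_zero, subCls_bot hS]
  have hYR : Y R = 0 := by
    refine Finset.sum_eq_zero fun q _ => ?_
    have h0 : pageBd ε X.N q R = ⊥ := by
      rw [eq_bot_iff]
      rintro _ ⟨x, -, rfl⟩
      have : x = 0 := (X.cyc_stable q q R).incl_injective (Subsingleton.elim _ _)
      rw [this, map_zero]
      exact Submodule.zero_mem _
    simp only [β]
    rw [h0, subCls_bot hS]
  have htel : ∀ m, ∑ n ∈ Finset.range m, (-1 : ℤ) ^ n • (Y (n + 1) + Y n)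
      = Y 0 - (-1 : ℤ) ^ m • Y m := by
    intro m
    induction m with
    | zero => simp
    | succ m ih =>
      rw [Finset.sum_range_succ, ih, pow_succ, mul_neg_one, neg_smul, smul_add]
      abel
  simp only [hH', smul_sub, Finset.sum_sub_distrib]
  rw [htel, hY0, hYR, smul_zero, sub_zero, sub_zero]

end FilteredComplex
end Filtered

/-! ### Alternating maps on a direct sum -/

section Birestriction

variable {A B U V : Type*} [AddCommGroup A] [Module ℂ A] [AddCommGroup B] [Module ℂ B]
  [AddCommGroup U] [Module ℂ U] [AddCommGroup V] [Module ℂ V] {a b n : ℕ}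

/-- The tuple `(v₁, …, v_a, w₁, …, w_b)`. -/
def joinVec (h : b + a = n) (v : Fin a → U) (w : Fin b → U) (k : Fin n) : U :=
  if hk : (k : ℕ) < a then v ⟨k, hk⟩ else w ⟨k - a, by omega⟩

theorem joinVec_lt (h : b + a = n) (v : Fin a → U) (w : Fin b → U) (k : Fin a) :
    joinVec h v w ⟨k, by omega⟩ = v k := by
  simp [joinVec]

theorem joinVec_ge (h : b + a = n) (v : Fin a → U) (w : Fin b → U) (k : Fin b) :
    joinVec h v w ⟨a + k, by omega⟩ = w k := by
  simp [joinVec]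

/-- An index of a joined tuple belongs to one of the two parts. -/
theorem joinVec_cases (h : b + a = n) {motive : Fin n → Prop}
    (h₁ : ∀ k : Fin a, motive ⟨k, by omega⟩) (h₂ : ∀ k : Fin b, motive ⟨a + k, by omega⟩)
    (k : Fin n) : motive k := by
  by_cases hk : (k : ℕ) < a
  · exact h₁ ⟨k, hk⟩
  · have := h₂ ⟨k - a, by omega⟩
    have e : (⟨a + (k - a), by omega⟩ : Fin n) = k := Fin.ext (by simp; omega)
    rwa [e] at this

theorem joinVec_ext (h : b + a = n) {x y : Fin n → U}
    (h₁ : ∀ k : Fin a, x ⟨k, by omega⟩ = y ⟨k, by omega⟩)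
    (h₂ : ∀ k : Fin b, x ⟨a + k, by omega⟩ = y ⟨a + k, by omega⟩) : x = y :=
  funext (joinVec_cases h h₁ h₂)

theorem joinVec_update_left (h : b + a = n) (v : Fin a → U) (w : Fin b → U) (k : Fin a) (x : U) :
    joinVec h (Function.update v k x) w
      = Function.update (joinVec h v w) ⟨k, by omega⟩ x := by
  refine joinVec_ext h (fun l => ?_) (fun l => ?_)
  · by_cases hl : l = k
    · subst hl; simp [joinVec_lt]
    · rw [joinVec_lt, Function.update_of_ne hl, Function.update_of_ne, joinVec_lt]
      simpa [Fin.ext_iff] using hl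
  · rw [joinVec_ge, Function.update_of_ne, joinVec_ge]
    simp only [ne_eq, Fin.mk.injEq]
    omega

theorem joinVec_update_right (h : b + a = n) (v : Fin a → U) (w : Fin b → U) (k : Fin b) (x : U) :
    joinVec h v (Function.update w k x)
      = Function.update (joinVec h v w) ⟨a + k, by omega⟩ x := by
  refine joinVec_ext h (fun l => ?_) (fun l => ?_)
  · rw [joinVec_lt, Function.update_of_ne, joinVec_lt]
    simp only [ne_eq, Fin.mk.injEq]
    omega
  · by_cases hl : l = k
    · subst hl; simp [joinVec_ge]
    · rw [joinVec_ge, Function.update_of_ne hl, Function.update_of_ne, joinVec_ge]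
      simpa [Fin.ext_iff] using hl

theorem joinVec_vecCons (h : b + a = n) (x : U) (v : Fin a → U) (w : Fin b → U) :
    joinVec (n := n + 1) (show b + (a + 1) = n + 1 by omega) (Matrix.vecCons x v) w
      = Matrix.vecCons x (joinVec h v w) := by
  funext k
  refine Fin.cases ?_ (fun k => ?_) k
  · simp [joinVec]
  · by_cases hk : (k : ℕ) < a
    · simp only [joinVec, Fin.val_succ, Nat.add_lt_add_iff_right, hk, dif_pos, Matrix.cons_val_succ]
      exact Matrix.cons_val_succ x v ⟨k, hk⟩
    · simp [joinVec, hk]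

theorem joinVec_insertNth (h : b + a = n) (y : U) (v : Fin a → U) (w : Fin b → U) :
    joinVec (n := n + 1) (show b + 1 + a = n + 1 by omega) v (Matrix.vecCons y w)
      = Fin.insertNth (α := fun _ => U) ⟨a, by omega⟩ y (joinVec h v w) := by
  refine (Fin.eq_insertNth_iff (α := fun _ => U)).2 ⟨?_, ?_⟩
  · simp [joinVec]
  · funext k
    by_cases hk : (k : ℕ) < a
    · have e : (⟨a, by omega⟩ : Fin (n + 1)).succAbove k = k.castSucc :=
        Fin.succAbove_of_castSucc_lt _ _ hk
      simp [Fin.removeNth, e, joinVec, hk]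
    · have e : (⟨a, by omega⟩ : Fin (n + 1)).succAbove k = k.succ :=
        Fin.succAbove_of_le_castSucc _ _ (by simpa [Fin.le_def] using hk)
      have h1 : ¬ (k : ℕ) + 1 < a := by omega
      have h2 : (⟨k + 1 - a, by omega⟩ : Fin (b + 1)) = Fin.succ ⟨k - a, by omega⟩ :=
        Fin.ext (by simp; omega)
      simp [Fin.removeNth, e, joinVec, hk, h1, h2]

theorem joinVec_removeNth (h : b + (a + 1) = n + 1) (v : Fin (a + 1) → U) (w : Fin b → U)
    (k : Fin (a + 1)) : Fin.removeNth (⟨k, by omega⟩ : Fin (n + 1)) (joinVec h v w)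
      = joinVec (show b + a = n by omega) (k.removeNth v) w := by
  funext l
  rcases lt_or_ge (l : ℕ) (k : ℕ) with hl | hl
  · have e : (⟨k, by omega⟩ : Fin (n + 1)).succAbove l = l.castSucc :=
      Fin.succAbove_of_castSucc_lt _ _ hl
    have hla : (l : ℕ) < a := by omega
    have e' : k.succAbove ⟨l, hla⟩ = (⟨l, hla⟩ : Fin a).castSucc :=
      Fin.succAbove_of_castSucc_lt _ _ hl
    have h1 : (l : ℕ) < a + 1 := by omega
    simp [Fin.removeNth, e, joinVec, hla, h1, e']
  · have e : (⟨k, by omega⟩ : Fin (n + 1)).succAbove l = l.succ :=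
      Fin.succAbove_of_le_castSucc _ _ hl
    by_cases hla : (l : ℕ) < a
    · have e' : k.succAbove ⟨l, hla⟩ = (⟨l, hla⟩ : Fin a).succ :=
        Fin.succAbove_of_le_castSucc _ _ hl
      simp [Fin.removeNth, e, joinVec, hla, e']
    · simp [Fin.removeNth, e, joinVec, hla]

theorem sum_joinVec (h : b + a = n) (f : Fin n → V) :
    ∑ k, f k = ∑ k : Fin a, f ⟨k, by omega⟩ + ∑ k : Fin b, f ⟨a + k, by omega⟩ := by
  obtain rfl : n = a + b := by omega
  rw [Fin.sum_univ_add]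
  rfl

/-- The component of bidegree `(a, b)` of an alternating map, with respect to the maps
`i : A → U` and `j : B → U`: `(v, w) ↦ ω (i v₁, …, i v_a, j w₁, …, j w_b)`. -/
def bires (i : A →ₗ[ℂ] U) (j : B →ₗ[ℂ] U) (h : b + a = n) (ω : U [⋀^Fin n]→ₗ[ℂ] V) :
    A [⋀^Fin a]→ₗ[ℂ] B [⋀^Fin b]→ₗ[ℂ] V where
  toFun v :=
    { toFun := fun w => ω (joinVec h (i ∘ v) (j ∘ w))
      map_update_add' := by
        intro inst w k x y
        obtain rfl : inst = instDecidableEqFin b := Subsingleton.elim _ _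
        simp only [Function.comp_update, joinVec_update_right, map_add]
        exact ω.map_update_add _ _ _ _
      map_update_smul' := by
        intro inst w k c x
        obtain rfl : inst = instDecidableEqFin b := Subsingleton.elim _ _
        simp only [Function.comp_update, joinVec_update_right, map_smul]
        exact ω.map_update_smul _ _ _ _
      map_eq_zero_of_eq' := fun w k l hkl hne => by
        refine ω.map_eq_zero_of_eq _ (i := ⟨a + k, by omega⟩) (j := ⟨a + l, by omega⟩) ?_ ?_
        · rw [joinVec_ge, joinVec_ge, Function.comp_apply, hkl, Function.comp_apply]
        · simpa [Fin.ext_iff] using hne }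
  map_update_add' := by
    intro inst v k x y
    obtain rfl : inst = instDecidableEqFin a := Subsingleton.elim _ _
    ext w
    change ω _ = ω _ + ω _
    simp only [Function.comp_update, joinVec_update_left, map_add]
    exact ω.map_update_add _ _ _ _
  map_update_smul' := by
    intro inst v k c x
    obtain rfl : inst = instDecidableEqFin a := Subsingleton.elim _ _
    ext w
    change ω _ = c • ω _
    simp only [Function.comp_update, joinVec_update_left, map_smul]
    exact ω.map_update_smul _ _ _ _
  map_eq_zero_of_eq' v k l hkl hne := by
    ext w
    refine ω.map_eq_zero_of_eq _ (i := ⟨k, by omega⟩) (j := ⟨l, by omega⟩) ?_ ?_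
    · rw [joinVec_lt, joinVec_lt, Function.comp_apply, hkl, Function.comp_apply]
    · simpa [Fin.ext_iff] using hne

variable (i : A →ₗ[ℂ] U) (j : B →ₗ[ℂ] U)

theorem bires_apply (h : b + a = n) (ω : U [⋀^Fin n]→ₗ[ℂ] V) (v : Fin a → A) (w : Fin b → B) :
    bires i j h ω v w = ω (joinVec h (i ∘ v) (j ∘ w)) := rfl

theorem bires_sub (h : b + a = n) (ω η : U [⋀^Fin n]→ₗ[ℂ] V) :
    bires i j h (ω - η) = bires i j h ω - bires i j h η := rfl

theorem bires_smul (h : b + a = n) (c : ℂ) (ω : U [⋀^Fin n]→ₗ[ℂ] V) :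
    bires i j h (c • ω) = c • bires i j h ω := rfl

theorem bires_curryLeft (h : b + a = n) (ω : U [⋀^Fin (n + 1)]→ₗ[ℂ] V) (x : A) :
    (bires i j (show b + (a + 1) = n + 1 by omega) ω).curryLeft x
      = bires i j h (ω.curryLeft (i x)) := by
  ext v w
  rw [AlternatingMap.curryLeft_apply_apply, bires_apply, bires_apply,
    AlternatingMap.curryLeft_apply_apply, ← joinVec_vecCons]
  congr 2
  funext k
  refine Fin.cases ?_ (fun k => ?_) k <;> simp

theorem bires_vecCons (h : b + a = n) (ω : U [⋀^Fin (n + 1)]→ₗ[ℂ] V) (y : B) (v : Fin a → A)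
    (w : Fin b → B) : bires i j (show b + 1 + a = n + 1 by omega) ω v (Matrix.vecCons y w)
      = (-1 : ℤ) ^ a • bires i j h (ω.curryLeft (j y)) v w := by
  have e : j ∘ Matrix.vecCons y w = Matrix.vecCons (j y) (j ∘ w) := by
    funext k
    refine Fin.cases ?_ (fun k => ?_) k <;> simp
  rw [bires_apply, e, joinVec_insertNth h, AlternatingMap.map_insertNth]
  rfl

theorem ext_curryLeft {ω η : U [⋀^Fin (n + 1)]→ₗ[ℂ] V}
    (h : ∀ x, ω.curryLeft x = η.curryLeft x) : ω = η := by
  ext v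
  have := congrArg (fun f : U [⋀^Fin n]→ₗ[ℂ] V => f (Fin.tail v)) (h (v 0))
  simpa [AlternatingMap.curryLeft_apply_apply, Matrix.vecCons, Fin.cons_self_tail] using this

/-- An alternating map is determined by its components, if `i` and `j` span. -/
theorem eq_zero_of_bires (hspan : ∀ u, ∃ x y, u = i x + j y) : ∀ {n : ℕ}
    (ω : U [⋀^Fin n]→ₗ[ℂ] V), (∀ (a b : ℕ) (h : b + a = n), bires i j h ω = 0) → ω = 0 := by
  intro n
  induction n with
  | zero =>
    intro ω h
    ext v
    have := congrArg
      (fun f : A [⋀^Fin 0]→ₗ[ℂ] B [⋀^Fin 0]→ₗ[ℂ] V => f ![] ![]) (h 0 0 rfl)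
    exact Eq.trans (congrArg (fun x => ω x) (Subsingleton.elim _ _)) this
  | succ n ih =>
    intro ω h
    refine ext_curryLeft fun u => ?_
    obtain ⟨x, y, rfl⟩ := hspan u
    have h1 : ω.curryLeft (i x) = 0 := ih _ fun a b hab => by
      rw [← bires_curryLeft, h]
      rfl
    have h2 : ω.curryLeft (j y) = 0 := ih _ fun a b hab => by
      ext v w
      have := bires_vecCons i j hab ω y v w
      rw [h] at this
      have h3 : (-1 : ℤ) ^ a • (-1 : ℤ) ^ a • bires i j hab (ω.curryLeft (j y)) v w = 0 := by
        rw [← this]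
        exact smul_zero _
      rwa [smul_smul, ← mul_pow, neg_one_mul, neg_neg, one_pow, one_smul] at h3
    rw [map_add, h1, h2, add_zero]
    rfl

theorem bires_altDer (h : b + a = n) {T : Module.End ℂ U} {TA : Module.End ℂ A}
    {TB : Module.End ℂ B} (hA : ∀ x, T (i x) = i (TA x)) (hB : ∀ y, T (j y) = j (TB y))
    (ω : U [⋀^Fin n]→ₗ[ℂ] V) (v : Fin a → A) (w : Fin b → B) :
    bires i j h (altDer T ω) v w
      = altDer TA (bires i j h ω) v w + altDer TB (bires i j h ω v) w := by
  have e : altDer TA (bires i j h ω) v w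
      = ∑ k, bires i j h ω (Function.update v k (TA (v k))) w := by
    rw [altDer_apply]
    exact map_sum (altEval (V := V) w) _ _
  rw [e, bires_apply, altDer_apply, altDer_apply, sum_joinVec h]
  simp only [bires_apply, Function.comp_update, joinVec_update_left, joinVec_update_right,
    joinVec_lt, joinVec_ge, Function.comp_apply, hA, hB]

theorem bires_compLinearMap (h : b + a = n) {T : U →ₗ[ℂ] U} {TA : A →ₗ[ℂ] A}
    {TB : B →ₗ[ℂ] B} (hA : ∀ x, T (i x) = i (TA x)) (hB : ∀ y, T (j y) = j (TB y))
    (ω : U [⋀^Fin n]→ₗ[ℂ] V) (v : Fin a → A) (w : Fin b → B) :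
    bires i j h (ω.compLinearMap T) v w = bires i j h ω (TA ∘ v) (TB ∘ w) := by
  rw [bires_apply, bires_apply, AlternatingMap.compLinearMap_apply]
  congr 1
  refine joinVec_ext h (fun k => ?_) (fun k => ?_)
  · simp [joinVec_lt, hA]
  · simp [joinVec_ge, hB]

/-- For projections `pA` and `pB` of `U` to `A` and `B`, every alternating map on `A` with values
in the alternating maps on `B` is the component of an alternating map on `U` all of whose other
components vanish. -/
theorem exists_bires_section (pA : U →ₗ[ℂ] A) (pB : U →ₗ[ℂ] B) (hAi : ∀ x, pA (i x) = x)
    (hAj : ∀ y, pA (j y) = 0) (hBi : ∀ x, pB (i x) = 0) (hBj : ∀ y, pB (j y) = y) :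
    ∀ (a b n : ℕ) (h : b + a = n), ∃ Ψ : (A [⋀^Fin a]→ₗ[ℂ] B [⋀^Fin b]→ₗ[ℂ] V) →ₗ[ℂ]
      (U [⋀^Fin n]→ₗ[ℂ] V), ∀ α, bires i j h (Ψ α) = α ∧
        ∀ (a' b' : ℕ) (h' : b' + a' = n), a' ≠ a → bires i j h' (Ψ α) = 0 := by
  intro a
  induction a with
  | zero =>
    rintro b n h
    obtain rfl : b = n := h
    refine ⟨{ toFun := fun α => (α ![]).compLinearMap pB
              map_add' := fun _ _ => rfl
              map_smul' := fun _ _ => rfl }, fun α => ⟨?_, ?_⟩⟩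
    · ext v w
      rw [Subsingleton.elim v ![]]
      change α ![] _ = α ![] w
      congr 1
      funext k
      exact (congrArg pB (by simp [joinVec])).trans (hBj (w k))
    · intro a' b' h' ha'
      ext v w
      change α ![] _ = 0
      refine AlternatingMap.map_coord_zero _ ⟨0, by omega⟩ ?_
      have := joinVec_lt h' (i ∘ v) (j ∘ w) ⟨0, by omega⟩
      exact (congrArg pB this).trans (hBi _)
  | succ a ih =>
    intro b n h
    obtain ⟨n, rfl⟩ : ∃ m, n = m + 1 := ⟨b + a, by omega⟩
    obtain ⟨Ψ, hΨ⟩ := ih b n (by omega)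
    -- antisymmetrizing one more argument in `A` yields `(a + 1) • α`
    let Θ : (A [⋀^Fin (a + 1)]→ₗ[ℂ] B [⋀^Fin b]→ₗ[ℂ] V) →ₗ[ℂ] (U [⋀^Fin (n + 1)]→ₗ[ℂ] V) :=
      { toFun := fun α => AlternatingMap.alternatizeUncurryFin (Ψ ∘ₗ α.curryLeft ∘ₗ pA)
        map_add' := fun α β => by
          rw [← AlternatingMap.alternatizeUncurryFin_add]
          congr 1
          ext1 x
          exact map_add Ψ (α.curryLeft (pA x)) (β.curryLeft (pA x))
        map_smul' := fun c α => by
          rw [RingHom.id_apply, ← AlternatingMap.alternatizeUncurryFin_smul]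
          congr 1
          ext1 x
          exact map_smul Ψ c (α.curryLeft (pA x)) }
    have hΘ : ∀ α x, Θ α x = ∑ k : Fin (n + 1),
        (-1 : ℤ) ^ (k : ℕ) • Ψ (α.curryLeft (pA (x k))) (k.removeNth x) := fun α x => by
      exact AlternatingMap.alternatizeUncurryFin_apply (Ψ ∘ₗ α.curryLeft ∘ₗ pA) x
    -- only the terms for which `x k` comes from `A` contribute
    have key : ∀ α (a' b' : ℕ) (h' : b' + (a' + 1) = n + 1) (v : Fin (a' + 1) → A)
        (w : Fin b' → B), bires i j h' (Θ α) v w = ∑ k : Fin (a' + 1),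
          (-1 : ℤ) ^ (k : ℕ) • bires i j (show b' + a' = n by omega) (Ψ (α.curryLeft (v k)))
            (k.removeNth v) w := by
      intro α a' b' h' v w
      rw [bires_apply, hΘ, sum_joinVec h']
      simp only [joinVec_lt, joinVec_ge, Function.comp_apply, hAi, hAj, map_zero,
        AlternatingMap.zero_apply, smul_zero, Finset.sum_const_zero, add_zero]
      refine Finset.sum_congr rfl fun k _ => ?_
      rw [joinVec_removeNth]
      rfl
    have hcons : ∀ (α : A [⋀^Fin (a + 1)]→ₗ[ℂ] B [⋀^Fin b]→ₗ[ℂ] V) (v : Fin (a + 1) → A)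
        (k : Fin (a + 1)), (-1 : ℤ) ^ (k : ℕ) • α.curryLeft (v k) (k.removeNth v) = α v := by
      intro α v k
      rw [AlternatingMap.curryLeft_apply_apply, ← AlternatingMap.map_insertNth,
        Fin.insertNth_self_removeNth]
    have hne : ((a : ℂ) + 1) ≠ 0 := Nat.cast_add_one_ne_zero a
    refine ⟨((a : ℂ) + 1)⁻¹ • Θ, fun α => ⟨?_, ?_⟩⟩
    · rw [LinearMap.smul_apply, bires_smul]
      have : bires i j h (Θ α) = ((a : ℂ) + 1) • α := by
        ext v w
        rw [key α a b h v w]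
        have h1 : ∀ k : Fin (a + 1), (-1 : ℤ) ^ (k : ℕ) • bires i j (show b + a = n by omega)
            (Ψ (α.curryLeft (v k))) (k.removeNth v) w = α v w := by
          intro k
          rw [(hΨ _).1]
          exact congrArg (fun f => f w) (hcons α v k)
        rw [Finset.sum_congr rfl fun k _ => h1 k]
        simp [← Nat.cast_smul_eq_nsmul ℂ]
      rw [this, smul_smul, inv_mul_cancel₀ hne, one_smul]
    · intro a' b' h' ha'
      rw [LinearMap.smul_apply, bires_smul]
      have : bires i j h' (Θ α) = 0 := by
        ext v w
        cases a' with
        | zero =>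
          rw [bires_apply, hΘ]
          refine Finset.sum_eq_zero fun k _ => ?_
          have h1 : pA (joinVec h' (i ∘ v) (j ∘ w) k) = 0 := by simp [joinVec, hAj]
          rw [h1, map_zero, map_zero]
          exact smul_zero _
        | succ a' =>
          rw [key α a' b' h' v w]
          refine Finset.sum_eq_zero fun k _ => ?_
          rw [(hΨ _).2 a' b' (by omega) (by omega)]
          exact smul_zero _
      rw [this, smul_zero]

end Birestriction

/-! ### The differential on components -/

section Bicomplex

variable {𝔫 V : Type*} [LieRing 𝔫] [LieAlgebra ℂ 𝔫] [AddCommGroup V] [Module ℂ V]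

/-- Cartan's formula in degree `0`. -/
theorem ceD_cartan_zero (ρ : 𝔫 →ₗ[ℂ] Module.End ℂ V) (x : 𝔫) (ω : 𝔫 [⋀^Fin 0]→ₗ[ℂ] V) :
    (ceD ρ 0 ω).curryLeft x = (ρ x).compAlternatingMap ω - altDer (adEnd x) ω := by
  ext v
  rw [AlternatingMap.curryLeft_apply_apply, ceD_apply]
  simp [altDer_apply, Fin.removeNth]

variable {A B : Type*} [LieRing A] [LieAlgebra ℂ A] [LieRing B] [LieAlgebra ℂ B]
  (i : A →ₗ[ℂ] 𝔫) (j : B →ₗ[ℂ] 𝔫) (σ : A →ₗ[ℂ] Module.End ℂ B) (ρ : 𝔫 →ₗ[ℂ] Module.End ℂ V)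

/-- The component of bidegree `(a, b)` of `dω` that comes from the differential in the direction
of `A`. -/
def horizontal {n : ℕ} (ω : 𝔫 [⋀^Fin n]→ₗ[ℂ] V) :
    ∀ (a b : ℕ), b + a = n + 1 → A [⋀^Fin a]→ₗ[ℂ] B [⋀^Fin b]→ₗ[ℂ] V
  | 0, _, _ => 0
  | a + 1, b, h => ceD (altRep b σ (ρ ∘ₗ i)) a (bires i j (by omega) ω)

/-- The component of bidegree `(a, b)` of `dω` that comes, up to sign, from the differential in the
direction of `B`. -/
def vertical {n : ℕ} (ω : 𝔫 [⋀^Fin n]→ₗ[ℂ] V) :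
    ∀ (a b : ℕ), b + a = n + 1 → A [⋀^Fin a]→ₗ[ℂ] B [⋀^Fin b]→ₗ[ℂ] V
  | _, 0, _ => 0
  | _, b + 1, h => (ceD (ρ ∘ₗ j) b).compAlternatingMap (bires i j (by omega) ω)

variable {i j σ}

theorem bires_lieDer (hi : ∀ x y, i ⁅x, y⁆ = ⁅i x, i y⁆)
    (hσ : ∀ x y, j (σ x y) = ⁅i x, j y⁆) {a b n : ℕ} (h : b + a = n) (x : A)
    (ω : 𝔫 [⋀^Fin n]→ₗ[ℂ] V) :
    bires i j h ((ρ (i x)).compAlternatingMap ω - altDer (adEnd (i x)) ω)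
      = (altRep b σ (ρ ∘ₗ i) x).compAlternatingMap (bires i j h ω)
        - altDer (adEnd x) (bires i j h ω) := by
  ext v w
  have h1 := bires_altDer i j h (T := adEnd (i x)) (TA := adEnd x) (TB := σ x)
    (fun y => (hi x y).symm) (fun y => (hσ x y).symm) ω v w
  rw [bires_sub]
  change bires i j h ((ρ (i x)).compAlternatingMap ω) v w
      - bires i j h (altDer (adEnd (i x)) ω) v w
    = (ρ (i x) (bires i j h ω v w) - altDer (σ x) (bires i j h ω v) w)
        - altDer (adEnd x) (bires i j h ω) v w
  rw [h1, sub_sub, add_comm]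
  rfl

theorem vertical_curryLeft {a b n : ℕ} (h : b + a = n + 1) (ω : 𝔫 [⋀^Fin (n + 1)]→ₗ[ℂ] V) (x : A) :
    (vertical i j ρ ω (a + 1) b (by omega)).curryLeft x
      = vertical i j ρ (ω.curryLeft (i x)) a b h := by
  cases b with
  | zero => rfl
  | succ b =>
    have := bires_curryLeft i j (show b + a = n by omega) ω x
    simp only [vertical]
    rw [AlternatingMap.curryLeft_compAlternatingMap, this]

theorem horizontal_curryLeft {a b n : ℕ} (h : b + a = n + 1) (ω : 𝔫 [⋀^Fin (n + 1)]→ₗ[ℂ] V)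
    (x : A) : (horizontal i j σ ρ ω (a + 1) b (by omega)).curryLeft x
      = (altRep b σ (ρ ∘ₗ i) x).compAlternatingMap (bires i j h ω)
          - altDer (adEnd x) (bires i j h ω) - horizontal i j σ ρ (ω.curryLeft (i x)) a b h := by
  cases a with
  | zero =>
    refine (ceD_cartan_zero (altRep b σ (ρ ∘ₗ i)) x (bires i j h ω)).trans ?_
    exact (sub_zero _).symm
  | succ a =>
    have := ceD_cartan (altRep b σ (ρ ∘ₗ i)) x (bires i j h ω)
    rw [bires_curryLeft i j (show b + a = n by omega)] at this
    exact eq_sub_of_add_eq this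

/-- The Chevalley–Eilenberg differential of a semidirect product is the total differential of a
double complex. -/
theorem bires_ceD (hi : ∀ x y, i ⁅x, y⁆ = ⁅i x, i y⁆) (hj : ∀ x y, j ⁅x, y⁆ = ⁅j x, j y⁆)
    (hσ : ∀ x y, j (σ x y) = ⁅i x, j y⁆) : ∀ {n : ℕ} (ω : 𝔫 [⋀^Fin n]→ₗ[ℂ] V) (a b : ℕ)
    (h : b + a = n + 1), bires i j h (ceD ρ n ω)
      = horizontal i j σ ρ ω a b h + (-1 : ℤ) ^ a • vertical i j ρ ω a b h := by
  intro n ω a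
  induction a generalizing n with
  | zero =>
    rintro b h
    obtain rfl : b = n + 1 := h
    ext v w
    have e : ∀ (m : ℕ) (η : 𝔫 [⋀^Fin m]→ₗ[ℂ] V) (v : Fin 0 → A),
        bires i j rfl η v = η.compLinearMap j := by
      intro m η v
      ext w
      rfl
    rw [e]
    have := ceD_natural ρ (ρ ∘ₗ j) LinearMap.id j hj (fun _ _ => rfl) ω
    change _ = (0 : V) + ((-1 : ℤ) ^ 0 • vertical i j ρ ω 0 (n + 1) rfl) v w
    rw [pow_zero, one_smul, zero_add]
    change _ = (ceD (ρ ∘ₗ j) n (bires i j rfl ω v)) w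
    rw [e]
    exact congrArg (fun f : B [⋀^Fin (n + 1)]→ₗ[ℂ] V => f w) this.symm
  | succ a ih =>
    rintro b h
    refine ext_curryLeft fun x => ?_
    have hn : b + a = n := by omega
    rw [bires_curryLeft i j hn]
    have hadd : (horizontal i j σ ρ ω (a + 1) b h
        + (-1 : ℤ) ^ (a + 1) • vertical i j ρ ω (a + 1) b h).curryLeft x
          = (horizontal i j σ ρ ω (a + 1) b h).curryLeft x
            + (-1 : ℤ) ^ (a + 1) • (vertical i j ρ ω (a + 1) b h).curryLeft x := rfl
    rw [hadd]
    cases n with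
    | zero =>
      obtain rfl : a = 0 := by omega
      obtain rfl : b = 0 := by omega
      rw [ceD_cartan_zero, bires_lieDer ρ hi hσ]
      have h1 : (vertical i j ρ ω 1 0 h).curryLeft x = 0 := rfl
      rw [h1, smul_zero, add_zero]
      exact (ceD_cartan_zero (altRep 0 σ (ρ ∘ₗ i)) x (bires i j hn ω)).symm
    | succ n =>
      have := ceD_cartan ρ (i x) ω
      rw [eq_sub_of_add_eq this, bires_sub, bires_lieDer ρ hi hσ, ih (ω.curryLeft (i x)) b hn,
        horizontal_curryLeft ρ hn, vertical_curryLeft ρ hn,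
        pow_succ, mul_neg_one, neg_smul, sub_add_eq_sub_sub, sub_eq_add_neg _ (_ • _)]

end Bicomplex

/-! ### Double complexes -/

section Double

variable {𝔤 K : Type*} [LieRing 𝔤] [LieAlgebra ℂ 𝔤] [Group K] [TopologicalSpace K]
  [IsTopologicalGroup K] {P : LiePair 𝔤 K} {S : HCModule.{u} P → Prop}

/-- A double complex `K` in the first quadrant, with finitely many rows, together with a model `C` of
its total complex: the homomorphisms `Φ a b` identify `C n` with the direct sum of the modules `K a b`
for `a + b = n`, and the differential of `C` is the sum of `dh` and `± dv`. -/
structure DoubleComplex (P : LiePair 𝔤 K) where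
  K : ℕ → ℕ → HCModule.{u} P
  dh : ∀ a b, HCHom (K a b) (K (a + 1) b)
  dv : ∀ a b, HCHom (K a b) (K a (b + 1))
  dv_dv : ∀ a b x, (dv a (b + 1)).toLinearMap ((dv a b).toLinearMap x) = 0
  dv_dh : ∀ a b x, (dv (a + 1) b).toLinearMap ((dh a b).toLinearMap x)
    = (dh a (b + 1)).toLinearMap ((dv a b).toLinearMap x)
  C : ℕ → HCModule.{u} P
  d : ∀ n, HCHom (C n) (C (n + 1))
  d_d : ∀ n x, (d (n + 1)).toLinearMap ((d n).toLinearMap x) = 0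
  Φ : ∀ (a b n : ℕ), b + a = n → HCHom (C n) (K a b)
  eq_zero : ∀ (n : ℕ) (x : C n), (∀ a b h, (Φ a b n h).toLinearMap x = 0) → x = 0
  exists_section : ∀ (a b n : ℕ) (h : b + a = n) (y : K a b), ∃ x : C n,
    (Φ a b n h).toLinearMap x = y ∧ ∀ a' b' h', b' ≠ b → (Φ a' b' n h').toLinearMap x = 0
  Φ_d_zero : ∀ (b n : ℕ) (h : b = n) (h' : b + 1 + 0 = n + 1) (x : C n),
    (Φ 0 (b + 1) (n + 1) h').toLinearMap ((d n).toLinearMap x)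
      = (dv 0 b).toLinearMap ((Φ 0 b n h).toLinearMap x)
  Φ_d_succ_zero : ∀ (a n : ℕ) (h : 0 + a = n) (h' : 0 + (a + 1) = n + 1) (x : C n),
    (Φ (a + 1) 0 (n + 1) h').toLinearMap ((d n).toLinearMap x)
      = (dh a 0).toLinearMap ((Φ a 0 n h).toLinearMap x)
  Φ_d_succ_succ : ∀ (a b n : ℕ) (h₁ : b + 1 + a = n) (h₂ : b + (a + 1) = n)
    (h' : b + 1 + (a + 1) = n + 1) (x : C n),
    (Φ (a + 1) (b + 1) (n + 1) h').toLinearMap ((d n).toLinearMap x)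
      = (dh a (b + 1)).toLinearMap ((Φ a (b + 1) n h₁).toLinearMap x)
        + (-1 : ℤ) ^ (a + 1) • (dv (a + 1) b).toLinearMap ((Φ (a + 1) b n h₂).toLinearMap x)
  N : ℕ
  subsingleton : ∀ a b, N ≤ b → Subsingleton (K a b)

namespace DoubleComplex

variable (X : DoubleComplex.{u} P)

/-- The canonical truncation: the elements whose components of vertical degree at least `q` vanish
and whose components of vertical degree `q - 1` are vertical cocycles. -/
def F (q n : ℕ) : Submodule ℂ (X.C n) :=
  ⨅ (a : ℕ) (b : ℕ) (h : b + a = n),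
    (⨅ _ : q ≤ b, LinearMap.ker (X.Φ a b n h).toLinearMap)
      ⊓ (⨅ _ : q ≤ b + 1, LinearMap.ker ((X.dv a b).comp (X.Φ a b n h)).toLinearMap)

theorem mem_F {q n : ℕ} {x : X.C n} : x ∈ X.F q n ↔ ∀ (a b : ℕ) (h : b + a = n),
    (q ≤ b → (X.Φ a b n h).toLinearMap x = 0) ∧
      (q ≤ b + 1 → (X.dv a b).toLinearMap ((X.Φ a b n h).toLinearMap x) = 0) := by
  simp only [F, Submodule.mem_iInf, Submodule.mem_inf, LinearMap.mem_ker]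
  rfl

/-- The vertical coboundaries. -/
def vBd (a : ℕ) : ∀ b, Submodule ℂ (X.K a b)
  | 0 => ⊥
  | b + 1 => LinearMap.range (X.dv a b).toLinearMap

/-- The horizontal coboundaries of vertical cocycles. -/
def hBd : ∀ a b, Submodule ℂ (X.K a b)
  | 0, _ => ⊥
  | a + 1, b => (LinearMap.ker (X.dv a b).toLinearMap).map (X.dh a b).toLinearMap

theorem vBd_stable (a b : ℕ) : (X.K a b).Stable (X.vBd a b) := by
  cases b with
  | zero => exact HCModule.stable_bot _
  | succ b => exact HCModule.stable_range _

/-- The vertical cocycles which represent horizontal cocycles of the vertical cohomology. -/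
def vCyc (a b : ℕ) : Submodule ℂ (X.K a b) :=
  LinearMap.ker (X.dv a b).toLinearMap ⊓ (X.vBd (a + 1) b).comap (X.dh a b).toLinearMap

theorem vCyc_stable (a b : ℕ) : (X.K a b).Stable (X.vCyc a b) :=
  (HCModule.stable_ker _).inf ((X.vBd_stable _ _).comap _)

/-- The module `E` represents the horizontal cohomology of the vertical cohomology in bidegree
`(a, b)` through the homomorphism `ε`. -/
structure IsIterated (a b : ℕ) {E : HCModule.{u} P}
    (ε : HCHom (HCModule.ofStable (X.vCyc_stable a b)) E) : Prop where
  surjective : Function.Surjective ε.toLinearMap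
  eq_zero_iff : ∀ x, ε.toLinearMap x = 0 ↔
    (X.vCyc_stable a b).incl.toLinearMap x ∈ X.hBd a b ⊔ X.vBd a b

theorem dv_vBd {a b : ℕ} {x : X.K a b} (hx : x ∈ X.vBd a b) : (X.dv a b).toLinearMap x = 0 := by
  cases b with
  | zero => rw [(Submodule.mem_bot ℂ).1 hx, map_zero]
  | succ b =>
    obtain ⟨y, rfl⟩ := hx
    exact X.dv_dv a b y

/-- If the component of bidegree `(a, b)` of `x` vanishes, the component of bidegree `(a + 1, b)` of
`dx` is a vertical coboundary; in general it is one modulo `dh`. -/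
theorem Φ_d_sub_mem {a b n : ℕ} (h : b + a = n) (x : X.C n) :
    (X.Φ (a + 1) b (n + 1) (by omega)).toLinearMap ((X.d n).toLinearMap x)
      - (X.dh a b).toLinearMap ((X.Φ a b n h).toLinearMap x) ∈ X.vBd (a + 1) b := by
  cases b with
  | zero =>
    rw [X.Φ_d_succ_zero a n h]
    simp
  | succ b =>
    rw [X.Φ_d_succ_succ a b n h (by omega), add_sub_cancel_left]
    exact zsmul_mem (LinearMap.mem_range_self _ _) _

theorem F_stable (q n : ℕ) : (X.C n).Stable (X.F q n) := by
  constructor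
  · intro x w hw
    rw [mem_F] at hw ⊢
    intro a b h
    refine ⟨fun hq => ?_, fun hq => ?_⟩
    · rw [HCHom.apply_rep, (hw a b h).1 hq, map_zero]
    · rw [HCHom.apply_rep, HCHom.apply_rep, (hw a b h).2 hq, map_zero]
  · intro x w hw
    rw [mem_F] at hw ⊢
    intro a b h
    refine ⟨fun hq => ?_, fun hq => ?_⟩
    · rw [HCHom.apply_act, (hw a b h).1 hq, map_zero]
    · rw [HCHom.apply_act, HCHom.apply_act, (hw a b h).2 hq, map_zero]

theorem F_mono {q q' : ℕ} (h : q ≤ q') (n : ℕ) : X.F q n ≤ X.F q' n := by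
  intro x hx
  rw [mem_F] at hx ⊢
  exact fun a b hab => ⟨fun hq => (hx a b hab).1 (h.trans hq), fun hq => (hx a b hab).2 (h.trans hq)⟩

theorem d_mem_F (q n : ℕ) (x : X.C n) (hx : x ∈ X.F q n) :
    (X.d n).toLinearMap x ∈ X.F q (n + 1) := by
  rw [mem_F] at hx ⊢
  intro a b h
  cases a with
  | zero =>
    obtain ⟨b, rfl⟩ : ∃ c, b = c + 1 := ⟨n, by omega⟩
    have hb : b = n := by omega
    rw [X.Φ_d_zero b n hb]
    exact ⟨(hx 0 b hb).2, fun _ => X.dv_dv _ _ _⟩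
  | succ a =>
    have hab : b + a = n := by omega
    have h1 : q ≤ b + 1 → (X.dv (a + 1) b).toLinearMap ((X.Φ (a + 1) b (n + 1) h).toLinearMap
        ((X.d n).toLinearMap x)) = 0 := by
      intro hq
      have := X.dv_vBd (X.Φ_d_sub_mem hab x)
      rwa [map_sub, X.dv_dh, (hx a b hab).2 hq, map_zero, sub_zero] at this
    refine ⟨fun hq => ?_, h1⟩
    cases b with
    | zero => rw [X.Φ_d_succ_zero a n hab, (hx a 0 hab).1 hq, map_zero]
    | succ b =>
      rw [X.Φ_d_succ_succ a b n hab (by omega), (hx a (b + 1) hab).1 hq,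
        (hx (a + 1) b (by omega)).2 hq, map_zero, smul_zero, add_zero]

/-- The total complex with the filtration by the canonical truncations of the columns. -/
def total : FilteredComplex.{u} P where
  C := X.C
  d := X.d
  d_d := X.d_d
  F := X.F
  stable := X.F_stable
  mono n _ _ h := X.F_mono h n
  d_mem := X.d_mem_F
  N := X.N
  zero n := by
    rw [eq_bot_iff]
    intro x hx
    rw [mem_F] at hx
    exact (Submodule.mem_bot ℂ).2 (X.eq_zero n x fun a b h => (hx a b h).1 (Nat.zero_le _))
  top n := by
    rw [eq_top_iff]
    intro x _
    rw [mem_F]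
    intro a b h
    refine ⟨fun hq => ?_, fun hq => ?_⟩
    · have := X.subsingleton a b hq
      exact Subsingleton.elim _ _
    · have := X.subsingleton a (b + 1) hq
      exact Subsingleton.elim _ _

theorem mem_F_of {p n : ℕ} {x : X.C n} (hx : x ∈ X.F (p + 1) n)
    (h : ∀ a h, (X.Φ a p n h).toLinearMap x = 0)
    (hd : ∀ a h, (X.Φ a p (n + 1) h).toLinearMap ((X.d n).toLinearMap x) = 0) :
    x ∈ X.F p n := by
  rw [mem_F] at hx ⊢
  intro a b hab
  rcases Nat.lt_trichotomy b p with hb | rfl | hb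
  · refine ⟨fun hq => by omega, fun hq => ?_⟩
    obtain rfl : p = b + 1 := by omega
    cases a with
    | zero =>
      have := hd 0 (by omega)
      rwa [X.Φ_d_zero b n hab] at this
    | succ a =>
      have := hd (a + 1) (by omega)
      rw [X.Φ_d_succ_succ a b n (by omega) (by omega), h, map_zero, zero_add] at this
      have h2 := congrArg (fun z => (-1 : ℤ) ^ (a + 1) • z) this
      rwa [smul_smul, ← mul_pow, neg_one_mul, neg_neg, one_pow, one_smul, smul_zero] at h2
  · rw [h a hab, map_zero]
    exact ⟨fun _ => rfl, fun _ => rfl⟩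
  · exact ⟨fun _ => (hx a b hab).1 hb, fun _ => (hx a b hab).2 (by omega)⟩

/-- An element concentrated in vertical degree `b`. -/
theorem exists_mem_F {a b n p : ℕ} (h : b + a = n) (y : X.K a b)
    (hb : b < p) (hy : b + 1 = p → (X.dv a b).toLinearMap y = 0) :
    ∃ x ∈ X.F p n, (X.Φ a b n h).toLinearMap x = y ∧
      ∀ a' b' h', b' ≠ b → (X.Φ a' b' n h').toLinearMap x = 0 := by
  obtain ⟨x, hx, hx'⟩ := X.exists_section a b n h y
  refine ⟨x, X.mem_F.2 fun a' b' h' => ?_, hx, hx'⟩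
  by_cases hbb : b' = b
  · subst hbb
    obtain rfl : a' = a := by omega
    rw [hx]
    exact ⟨fun hq => by omega, fun hq => hy (by omega)⟩
  · rw [hx' a' b' h' hbb, map_zero]
    exact ⟨fun _ => rfl, fun _ => rfl⟩

theorem exists_of_mem_hBd {a p n : ℕ} (h : p + a = n) {y : X.K a p} (hy : y ∈ X.hBd a p) :
    ∃ x : X.C n, x ∈ X.total.bd (p + 1) n ∧ (X.Φ a p n h).toLinearMap x = y := by
  cases a with
  | zero =>
    rw [(Submodule.mem_bot ℂ).1 hy]
    exact ⟨0, Submodule.zero_mem _, map_zero _⟩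
  | succ a =>
    obtain ⟨z, hz, rfl⟩ := hy
    obtain ⟨n, rfl⟩ : ∃ m, n = m + 1 := ⟨p + a, by omega⟩
    obtain ⟨x, hx, hx1, hx2⟩ := X.exists_mem_F (show p + a = n by omega) z (Nat.lt_succ_self p)
      (fun _ => hz)
    refine ⟨(X.d n).toLinearMap x, ⟨x, hx, rfl⟩, ?_⟩
    cases p with
    | zero => rw [X.Φ_d_succ_zero a n (by omega), hx1]
    | succ p =>
      rw [X.Φ_d_succ_succ a p n (by omega) (by omega), hx1, hx2 _ _ _ (by omega), map_zero,
        smul_zero, add_zero]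

theorem exists_of_mem_vBd {a p n : ℕ} (h : p + a = n + 1) {y : X.K a p} (hy : y ∈ X.vBd a p) :
    ∃ x ∈ X.F (p + 1) n, (∀ a' h', (X.Φ a' p n h').toLinearMap x = 0) ∧
      (X.Φ a p (n + 1) h).toLinearMap ((X.d n).toLinearMap x) = y := by
  cases p with
  | zero =>
    rw [(Submodule.mem_bot ℂ).1 hy]
    exact ⟨0, Submodule.zero_mem _, fun _ _ => map_zero _, by rw [map_zero, map_zero]⟩
  | succ p =>
    obtain ⟨z, rfl⟩ := hy
    have hz : ∃ x ∈ X.F (p + 2) n, (X.Φ a p n (by omega)).toLinearMap x = (-1 : ℤ) ^ a • z ∧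
      ∀ a' b' h', b' ≠ p → (X.Φ a' b' n h').toLinearMap x = 0 :=
      X.exists_mem_F _ _ (by omega) (by omega)
    obtain ⟨x, hx, hx1, hx2⟩ := hz
    have key : (X.Φ a (p + 1) (n + 1) h).toLinearMap ((X.d n).toLinearMap x)
        = (X.dv a p).toLinearMap z := by
      cases a with
      | zero => rw [X.Φ_d_zero p n (by omega), hx1, pow_zero, one_smul]
      | succ a =>
        rw [X.Φ_d_succ_succ a p n (by omega) (by omega), hx1, hx2 _ _ _ (by omega), map_zero,
          zero_add, map_zsmul, smul_smul, ← mul_pow, neg_one_mul, neg_neg, one_pow, one_smul]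
    exact ⟨x, hx, fun a' h' => hx2 a' _ h' (by omega), key⟩

theorem Φ_bd {a p n : ℕ} (h : p + a = n) {x : X.C n} (hx : x ∈ X.total.bd (p + 1) n) :
    (X.Φ a p n h).toLinearMap x ∈ X.hBd a p ⊔ X.vBd a p := by
  cases n with
  | zero =>
    have hx : x = 0 := hx
    rw [hx, map_zero]
    exact Submodule.zero_mem _
  | succ n =>
    obtain ⟨x, hx, rfl⟩ : ∃ y : X.C n, y ∈ X.F (p + 1) n ∧ (X.d n).toLinearMap y = x := hx
    rw [mem_F] at hx
    cases a with
    | zero =>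
      obtain ⟨p, rfl⟩ : ∃ c, p = c + 1 := ⟨n, by omega⟩
      rw [X.Φ_d_zero p n (by omega)]
      exact Submodule.mem_sup_right (LinearMap.mem_range_self _ _)
    | succ a =>
      have h1 := X.Φ_d_sub_mem (show p + a = n by omega) x
      refine Submodule.mem_sup.2 ⟨_, ⟨_, ?_, rfl⟩, _, h1, add_sub_cancel _ _⟩
      exact (hx a p _).2 le_rfl

/-- The graded pieces of the total complex, for the filtration by the canonical truncations of the
columns, have the horizontal cohomology of the vertical cohomology as their cohomology. -/
theorem exists_isGraded {a p : ℕ} {E : HCModule.{u} P}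
    (ε : HCHom (HCModule.ofStable (X.vCyc_stable a p)) E) (hε : X.IsIterated a p ε)
    (n : ℕ) (h : p + a = n) :
    ∃ ε' : HCHom (HCModule.ofStable (X.total.cyc_stable p p n)) E, X.total.IsGraded p n ε' := by
  let j : HCHom (HCModule.ofStable (X.total.cyc_stable p p n)) (X.C n) :=
    (X.total.cyc_stable p p n).incl
  have hj : ∀ x, j.toLinearMap x ∈ X.F (p + 1) n ∧
      (X.d n).toLinearMap (j.toLinearMap x) ∈ X.F p (n + 1) :=
    (X.total.cyc_stable p p n).incl_mem
  have hjd : ∀ x a h, (X.Φ a p (n + 1) h).toLinearMap ((X.d n).toLinearMap (j.toLinearMap x)) = 0 :=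
    fun x a h => (X.mem_F.1 (hj x).2 a p h).1 le_rfl
  have hmem : ∀ x, ((X.Φ a p n h).comp j).toLinearMap x ∈ X.vCyc a p := by
    intro x
    refine ⟨(X.mem_F.1 (hj x).1 a p h).2 le_rfl, ?_⟩
    have := X.Φ_d_sub_mem h (j.toLinearMap x)
    rw [hjd, zero_sub] at this
    exact (Submodule.neg_mem_iff (X.vBd (a + 1) p)).1 this
  let f := (X.vCyc_stable a p).cod ((X.Φ a p n h).comp j) hmem
  refine ⟨ε.comp f, ?_, ?_⟩
  · intro e
    obtain ⟨y, rfl⟩ := hε.surjective e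
    obtain ⟨hy1, hy2⟩ := (X.vCyc_stable a p).incl_mem y
    obtain ⟨x, hx, hx1, hx2⟩ := X.exists_mem_F h _ (Nat.lt_succ_self p) (fun _ => hy1)
    have h1 := X.Φ_d_sub_mem h x
    have h2 : (X.Φ (a + 1) p (n + 1) (by omega)).toLinearMap ((X.d n).toLinearMap x)
        ∈ X.vBd (a + 1) p := by
      rw [hx1] at h1
      have := Submodule.add_mem _ h1 hy2
      rwa [sub_add_cancel] at this
    obtain ⟨z, hz, hz1, hz2⟩ := X.exists_of_mem_vBd (n := n) (by omega) h2
    have hxz : x - z ∈ X.F (p + 1) n := Submodule.sub_mem _ hx hz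
    have hd : (X.d n).toLinearMap (x - z) ∈ X.F p (n + 1) := by
      refine X.mem_F_of (X.d_mem_F _ _ _ hxz) (fun a' h' => ?_) (fun a' h' => ?_)
      · obtain rfl : a' = a + 1 := by omega
        rw [map_sub, map_sub, hz2, sub_self]
      · rw [X.d_d, map_zero]
    obtain ⟨t, ht⟩ := (X.total.cyc_stable p p n).exists_incl (v := x - z) ⟨hxz, hd⟩
    refine ⟨t, congrArg ε.toLinearMap ((X.vCyc_stable a p).incl_injective ?_)⟩
    change (X.Φ a p n h).toLinearMap ((X.total.cyc_stable p p n).incl.toLinearMap t) = _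
    rw [ht]
    rw [map_sub, hz1, sub_zero, hx1]
  · intro x
    rw [HCHom.comp_apply, hε.eq_zero_iff]
    change (X.Φ a p n h).toLinearMap (j.toLinearMap x) ∈ _ ↔ _
    constructor
    · intro hx
      obtain ⟨y, hy, z, hz, hyz⟩ := Submodule.mem_sup.1 hx
      obtain ⟨y', hy', hy1⟩ := X.exists_of_mem_hBd h hy
      have hz' : ∃ z' : X.C n, z' ∈ X.total.bd (p + 1) n ∧ (X.Φ a p n h).toLinearMap z' = z := by
        cases n with
        | zero =>
          obtain rfl : p = 0 := by omega
          have hz : z = 0 := hz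
          exact ⟨0, Submodule.zero_mem _, (map_zero _).trans hz.symm⟩
        | succ n =>
          obtain ⟨z', hz', -, hz1⟩ := X.exists_of_mem_vBd h hz
          exact ⟨_, ⟨z', hz', rfl⟩, hz1⟩
      obtain ⟨z', hz', hz1⟩ := hz'
      have hs := Submodule.add_mem _ hy' hz'
      refine ⟨y' + z', hs, X.mem_F_of ?_ (fun a' h' => ?_) (fun a' h' => ?_)⟩
      · exact Submodule.sub_mem _ (hj x).1 (X.total.bd_le _ _ hs)
      · obtain rfl : a' = a := by omega
        change (X.Φ a' p n h).toLinearMap (j.toLinearMap x - (y' + z')) = 0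
        rw [map_sub, map_add, hy1, hz1, hyz, sub_self]
      · change (X.Φ a' p (n + 1) h').toLinearMap ((X.d n).toLinearMap (j.toLinearMap x - (y' + z')))
          = 0
        have : (X.d n).toLinearMap (y' + z') = 0 := X.total.d_bd hs
        rw [map_sub, this, sub_zero, hjd]
    · rintro ⟨(y : X.C n), hy, (hxy : j.toLinearMap x - y ∈ X.F p n)⟩
      have h1 := (X.mem_F.1 hxy a p h).1 le_rfl
      rw [map_sub, sub_eq_zero] at h1
      rw [h1]
      exact X.Φ_bd h hy

/-- In total degrees below `p`, the graded piece of index `p` is acyclic. -/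
theorem isGraded_of_lt {p n : ℕ} (hn : n < p) {E : HCModule.{u} P} [Subsingleton E]
    (ε : HCHom (HCModule.ofStable (X.total.cyc_stable p p n)) E) : X.total.IsGraded p n ε where
  surjective e := ⟨0, Subsingleton.elim _ _⟩
  eq_zero_iff x := by
    refine ⟨fun _ => ⟨0, Submodule.zero_mem _, ?_⟩, fun _ => Subsingleton.elim _ _⟩
    rw [sub_zero]
    obtain ⟨h1, h2⟩ := (X.total.cyc_stable p p n).incl_mem x
    exact X.mem_F_of h1 (fun a h => by omega) (fun a h => (X.mem_F.1 h2 a p h).1 le_rfl)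

end DoubleComplex

end Double

/-! ### Iterated cohomology -/

section Iterated

variable {𝔪 N : Type*} {𝔩 : Type u} {M : Type*} [LieRing 𝔪]
  [LieAlgebra ℂ 𝔪] [Group N] [TopologicalSpace N] [IsTopologicalGroup N] [LieRing 𝔩]
  [LieAlgebra ℂ 𝔩] [FiniteDimensional ℂ 𝔩] [Group M] [TopologicalSpace M] [IsTopologicalGroup M]
  {P₂ : LiePair 𝔪 N} {P₁ : LiePair 𝔩 M}

theorem HCModule.subsingleton_alt {P : LiePair 𝔪 N} (n : ℕ) (U V : HCModule.{u} P)
    [FiniteDimensional ℂ U] (hn : Module.finrank ℂ U < n) :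
    Subsingleton (HCModule.alt n U V) := by
  have h0 : ∀ ω : U [⋀^Fin n]→ₗ[ℂ] V, ω = 0 := by
    intro ω
    ext v
    refine ω.map_linearDependent v fun hv => ?_
    have := hv.fintype_card_le_finrank
    simp at this
    omega
  exact ⟨fun a b => (h0 a).trans (h0 b).symm⟩

namespace CohDatum

variable (D : CohDatum P₂ P₁)

theorem subsingleton_cochain (n : ℕ) (hn : Module.finrank ℂ D.𝔲 < n) (V : HCModule.{u} P₁) :
    Subsingleton (D.cochain n V) :=
  HCModule.subsingleton_alt n D.nil _ hn

theorem subsingleton_cochain_of (n : ℕ) (V : HCModule.{u} P₁) [Subsingleton V] :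
    Subsingleton (D.cochain n V) :=
  ⟨fun (_ _ : D.𝔲 [⋀^Fin n]→ₗ[ℂ] V) => AlternatingMap.ext fun _ => Subsingleton.elim _ _⟩

/-- The class of a cocycle, as a homomorphism. -/
def classHom (n : ℕ) (V : HCModule.{u} P₁) :
    HCHom (HCModule.ofStable (HCModule.stable_ker (D.d n V))) (D.cohomology n V) where
  toLinearMap := D.classOf n V
  map_rep _ _ := rfl
  map_act _ _ := rfl

theorem classHom_surjective (n : ℕ) (V : HCModule.{u} P₁) :
    Function.Surjective (D.classHom n V).toLinearMap := D.classOf_surjective n V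

theorem classHom_eq_zero {n : ℕ} {V : HCModule.{u} P₁}
    {ω : HCModule.ofStable (HCModule.stable_ker (D.d n V))} :
    (D.classHom n V).toLinearMap ω = 0 ↔
      (HCModule.stable_ker (D.d n V)).incl.toLinearMap ω ∈ D.coboundary V n :=
  D.classOf_eq_zero

/-- The cochains with values in a subspace. -/
def cochainIn (n : ℕ) {V : HCModule.{u} P₁} (A : Submodule ℂ V) : Submodule ℂ (D.cochain n V) where
  carrier := {ω : D.𝔲 [⋀^Fin n]→ₗ[ℂ] V | ∀ v, ω v ∈ A}
  add_mem' h₁ h₂ v := A.add_mem (h₁ v) (h₂ v)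
  zero_mem' _ := A.zero_mem
  smul_mem' c _ h v := A.smul_mem c (h v)

theorem cochainIn_bot (n : ℕ) (V : HCModule.{u} P₁) : D.cochainIn n (⊥ : Submodule ℂ V) = ⊥ := by
  rw [eq_bot_iff]
  intro ω hω
  exact (Submodule.mem_bot ℂ).2 (AlternatingMap.ext fun v => (Submodule.mem_bot ℂ).1 (hω v))

theorem cochainIn_range (n : ℕ) {V W : HCModule.{u} P₁} (f : HCHom V W) :
    D.cochainIn n (LinearMap.range f.toLinearMap)
      = LinearMap.range (D.cochainMap n f).toLinearMap := by
  apply le_antisymm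
  · intro (ω : D.𝔲 [⋀^Fin n]→ₗ[ℂ] W) hω
    obtain ⟨s, hs⟩ := f.toLinearMap.rangeRestrict.exists_rightInverse_of_surjective
      f.toLinearMap.range_rangeRestrict
    refine ⟨s.compAlternatingMap (ω.codRestrict _ hω), AlternatingMap.ext fun v => ?_⟩
    exact congrArg Subtype.val (LinearMap.congr_fun hs ⟨ω v, hω v⟩)
  · rintro _ ⟨η, rfl⟩ v
    exact ⟨(show D.𝔲 [⋀^Fin n]→ₗ[ℂ] V from η) v, rfl⟩

theorem cochainIn_ker (n : ℕ) {V W : HCModule.{u} P₁} (f : HCHom V W) :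
    D.cochainIn n (LinearMap.ker f.toLinearMap)
      = LinearMap.ker (D.cochainMap n f).toLinearMap := by
  ext ω
  exact ⟨fun h => AlternatingMap.ext h, fun h v =>
    congrArg (fun η : D.𝔲 [⋀^Fin n]→ₗ[ℂ] W => η v) h⟩

theorem cochainMap_surjective (n : ℕ) {V W : HCModule.{u} P₁} (f : HCHom V W)
    (hf : Function.Surjective f.toLinearMap) :
    Function.Surjective (D.cochainMap n f).toLinearMap := by
  rw [← LinearMap.range_eq_top, ← cochainIn_range, LinearMap.range_eq_top.2 hf, eq_top_iff]
  exact fun _ _ _ => Submodule.mem_top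

/-- Factoring a homomorphism to cochains through the cochains with values in a kernel. -/
theorem exists_cod_ker (n : ℕ) {V W : HCModule.{u} P₁} (f : HCHom V W) {X : HCModule.{u} P₂}
    (c : HCHom X (D.cochain n V))
    (hc : ∀ x, (D.cochainMap n f).toLinearMap (c.toLinearMap x) = 0) :
    ∃ c' : HCHom X (D.cochain n f.ker), ∀ x,
      (D.cochainMap n f.kerι).toLinearMap (c'.toLinearMap x) = c.toLinearMap x := by
  obtain ⟨r, hr⟩ := D.exists_retraction f.shortExact_ker n
  have hi := D.cochainMap_injective f.shortExact_ker n
  have key : ∀ x, (D.cochainMap n f.kerι).toLinearMap ((r ∘ₗ c.toLinearMap) x)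
      = c.toLinearMap x := fun x => hr _ (by
    have h : c.toLinearMap x ∈ D.cochainIn n (LinearMap.ker f.toLinearMap) := by
      rw [cochainIn_ker]
      exact hc x
    exact AlternatingMap.ext fun v => Subtype.ext (h v))
  refine ⟨⟨r ∘ₗ c.toLinearMap, fun y x => hi ?_, fun k x => hi ?_⟩, key⟩
  · refine (key _).trans ((c.apply_rep y x).trans ?_)
    exact (congrArg _ (key x).symm).trans ((D.cochainMap n f.kerι).apply_rep y _).symm
  · refine (key _).trans ((c.apply_act k x).trans ?_)
    exact (congrArg _ (key x).symm).trans ((D.cochainMap n f.kerι).apply_act k _).symm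

/-- The coboundaries of the cochains with values in the kernel of `f`. -/
def kerBd {V W : HCModule.{u} P₁} (f : HCHom V W) : ∀ n, Submodule ℂ (D.cochain n V)
  | 0 => ⊥
  | n + 1 => (LinearMap.ker (D.cochainMap n f).toLinearMap).map (D.d n V).toLinearMap

/-- The cohomology of `H = ker f / A`, in terms of cochains with values in `V`. -/
theorem exists_cohomology_subquotient (n : ℕ) {V W H : HCModule.{u} P₁} (f : HCHom V W)
    (π : HCHom f.ker H) (hπ : Function.Surjective π.toLinearMap) (A : Submodule ℂ V)
    (hA : ∀ z, π.toLinearMap z = 0 ↔ f.kerι.toLinearMap z ∈ A)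
    {X : HCModule.{u} P₂} (c : HCHom X (D.cochain n V))
    (hc : LinearMap.range c.toLinearMap = LinearMap.ker (D.cochainMap n f).toLinearMap
      ⊓ (D.cochainIn (n + 1) A).comap (D.d n V).toLinearMap) :
    ∃ ε : HCHom X (D.cohomology n H), Function.Surjective ε.toLinearMap ∧
      ∀ x, ε.toLinearMap x = 0 ↔ c.toLinearMap x ∈ D.kerBd f n ⊔ D.cochainIn n A := by
  have hc1 : ∀ x, c.toLinearMap x ∈ LinearMap.ker (D.cochainMap n f).toLinearMap
      ⊓ (D.cochainIn (n + 1) A).comap (D.d n V).toLinearMap := fun x => by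
    rw [← hc]
    exact LinearMap.mem_range_self _ x
  obtain ⟨c', hc'⟩ := D.exists_cod_ker n f c (fun x => (hc1 x).1)
  have hπA : ∀ (m : ℕ) (z : D.cochain m f.ker), (D.cochainMap m π).toLinearMap z = 0 ↔
      (D.cochainMap m f.kerι).toLinearMap z ∈ D.cochainIn m A := by
    intro m z
    constructor
    · intro h v
      exact (hA _).1 (congrArg (fun η : D.𝔲 [⋀^Fin m]→ₗ[ℂ] H => η v) h)
    · intro h
      exact AlternatingMap.ext fun v => (hA _).2 (h v)
  have hd : ∀ x, (D.d n H).toLinearMap ((D.cochainMap n π).toLinearMap (c'.toLinearMap x)) = 0 := by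
    intro x
    rw [d_cochainMap, hπA, ← d_cochainMap, hc']
    exact (hc1 x).2
  have hlift : ∀ (m : ℕ) (ω : D.cochain m V), ω ∈ LinearMap.ker (D.cochainMap m f).toLinearMap →
      ∃ z : D.cochain m f.ker, (D.cochainMap m f.kerι).toLinearMap z = ω := by
    intro m ω hω
    obtain ⟨r, hr⟩ := D.exists_retraction f.shortExact_ker m
    refine ⟨r ω, hr ω ?_⟩
    rw [← cochainIn_ker] at hω
    exact AlternatingMap.ext fun v => Subtype.ext (hω v)
  have hker : ∀ (m : ℕ) (z : D.cochain m f.ker), (D.cochainMap m f.kerι).toLinearMap z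
      ∈ LinearMap.ker (D.cochainMap m f).toLinearMap := by
    intro m z
    rw [← cochainIn_ker]
    exact fun v => Subtype.property (p := (· ∈ LinearMap.ker f.toLinearMap)) _
  refine ⟨(D.classHom n H).comp ((HCModule.stable_ker (D.d n H)).cod
    ((D.cochainMap n π).comp c') hd), ?_, ?_⟩
  · intro e
    obtain ⟨y, rfl⟩ := D.classHom_surjective n H e
    obtain ⟨z, hz⟩ := D.cochainMap_surjective n π hπ
      ((HCModule.stable_ker (D.d n H)).incl.toLinearMap y)
    have hz' : (D.cochainMap n f.kerι).toLinearMap z ∈ LinearMap.range c.toLinearMap := by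
      rw [hc]
      refine ⟨hker n z, ?_⟩
      change (D.d n V).toLinearMap _ ∈ D.cochainIn (n + 1) A
      rw [d_cochainMap, ← hπA, ← d_cochainMap, hz]
      exact (HCModule.stable_ker (D.d n H)).incl_mem y
    obtain ⟨x, hx⟩ := hz'
    refine ⟨x, congrArg (D.classHom n H).toLinearMap
      ((HCModule.stable_ker (D.d n H)).incl_injective ?_)⟩
    change (D.cochainMap n π).toLinearMap (c'.toLinearMap x) = _
    rw [← hz]
    congr 1
    refine D.cochainMap_injective f.shortExact_ker n ?_
    rw [hc', hx]
  · intro x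
    rw [HCHom.comp_apply, classHom_eq_zero]
    change (D.cochainMap n π).toLinearMap (c'.toLinearMap x) ∈ _ ↔ _
    cases n with
    | zero =>
      rw [kerBd, bot_sup_eq, ← hc', ← hπA]
      rfl
    | succ n =>
      constructor
      · rintro ⟨y, hy⟩
        obtain ⟨z, rfl⟩ := D.cochainMap_surjective n π hπ y
        rw [d_cochainMap, ← sub_eq_zero, ← map_sub, hπA, map_sub, hc', ← d_cochainMap] at hy
        refine Submodule.mem_sup.2 ⟨_, ⟨_, hker n z, rfl⟩, _, Submodule.neg_mem _ hy, ?_⟩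
        abel
      · intro hx
        obtain ⟨_, ⟨y, hy, rfl⟩, w, hw, hyw⟩ := Submodule.mem_sup.1 hx
        obtain ⟨z, rfl⟩ := hlift n y hy
        refine ⟨(D.cochainMap n π).toLinearMap z, ?_⟩
        rw [d_cochainMap, ← sub_eq_zero, ← map_sub, hπA, map_sub, hc', ← d_cochainMap, ← hyw,
          sub_add_cancel_left]
        exact Submodule.neg_mem _ hw

end CohDatum

end Iterated

/-! ### The Hochschild–Serre relation -/

section Birestrict

variable {𝔤 K : Type*} [LieRing 𝔤] [LieAlgebra ℂ 𝔤] [Group K] [TopologicalSpace K]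
  [IsTopologicalGroup K] {P : LiePair 𝔤 K}

/-- The components of alternating maps, as homomorphisms of modules. -/
def HCModule.altBires {U A B : HCModule.{u} P} [FiniteDimensional ℂ U] [FiniteDimensional ℂ A]
    [FiniteDimensional ℂ B] (i : HCHom A U) (j : HCHom B U) {a b n : ℕ} (h : b + a = n)
    (X : HCModule.{u} P) :
    HCHom (HCModule.alt n U X) (HCModule.alt a A (HCModule.alt b B X)) where
  toFun := fun ω : U [⋀^Fin n]→ₗ[ℂ] X => bires i.toLinearMap j.toLinearMap h ω
  map_add' _ _ := rfl
  map_smul' _ _ := rfl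
  map_rep x := by
    intro (ω : U [⋀^Fin n]→ₗ[ℂ] X)
    refine AlternatingMap.ext fun v => AlternatingMap.ext fun w => ?_
    change X.rep x (bires i.toLinearMap j.toLinearMap h ω v w)
        - bires i.toLinearMap j.toLinearMap h (altDer (U.rep x) ω) v w
      = (X.rep x (bires i.toLinearMap j.toLinearMap h ω v w)
        - altDer (B.rep x) (bires i.toLinearMap j.toLinearMap h ω v) w)
        - altDer (A.rep x) (bires i.toLinearMap j.toLinearMap h ω) v w
    rw [bires_altDer i.toLinearMap j.toLinearMap h (fun y => (i.apply_rep x y).symm)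
      (fun y => (j.apply_rep x y).symm) ω v w, sub_sub, add_comm]
  map_act k := by
    intro (ω : U [⋀^Fin n]→ₗ[ℂ] X)
    refine AlternatingMap.ext fun v => AlternatingMap.ext fun w => ?_
    exact congrArg (X.act k) (bires_compLinearMap i.toLinearMap j.toLinearMap h
      (fun y => (i.apply_act k⁻¹ y).symm) (fun y => (j.apply_act k⁻¹ y).symm) ω v w)

end Birestrict

section Bijective

variable {U A B X : Type*} [AddCommGroup U] [Module ℂ U] [AddCommGroup A] [Module ℂ A]
  [AddCommGroup B] [Module ℂ B] [AddCommGroup X] [Module ℂ X] {i : A →ₗ[ℂ] U} {j : B →ₗ[ℂ] U}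

theorem eq_zero_of_bires_of_bijective (hij : Function.Bijective (i.coprod j)) {n : ℕ}
    (ω : U [⋀^Fin n]→ₗ[ℂ] X)
    (hω : ∀ (a b : ℕ) (h : b + a = n), bires i j h ω = 0) : ω = 0 := by
  refine eq_zero_of_bires i j (fun u => ?_) _ hω
  obtain ⟨⟨x, y⟩, h⟩ := hij.2 u
  exact ⟨x, y, h.symm⟩

theorem exists_bires_eq (hij : Function.Bijective (i.coprod j)) {a b n : ℕ} (h : b + a = n)
    (α : A [⋀^Fin a]→ₗ[ℂ] B [⋀^Fin b]→ₗ[ℂ] X) :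
    ∃ ω : U [⋀^Fin n]→ₗ[ℂ] X, bires i j h ω = α ∧
      ∀ (a' b' : ℕ) (h' : b' + a' = n), a' ≠ a → bires i j h' ω = 0 := by
  let e := LinearEquiv.ofBijective (i.coprod j) hij
  have hi : ∀ x, e.symm (i x) = (x, 0) := fun x => by
    rw [LinearEquiv.symm_apply_eq]
    simp [e]
  have hj : ∀ y, e.symm (j y) = (0, y) := fun y => by
    rw [LinearEquiv.symm_apply_eq]
    simp [e]
  obtain ⟨Ψ, hΨ⟩ := exists_bires_section (V := X) i j
    (LinearMap.fst ℂ A B ∘ₗ e.symm.toLinearMap) (LinearMap.snd ℂ A B ∘ₗ e.symm.toLinearMap)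
    (fun x => by simp [hi]) (fun y => by simp [hj]) (fun x => by simp [hi])
    (fun y => by simp [hj]) a b n h
  exact ⟨Ψ α, hΨ α⟩

end Bijective

section Tower

variable {𝔪 N : Type*} {𝔩 : Type u} {M : Type*} {𝔤 : Type u} {K : Type*} [LieRing 𝔪]
  [LieAlgebra ℂ 𝔪] [Group N] [TopologicalSpace N] [IsTopologicalGroup N] [LieRing 𝔩]
  [LieAlgebra ℂ 𝔩] [FiniteDimensional ℂ 𝔩] [Group M] [TopologicalSpace M] [IsTopologicalGroup M]
  [LieRing 𝔤] [LieAlgebra ℂ 𝔤] [FiniteDimensional ℂ 𝔤] [Group K] [TopologicalSpace K]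
  [IsTopologicalGroup K] {P₂ : LiePair 𝔪 N} {P₁ : LiePair 𝔩 M} {P : LiePair 𝔤 K}

namespace CohDatum

/-- The datum `D''` is the composition of the data `D` and `D'`: the nilpotent algebra of `D''` is
the semidirect product of those of `D'` and of `D`. -/
structure IsTower (D : CohDatum P₁ P) (D' : CohDatum P₂ P₁) (D'' : CohDatum P₂ P) : Prop where
  φ_eq : ∀ x, D''.φ x = D.φ (D'.φ x)
  ψ_eq : ∀ m, D''.ψ m = D.ψ (D'.ψ m)
  map_mem : ∀ x ∈ D'.𝔲, D.φ x ∈ D''.𝔲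
  le : ∀ y ∈ D.𝔲, y ∈ D''.𝔲
  exists_add : ∀ z ∈ D''.𝔲, ∃ x ∈ D'.𝔲, ∃ y ∈ D.𝔲, z = D.φ x + y
  disjoint : ∀ x ∈ D'.𝔲, D.φ x ∈ D.𝔲 → x = 0

variable {D : CohDatum P₁ P} {D' : CohDatum P₂ P₁} {D'' : CohDatum P₂ P}

variable (D D') in
/-- The action of the nilpotent algebra of `D'` on that of `D`. -/
def nilAd : D'.𝔲 →ₗ[ℂ] Module.End ℂ D.𝔲 where
  toFun x := D.adRep x
  map_add' _ _ := map_add D.adRep _ _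
  map_smul' _ _ := map_smul D.adRep _ _

instance : FiniteDimensional ℂ (D'.restrict D.nil) :=
  inferInstanceAs (FiniteDimensional ℂ D.𝔲)

namespace IsTower

variable (T : IsTower D D' D'')

/-- The inclusion of the nilpotent algebra of `D'` in that of `D''`. -/
def inlMap : D'.𝔲 →ₗ[ℂ] D''.𝔲 where
  toFun x := ⟨D.φ x, T.map_mem x x.2⟩
  map_add' _ _ := Subtype.ext (map_add D.φ _ _)
  map_smul' _ _ := Subtype.ext (map_smul D.φ _ _)

/-- The inclusion of the nilpotent algebra of `D` in that of `D''`. -/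
def inrMap : D.𝔲 →ₗ[ℂ] D''.𝔲 where
  toFun x := ⟨x, T.le x x.2⟩
  map_add' _ _ := rfl
  map_smul' _ _ := rfl

theorem inlMap_lie (x y : D'.𝔲) : T.inlMap ⁅x, y⁆ = ⁅T.inlMap x, T.inlMap y⁆ :=
  Subtype.ext (LieHom.map_lie D.φ _ _)

theorem inrMap_lie (x y : D.𝔲) : T.inrMap ⁅x, y⁆ = ⁅T.inrMap x, T.inrMap y⁆ := rfl

theorem inrMap_nilAd (x : D'.𝔲) (y : D.𝔲) :
    T.inrMap (D.nilAd D' x y) = ⁅T.inlMap x, T.inrMap y⁆ :=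
  Subtype.ext rfl

/-- The inclusion of the nilpotent algebra of `D'`, as a homomorphism of modules. -/
def inl : HCHom D'.nil D''.nil where
  toLinearMap := T.inlMap
  map_rep x y := Subtype.ext ((LieHom.map_lie D.φ _ _).trans (by rw [← T.φ_eq]; rfl))
  map_act m y := Subtype.ext ((D.φ_Ad _ _).trans (by rw [← T.ψ_eq]; rfl))

/-- The inclusion of the nilpotent algebra of `D`, as a homomorphism of modules. -/
def inr : HCHom (D'.restrict D.nil) D''.nil where
  toLinearMap := T.inrMap
  map_rep x y := Subtype.ext (by
    change ⁅D.φ (D'.φ x), _⁆ = ⁅D''.φ x, _⁆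
    rw [← T.φ_eq]
    rfl)
  map_act m y := Subtype.ext (by
    change P.Ad (D.ψ (D'.ψ m)) _ = P.Ad (D''.ψ m) _
    rw [← T.ψ_eq]
    rfl)

theorem bijective : Function.Bijective (T.inlMap.coprod T.inrMap) := by
  constructor
  · rw [injective_iff_map_eq_zero]
    rintro ⟨x, y⟩ h
    have h1 : D.φ x + (y : 𝔤) = 0 := congrArg Subtype.val h
    have hx : x = 0 := Subtype.ext (T.disjoint _ x.2 (by
      rw [eq_neg_of_add_eq_zero_left h1]
      exact D.𝔲.neg_mem y.2))
    subst hx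
    have hy : y = 0 := Subtype.ext (by simpa using h1)
    rw [hy]
    rfl
  · rintro ⟨z, hz⟩
    obtain ⟨x, hx, y, hy, h⟩ := T.exists_add z hz
    exact ⟨(⟨x, hx⟩, ⟨y, hy⟩), Subtype.ext h.symm⟩

/-- The restriction of an iterated cochain module. -/
def iteratedId (a b : ℕ) (V : HCModule.{u} P) :
    HCHom (HCModule.alt a D'.nil (HCModule.alt b (D'.restrict D.nil) (D''.restrict V)))
      (D'.cochain a (D.cochain b V)) where
  toLinearMap := LinearMap.id
  map_rep x ω := by
    have h : D''.φ x = D.φ (D'.φ x) := T.φ_eq x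
    change altRep a D'.nil.rep (altRep b (D'.restrict D.nil).rep (D''.restrict V).rep) x ω
      = altRep a D'.nil.rep (D'.restrict (D.cochain b V)).rep x ω
    have : altRep b (D'.restrict D.nil).rep (D''.restrict V).rep x
        = (D'.restrict (D.cochain b V)).rep x := by
      refine LinearMap.ext fun (η : D.𝔲 [⋀^Fin b]→ₗ[ℂ] V) => AlternatingMap.ext fun v => ?_
      change V.rep (D''.φ x) (η v) - _ = V.rep (D.φ (D'.φ x)) (η v) - _
      rw [h]
      rfl
    change (altRep b (D'.restrict D.nil).rep (D''.restrict V).rep x).compAlternatingMap _ - _ = _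
    rw [this]
    rfl
  map_act m ω := by
    have h : D''.ψ m = D.ψ (D'.ψ m) := T.ψ_eq m
    refine AlternatingMap.ext fun v => AlternatingMap.ext fun w => ?_
    change V.act (D''.ψ m) _ = V.act (D.ψ (D'.ψ m)) _
    rw [h, ← map_inv D'.ψ.toMonoidHom m]
    rfl

/-- The components of the cochains of the large nilpotent algebra. -/
def component (a b n : ℕ) (h : b + a = n) (V : HCModule.{u} P) :
    HCHom (D''.cochain n V) (D'.cochain a (D.cochain b V)) :=
  (T.iteratedId a b V).comp (HCModule.altBires T.inl T.inr h (D''.restrict V))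

theorem bires_d {n : ℕ} (V : HCModule.{u} P) (ω : D''.𝔲 [⋀^Fin n]→ₗ[ℂ] V) (a b : ℕ)
    (h : b + a = n + 1) :
    bires T.inlMap T.inrMap h (ceD (D''.nilRep V) n ω)
      = horizontal T.inlMap T.inrMap (D.nilAd D') (D''.nilRep V) ω a b h
        + (-1 : ℤ) ^ a • vertical T.inlMap T.inrMap (D''.nilRep V) ω a b h := by
  have := bires_ceD (D''.nilRep V) T.inlMap_lie T.inrMap_lie T.inrMap_nilAd ω a b h
  exact this

theorem component_d_zero (b n : ℕ) (h : b = n) (h' : b + 1 + 0 = n + 1) (V : HCModule.{u} P)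
    (ω : D''.cochain n V) :
    (T.component 0 (b + 1) (n + 1) h' V).toLinearMap ((D''.d n V).toLinearMap ω)
      = (D'.cochainMap 0 (D.d b V)).toLinearMap ((T.component 0 b n h V).toLinearMap ω) := by
  refine (T.bires_d V ω 0 (b + 1) h').trans ?_
  rw [pow_zero, one_smul]
  exact zero_add _

theorem component_d_succ_zero (a n : ℕ) (h : 0 + a = n) (h' : 0 + (a + 1) = n + 1)
    (V : HCModule.{u} P) (ω : D''.cochain n V) :
    (T.component (a + 1) 0 (n + 1) h' V).toLinearMap ((D''.d n V).toLinearMap ω)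
      = (D'.d a (D.cochain 0 V)).toLinearMap ((T.component a 0 n h V).toLinearMap ω) := by
  refine (T.bires_d V ω (a + 1) 0 h').trans ?_
  exact (congrArg _ (smul_zero _)).trans (add_zero _)

theorem component_d_succ_succ (a b n : ℕ) (h₁ : b + 1 + a = n) (h₂ : b + (a + 1) = n)
    (h' : b + 1 + (a + 1) = n + 1) (V : HCModule.{u} P) (ω : D''.cochain n V) :
    (T.component (a + 1) (b + 1) (n + 1) h' V).toLinearMap ((D''.d n V).toLinearMap ω)
      = (D'.d a (D.cochain (b + 1) V)).toLinearMap ((T.component a (b + 1) n h₁ V).toLinearMap ω)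
        + (-1 : ℤ) ^ (a + 1) • (D'.cochainMap (a + 1) (D.d b V)).toLinearMap
          ((T.component (a + 1) b n h₂ V).toLinearMap ω) :=
  T.bires_d V ω (a + 1) (b + 1) h'

theorem eq_zero_of_component {n : ℕ} (V : HCModule.{u} P) (ω : D''.cochain n V)
    (hω : ∀ a b h, (T.component a b n h V).toLinearMap ω = 0) : ω = 0 :=
  eq_zero_of_bires_of_bijective (X := V) T.bijective ω hω

theorem exists_component_eq {n : ℕ} (a b : ℕ) (h : b + a = n) (V : HCModule.{u} P)
    (α : D'.cochain a (D.cochain b V)) :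
    ∃ ω : D''.cochain n V, (T.component a b n h V).toLinearMap ω = α ∧
      ∀ a' b' h', b' ≠ b → (T.component a' b' n h' V).toLinearMap ω = 0 := by
  obtain ⟨ω, h1, h2⟩ := exists_bires_eq (X := V) T.bijective h α
  exact ⟨ω, h1, fun a' b' h' hb => h2 a' b' h' (by omega)⟩

/-- The Hochschild–Serre double complex. -/
def doubleComplex (V : HCModule.{u} P) : DoubleComplex.{u} P₂ where
  K a b := D'.cochain a (D.cochain b V)
  dh a b := D'.d a (D.cochain b V)
  dv a b := D'.cochainMap a (D.d b V)
  dv_dv a b x := AlternatingMap.ext fun v => D.d_d b V _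
  dv_dh a b x := (D'.d_cochainMap a (D.d b V) x).symm
  C n := D''.cochain n V
  d n := D''.d n V
  d_d n := D''.d_d n V
  Φ a b n h := T.component a b n h V
  eq_zero _ x hx := T.eq_zero_of_component V x hx
  exists_section a b _ h y := T.exists_component_eq a b h V y
  Φ_d_zero b n h h' x := T.component_d_zero b n h h' V x
  Φ_d_succ_zero a n h h' x := T.component_d_succ_zero a n h h' V x
  Φ_d_succ_succ a b n h₁ h₂ h' x := T.component_d_succ_succ a b n h₁ h₂ h' V x
  N := Module.finrank ℂ D.𝔲 + 1
  subsingleton a b hb := by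
    have := D.subsingleton_cochain b (by omega) V
    exact D'.subsingleton_cochain_of a _

end IsTower
end CohDatum
end Tower

/-! ### Transitivity of Euler characteristics -/

section TowerEuler

variable {𝔪 N : Type*} {𝔩 : Type u} {M : Type*} {𝔤 : Type u} {K : Type*} [LieRing 𝔪]
  [LieAlgebra ℂ 𝔪] [Group N] [TopologicalSpace N] [IsTopologicalGroup N] [LieRing 𝔩]
  [LieAlgebra ℂ 𝔩] [FiniteDimensional ℂ 𝔩] [Group M] [TopologicalSpace M] [IsTopologicalGroup M]
  [LieRing 𝔤] [LieAlgebra ℂ 𝔤] [FiniteDimensional ℂ 𝔤] [Group K] [TopologicalSpace K]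
  [IsTopologicalGroup K] {P₂ : LiePair 𝔪 N} {P₁ : LiePair 𝔩 M} {P : LiePair 𝔤 K}

namespace CohDatum

variable {D : CohDatum P₁ P} {D' : CohDatum P₂ P₁} {D'' : CohDatum P₂ P}

/-- The projection of the cocycles to the cohomology. -/
def cocycleProj (D : CohDatum P₁ P) (n : ℕ) (V : HCModule.{u} P) :
    HCHom (D.d n V).ker (D.cohomology n V) where
  toLinearMap := D.classOf n V
  map_rep _ _ := rfl
  map_act _ _ := rfl

namespace IsTower

variable (T : IsTower D D' D'')

theorem vBd_eq (V : HCModule.{u} P) (a b : ℕ) :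
    (T.doubleComplex V).vBd a b = D'.cochainIn a (D.coboundary V b) := by
  cases b with
  | zero => exact (D'.cochainIn_bot a (D.cochain 0 V)).symm
  | succ b => exact (D'.cochainIn_range a (D.d b V)).symm

theorem hBd_eq (V : HCModule.{u} P) (a b : ℕ) :
    (T.doubleComplex V).hBd a b = D'.kerBd (D.d b V) a := by
  cases a with
  | zero => rfl
  | succ a => rfl

/-- The second page of the Hochschild–Serre spectral sequence. -/
theorem exists_isIterated (V : HCModule.{u} P) (a b : ℕ) :
    ∃ ε : HCHom (HCModule.ofStable ((T.doubleComplex V).vCyc_stable a b))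
      (D'.cohomology a (D.cohomology b V)), (T.doubleComplex V).IsIterated a b ε := by
  obtain ⟨ε, h1, h2⟩ := D'.exists_cohomology_subquotient a (D.d b V) (D.cocycleProj b V)
    (D.classOf_surjective b V) (D.coboundary V b) (fun z => D.classOf_eq_zero)
    (((T.doubleComplex V).vCyc_stable a b).incl)
    ((HCModule.Stable.range_incl _).trans (congrArg
      (fun B : Submodule ℂ (D'.cochain (a + 1) (D.cochain b V)) =>
        LinearMap.ker (D'.cochainMap a (D.d b V)).toLinearMap
          ⊓ B.comap (D'.d a (D.cochain b V)).toLinearMap) (T.vBd_eq V (a + 1) b)))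
  refine ⟨ε, h1, fun x => ?_⟩
  rw [T.vBd_eq, T.hBd_eq]
  exact h2 x

end IsTower
end CohDatum

/-- Reindexing of the total complex of a double complex by columns. -/
theorem sum_total_eq {A : Type*} [AddCommGroup A] (E : ℕ → ℕ → A) (R N R' : ℕ)
    (hR : N + R' ≤ R) (hE : ∀ a p, R' < a → E a p = 0) :
    ∑ n ∈ Finset.range R, (-1 : ℤ) ^ n • ∑ p ∈ Finset.range N, (if p ≤ n then E (n - p) p else 0)
      = ∑ p ∈ Finset.range N, (-1 : ℤ) ^ p • ∑ a ∈ Finset.range (R' + 1), (-1 : ℤ) ^ a • E a p := by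
  simp only [Finset.smul_sum]
  rw [Finset.sum_comm]
  refine Finset.sum_congr rfl fun p hp => ?_
  have hp := Finset.mem_range.1 hp
  obtain ⟨k, rfl⟩ : ∃ k, R = p + (R' + 1 + k) := ⟨R - p - R' - 1, by omega⟩
  rw [Finset.sum_range_add _ p, Finset.sum_eq_zero fun n hn => by
    rw [if_neg (by have := Finset.mem_range.1 hn; omega), smul_zero], zero_add,
    Finset.sum_range_add, Finset.sum_eq_zero (s := Finset.range k) fun n _ => by
      rw [if_pos (by omega), hE _ _ (by omega), smul_zero], add_zero]
  refine Finset.sum_congr rfl fun a _ => ?_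
  rw [if_pos (by omega), Nat.add_sub_cancel_left, pow_add, mul_smul]

variable {D : CohDatum P₁ P} {D' : CohDatum P₂ P₁} {D'' : CohDatum P₂ P}
  {catG : HCModule.{u} P → Prop} {catL : HCModule.{u} P₁ → Prop} {catM : HCModule.{u} P₂ → Prop}

theorem IsAdmissiblePair.euler_cls (h : IsAdmissiblePair D'' catG catM) (V : HCModule.{u} P)
    (hV : catG V) : h.euler (GrothendieckGroup.cls V hV)
      = ∑ n ∈ Finset.range (Module.finrank ℂ D''.𝔲 + 1), (-1 : ℤ) ^ n •
        GrothendieckGroup.cls (D''.cohomology n V) (h.cohomology_mem n V hV) :=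
  GrothendieckGroup.lift_cls _ h.euler_additive V hV

theorem IsAdmissiblePair.euler_cls_of_lt (h : IsAdmissiblePair D'' catG catM) (V : HCModule.{u} P)
    (hV : catG V) {R : ℕ} (hR : Module.finrank ℂ D''.𝔲 + 1 ≤ R) :
    h.euler (GrothendieckGroup.cls V hV) = ∑ n ∈ Finset.range R, (-1 : ℤ) ^ n •
        GrothendieckGroup.cls (D''.cohomology n V) (h.cohomology_mem n V hV) := by
  rw [h.euler_cls]
  refine Finset.sum_subset (Finset.range_mono hR) fun n _ hn => ?_
  have := D''.subsingleton_cohomology n (by simpa using hn) V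
  rw [GrothendieckGroup.cls_eq_zero, smul_zero]

/-- The Euler characteristic form of the Hochschild–Serre spectral sequence. -/
theorem CohDatum.IsTower.euler_euler (T : CohDatum.IsTower D D' D'')
    (h : IsAdmissiblePair D catG catL)
    (h' : IsAdmissiblePair D' catL catM) (h'' : IsAdmissiblePair D'' catG catM)
    (x : GrothendieckGroup catG) : h''.euler x = h'.euler (h.euler x) := by
  suffices key : h''.euler = h'.euler.comp h.euler from DFunLike.congr_fun key x
  refine GrothendieckGroup.hom_ext fun V hV => ?_
  let X := T.doubleComplex V
  let R := Module.finrank ℂ D.𝔲 + 1 + Module.finrank ℂ D'.𝔲 + Module.finrank ℂ D''.𝔲 + 1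
  have hE : ∀ a p, catM (D'.cohomology a (D.cohomology p V)) := fun a p =>
    h'.cohomology_mem a _ (h.cohomology_mem p V hV)
  have h1 := X.total.sum_cls_cohomology h'.abelian_right (fun n => D''.cohomology n V)
    (fun n => h''.cohomology_mem n V hV) (fun n => D''.classHom n V)
    (fun n => ⟨D''.classHom_surjective n V, fun x => by
      have : D''.coboundary V n = X.total.bd X.total.N n := by
        cases n with
        | zero => rfl
        | succ n =>
          rw [FilteredComplex.bd, X.total.top, Submodule.map_top]
          rfl
      rw [← this]
      exact D''.classOf_eq_zero⟩)
    (fun p n => if p ≤ n then GrothendieckGroup.cls _ (hE (n - p) p) else 0)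
    (fun p n => by
      by_cases hpn : p ≤ n
      · obtain ⟨ε, hε⟩ := T.exists_isIterated V (n - p) p
        obtain ⟨ε', hε'⟩ := X.exists_isGraded ε hε n (by omega)
        exact ⟨_, hE (n - p) p, ε', hε', by rw [if_pos hpn]⟩
      · let Z := HCModule.ofStable ((X.total.C n).stable_bot)
        have hZ : Subsingleton Z := ⟨fun a b => (HCModule.stable_bot _).incl_injective
          (((Submodule.mem_bot ℂ).1 ((HCModule.stable_bot _).incl_mem a)).trans
            ((Submodule.mem_bot ℂ).1 ((HCModule.stable_bot _).incl_mem b)).symm)⟩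
        refine ⟨Z, h'.abelian_right.zero Z hZ, ⟨0, fun x v => ?_, fun k v => ?_⟩,
          X.isGraded_of_lt (by omega) _, ?_⟩
        · exact Subsingleton.elim _ _
        · exact Subsingleton.elim _ _
        · rw [if_neg hpn]
          exact GrothendieckGroup.cls_eq_zero Z _)
    R (D''.subsingleton_cochain R (by omega) V)
  rw [AddMonoidHom.comp_apply, h''.euler_cls_of_lt V hV (R := R) (by omega), h1, h.euler_cls,
    map_sum]
  refine (sum_total_eq (fun a p => GrothendieckGroup.cls _ (hE a p)) R _
    (Module.finrank ℂ D'.𝔲) ?_ ?_).trans ?_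
  · change Module.finrank ℂ D.𝔲 + 1 + Module.finrank ℂ D'.𝔲 ≤ R
    omega
  · intro a p ha
    have := D'.subsingleton_cohomology a ha (D.cohomology p V)
    exact GrothendieckGroup.cls_eq_zero _ _
  · refine Finset.sum_congr rfl fun p _ => ?_
    rw [map_zsmul, h'.euler_cls]

end TowerEuler

/-! ### Weyl denominators of direct sums -/

section WeylSum

variable {𝔤 K : Type*} [LieRing 𝔤] [LieAlgebra ℂ 𝔤] [Group K] [TopologicalSpace K]
  [IsTopologicalGroup K] {P : LiePair 𝔤 K} {S : HCModule.{u} P → Prop}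

/-- The zero homomorphism. -/
def HCHom.zero (V W : HCModule.{u} P) : HCHom V W where
  toLinearMap := 0
  map_rep x _ := (map_zero (W.rep x)).symm
  map_act k _ := (map_zero (W.act k)).symm

/-- The difference of two homomorphisms. -/
def HCHom.sub {V W : HCModule.{u} P} (f g : HCHom V W) : HCHom V W where
  toLinearMap := f.toLinearMap - g.toLinearMap
  map_rep x v := by
    change f.toLinearMap _ - g.toLinearMap _ = W.rep x (f.toLinearMap v - g.toLinearMap v)
    rw [f.apply_rep, g.apply_rep, map_sub]
  map_act k v := by
    change f.toLinearMap _ - g.toLinearMap _ = W.act k (f.toLinearMap v - g.toLinearMap v)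
    rw [f.apply_act, g.apply_act, map_sub]

/-- The pullback of alternating maps. -/
def HCModule.altPullback (n : ℕ) {U B : HCModule.{u} P} [FiniteDimensional ℂ U]
    [FiniteDimensional ℂ B] (f : HCHom B U) (X : HCModule.{u} P) :
    HCHom (HCModule.alt n U X) (HCModule.alt n B X) where
  toFun := fun ω : U [⋀^Fin n]→ₗ[ℂ] X => ω.compLinearMap f.toLinearMap
  map_add' _ _ := rfl
  map_smul' _ _ := rfl
  map_rep x := by
    intro (ω : U [⋀^Fin n]→ₗ[ℂ] X)
    refine AlternatingMap.ext fun v => ?_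
    change X.rep x (ω (f.toLinearMap ∘ v)) - altDer (U.rep x) ω (f.toLinearMap ∘ v)
      = X.rep x (ω (f.toLinearMap ∘ v)) - altDer (B.rep x) (ω.compLinearMap f.toLinearMap) v
    rw [altDer_apply, altDer_apply]
    congr 1
    refine Finset.sum_congr rfl fun k _ => ?_
    rw [AlternatingMap.compLinearMap_apply]
    congr 1
    change _ = f.toLinearMap ∘ Function.update v k _
    rw [Function.comp_update, f.apply_rep]
    rfl
  map_act k := by
    intro (ω : U [⋀^Fin n]→ₗ[ℂ] X)
    refine AlternatingMap.ext fun v => ?_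
    change X.act k (ω _) = X.act k (ω _)
    congr 2
    funext l
    exact (f.apply_act k⁻¹ (v l)).symm

/-- If `B` is a direct summand of `U` and `⋀ⁿ U* ⊗ X` belongs to `S`, so does `⋀ⁿ B* ⊗ X`. -/
theorem alt_mem_of_retract (hS : IsAbelianSubcategory S) (n : ℕ) {U B : HCModule.{u} P}
    [FiniteDimensional ℂ U] [FiniteDimensional ℂ B] (j : HCHom B U) (r : HCHom U B)
    (hr : ∀ y, r.toLinearMap (j.toLinearMap y) = y) {X : HCModule.{u} P}
    (hX : S (HCModule.alt n U X)) : S (HCModule.alt n B X) := by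
  have h1 : ∀ ω, (HCModule.altPullback n j X).toLinearMap
      ((HCModule.altPullback n r X).toLinearMap ω) = ω := by
    intro (ω : B [⋀^Fin n]→ₗ[ℂ] X)
    refine AlternatingMap.ext fun v => ?_
    change ω _ = ω v
    congr 1
    funext l
    exact hr (v l)
  refine hS.kernel ((HCHom.id _).sub ((HCModule.altPullback n r X).comp
    (HCModule.altPullback n j X))) (HCModule.altPullback n r X)
    (Function.LeftInverse.injective h1) (fun ω => ?_) hX hX
  change ω - (HCModule.altPullback n r X).toLinearMap
    ((HCModule.altPullback n j X).toLinearMap ω) = 0 ↔ _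
  constructor
  · intro h
    exact ⟨_, (sub_eq_zero.1 h).symm⟩
  · rintro ⟨η, rfl⟩
    rw [h1, sub_self]

theorem exists_retraction_of_bijective {U A B : HCModule.{u} P} (i : HCHom A U) (j : HCHom B U)
    (hij : Function.Bijective (i.toLinearMap.coprod j.toLinearMap)) :
    ∃ r : HCHom U B, ∀ y, r.toLinearMap (j.toLinearMap y) = y := by
  let e := LinearEquiv.ofBijective (i.toLinearMap.coprod j.toLinearMap) hij
  let r : U →ₗ[ℂ] B := LinearMap.snd ℂ A B ∘ₗ e.symm.toLinearMap
  have hr : ∀ x y, r (i.toLinearMap x + j.toLinearMap y) = y := by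
    intro x y
    have : e (x, y) = i.toLinearMap x + j.toLinearMap y := rfl
    rw [← this]
    simp [r]
  have hj : ∀ y, r (j.toLinearMap y) = y := fun y => by simpa using hr 0 y
  have hs : ∀ u, ∃ x y, u = i.toLinearMap x + j.toLinearMap y := fun u => by
    obtain ⟨⟨x, y⟩, h⟩ := hij.2 u
    exact ⟨x, y, h.symm⟩
  refine ⟨⟨r, fun z u => ?_, fun k u => ?_⟩, hj⟩
  · obtain ⟨x, y, rfl⟩ := hs u
    change r (U.rep z _) = B.rep z (r _)
    rw [map_add, ← i.apply_rep, ← j.apply_rep, hr, hr]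
  · obtain ⟨x, y, rfl⟩ := hs u
    change r (U.act k _) = B.act k (r _)
    rw [map_add, ← i.apply_act, ← j.apply_act, hr, hr]

theorem weylMul_cls_of_le (U : HCModule.{u} P) [FiniteDimensional ℂ U]
    (h : ∀ n V, S V → S (HCModule.alt n U V)) (V : HCModule.{u} P) (hV : S V) {R : ℕ}
    (hR : Module.finrank ℂ U + 1 ≤ R) :
    weylMul U h (GrothendieckGroup.cls V hV)
      = ∑ n ∈ Finset.range R,
        (-1 : ℤ) ^ n • GrothendieckGroup.cls (HCModule.alt n U V) (h n V hV) := by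
  rw [weylMul_cls]
  refine Finset.sum_subset (Finset.range_mono hR) fun n _ hn => ?_
  have := HCModule.subsingleton_alt n U V (by simpa using hn)
  rw [GrothendieckGroup.cls_eq_zero, smul_zero]

/-- `[⋀ⁿ (A ⊕ B)* ⊗ X]` is the sum of the classes `[⋀ⁿ⁻ᵖ A* ⊗ ⋀ᵖ B* ⊗ X]`. -/
theorem cls_alt_eq_sum (hS : IsAbelianSubcategory S) {U A B : HCModule.{u} P}
    [FiniteDimensional ℂ U] [FiniteDimensional ℂ A] [FiniteDimensional ℂ B] (i : HCHom A U)
    (j : HCHom B U) (hij : Function.Bijective (i.toLinearMap.coprod j.toLinearMap)) (n : ℕ)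
    (X : HCModule.{u} P) (hX : S (HCModule.alt n U X))
    (hY : ∀ a b, S (HCModule.alt a A (HCModule.alt b B X))) :
    GrothendieckGroup.cls _ hX
      = ∑ p ∈ Finset.range (n + 1), GrothendieckGroup.cls _ (hY (n - p) p) := by
  refine cls_eq_sum hS hX (n + 1) _ (fun p => hY (n - p) p) (fun p =>
    if h : p ≤ n then HCModule.altBires i j (Nat.add_sub_cancel' h) X else HCHom.zero _ _) ?_ ?_
  · intro ω hω
    refine eq_zero_of_bires_of_bijective (X := X) hij ω fun a b h => ?_
    obtain rfl : a = n - b := by omega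
    have := hω b (by omega)
    rw [dif_pos (by omega)] at this
    exact this
  · intro p hp α
    obtain ⟨ω, h1, h2⟩ := exists_bires_eq (X := X) hij
      (Nat.add_sub_cancel' (Nat.lt_succ_iff.1 hp)) α
    refine ⟨ω, ?_, fun q hq hqp => ?_⟩
    · rw [dif_pos (Nat.lt_succ_iff.1 hp)]
      exact h1
    · rw [dif_pos (Nat.lt_succ_iff.1 hq)]
      exact h2 _ _ _ (by omega)

/-- The Weyl denominator of a direct sum is the product of the Weyl denominators. -/
theorem weylMul_of_bijective (hS : IsAbelianSubcategory S) {U A B : HCModule.{u} P}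
    [FiniteDimensional ℂ U] [FiniteDimensional ℂ A] [FiniteDimensional ℂ B] (i : HCHom A U)
    (j : HCHom B U) (hij : Function.Bijective (i.toLinearMap.coprod j.toLinearMap))
    (hU : ∀ n V, S V → S (HCModule.alt n U V)) (hA : ∀ n V, S V → S (HCModule.alt n A V))
    (hB : ∀ n V, S V → S (HCModule.alt n B V)) (x : GrothendieckGroup S) :
    weylMul U hU x = weylMul A hA (weylMul B hB x) := by
  suffices key : weylMul U hU = (weylMul A hA).comp (weylMul B hB) from DFunLike.congr_fun key x
  refine GrothendieckGroup.hom_ext fun X hX => ?_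
  let N := Module.finrank ℂ B + 1
  -- beyond the degree `R`, all summands vanish
  let R := Module.finrank ℂ B + 1 + Module.finrank ℂ A + (Module.finrank ℂ U + 1)
  have hE : ∀ a b, S (HCModule.alt a A (HCModule.alt b B X)) := fun a b => hA a _ (hB b X hX)
  have h0 : ∀ a b, Module.finrank ℂ B < b → GrothendieckGroup.cls _ (hE a b) = 0 := by
    intro a b hb
    have := HCModule.subsingleton_alt b B X hb
    have : Subsingleton (HCModule.alt a A (HCModule.alt b B X)) :=
      ⟨fun (α β : A [⋀^Fin a]→ₗ[ℂ] (HCModule.alt b B X)) =>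
        AlternatingMap.ext fun v => Subsingleton.elim (α v) (β v)⟩
    exact GrothendieckGroup.cls_eq_zero _ _
  have hn : ∀ n, GrothendieckGroup.cls _ (hU n X hX) = ∑ p ∈ Finset.range N,
      (if p ≤ n then GrothendieckGroup.cls _ (hE (n - p) p) else 0) := by
    intro n
    rw [cls_alt_eq_sum hS i j hij n X (hU n X hX) hE, ← Finset.sum_filter]
    refine (Finset.sum_subset (fun p hp => ?_) fun p hp hp' => ?_).symm
    · have := (Finset.mem_filter.1 hp).2
      exact Finset.mem_range.2 (by omega)
    · refine h0 _ _ ?_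
      have := Finset.mem_range.1 hp
      simp only [Finset.mem_filter, Finset.mem_range, not_and, N] at hp'
      by_contra hlt
      exact hp' (by omega) (by omega)
  rw [AddMonoidHom.comp_apply, weylMul_cls_of_le U hU X hX (R := R) (by omega), weylMul_cls B,
    map_sum, Finset.sum_congr rfl fun n _ => congrArg ((-1 : ℤ) ^ n • ·) (hn n)]
  refine (sum_total_eq (fun a p => GrothendieckGroup.cls _ (hE a p)) R N
    (Module.finrank ℂ A) (by omega) ?_).trans ?_
  · intro a p ha
    have := HCModule.subsingleton_alt a A (HCModule.alt p B X) ha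
    exact GrothendieckGroup.cls_eq_zero _ _
  · refine Finset.sum_congr rfl fun p _ => ?_
    rw [map_zsmul, weylMul_cls]

end WeylSum

section TowerWeyl

variable {𝔪 N : Type*} {𝔩 : Type u} {M : Type*} {𝔤 : Type u} {K : Type*} [LieRing 𝔪]
  [LieAlgebra ℂ 𝔪] [Group N] [TopologicalSpace N] [IsTopologicalGroup N] [LieRing 𝔩]
  [LieAlgebra ℂ 𝔩] [FiniteDimensional ℂ 𝔩] [Group M] [TopologicalSpace M] [IsTopologicalGroup M]
  [LieRing 𝔤] [LieAlgebra ℂ 𝔤] [FiniteDimensional ℂ 𝔤] [Group K] [TopologicalSpace K]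
  [IsTopologicalGroup K] {P₂ : LiePair 𝔪 N} {P₁ : LiePair 𝔩 M} {P : LiePair 𝔤 K}
  {D : CohDatum P₁ P} {D' : CohDatum P₂ P₁} {D'' : CohDatum P₂ P}
  {catG : HCModule.{u} P → Prop} {catL : HCModule.{u} P₁ → Prop} {catM : HCModule.{u} P₂ → Prop}

/-- The category `ℳ` is closed under tensor products with the restrictions of the modules `⋀ⁿ 𝔲*`. -/
theorem CohDatum.IsTower.tensor_mem (T : CohDatum.IsTower D D' D'')
    (h'' : IsAdmissiblePair D'' catG catM) (n : ℕ) (X : HCModule.{u} P₂) (hX : catM X) :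
    catM (HCModule.alt n (D'.restrict D.nil) X) := by
  obtain ⟨r, hr⟩ := exists_retraction_of_bijective T.inl T.inr T.bijective
  exact alt_mem_of_retract h''.abelian_right n T.inr r hr (h''.tensor_mem n X hX)

/-- `W'' = W' · W` on the Grothendieck group of `ℳ`. -/
theorem CohDatum.IsTower.weyl_eq (T : CohDatum.IsTower D D' D'')
    (h' : IsAdmissiblePair D' catL catM) (h'' : IsAdmissiblePair D'' catG catM)
    (x : GrothendieckGroup catM) :
    h''.weyl x = h'.weyl (weylMul (D'.restrict D.nil) (T.tensor_mem h'') x) :=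
  weylMul_of_bijective h''.abelian_right T.inl T.inr T.bijective h''.tensor_mem h'.tensor_mem
    (T.tensor_mem h'') x

end TowerWeyl

/-! ### Weights of alternating maps -/

section Weights

variable {U X Y ι : Type*} [AddCommGroup U] [Module ℂ U] [AddCommGroup X] [Module ℂ X]
  [AddCommGroup Y] [Module ℂ Y] {b : ℕ}

/-- The operator `(A - (p - 1)) ⋯ (A - 1) A` on alternating maps, where `A = altDer E`. For a
diagonalizable operator `E` with eigenvalues in `ℕ`, its kernel is the sum of the eigenspaces of `A`
for the eigenvalues smaller than `p`. -/
def weightProd (E : Module.End ℂ U) : ℕ → (U [⋀^Fin b]→ₗ[ℂ] X) →ₗ[ℂ] (U [⋀^Fin b]→ₗ[ℂ] X)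
  | 0 => LinearMap.id
  | p + 1 =>
    { toFun := fun f => altDer E (weightProd E p f) - (p : ℂ) • weightProd E p f
      map_add' := fun f g => by rw [map_add, altDer_add, smul_add]; abel
      map_smul' := fun c f => by
        rw [map_smul, altDer_smul, smul_comm, RingHom.id_apply, smul_sub] }

theorem weightProd_succ (E : Module.End ℂ U) (p : ℕ) (f : U [⋀^Fin b]→ₗ[ℂ] X) :
    weightProd E (p + 1) f = altDer E (weightProd E p f) - (p : ℂ) • weightProd E p f := rfl

theorem weightProd_comp (E : Module.End ℂ U) (T : X →ₗ[ℂ] Y) (p : ℕ) (f : U [⋀^Fin b]→ₗ[ℂ] X) :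
    weightProd E p (T.compAlternatingMap f) = T.compAlternatingMap (weightProd E p f) := by
  induction p with
  | zero => rfl
  | succ p ih =>
    rw [weightProd_succ, weightProd_succ, ih, altDer_comp]
    ext v
    simp

variable [Finite ι] {e : Module.Basis ι ℂ U} {deg : ι → ℕ} {E : Module.End ℂ U}

/-- The weight of a family of basis vectors. -/
def wt (deg : ι → ℕ) (w : Fin b → ι) : ℕ := ∑ l, deg (w l)

theorem alt_ext_basis (e : Module.Basis ι ℂ U) {f g : U [⋀^Fin b]→ₗ[ℂ] X}
    (h : ∀ w : Fin b → ι, f (e ∘ w) = g (e ∘ w)) : f = g :=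
  Module.Basis.ext_alternating e fun w _ => h w

theorem altDer_basis (hE : ∀ i, E (e i) = (deg i : ℂ) • e i) (f : U [⋀^Fin b]→ₗ[ℂ] X)
    (w : Fin b → ι) : altDer E f (e ∘ w) = (wt deg w : ℂ) • f (e ∘ w) := by
  rw [altDer_apply, wt, Nat.cast_sum, Finset.sum_smul]
  refine Finset.sum_congr rfl fun l _ => ?_
  rw [Function.comp_apply, hE, f.map_update_smul]
  congr 2
  exact Function.update_eq_self l (e ∘ w)

theorem weightProd_basis (hE : ∀ i, E (e i) = (deg i : ℂ) • e i) (p : ℕ)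
    (f : U [⋀^Fin b]→ₗ[ℂ] X) (w : Fin b → ι) : weightProd E p f (e ∘ w)
      = (∏ q ∈ Finset.range p, ((wt deg w : ℂ) - q)) • f (e ∘ w) := by
  induction p with
  | zero => simp [weightProd]
  | succ p ih =>
    rw [weightProd_succ, AlternatingMap.sub_apply, AlternatingMap.smul_apply, altDer_basis hE, ih,
      ← sub_smul, smul_smul, Finset.prod_range_succ, mul_comm]

theorem weightProd_eq_zero_iff (hE : ∀ i, E (e i) = (deg i : ℂ) • e i) (p : ℕ)
    (f : U [⋀^Fin b]→ₗ[ℂ] X) : weightProd E p f = 0 ↔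
      ∀ w : Fin b → ι, p ≤ wt deg w → f (e ∘ w) = 0 := by
  constructor
  · intro h w hw
    have h1 := weightProd_basis hE p f w
    rw [h, AlternatingMap.zero_apply] at h1
    refine (smul_eq_zero.1 h1.symm).resolve_left (Finset.prod_ne_zero_iff.2 fun q hq => ?_)
    have hq := Finset.mem_range.1 hq
    exact sub_ne_zero.2 (Nat.cast_injective.ne (by omega))
  · intro h
    refine alt_ext_basis e fun w => ?_
    rw [weightProd_basis hE, AlternatingMap.zero_apply]
    by_cases hw : p ≤ wt deg w
    · rw [h w hw, smul_zero]
    · rw [Finset.prod_eq_zero (Finset.mem_range.2 (by omega : wt deg w < p)) (sub_self _), zero_smul]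

/-- An eigenvector of weight `p` is supported on the families of basis vectors of weight `p`. -/
theorem eq_zero_of_altDer_eq (hE : ∀ i, E (e i) = (deg i : ℂ) • e i) {p : ℕ}
    {f : U [⋀^Fin b]→ₗ[ℂ] X} (hf : altDer E f = (p : ℂ) • f) (w : Fin b → ι) (hw : wt deg w ≠ p) :
    f (e ∘ w) = 0 := by
  have h := altDer_basis hE f w
  rw [hf, AlternatingMap.smul_apply, ← sub_eq_zero, ← sub_smul, smul_eq_zero, sub_eq_zero,
    Nat.cast_inj] at h
  exact h.resolve_left (Ne.symm hw)

theorem weightProd_of_altDer_eq (hE : ∀ i, E (e i) = (deg i : ℂ) • e i) {p : ℕ}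
    {f : U [⋀^Fin b]→ₗ[ℂ] X} (hf : altDer E f = (p : ℂ) • f) :
    weightProd E p f = (∏ q ∈ Finset.range p, ((p : ℂ) - q)) • f := by
  refine alt_ext_basis e fun w => ?_
  rw [weightProd_basis hE, AlternatingMap.smul_apply]
  by_cases hw : wt deg w = p
  · rw [hw]
  · rw [eq_zero_of_altDer_eq hE hf w hw, smul_zero, smul_zero]

theorem weightProd_succ_of_altDer_eq (hE : ∀ i, E (e i) = (deg i : ℂ) • e i) {p : ℕ}
    {f : U [⋀^Fin b]→ₗ[ℂ] X} (hf : altDer E f = (p : ℂ) • f) : weightProd E (p + 1) f = 0 := by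
  rw [weightProd_succ, weightProd_of_altDer_eq hE hf, altDer_smul, hf, smul_comm, sub_self]

theorem prod_sub_ne_zero (p : ℕ) : (∏ q ∈ Finset.range p, ((p : ℂ) - q)) ≠ 0 := by
  refine Finset.prod_ne_zero_iff.2 fun q hq => ?_
  have hq := Finset.mem_range.1 hq
  exact sub_ne_zero.2 (Nat.cast_injective.ne (by omega))

theorem weightProd_mono (hE : ∀ i, E (e i) = (deg i : ℂ) • e i) {p q : ℕ} (hpq : p ≤ q)
    {f : U [⋀^Fin b]→ₗ[ℂ] X} (hf : weightProd E p f = 0) : weightProd E q f = 0 := by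
  rw [weightProd_eq_zero_iff hE] at hf ⊢
  exact fun w hw => hf w (hpq.trans hw)

/-- An operator which raises the degree induces an operator on alternating maps which lowers the
weight. -/
theorem weightProd_altDer (hE : ∀ i, E (e i) = (deg i : ℂ) • e i) {A : Module.End ℂ U}
    (hA : ∀ i j, deg j ≤ deg i → e.repr (A (e i)) j = 0) {p : ℕ} {f : U [⋀^Fin b]→ₗ[ℂ] X}
    (hf : weightProd E (p + 1) f = 0) : weightProd E p (altDer A f) = 0 := by
  have := Fintype.ofFinite ι
  rw [weightProd_eq_zero_iff hE] at hf ⊢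
  intro w hw
  rw [altDer_apply]
  refine Finset.sum_eq_zero fun l _ => ?_
  rw [Function.comp_apply, ← e.sum_repr (A (e (w l))), AlternatingMap.map_update_sum]
  refine Finset.sum_eq_zero fun j _ => ?_
  rw [f.map_update_smul]
  by_cases hj : deg j ≤ deg (w l)
  · rw [hA _ _ hj, zero_smul]
  · have h1 : Function.update (e ∘ w) l (e j) = e ∘ Function.update w l j :=
      (Function.comp_update e w l j).symm
    rw [h1, hf, smul_zero]
    have h2 : wt deg w < wt deg (Function.update w l j) := by
      refine Finset.sum_lt_sum (fun k _ => ?_) ⟨l, Finset.mem_univ l, ?_⟩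
      · by_cases hk : k = l
        · subst hk
          rw [Function.update_self]
          omega
        · rw [Function.update_of_ne hk]
      · rw [Function.update_self]
        omega
    omega

/-- The weights are bounded. -/
theorem exists_weightProd_eq_zero (hE : ∀ i, E (e i) = (deg i : ℂ) • e i) (b : ℕ) :
    ∃ N, ∀ {X : Type*} [AddCommGroup X] [Module ℂ X] (f : U [⋀^Fin b]→ₗ[ℂ] X),
      weightProd E N f = 0 := by
  have := Fintype.ofFinite ι
  refine ⟨b * (∑ i, deg i) + 1, fun f => (weightProd_eq_zero_iff hE _ f).2 fun w hw => ?_⟩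
  have : wt deg w ≤ ∑ _l : Fin b, ∑ i, deg i :=
    Finset.sum_le_sum fun l _ => Finset.single_le_sum (f := deg) (fun _ _ => Nat.zero_le _)
      (Finset.mem_univ (w l))
  simp at this
  omega

end Weights

section WeightModules

variable {𝔤 K : Type*} [LieRing 𝔤] [LieAlgebra ℂ 𝔤] [Group K] [TopologicalSpace K]
  [IsTopologicalGroup K] {P : LiePair 𝔤 K} {S : HCModule.{u} P → Prop}

/-- An endomorphism of `U` acts on alternating maps as a derivation. -/
def HCModule.altDerHom (b : ℕ) {U : HCModule.{u} P} [FiniteDimensional ℂ U] (E : HCHom U U)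
    (X : HCModule.{u} P) : HCHom (HCModule.alt b U X) (HCModule.alt b U X) where
  toFun := fun f : U [⋀^Fin b]→ₗ[ℂ] X => altDer E.toLinearMap f
  map_add' f g := altDer_add _ _ _
  map_smul' c f := altDer_smul _ _ _
  map_rep x := by
    intro (f : U [⋀^Fin b]→ₗ[ℂ] X)
    change altDer E.toLinearMap ((X.rep x).compAlternatingMap f - altDer (U.rep x) f)
      = (X.rep x).compAlternatingMap (altDer E.toLinearMap f)
        - altDer (U.rep x) (altDer E.toLinearMap f)
    have h : E.toLinearMap * U.rep x - U.rep x * E.toLinearMap = 0 := by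
      rw [sub_eq_zero]
      exact LinearMap.ext fun y => E.apply_rep x y
    have h1 := altDer_comm (U.rep x) E.toLinearMap f
    rw [h, sub_eq_iff_eq_add] at h1
    rw [altDer_sub, altDer_comp, h1]
    have h2 : altDer (0 : Module.End ℂ U) f = 0 := by
      ext v
      rw [altDer_apply]
      exact Finset.sum_eq_zero fun l _ => f.map_coord_zero l (by simp)
    rw [h2, zero_add]
  map_act k := by
    intro (f : U [⋀^Fin b]→ₗ[ℂ] X)
    refine AlternatingMap.ext fun v => ?_
    change altDer E.toLinearMap ((X.act k).compAlternatingMap (f.compLinearMap (U.act k⁻¹))) v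
      = X.act k (altDer E.toLinearMap f _)
    rw [altDer_apply, altDer_apply, map_sum]
    refine Finset.sum_congr rfl fun l _ => ?_
    rw [LinearMap.compAlternatingMap_apply, AlternatingMap.compLinearMap_apply]
    congr 2
    change U.act k⁻¹ ∘ Function.update v l _ = _
    rw [Function.comp_update, ← E.apply_act]
    rfl

/-- Multiplication by a scalar. -/
def HCHom.scalar (V : HCModule.{u} P) (c : ℂ) : HCHom V V where
  toLinearMap := c • LinearMap.id
  map_rep x v := (map_smul (V.rep x) c v).symm
  map_act k v := (map_smul (V.act k) c v).symm

/-- `weightProd` as a homomorphism of modules. -/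
def HCModule.weightHom (b : ℕ) {U : HCModule.{u} P} [FiniteDimensional ℂ U] (E : HCHom U U)
    (X : HCModule.{u} P) : ℕ → HCHom (HCModule.alt b U X) (HCModule.alt b U X)
  | 0 => HCHom.scalar _ 1
  | p + 1 => ((HCModule.altDerHom b E X).comp (HCModule.weightHom b E X p)).sub
      ((HCHom.scalar _ (p : ℂ)).comp (HCModule.weightHom b E X p))

theorem HCModule.weightHom_apply (b : ℕ) {U : HCModule.{u} P} [FiniteDimensional ℂ U]
    (E : HCHom U U) (X : HCModule.{u} P) (p : ℕ) (f : U [⋀^Fin b]→ₗ[ℂ] X) :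
    (HCModule.weightHom b E X p).toLinearMap f = weightProd E.toLinearMap p f := by
  induction p with
  | zero => exact one_smul ℂ f
  | succ p ih =>
    exact congrArg (fun g : U [⋀^Fin b]→ₗ[ℂ] X => altDer E.toLinearMap g - (p : ℂ) • g) ih

/-- The operator `A - p`, whose kernel is the eigenspace of weight `p`. -/
def HCModule.eigenHom (b : ℕ) {U : HCModule.{u} P} [FiniteDimensional ℂ U] (E : HCHom U U)
    (X : HCModule.{u} P) (p : ℕ) : HCHom (HCModule.alt b U X) (HCModule.alt b U X) :=
  (HCModule.altDerHom b E X).sub (HCHom.scalar _ (p : ℂ))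

/-- The eigenspace of weight `p` of the module of alternating maps. -/
abbrev HCModule.weightSpace (b : ℕ) {U : HCModule.{u} P} [FiniteDimensional ℂ U] (E : HCHom U U)
    (X : HCModule.{u} P) (p : ℕ) : HCModule.{u} P :=
  HCModule.ofStable (HCModule.stable_ker (HCModule.eigenHom b E X p))

theorem HCModule.mem_ker_eigenHom {b : ℕ} {U : HCModule.{u} P} [FiniteDimensional ℂ U]
    {E : HCHom U U} {X : HCModule.{u} P} {p : ℕ} {f : U [⋀^Fin b]→ₗ[ℂ] X} :
    (show HCModule.alt b U X from f) ∈ LinearMap.ker (HCModule.eigenHom b E X p).toLinearMap ↔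
      altDer E.toLinearMap f = (p : ℂ) • f := sub_eq_zero

theorem HCModule.weightSpace_mem (hS : IsAbelianSubcategory S) (b : ℕ) {U : HCModule.{u} P}
    [FiniteDimensional ℂ U] (E : HCHom U U) (X : HCModule.{u} P) (p : ℕ)
    (hX : S (HCModule.alt b U X)) : S (HCModule.weightSpace b E X p) :=
  (subMem_ker hS (HCModule.eigenHom b E X p) hX hX).2

/-- The kernels of `weightHom` are the sums of the weight spaces of smaller weights. -/
theorem cls_ker_weightHom_succ (hS : IsAbelianSubcategory S) (b : ℕ)
    {U : HCModule.{u} P} [FiniteDimensional ℂ U] (E : HCHom U U) {ι : Type*} [Finite ι]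
    {e : Module.Basis ι ℂ U} {deg : ι → ℕ} (hE : ∀ i, E.toLinearMap (e i) = (deg i : ℂ) • e i)
    {X : HCModule.{u} P} (hX : S (HCModule.alt b U X)) (p : ℕ)
    (h : S (HCModule.ofStable (HCModule.stable_ker (HCModule.weightHom b E X (p + 1)))))
    (h' : S (HCModule.ofStable (HCModule.stable_ker (HCModule.weightHom b E X p)))) :
    GrothendieckGroup.cls _ h = GrothendieckGroup.cls _ h'
      + GrothendieckGroup.cls _ (HCModule.weightSpace_mem hS b E X p hX) := by
  have hw : ∀ (p : ℕ) (f : U [⋀^Fin b]→ₗ[ℂ] X), (show HCModule.alt b U X from f)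
      ∈ LinearMap.ker (HCModule.weightHom b E X p).toLinearMap ↔ weightProd E.toLinearMap p f = 0 :=
    fun p f => by
      rw [LinearMap.mem_ker]
      exact ⟨fun h => (HCModule.weightHom_apply b E X p f).symm.trans h,
        fun h => (HCModule.weightHom_apply b E X p f).trans h⟩
  have s1 := HCModule.stable_ker (HCModule.weightHom b E X (p + 1))
  have s0 := HCModule.stable_ker (HCModule.weightHom b E X p)
  have s2 := HCModule.stable_ker (HCModule.eigenHom b E X p)
  let α : HCHom (HCModule.ofStable s0) (HCModule.ofStable s1) := s1.cod s0.incl fun f =>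
    (hw _ _).2 (weightProd_mono hE (Nat.le_succ p) ((hw _ _).1 (s0.incl_mem f)))
  have hα : ∀ f, s1.incl.toLinearMap (α.toLinearMap f) = s0.incl.toLinearMap f :=
    fun f => s1.incl_cod _ _ f
  let β : HCHom (HCModule.ofStable s1) (HCModule.weightSpace b E X p) :=
    s2.cod ((HCModule.weightHom b E X p).comp s1.incl) fun f => s1.incl_mem f
  have hβ : ∀ f, s2.incl.toLinearMap (β.toLinearMap f)
      = (HCModule.weightHom b E X p).toLinearMap (s1.incl.toLinearMap f) :=
    fun f => s2.incl_cod _ _ f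
  refine GrothendieckGroup.cls_eq_add α β ⟨?_, ?_, ?_⟩ _ _ _
  · exact fun x y hxy => s0.incl_injective (by rw [← hα, ← hα, hxy])
  · intro g
    have hg := HCModule.mem_ker_eigenHom.1 (s2.incl_mem g)
    obtain ⟨f, hf⟩ := s1.exists_incl ((hw _ _).2 (weightProd_succ_of_altDer_eq hE hg))
    refine ⟨(∏ q ∈ Finset.range p, ((p : ℂ) - q))⁻¹ • f, s2.incl_injective ?_⟩
    rw [map_smul, map_smul, hβ, hf]
    refine (congrArg (_ • ·) ((HCModule.weightHom_apply b E X p _).trans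
      (weightProd_of_altDer_eq hE hg))).trans ?_
    exact inv_smul_smul₀ (prod_sub_ne_zero p) _
  · intro f
    constructor
    · intro hf
      have h1 : (HCModule.weightHom b E X p).toLinearMap (s1.incl.toLinearMap f) = 0 := by
        rw [← hβ, hf, map_zero]
      obtain ⟨g, hg⟩ := s0.exists_incl h1
      exact ⟨g, s1.incl_injective ((hα g).trans hg)⟩
    · rintro ⟨g, rfl⟩
      refine s2.incl_injective ?_
      rw [hβ, hα, map_zero]
      exact s0.incl_mem g

/-- A module of alternating maps is the sum of its weight spaces. -/
theorem exists_cls_alt_eq_sum_weightSpace (hS : IsAbelianSubcategory S) (b : ℕ)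
    {U : HCModule.{u} P} [FiniteDimensional ℂ U] (E : HCHom U U) {ι : Type*} [Finite ι]
    {e : Module.Basis ι ℂ U} {deg : ι → ℕ} (hE : ∀ i, E.toLinearMap (e i) = (deg i : ℂ) • e i)
    {X : HCModule.{u} P} (hX : S (HCModule.alt b U X)) (N : ℕ)
    (hN : ∀ f : U [⋀^Fin b]→ₗ[ℂ] X, weightProd E.toLinearMap N f = 0) :
    GrothendieckGroup.cls _ hX = ∑ p ∈ Finset.range N,
      GrothendieckGroup.cls _ (HCModule.weightSpace_mem hS b E X p hX) := by
  have hst : ∀ p, S (HCModule.ofStable (HCModule.stable_ker (HCModule.weightHom b E X p))) :=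
    fun p => (subMem_ker hS (HCModule.weightHom b E X p) hX hX).2
  have key : ∀ p, GrothendieckGroup.cls _ (hst p) = ∑ p ∈ Finset.range p,
      GrothendieckGroup.cls _ (HCModule.weightSpace_mem hS b E X p hX) := by
    intro p
    induction p with
    | zero =>
      have s0 := HCModule.stable_ker (HCModule.weightHom b E X 0)
      have h0 : ∀ x, s0.incl.toLinearMap x = 0 := fun x =>
        (one_smul ℂ _).symm.trans (s0.incl_mem x)
      have : Subsingleton (HCModule.ofStable s0) :=
        ⟨fun x y => s0.incl_injective ((h0 x).trans (h0 y).symm)⟩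
      exact GrothendieckGroup.cls_eq_zero _ _
    | succ p ih =>
      rw [Finset.sum_range_succ, ← ih]
      exact cls_ker_weightHom_succ hS b E hE hX p _ _
  rw [← key N]
  have sN := HCModule.stable_ker (HCModule.weightHom b E X N)
  refine (GrothendieckGroup.cls_eq_of_bijective hS sN.incl
    ⟨sN.incl_injective, fun f => sN.exists_incl ?_⟩ _ _).symm
  exact (HCModule.weightHom_apply b E X N f).trans (hN f)

end WeightModules

/-! ### Cohomology with values in alternating maps on a nilpotent module -/

section WeightDifferential

variable {𝔫 U Y ι : Type*} [LieRing 𝔫] [LieAlgebra ℂ 𝔫] [AddCommGroup U] [Module ℂ U]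
  [AddCommGroup Y] [Module ℂ Y] {a b : ℕ}

/-- The differential with values in alternating maps on `U`, as the sum of the differential for the
trivial action on `U` and of a term induced by the action on `U`. -/
theorem ceD_altRep_apply (σ : 𝔫 →ₗ[ℂ] Module.End ℂ U) (ρ : 𝔫 →ₗ[ℂ] Module.End ℂ Y)
    (ω : 𝔫 [⋀^Fin a]→ₗ[ℂ] U [⋀^Fin b]→ₗ[ℂ] Y) (v : Fin (a + 1) → 𝔫) (w : Fin b → U) :
    ceD (altRep b σ ρ) a ω v w = ceD ρ a (altSwapFun ω w) v
      - ∑ i : Fin (a + 1), (-1 : ℤ) ^ (i : ℕ) • altDer (σ (v i)) (ω (i.removeNth v)) w := by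
  have h : ∀ η : U [⋀^Fin b]→ₗ[ℂ] Y, η w = altEval w η := fun _ => rfl
  rw [ceD_apply, ceD_apply, h, map_sum, ← Finset.sum_sub_distrib]
  refine Finset.sum_congr rfl fun i _ => ?_
  rw [map_zsmul, map_sub, ← smul_sub]
  congr 1
  rw [← h, ← h, AlternatingMap.smul_apply, h (∑ j, _), map_sum]
  exact sub_right_comm _ _ _

variable [Finite ι] {e : Module.Basis ι ℂ U} {deg : ι → ℕ} {E : Module.End ℂ U}

/-- On the graded pieces of the filtration by weights, the differential does not see the action on
`U`, which raises the degrees. -/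
theorem weightProd_altSwapFun_ceD (hE : ∀ i, E (e i) = (deg i : ℂ) • e i)
    (σ : 𝔫 →ₗ[ℂ] Module.End ℂ U) (ρ : 𝔫 →ₗ[ℂ] Module.End ℂ Y)
    (hσ : ∀ y i j, deg j ≤ deg i → e.repr (σ y (e i)) j = 0) (p : ℕ)
    (ω : 𝔫 [⋀^Fin a]→ₗ[ℂ] U [⋀^Fin b]→ₗ[ℂ] Y) (hω : weightProd E (p + 1) (altSwapFun ω) = 0) :
    weightProd E p (altSwapFun (ceD (altRep b σ ρ) a ω))
      = (ceD ρ a).compAlternatingMap (weightProd E p (altSwapFun ω)) := by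
  rw [← weightProd_comp, ← sub_eq_zero, ← map_sub]
  -- evaluation of the term induced by the action on `U`
  have hev : ∀ v : Fin (a + 1) → 𝔫, (⟨⟨fun f => f v, fun _ _ => rfl⟩, fun _ _ => rfl⟩ :
      (𝔫 [⋀^Fin (a + 1)]→ₗ[ℂ] Y) →ₗ[ℂ] Y).compAlternatingMap
        (altSwapFun (ceD (altRep b σ ρ) a ω) - (ceD ρ a).compAlternatingMap (altSwapFun ω))
      = - ∑ i : Fin (a + 1), (-1 : ℤ) ^ (i : ℕ) • altDer (σ (v i)) (ω (i.removeNth v)) := by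
    intro v
    refine AlternatingMap.ext fun w => ?_
    change ceD (altRep b σ ρ) a ω v w - ceD ρ a (altSwapFun ω w) v = _
    rw [ceD_altRep_apply, sub_sub_cancel_left]
    rw [AlternatingMap.neg_apply]
    refine congrArg Neg.neg (Eq.trans ?_ (map_sum (altEval (V := Y) w) _ _).symm)
    rfl
  refine AlternatingMap.ext fun w => AlternatingMap.ext fun v => ?_
  refine (congrArg (fun f : U [⋀^Fin b]→ₗ[ℂ] Y => f w)
    (weightProd_comp E (⟨⟨fun f => f v, fun _ _ => rfl⟩, fun _ _ => rfl⟩ :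
      (𝔫 [⋀^Fin (a + 1)]→ₗ[ℂ] Y) →ₗ[ℂ] Y) p _).symm).trans ?_
  rw [hev v, map_neg, map_sum, Finset.sum_eq_zero]
  · exact neg_zero
  · intro i _
    rw [map_zsmul]
    have h : weightProd E (p + 1) (ω (i.removeNth v)) = 0 :=
      (weightProd_comp E (⟨⟨fun f => f (i.removeNth v), fun _ _ => rfl⟩, fun _ _ => rfl⟩ :
        (𝔫 [⋀^Fin a]→ₗ[ℂ] Y) →ₗ[ℂ] Y) (p + 1) (altSwapFun ω)).trans (by rw [hω]; rfl)
    rw [weightProd_altDer hE (hσ (v i)) h, smul_zero]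

/-- A preimage under `weightProd`: an eigenvector of weight `p`, up to a scalar. -/
theorem exists_weightProd_eq (hE : ∀ i, E (e i) = (deg i : ℂ) • e i) {p : ℕ}
    {f : U [⋀^Fin b]→ₗ[ℂ] Y} (hf : altDer E f = (p : ℂ) • f) :
    ∃ g : U [⋀^Fin b]→ₗ[ℂ] Y, weightProd E p g = f ∧ weightProd E (p + 1) g = 0 := by
  have hg : altDer E ((∏ q ∈ Finset.range p, ((p : ℂ) - q))⁻¹ • f)
      = (p : ℂ) • (∏ q ∈ Finset.range p, ((p : ℂ) - q))⁻¹ • f := by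
    rw [altDer_smul, hf, smul_comm]
  refine ⟨(∏ q ∈ Finset.range p, ((p : ℂ) - q))⁻¹ • f, ?_, weightProd_succ_of_altDer_eq hE hg⟩
  rw [weightProd_of_altDer_eq hE hg]
  exact smul_inv_smul₀ (prod_sub_ne_zero p) f

theorem altDer_weightProd {p : ℕ} {f : U [⋀^Fin b]→ₗ[ℂ] Y} (hf : weightProd E (p + 1) f = 0) :
    altDer E (weightProd E p f) = (p : ℂ) • weightProd E p f := sub_eq_zero.1 hf

end WeightDifferential

/-- A homomorphism factors through an injective one, if its values are in the image. -/
theorem HCHom.exists_factor {𝔤 K : Type*} [LieRing 𝔤] [LieAlgebra ℂ 𝔤] [Group K]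
    [TopologicalSpace K] [IsTopologicalGroup K] {P : LiePair 𝔤 K} {U V W : HCModule.{u} P}
    (f : HCHom U W) (i : HCHom V W) (hi : Function.Injective i.toLinearMap)
    (h : ∀ t, ∃ v, i.toLinearMap v = f.toLinearMap t) :
    ∃ l : HCHom U V, ∀ t, i.toLinearMap (l.toLinearMap t) = f.toLinearMap t := by
  choose l hl using h
  refine ⟨⟨⟨⟨l, fun s t => hi ?_⟩, fun c t => hi ?_⟩, fun x t => hi ?_, fun k t => hi ?_⟩, hl⟩
  · rw [map_add, hl, hl, hl, map_add]
  · rw [map_smul, hl, hl, RingHom.id_apply, map_smul]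
  · exact (hl _).trans ((f.apply_rep x t).trans
      ((congrArg _ (hl t).symm).trans (i.apply_rep x _).symm))
  · exact (hl _).trans ((f.apply_act k t).trans
      ((congrArg _ (hl t).symm).trans (i.apply_act k _).symm))

section WeightComplex

variable {𝔪 N M : Type*} {𝔩 : Type u} [LieRing 𝔪]
  [LieAlgebra ℂ 𝔪] [Group N] [TopologicalSpace N] [IsTopologicalGroup N] [LieRing 𝔩]
  [LieAlgebra ℂ 𝔩] [FiniteDimensional ℂ 𝔩] [Group M] [TopologicalSpace M] [IsTopologicalGroup M]
  {P₂ : LiePair 𝔪 N} {P₁ : LiePair 𝔩 M}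

namespace CohDatum

variable (D : CohDatum P₂ P₁)

instance (U : HCModule.{u} P₁) [FiniteDimensional ℂ U] : FiniteDimensional ℂ (D.restrict U) :=
  inferInstanceAs (FiniteDimensional ℂ U)

/-- Exchanging the arguments of the cochains with values in `⋀ᵇ U* ⊗ Y`. -/
def swapHom (a b : ℕ) (U Y : HCModule.{u} P₁) [FiniteDimensional ℂ U] :
    HCHom (D.cochain a (HCModule.alt b U Y)) (HCModule.alt b (D.restrict U) (D.cochain a Y)) where
  toFun := fun ω : D.𝔲 [⋀^Fin a]→ₗ[ℂ] U [⋀^Fin b]→ₗ[ℂ] Y => altSwapFun ω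
  map_add' _ _ := rfl
  map_smul' _ _ := rfl
  map_rep x ω := (HCModule.altSwap a b D.nil (D.restrict U) (D.restrict Y)).map_rep x ω
  map_act m := by
    intro (ω : D.𝔲 [⋀^Fin a]→ₗ[ℂ] U [⋀^Fin b]→ₗ[ℂ] Y)
    refine AlternatingMap.ext fun w => AlternatingMap.ext fun v => ?_
    change Y.act (D.ψ m) (ω (fun i => D.adAct m⁻¹ (v i)) fun i => U.act (D.ψ m)⁻¹ (w i))
      = Y.act (D.ψ m) (ω (fun i => D.adAct m⁻¹ (v i)) fun i => U.act (D.ψ m⁻¹) (w i))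
    rw [show (D.ψ m)⁻¹ = D.ψ m⁻¹ from (map_inv D.ψ.toMonoidHom m).symm]

variable {D} {U Y : HCModule.{u} P₁} [FiniteDimensional ℂ U]
  {E : HCHom (D.restrict U) (D.restrict U)} {ι : Type*} [Finite ι] {e : Module.Basis ι ℂ U}
  {deg : ι → ℕ}

/-- An endomorphism of the restriction of `U`, as an endomorphism of the space `U`. -/
def endRestrict (E : HCHom (D.restrict U) (D.restrict U)) : Module.End ℂ U := E.toLinearMap

/-- The alternating map underlying `swapHom`, followed by `weightProd`. -/
theorem weightHom_swapHom (a b p : ℕ) (ω : D.𝔲 [⋀^Fin a]→ₗ[ℂ] U [⋀^Fin b]→ₗ[ℂ] Y) :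
    ((HCModule.weightHom b E (D.cochain a Y) p).comp (D.swapHom a b U Y)).toLinearMap ω
      = weightProd (endRestrict E) p (altSwapFun ω) :=
  HCModule.weightHom_apply b E (D.cochain a Y) p _

/-- The filtration by the weights of the complex of cochains with values in `⋀ᵇ U* ⊗ Y`. -/
def weightComplex (Y : HCModule.{u} P₁) (b : ℕ)
    (hE : ∀ i, endRestrict E (e i) = (deg i : ℂ) • e i)
    (hσ : ∀ y ∈ D.𝔲, ∀ i j, deg j ≤ deg i → e.repr (U.rep y (e i)) j = 0) (N : ℕ)
    (hN : ∀ (a : ℕ) (f : U [⋀^Fin b]→ₗ[ℂ] D.𝔲 [⋀^Fin a]→ₗ[ℂ] Y), weightProd (endRestrict E) N f = 0) : FilteredComplex.{u} P₂ where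
  C a := D.cochain a (HCModule.alt b U Y)
  d a := D.d a (HCModule.alt b U Y)
  d_d a x := D.d_d a _ x
  F p a := LinearMap.ker
    ((HCModule.weightHom b E (D.cochain a Y) p).comp (D.swapHom a b U Y)).toLinearMap
  stable p a := HCModule.stable_ker _
  mono a p q hpq := by
    intro (ω : D.𝔲 [⋀^Fin a]→ₗ[ℂ] U [⋀^Fin b]→ₗ[ℂ] Y) hω
    exact (weightHom_swapHom a b q ω).trans
      (weightProd_mono hE hpq ((weightHom_swapHom a b p ω).symm.trans hω))
  d_mem p a := by
    intro (ω : D.𝔲 [⋀^Fin a]→ₗ[ℂ] U [⋀^Fin b]→ₗ[ℂ] Y) hω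
    have h := (weightHom_swapHom a b p ω).symm.trans hω
    refine (weightHom_swapHom (a + 1) b p _).trans ?_
    refine (weightProd_altSwapFun_ceD hE (D.nilRep U) (D.nilRep Y)
      (fun y => hσ y y.2) p ω (weightProd_mono hE (Nat.le_succ p) h)).trans ?_
    rw [h]
    exact AlternatingMap.ext fun w => map_zero (ceD (D.nilRep Y) a)
  N := N
  zero a := by
    rw [eq_bot_iff]
    intro (ω : D.𝔲 [⋀^Fin a]→ₗ[ℂ] U [⋀^Fin b]→ₗ[ℂ] Y) hω
    have h : altSwapFun ω = 0 := (weightHom_swapHom (E := E) a b 0 ω).symm.trans hω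
    exact congrArg (fun f : U [⋀^Fin b]→ₗ[ℂ] D.𝔲 [⋀^Fin a]→ₗ[ℂ] Y => altSwapFun f) h
  top a := by
    rw [eq_top_iff]
    intro (ω : D.𝔲 [⋀^Fin a]→ₗ[ℂ] U [⋀^Fin b]→ₗ[ℂ] Y) _
    exact (weightHom_swapHom a b N ω).trans (hN a _)

/-- The homomorphism `ω ↦ weightProd p ω` of the weight complex. -/
def weightMap (D : CohDatum P₂ P₁) (U Y : HCModule.{u} P₁) [FiniteDimensional ℂ U]
    (E : HCHom (D.restrict U) (D.restrict U)) (b p n : ℕ) :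
    HCHom (D.cochain n (HCModule.alt b U Y)) (HCModule.alt b (D.restrict U) (D.cochain n Y)) :=
  (HCModule.weightHom b E (D.cochain n Y) p).comp (D.swapHom n b U Y)

theorem weightMap_apply (b p n : ℕ) (ω : D.𝔲 [⋀^Fin n]→ₗ[ℂ] U [⋀^Fin b]→ₗ[ℂ] Y) :
    (weightMap D U Y E b p n).toLinearMap ω = weightProd (endRestrict E) p (altSwapFun ω) :=
  weightHom_swapHom n b p ω

/-- The cohomology of the graded pieces of the weight complex. -/
theorem exists_isGraded_weightComplex (Y : HCModule.{u} P₁) (b : ℕ)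
    (hE : ∀ i, endRestrict E (e i) = (deg i : ℂ) • e i)
    (hσ : ∀ y ∈ D.𝔲, ∀ i j, deg j ≤ deg i → e.repr (U.rep y (e i)) j = 0) (N : ℕ)
    (hN : ∀ (a : ℕ) (f : U [⋀^Fin b]→ₗ[ℂ] D.𝔲 [⋀^Fin a]→ₗ[ℂ] Y), weightProd (endRestrict E) N f = 0)
    (p n : ℕ) :
    ∃ ε : HCHom (HCModule.ofStable ((weightComplex Y b hE hσ N hN).cyc_stable p p n))
      (HCModule.weightSpace b E (D.cohomology n Y) p),
      (weightComplex Y b hE hσ N hN).IsGraded p n ε := by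
  let X := weightComplex Y b hE hσ N hN
  have hF : ∀ (q m : ℕ) (ω : D.𝔲 [⋀^Fin m]→ₗ[ℂ] U [⋀^Fin b]→ₗ[ℂ] Y),
      (show X.C m from ω) ∈ X.F q m ↔ weightProd (endRestrict E) q (altSwapFun ω) = 0 :=
    fun q m ω => ⟨fun h => (weightMap_apply b q m ω).symm.trans h,
      fun h => (weightMap_apply b q m ω).trans h⟩
  have hd : ∀ (m : ℕ) (ω : D.𝔲 [⋀^Fin m]→ₗ[ℂ] U [⋀^Fin b]→ₗ[ℂ] Y),
      (show X.C m from ω) ∈ X.F (p + 1) m →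
      weightProd (endRestrict E) p (altSwapFun
        (show D.𝔲 [⋀^Fin (m + 1)]→ₗ[ℂ] U [⋀^Fin b]→ₗ[ℂ] Y from (X.d m).toLinearMap ω))
      = (ceD (D.nilRep Y) m).compAlternatingMap (weightProd (endRestrict E) p (altSwapFun ω)) :=
    fun m ω h => weightProd_altSwapFun_ceD hE (D.nilRep U) (D.nilRep Y)
      (fun y => hσ y y.2) p ω ((hF _ _ ω).1 h)
  have hst := X.cyc_stable p p n
  -- the values of `weightProd p ω` are cocycles
  obtain ⟨c, hc⟩ := HCHom.exists_factor ((weightMap D U Y E b p n).comp hst.incl)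
    (HCModule.altMap b (D.restrict U) (D.d n Y).kerι) (((D.d n Y).shortExact_ker.altMap b _).injective)
    (fun t => by
      obtain ⟨h1, h2⟩ := X.mem_cyc.1 (hst.incl_mem t)
      have h3 := (hd n _ h1).symm.trans ((hF _ _ _).1 h2)
      refine (((D.d n Y).shortExact_ker.altMap b (D.restrict U)).exact _).1 ?_
      refine AlternatingMap.ext fun w => Subtype.ext ?_
      refine (congrArg (fun f : D.𝔲 [⋀^Fin n]→ₗ[ℂ] Y => ceD (D.nilRep Y) n f)
        (congrArg (fun f : U [⋀^Fin b]→ₗ[ℂ] D.𝔲 [⋀^Fin n]→ₗ[ℂ] Y => f w)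
          (weightMap_apply b p n _))).trans ?_
      exact congrArg (fun f : U [⋀^Fin b]→ₗ[ℂ] D.𝔲 [⋀^Fin (n + 1)]→ₗ[ℂ] Y => f w) h3)
  let Z : Submodule ℂ (D.𝔲 [⋀^Fin n]→ₗ[ℂ] Y) := LinearMap.ker (D.d n Y).toLinearMap
  let κ : HCModule.ofStable hst → U [⋀^Fin b]→ₗ[ℂ] Z := fun t => c.toLinearMap t
  let ω : HCModule.ofStable hst → D.𝔲 [⋀^Fin n]→ₗ[ℂ] U [⋀^Fin b]→ₗ[ℂ] Y :=
    fun t => hst.incl.toLinearMap t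
  have hκ : ∀ t, Z.subtype.compAlternatingMap (κ t)
      = weightProd (endRestrict E) p (altSwapFun (ω t)) := fun t =>
    (hc t).trans (weightMap_apply b p n _)
  have hκE : ∀ t, altDer (endRestrict E) (κ t) = (p : ℂ) • κ t := fun t => by
    have h1 := altDer_weightProd ((hF _ _ (ω t)).1 (X.mem_cyc.1 (hst.incl_mem t)).1)
    rw [← hκ, altDer_comp] at h1
    refine AlternatingMap.ext fun w => Subtype.ext ?_
    exact congrArg (fun f : U [⋀^Fin b]→ₗ[ℂ] D.𝔲 [⋀^Fin n]→ₗ[ℂ] Y => f w) h1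
  let π : Z →ₗ[ℂ] D.cohomology n Y := D.classOf n Y
  let s2 := HCModule.stable_ker (HCModule.eigenHom b E (D.cohomology n Y) p)
  let ε : HCHom (HCModule.ofStable hst) (HCModule.weightSpace b E (D.cohomology n Y) p) :=
    s2.cod ((HCModule.altMap b (D.restrict U) (show HCHom (D.d n Y).ker (D.cohomology n Y) from D.classHom n Y)).comp c) (fun t => by
      refine HCModule.mem_ker_eigenHom.2 ?_
      refine (altDer_comp π (endRestrict E) (κ t)).trans ?_
      rw [hκE]
      exact AlternatingMap.ext fun w => map_smul π _ _)
  have hε : ∀ t, s2.incl.toLinearMap (ε.toLinearMap t)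
      = (show HCModule.alt b (D.restrict U) (D.cohomology n Y) from
        π.compAlternatingMap (κ t)) := fun t => rfl
  have hε0 : ∀ t, ε.toLinearMap t = 0 ↔
      ∀ w, weightProd (endRestrict E) p (altSwapFun (ω t)) w ∈ D.coboundary Y n := fun t => by
    have h1 : ε.toLinearMap t = 0 ↔ π.compAlternatingMap (κ t) = 0 :=
      ⟨fun h => (hε t).symm.trans ((congrArg s2.incl.toLinearMap h).trans (map_zero _)),
        fun h => s2.incl_injective ((hε t).trans (h.trans (map_zero s2.incl.toLinearMap).symm))⟩
    rw [h1, ← hκ]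
    refine ⟨fun h w => ?_, fun h => AlternatingMap.ext fun w => ?_⟩
    · exact D.classOf_eq_zero.1
        (congrArg (fun f : U [⋀^Fin b]→ₗ[ℂ] D.cohomology n Y => f w) h)
    · exact D.classOf_eq_zero.2 (h w)
  refine ⟨ε, fun f => ?_, fun t => (hε0 t).trans ?_⟩
  · -- lift an eigenvector to an eigenvector with values in the cocycles
    obtain ⟨σ, hσ'⟩ := π.exists_rightInverse_of_surjective
      (LinearMap.range_eq_top.2 (D.classOf_surjective n Y))
    let g : U [⋀^Fin b]→ₗ[ℂ] D.cohomology n Y := s2.incl.toLinearMap f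
    have hg : altDer (endRestrict E) g = (p : ℂ) • g :=
      HCModule.mem_ker_eigenHom.1 (s2.incl_mem f)
    have hg' : altDer (endRestrict E) ((Z.subtype ∘ₗ σ).compAlternatingMap g)
        = (p : ℂ) • (Z.subtype ∘ₗ σ).compAlternatingMap g := by
      rw [altDer_comp, hg]
      exact AlternatingMap.ext fun w => map_smul (Z.subtype ∘ₗ σ) _ _
    obtain ⟨η, h1, h2⟩ := exists_weightProd_eq hE hg'
    have hη : (show X.C n from altSwapFun η) ∈ X.cyc p p n := by
      refine X.mem_cyc.2 ⟨(hF _ _ _).2 h2, (hF _ _ _).2 ?_⟩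
      refine (hd n (altSwapFun η) ((hF _ _ _).2 h2)).trans (AlternatingMap.ext fun w => ?_)
      refine (congrArg (fun f : U [⋀^Fin b]→ₗ[ℂ] D.𝔲 [⋀^Fin n]→ₗ[ℂ] Y => ceD (D.nilRep Y) n (f w))
        h1).trans ?_
      exact (σ (g w)).2
    obtain ⟨t, ht⟩ := hst.exists_incl hη
    refine ⟨t, s2.incl_injective ((hε t).trans ?_)⟩
    have h3 : κ t = σ.compAlternatingMap g := by
      refine AlternatingMap.ext fun w => Subtype.ext ?_
      have h4 := (hκ t).trans ((congrArg (fun f : D.𝔲 [⋀^Fin n]→ₗ[ℂ] U [⋀^Fin b]→ₗ[ℂ] Y =>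
        weightProd (endRestrict E) p (altSwapFun f)) ht).trans h1)
      exact congrArg (fun f : U [⋀^Fin b]→ₗ[ℂ] D.𝔲 [⋀^Fin n]→ₗ[ℂ] Y => f w) h4
    rw [h3]
    exact AlternatingMap.ext fun w => LinearMap.congr_fun hσ' (g w)
  · have hFn : ∀ y : X.C n, hst.incl.toLinearMap t - y ∈ X.F p n ↔
        weightProd (endRestrict E) p (altSwapFun (ω t)) = weightProd (endRestrict E) p
          (altSwapFun (show D.𝔲 [⋀^Fin n]→ₗ[ℂ] U [⋀^Fin b]→ₗ[ℂ] Y from y)) := fun y => by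
      have h1 : weightProd (endRestrict E) p (altSwapFun
          (show D.𝔲 [⋀^Fin n]→ₗ[ℂ] U [⋀^Fin b]→ₗ[ℂ] Y from hst.incl.toLinearMap t - y))
          = weightProd (endRestrict E) p (altSwapFun (ω t)) - weightProd (endRestrict E) p
            (altSwapFun (show D.𝔲 [⋀^Fin n]→ₗ[ℂ] U [⋀^Fin b]→ₗ[ℂ] Y from y)) :=
        map_sub (weightProd (endRestrict E) p) (altSwapFun (ω t)) (altSwapFun
          (show D.𝔲 [⋀^Fin n]→ₗ[ℂ] U [⋀^Fin b]→ₗ[ℂ] Y from y))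
      exact ⟨fun h => sub_eq_zero.1 (h1.symm.trans ((hF _ _ _).1 h)),
        fun h => (hF _ _ _).2 (h1.trans (sub_eq_zero.2 h))⟩
    cases n with
    | zero =>
      constructor
      · intro h
        refine ⟨0, Submodule.zero_mem _, (hFn 0).2 (AlternatingMap.ext fun w => ?_)⟩
        exact (h w).trans (congrArg (fun f : U [⋀^Fin b]→ₗ[ℂ] D.𝔲 [⋀^Fin 0]→ₗ[ℂ] Y => f w)
          (map_zero (weightProd (endRestrict E) p))).symm
      · rintro ⟨y, hy, h⟩ w
        have hy : y = 0 := hy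
        subst hy
        refine (congrArg (fun f : U [⋀^Fin b]→ₗ[ℂ] D.𝔲 [⋀^Fin 0]→ₗ[ℂ] Y => f w)
          ((hFn 0).1 h)).trans ?_
        exact congrArg (fun f : U [⋀^Fin b]→ₗ[ℂ] D.𝔲 [⋀^Fin 0]→ₗ[ℂ] Y => f w)
          (map_zero (weightProd (endRestrict E) p))
    | succ n =>
      have hd' : ∀ m (η : D.𝔲 [⋀^Fin m]→ₗ[ℂ] U [⋀^Fin b]→ₗ[ℂ] Y),
        (show X.C m from η) ∈ X.F (p + 1) m → ∀ w, weightProd (endRestrict E) p (altSwapFun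
          (show D.𝔲 [⋀^Fin (m + 1)]→ₗ[ℂ] U [⋀^Fin b]→ₗ[ℂ] Y from (X.d m).toLinearMap η)) w
          = ceD (D.nilRep Y) m (weightProd (endRestrict E) p (altSwapFun η) w) :=
        fun m η h w => congrArg
          (fun f : U [⋀^Fin b]→ₗ[ℂ] D.𝔲 [⋀^Fin (m + 1)]→ₗ[ℂ] Y => f w)
          (weightProd_altSwapFun_ceD hE (D.nilRep U) (D.nilRep Y)
            (fun y => hσ y y.2) p η ((hF _ _ η).1 h))
      constructor
      · intro h
        -- a primitive of `weightProd p ω`, which is again an eigenvector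
        obtain ⟨σ, hσ'⟩ := (ceD (D.nilRep Y) n).rangeRestrict.exists_rightInverse_of_surjective
          (LinearMap.range_eq_top.2 (LinearMap.surjective_rangeRestrict _))
        obtain ⟨τ, hτ⟩ := LinearMap.exists_extend σ
        have hτ' : ∀ f ∈ LinearMap.range (ceD (D.nilRep Y) n), ceD (D.nilRep Y) n (τ f) = f :=
          fun f hf => (congrArg _ (LinearMap.congr_fun hτ ⟨f, hf⟩)).trans
            (congrArg Subtype.val (LinearMap.congr_fun hσ' ⟨f, hf⟩))
        have hg : altDer (endRestrict E) (τ.compAlternatingMap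
            (weightProd (endRestrict E) p (altSwapFun (ω t)))) = (p : ℂ) • τ.compAlternatingMap
            (weightProd (endRestrict E) p (altSwapFun (ω t))) := by
          rw [altDer_comp, altDer_weightProd
            ((hF _ _ (ω t)).1 (X.mem_cyc.1 (hst.incl_mem t)).1)]
          exact AlternatingMap.ext fun w => map_smul τ _ _
        obtain ⟨η, h1, h2⟩ := exists_weightProd_eq hE hg
        have hη : (show X.C n from altSwapFun η) ∈ X.F (p + 1) n := (hF _ _ _).2 h2
        refine ⟨(X.d n).toLinearMap (altSwapFun η), ⟨_, hη, rfl⟩, (hFn _).2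
          (AlternatingMap.ext fun w => ?_)⟩
        refine Eq.trans ?_ (hd' n (altSwapFun η) hη w).symm
        refine Eq.trans ?_ (congrArg (fun f : U [⋀^Fin b]→ₗ[ℂ] D.𝔲 [⋀^Fin n]→ₗ[ℂ] Y =>
          ceD (D.nilRep Y) n (f w)) h1).symm
        exact (hτ' _ (h w)).symm
      · rintro ⟨_, ⟨η, hη, rfl⟩, h⟩ w
        refine ⟨weightProd (endRestrict E) p
          (altSwapFun (show D.𝔲 [⋀^Fin n]→ₗ[ℂ] U [⋀^Fin b]→ₗ[ℂ] Y from η)) w, ?_⟩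
        refine (hd' n η hη w).symm.trans ?_
        exact congrArg (fun f : U [⋀^Fin b]→ₗ[ℂ] D.𝔲 [⋀^Fin (n + 1)]→ₗ[ℂ] Y => f w)
          ((hFn _).1 h).symm

/-- The Euler characteristic of the cohomology with values in `⋀ᵇ U* ⊗ Y`, if `U` has a grading
whose degrees are raised by `𝔲`. -/
theorem sum_cls_cohomology_alt {S : HCModule.{u} P₂ → Prop} (hS : IsAbelianSubcategory S)
    (hE : ∀ i, endRestrict E (e i) = (deg i : ℂ) • e i)
    (hσ : ∀ y ∈ D.𝔲, ∀ i j, deg j ≤ deg i → e.repr (U.rep y (e i)) j = 0) (b : ℕ)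
    (h₁ : ∀ n, S (D.cohomology n (HCModule.alt b U Y)))
    (h₃ : ∀ n, S (HCModule.alt b (D.restrict U) (D.cohomology n Y))) (R : ℕ)
    (hR : Module.finrank ℂ D.𝔲 < R) :
    ∑ n ∈ Finset.range R, (-1 : ℤ) ^ n • GrothendieckGroup.cls _ (h₁ n)
      = ∑ n ∈ Finset.range R, (-1 : ℤ) ^ n • GrothendieckGroup.cls _ (h₃ n) := by
  obtain ⟨N, hN⟩ := exists_weightProd_eq_zero (E := endRestrict E) hE b
  let X := weightComplex Y b hE hσ N (fun a f => hN f)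
  have h := X.sum_cls_cohomology hS (fun n => D.cohomology n (HCModule.alt b U Y)) h₁
    (fun n => D.classHom n _)
    (fun n => ⟨D.classHom_surjective n _, fun x => by
      have : D.coboundary (HCModule.alt b U Y) n = X.bd X.N n := by
        cases n with
        | zero => rfl
        | succ n =>
          rw [FilteredComplex.bd, X.top, Submodule.map_top]
          rfl
      rw [← this]
      exact D.classOf_eq_zero⟩)
    (fun p n => GrothendieckGroup.cls _ (HCModule.weightSpace_mem hS b E _ p (h₃ n)))
    (fun p n => by
      obtain ⟨ε, hε⟩ := exists_isGraded_weightComplex Y b hE hσ N (fun a f => hN f) p n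
      exact ⟨_, _, ε, hε, rfl⟩) R (D.subsingleton_cochain R hR _)
  refine h.trans (Finset.sum_congr rfl fun n _ => ?_)
  rw [exists_cls_alt_eq_sum_weightSpace hS b E (U := D.restrict U) (e := e) (deg := deg) hE (h₃ n) N (fun f => hN f)]
  rfl

end CohDatum

/-- If the module `U` has a grading which is preserved by `𝔪` and `N` and whose degrees are raised by
`𝔲`, the Euler characteristic of the cohomology commutes with the multiplication by
`∑ₙ (-1)ⁿ [⋀ⁿ U*]`. -/
theorem IsAdmissiblePair.euler_weylMul {D : CohDatum P₂ P₁} {U : HCModule.{u} P₁}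
    [FiniteDimensional ℂ U] {E : HCHom (D.restrict U) (D.restrict U)} {ι : Type*} [Finite ι]
    {e : Module.Basis ι ℂ U} {deg : ι → ℕ}
    {catL : HCModule.{u} P₁ → Prop} {catM : HCModule.{u} P₂ → Prop}
    (h : IsAdmissiblePair D catL catM) (hE : ∀ i, CohDatum.endRestrict E (e i) = (deg i : ℂ) • e i)
    (hσ : ∀ y ∈ D.𝔲, ∀ i j, deg j ≤ deg i → e.repr (U.rep y (e i)) j = 0)
    (hU : ∀ n V, catL V → catL (HCModule.alt n U V))
    (hU' : ∀ n V, catM V → catM (HCModule.alt n (D.restrict U) V)) (x : GrothendieckGroup catL) :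
    h.euler (weylMul U hU x) = weylMul (D.restrict U) hU' (h.euler x) := by
  suffices key : h.euler.comp (weylMul U hU) = (weylMul (D.restrict U) hU').comp h.euler from
    DFunLike.congr_fun key x
  refine GrothendieckGroup.hom_ext fun V hV => ?_
  rw [AddMonoidHom.comp_apply, AddMonoidHom.comp_apply, weylMul_cls, map_sum, h.euler_cls, map_sum]
  simp only [map_zsmul, weylMul_cls, h.euler_cls]
  rw [show Module.finrank ℂ (D.restrict U) = Module.finrank ℂ U from rfl]
  simp only [Finset.smul_sum]
  rw [Finset.sum_comm (s := Finset.range (Module.finrank ℂ D.𝔲 + 1))]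
  refine Finset.sum_congr rfl fun b _ => ?_
  have h1 := CohDatum.sum_cls_cohomology_alt (Y := V) h.abelian_right hE hσ b
    (fun n => h.cohomology_mem n _ (hU b V hV))
    (fun n => hU' b _ (h.cohomology_mem n V hV)) (Module.finrank ℂ D.𝔲 + 1) (Nat.lt_succ_self _)
  rw [← Finset.smul_sum, h1, Finset.smul_sum]
  exact Finset.sum_congr rfl fun n _ => smul_comm _ _ _

end WeightComplex

/-! ### Fractions -/

section Fractions

open Polynomial

variable {A B : Type*} [AddCommGroup A] [AddCommGroup B]

namespace Localized

variable (w : A →+ A)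

theorem X_pow_smul_of (k : ℕ) (a : A) :
    (X ^ k : ℤ[X]) • Module.AEval'.of w.toIntLinearMap a
      = Module.AEval'.of w.toIntLinearMap (w^[k] a) := by
  induction k generalizing a with
  | zero => simp
  | succ k ih =>
    rw [pow_succ, mul_smul, Module.AEval'.X_smul_of]
    exact ih (w a)

theorem frac_eq_iff {a b : A} {k l : ℕ} : frac w a k = frac w b l ↔
    ∃ j, w^[j] (w^[l] a) = w^[j] (w^[k] b) := by
  unfold frac
  rw [LocalizedModule.mk_eq]
  constructor
  · rintro ⟨⟨_, j, rfl⟩, h⟩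
    refine ⟨j, (Module.AEval'.of w.toIntLinearMap).injective ?_⟩
    rw [← X_pow_smul_of, ← X_pow_smul_of, ← X_pow_smul_of, ← X_pow_smul_of]
    exact h
  · rintro ⟨j, h⟩
    refine ⟨⟨X ^ j, j, rfl⟩, ?_⟩
    change (X ^ j : ℤ[X]) • (X ^ l : ℤ[X]) • Module.AEval'.of w.toIntLinearMap a
      = (X ^ j : ℤ[X]) • (X ^ k : ℤ[X]) • Module.AEval'.of w.toIntLinearMap b
    rw [X_pow_smul_of, X_pow_smul_of, X_pow_smul_of, X_pow_smul_of, h]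

theorem exists_frac (z : Localized w) : ∃ a k, z = frac w a k := by
  induction z using LocalizedModule.induction_on with
  | h m s =>
    obtain ⟨_, k, rfl⟩ := s
    obtain ⟨a, rfl⟩ := (Module.AEval'.of w.toIntLinearMap).surjective m
    exact ⟨a, k, rfl⟩

theorem frac_add (a b : A) (k l : ℕ) :
    frac w a k + frac w b l = frac w (w^[l] a + w^[k] b) (k + l) := by
  unfold frac
  rw [LocalizedModule.mk_add_mk]
  have h : (⟨X ^ k, k, rfl⟩ * ⟨X ^ l, l, rfl⟩ : Submonoid.powers (X : ℤ[X]))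
      = ⟨X ^ (k + l), k + l, rfl⟩ := Subtype.ext (pow_add _ _ _).symm
  rw [h]
  congr 1
  rw [map_add, ← X_pow_smul_of, ← X_pow_smul_of]
  rfl

theorem frac_zero (k : ℕ) : frac w 0 k = 0 := map_zero (fracHom w k)

theorem frac_eq_zero_iff {a : A} {k : ℕ} : frac w a k = 0 ↔ ∃ j, w^[j] a = 0 := by
  rw [← frac_zero w 0, frac_eq_iff]
  simp only [Function.iterate_zero, id_eq, iterate_map_zero]

theorem frac_apply_succ (a : A) (k : ℕ) : frac w (w a) (k + 1) = frac w a k :=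
  (frac_eq_iff w).2 ⟨0, (Function.iterate_succ_apply w k a).symm⟩

theorem mul_frac (a : A) (k : ℕ) : mul w (frac w a k) = frac w (w a) k := by
  change (X : ℤ[X]) • frac w a k = _
  rw [frac, LocalizedModule.smul'_mk, Module.AEval'.X_smul_of]
  rfl

theorem mul_frac_succ (a : A) (k : ℕ) : mul w (frac w a (k + 1)) = frac w a k := by
  rw [mul_frac, frac_apply_succ]

theorem mul_injective : Function.Injective (mul w) := by
  rw [injective_iff_map_eq_zero]
  intro z hz
  obtain ⟨a, k, rfl⟩ := exists_frac w z
  rw [mul_frac, frac_eq_zero_iff] at hz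
  obtain ⟨j, hj⟩ := hz
  exact (frac_eq_zero_iff w).2 ⟨j + 1, hj⟩

theorem map_frac {w : A →+ A} {w' : B →+ B} {f : A →+ B} (h : ∀ a, f (w a) = w' (f a)) (a : A)
    (k : ℕ) : map w w' f h (frac w a k) = frac w' (f a) k := by
  change IsLocalizedModule.map _ _ _ _ (LocalizedModule.mk _ _) = LocalizedModule.mk _ _
  rw [IsLocalizedModule.map_LocalizedModules]
  rfl

/-- Let `f (w a) = a` after application of `T`. Then `a / wᵏ ↦ Tᵏ (f a)` is well-defined. -/
theorem exists_lift {C : Type*} [AddCommGroup C] (f : A →+ C) (T : C →+ C)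
    (hT : ∀ a, T (f (w a)) = f a) :
    ∃ e : Localized w →+ C, ∀ a k, e (frac w a k) = T^[k] (f a) := by
  have hT' : ∀ j a, T^[j] (f (w^[j] a)) = f a := by
    intro j
    induction j with
    | zero => intro a; rfl
    | succ j ih =>
      intro a
      rw [Function.iterate_succ_apply', Function.iterate_succ_apply, ih, hT]
  let F : Module.AEval' w.toIntLinearMap × Submonoid.powers (X : ℤ[X]) → C := fun p =>
    T^[(p.2 : ℤ[X]).natDegree] (f ((Module.AEval'.of w.toIntLinearMap).symm p.1))
  have hF : ∀ p q, p ≈ q → F p = F q := by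
    rintro ⟨m, s, k, rfl⟩ ⟨m', s', l, rfl⟩ ⟨⟨_, j, rfl⟩, h⟩
    obtain ⟨a, rfl⟩ := (Module.AEval'.of w.toIntLinearMap).surjective m
    obtain ⟨b, rfl⟩ := (Module.AEval'.of w.toIntLinearMap).surjective m'
    have h' : w^[j] (w^[l] a) = w^[j] (w^[k] b) :=
      (Module.AEval'.of w.toIntLinearMap).injective (by
        rw [← X_pow_smul_of, ← X_pow_smul_of, ← X_pow_smul_of, ← X_pow_smul_of]
        exact h)
    simp only [F, natDegree_X_pow, LinearEquiv.symm_apply_apply]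
    rw [← hT' l a, ← hT' j (w^[l] a), h', ← hT' k b, ← hT' j (w^[k] b)]
    exact Function.Commute.iterate_iterate_self T k l _
  have he : ∀ a k, LocalizedModule.liftOn (frac w a k) F hF = T^[k] (f a) := by
    intro a k
    refine (LocalizedModule.liftOn_mk hF _ _).trans ?_
    simp only [F, natDegree_X_pow, LinearEquiv.symm_apply_apply]
  refine ⟨AddMonoidHom.mk' (fun z => LocalizedModule.liftOn z F hF) fun x y => ?_, he⟩
  obtain ⟨a, k, rfl⟩ := exists_frac w x
  obtain ⟨b, l, rfl⟩ := exists_frac w y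
  rw [frac_add, he, he, he, map_add, iterate_map_add, Function.iterate_add_apply, hT',
    add_comm k l, Function.iterate_add_apply, hT']

end Localized

open Localized

/-- The natural extension, for homomorphisms `f : A → B` with `w' f w = w'' f`. Here `f` has the role
of the Euler characteristic and `w`, `w'`, `w''` the roles of the three Weyl denominators; the second
hypothesis holds if `w''` is a multiple of `w'`. -/
theorem existsUnique_extension (w : A →+ A) (w' w'' : B →+ B) (f : A →+ B)
    (hcomm : ∀ b, w' (w'' b) = w'' (w' b)) (hker : ∀ b, w' b = 0 → w'' b = 0)
    (hf : ∀ a, w' (f (w a)) = w'' (f a)) :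
    ∃ e : Localized w →+ Localized w'',
      ((∀ a b k, frac w' (f a) 1 = frac w' b k →
        (Localized.map w'' w'' w' hcomm)^[k] (e (frac w a 0)) = frac w'' b 0) ∧
      ∀ z, Localized.map w'' w'' w' hcomm (e (mul w z)) = mul w'' (e z)) ∧
      (∀ e' : Localized w →+ Localized w'',
        ((∀ a b k, frac w' (f a) 1 = frac w' b k →
          (Localized.map w'' w'' w' hcomm)^[k] (e' (frac w a 0)) = frac w'' b 0) ∧
        ∀ z, Localized.map w'' w'' w' hcomm (e' (mul w z)) = mul w'' (e' z)) → e' = e) ∧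
      ∀ a, e (frac w a 1) = frac w'' (f a) 1 := by
  let m := Localized.map w'' w'' w' hcomm
  have hm : ∀ b k, m (frac w'' b k) = frac w'' (w' b) k := map_frac hcomm
  have hmk : ∀ j b, m^[j] (frac w'' b 0) = frac w'' (w'^[j] b) 0 := by
    intro j
    induction j with
    | zero => intro b; rfl
    | succ j ih =>
      intro b
      rw [Function.iterate_succ_apply', ih, hm, Function.iterate_succ_apply']
  -- an element annihilated by `w'` is annihilated by `w''`, which is invertible in the fractions
  have hinj : Function.Injective m := by
    rw [injective_iff_map_eq_zero]
    intro z hz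
    obtain ⟨b, k, rfl⟩ := exists_frac w'' z
    rw [hm, frac_eq_zero_iff] at hz
    obtain ⟨j, hj⟩ := hz
    have hc : w' (w''^[j] b) = w''^[j] (w' b) := Function.Commute.iterate_right
      (show Function.Commute w' w'' from hcomm) j b
    refine (frac_eq_zero_iff w'').2 ⟨j + 1, ?_⟩
    rw [Function.iterate_succ_apply']
    exact hker _ (hc.trans hj)
  -- the multiplication by `w' / w''`
  have hbij : Function.Bijective (mul w'') := ⟨mul_injective w'', fun z => by
    obtain ⟨b, k, rfl⟩ := exists_frac w'' z
    exact ⟨_, mul_frac_succ w'' b k⟩⟩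
  let T : Localized w'' →+ Localized w'' :=
    (AddEquiv.ofBijective (mul w'') hbij).symm.toAddMonoidHom.comp m
  have hmT : ∀ z, mul w'' (T z) = m z := fun z =>
    (AddEquiv.ofBijective (mul w'') hbij).apply_symm_apply (m z)
  have hT : ∀ b k, T (frac w'' b k) = frac w'' (w' b) (k + 1) := fun b k =>
    mul_injective w'' ((hmT _).trans ((hm b k).trans (mul_frac_succ w'' _ k).symm))
  have hTf : ∀ a, T (frac w'' (f (w a)) 1) = frac w'' (f a) 1 := fun a => by
    rw [hT, hf, frac_apply_succ]
  -- the extension is `a / wᵏ ↦ Tᵏ (f (w a) / w'')`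
  obtain ⟨e, he⟩ := Localized.exists_lift w (((fracHom w'' 1).comp f).comp w) T
    (fun a => hTf (w a))
  have he : ∀ a k, e (frac w a k) = T^[k] (frac w'' (f (w a)) 1) := he
  have hme : ∀ a, m (e (frac w a 0)) = frac w'' (f a) 0 := fun a => by
    rw [he, Function.iterate_zero, id_eq, hm, hf, frac_apply_succ]
  have hew : ∀ z, m (e (mul w z)) = mul w'' (e z) := fun z => by
    obtain ⟨a, k, rfl⟩ := exists_frac w z
    rw [mul_frac, he, ← hmT, ← Function.iterate_succ_apply' T, Function.iterate_succ_apply, hTf, he]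
  refine ⟨e, ⟨fun a b k hab => ?_, fun z => ?_⟩, fun e' ⟨h1, h2⟩ => ?_, fun a => ?_⟩
  · obtain ⟨j, hj⟩ := (frac_eq_iff w').1 hab
    refine hinj.iterate (j + 1) ?_
    change m^[j + 1] (m^[k] (e (frac w a 0))) = m^[j + 1] (frac w'' b 0)
    rw [← Function.iterate_add_apply, show j + 1 + k = j + k + 1 by omega,
      Function.iterate_succ_apply, hme, hmk, hmk, Function.iterate_add_apply, hj]
    rfl
  · exact hew z
  · refine DFunLike.ext _ _ fun z => ?_
    obtain ⟨a, k, rfl⟩ := exists_frac w z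
    induction k with
    | zero => exact hinj ((h1 a (f a) 1 rfl).trans (hme a).symm)
    | succ k ih =>
      refine mul_injective w'' ?_
      rw [← h2, ← hew, mul_frac_succ, ih]
  · rw [he, Function.iterate_one, hTf]

end Fractions

section Extension

variable {𝔪 N : Type*} {𝔩 : Type u} {M : Type*} {𝔤 : Type u} {K : Type*} [LieRing 𝔪]
  [LieAlgebra ℂ 𝔪] [Group N] [TopologicalSpace N] [IsTopologicalGroup N] [LieRing 𝔩]
  [LieAlgebra ℂ 𝔩] [FiniteDimensional ℂ 𝔩] [Group M] [TopologicalSpace M] [IsTopologicalGroup M]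
  [LieRing 𝔤] [LieAlgebra ℂ 𝔤] [FiniteDimensional ℂ 𝔤] [Group K] [TopologicalSpace K]
  [IsTopologicalGroup K] {P₂ : LiePair 𝔪 N} {P₁ : LiePair 𝔩 M} {P : LiePair 𝔤 K}
  {D : CohDatum P₁ P} {D' : CohDatum P₂ P₁} {D'' : CohDatum P₂ P}
  {catG : HCModule.{u} P → Prop} {catL : HCModule.{u} P₁ → Prop} {catM : HCModule.{u} P₂ → Prop}
  {h : IsAdmissiblePair D catG catL} {h' : IsAdmissiblePair D' catL catM}
  {h'' : IsAdmissiblePair D'' catG catM} {KG : AddSubgroup (GrothendieckGroup catG)}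
  {KL : AddSubgroup (GrothendieckGroup catL)} {KM : AddSubgroup (GrothendieckGroup catM)}

/-- The transitivity of characters for a composition of data, such that the nilpotent algebra of `D`
has a grading which is preserved by `D'` and whose degrees are raised by the nilpotent algebra of
`D'`. -/
theorem CohDatum.IsTower.existsUnique_isNaturalExtension (T : CohDatum.IsTower D D' D'')
    {E : HCHom (D'.restrict D.nil) (D'.restrict D.nil)} {ι : Type*} [Finite ι]
    {e : Module.Basis ι ℂ D.nil} {deg : ι → ℕ}
    (hE : ∀ i, CohDatum.endRestrict E (e i) = (deg i : ℂ) • e i)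
    (hσ : ∀ y ∈ D'.𝔲, ∀ i j, deg j ≤ deg i → e.repr (D.nil.rep y (e i)) j = 0)
    (Q : IsAdmissibleQuadruple h KG KL) (Q' : IsAdmissibleQuadruple h' KL KM)
    (Q'' : IsAdmissibleQuadruple h'' KG KM) :
    ∃ e : Q.CharGroup →+ Q''.CharGroup, IsNaturalExtension Q Q' Q'' e ∧
      (∀ e' : Q.CharGroup →+ Q''.CharGroup, IsNaturalExtension Q Q' Q'' e' → e' = e) ∧
      ∀ X : KG, Q''.char X = e (Q.char X) := by
  have hcomm := weylMul_comm h'.abelian_right D'.nil (D'.restrict D.nil) h'.tensor_mem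
    (T.tensor_mem h'')
  obtain ⟨e, ⟨h1, h2⟩, h3, h4⟩ := existsUnique_extension Q.weyl Q'.weyl Q''.weyl Q'.euler
    (weyl_comm Q' Q'')
    (fun b hb => Subtype.ext (by
      have hb : weylMul D'.nil h'.tensor_mem b = 0 := congrArg Subtype.val hb
      refine (T.weyl_eq h' h'' b).trans ((hcomm b).trans ?_)
      rw [hb, map_zero]
      rfl))
    (fun a => Subtype.ext (by
      refine Eq.trans ?_ (T.weyl_eq h' h'' _).symm
      exact congrArg h'.weyl (h'.euler_weylMul hE hσ h.tensor_mem (T.tensor_mem h'') a)))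
  refine ⟨e, ⟨h1, h2⟩, fun e' he' => h3 e' ⟨he'.1, he'.2⟩, fun X => ?_⟩
  refine Eq.trans ?_ (h4 (Q.euler X)).symm
  exact congrArg (fun b => Localized.frac Q''.weyl b 1)
    (Subtype.ext (T.euler_euler h h' h'' X))

end Extension

/-! ### The action of the nilpotent radical on modules -/

section Nilpotent

variable {L M : Type*} [LieRing L] [LieAlgebra ℂ L] [FiniteDimensional ℂ L] [AddCommGroup M]
  [Module ℂ M] [LieRingModule L M] [LieModule ℂ L M] [FiniteDimensional ℂ M]

/-- The ideal `[L, rad L]` annihilates a nonzero vector of every nonzero module: on a weight space of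
`rad L`, the brackets in `[L, rad L]` act as scalars of trace zero. -/
theorem exists_ne_zero_forall_lie_eq_zero (L M : Type*) [LieRing L] [LieAlgebra ℂ L]
    [FiniteDimensional ℂ L] [AddCommGroup M] [Module ℂ M] [LieRingModule L M] [LieModule ℂ L M]
    [FiniteDimensional ℂ M] [Nontrivial M] :
    ∃ m : M, m ≠ 0 ∧ ∀ u ∈ ⁅(⊤ : LieIdeal ℂ L), LieAlgebra.radical ℂ L⁆, ⁅u, m⁆ = 0 := by
  obtain ⟨χ, hχ⟩ := LieModule.exists_nontrivial_weightSpace_of_isSolvable ℂ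
    (LieAlgebra.radical ℂ L) M
  let N : LieSubmodule ℂ L M := LieModule.weightSpaceOfIsLieTower ℂ M χ
  have hN : Nontrivial N := hχ
  have hact : ∀ (s : L) (hs : s ∈ LieAlgebra.radical ℂ L) (m : M), m ∈ N →
      ⁅s, m⁆ = χ ⟨s, hs⟩ • m := fun s hs m hm =>
    (LieModule.mem_weightSpace χ m).1 hm ⟨s, hs⟩
  let A : L →ₗ[ℂ] Module.End ℂ N := (LieModule.toEnd ℂ L N : L →ₗ[ℂ] Module.End ℂ N)
  have hA : ∀ x s : L, A ⁅x, s⁆ = A x * A s - A s * A x := fun x s =>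
    LinearMap.ext fun m => lie_lie x s m
  have hle : (⁅(⊤ : LieIdeal ℂ L), LieAlgebra.radical ℂ L⁆ : LieIdeal ℂ L).toSubmodule
      ≤ LinearMap.ker A := by
    rw [LieSubmodule.lieIdeal_oper_eq_linear_span', Submodule.span_le]
    rintro _ ⟨x, -, s, hs, rfl⟩
    have hxs := lie_mem_right ℂ L (LieAlgebra.radical ℂ L) x s hs
    have h1 : A ⁅x, s⁆ = χ ⟨⁅x, s⁆, hxs⟩ • 1 :=
      LinearMap.ext fun m => Subtype.ext (hact _ hxs m m.2)
    have h2 : LinearMap.trace ℂ N (A ⁅x, s⁆) = 0 := by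
      rw [hA, map_sub, LinearMap.trace_mul_comm, sub_self]
    rw [h1, map_smul, LinearMap.trace_one, smul_eq_mul, mul_eq_zero, Nat.cast_eq_zero] at h2
    change A ⁅x, s⁆ = 0
    rw [h1, h2.resolve_right Module.finrank_pos.ne', zero_smul]
  obtain ⟨m, hm⟩ := exists_ne (0 : N)
  refine ⟨m, fun h => hm (Subtype.ext h), fun u hu => ?_⟩
  exact congrArg Subtype.val (LinearMap.congr_fun (hle hu) m)

/-- The coinvariants of the ideal `[L, rad L]` in a nonzero module do not vanish, by the existence of
invariants in the dual module. -/
theorem lie_lt (N : LieSubmodule ℂ L M) (hN : N ≠ ⊥) :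
    ⁅⁅(⊤ : LieIdeal ℂ L), LieAlgebra.radical ℂ L⁆, N⁆ < N := by
  refine lt_of_le_of_ne (LieSubmodule.lie_le_right _ _) fun h => ?_
  have hn : Nontrivial N := (LieSubmodule.nontrivial_iff_ne_bot ℂ L M).2 hN
  -- an invariant linear form on `N`
  obtain ⟨f, hf, hf'⟩ := exists_ne_zero_forall_lie_eq_zero L (N →ₗ[ℂ] ℂ)
  refine hf (LinearMap.ext fun n => ?_)
  have hle : (⁅⁅(⊤ : LieIdeal ℂ L), LieAlgebra.radical ℂ L⁆, N⁆ : LieSubmodule ℂ L M).toSubmodule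
      ≤ (LinearMap.ker f).map N.toSubmodule.subtype := by
    rw [LieSubmodule.lieIdeal_oper_eq_linear_span', Submodule.span_le]
    rintro _ ⟨u, hu, m, hm, rfl⟩
    refine ⟨(⁅u, (⟨m, hm⟩ : N)⁆ : N), ?_, rfl⟩
    have := LinearMap.congr_fun (hf' u hu) ⟨m, hm⟩
    rw [Module.Dual.lie_apply] at this
    exact neg_eq_zero.1 this
  obtain ⟨m, hm, hmn⟩ := hle (by rw [h]; exact n.2)
  rw [← Subtype.ext hmn]
  exact hm

variable (L M) in
/-- The ideal `[L, rad L]` acts nilpotently on every module. -/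
theorem exists_lcs_eq_bot :
    ∃ k, (⁅(⊤ : LieIdeal ℂ L), LieAlgebra.radical ℂ L⁆ : LieIdeal ℂ L).lcs M k = ⊥ := by
  suffices key : ∀ (d : ℕ) (N : LieSubmodule ℂ L M), Module.finrank ℂ N ≤ d → ∃ k,
      (fun N : LieSubmodule ℂ L M => ⁅⁅(⊤ : LieIdeal ℂ L), LieAlgebra.radical ℂ L⁆, N⁆)^[k] N = ⊥ from
    key _ ⊤ le_rfl
  intro d
  induction d with
  | zero =>
    intro N hN
    refine ⟨0, ?_⟩
    rw [← LieSubmodule.toSubmodule_eq_bot]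
    exact Submodule.finrank_eq_zero.1 (Nat.le_zero.1 hN)
  | succ d ih =>
    intro N hN
    by_cases h0 : N = ⊥
    · exact ⟨0, h0⟩
    · have h1 := Submodule.finrank_lt_finrank_of_lt
        (show (⁅⁅(⊤ : LieIdeal ℂ L), LieAlgebra.radical ℂ L⁆, N⁆ : LieSubmodule ℂ L M).toSubmodule
          < N.toSubmodule from lie_lt N h0)
      obtain ⟨k, hk⟩ := ih ⁅⁅(⊤ : LieIdeal ℂ L), LieAlgebra.radical ℂ L⁆, N⁆
        (Nat.le_of_lt_succ (h1.trans_le hN))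
      exact ⟨k + 1, hk⟩

/-- The ideal `[L, rad L]` is orthogonal to `L` for the trace form of every module. -/
theorem trace_toEnd_mul_eq_zero {u : L} (hu : u ∈ ⁅(⊤ : LieIdeal ℂ L), LieAlgebra.radical ℂ L⁆)
    (x : L) :
    LinearMap.trace ℂ M (LieModule.toEnd ℂ L M u * LieModule.toEnd ℂ L M x) = 0 := by
  obtain ⟨k, hk⟩ := exists_lcs_eq_bot L M
  refine (LinearMap.isNilpotent_trace_of_isNilpotent ⟨k, LinearMap.ext fun m => ?_⟩).eq_zero
  have key : ∀ j, ((LieModule.toEnd ℂ L M u * LieModule.toEnd ℂ L M x) ^ j) m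
      ∈ (⁅(⊤ : LieIdeal ℂ L), LieAlgebra.radical ℂ L⁆ : LieIdeal ℂ L).lcs M j := by
    intro j
    induction j with
    | zero => exact LieSubmodule.mem_top _
    | succ j ih =>
      rw [pow_succ', LieIdeal.lcs_succ]
      exact LieSubmodule.lie_mem_lie hu (LieSubmodule.lie_mem _ ih)
  have := key k
  rwa [hk, LieSubmodule.mem_bot] at this

end Nilpotent

section Borel

/-- An extension of solvable Lie algebras is solvable. -/
theorem isSolvable_of_hom {H Q : Type*} [LieRing H] [LieAlgebra ℂ H] [LieRing Q] [LieAlgebra ℂ Q]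
    (f : H →ₗ⁅ℂ⁆ Q) [hQ : LieAlgebra.IsSolvable Q] [hf : LieAlgebra.IsSolvable f.ker] :
    LieAlgebra.IsSolvable H := by
  obtain ⟨k, hk⟩ := LieAlgebra.IsSolvable.solvable ℂ Q
  obtain ⟨l, hl⟩ := LieAlgebra.IsSolvable.solvable ℂ f.ker
  refine LieAlgebra.IsSolvable.mk (R := ℂ) (k := l + k) ?_
  have h1 : LieAlgebra.derivedSeries ℂ H k ≤ f.ker := by
    rw [← LieIdeal.map_eq_bot_iff, eq_bot_iff, ← hk]
    exact LieIdeal.derivedSeries_map_le k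
  rw [LieIdeal.derivedSeries_eq_bot_iff] at hl
  rw [LieAlgebra.derivedSeries_def, LieAlgebra.derivedSeriesOfIdeal_add, eq_bot_iff, ← hl]
  exact LieAlgebra.derivedSeriesOfIdeal_mono h1 l

variable {L : Type*} [LieRing L] [LieAlgebra ℂ L] [FiniteDimensional ℂ L]

/-- A Borel subalgebra contained in `𝔮` contains the radical of `𝔮`. -/
theorem mem_of_mem_radical {𝔟 𝔮 : LieSubalgebra ℂ L}
    (h : Maximal (fun 𝔟 : LieSubalgebra ℂ L => LieAlgebra.IsSolvable 𝔟) 𝔟) (hle : 𝔟 ≤ 𝔮) {x : 𝔮}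
    (hx : x ∈ LieAlgebra.radical ℂ 𝔮) : (x : L) ∈ 𝔟 := by
  let R : Submodule ℂ L := (LieAlgebra.radical ℂ 𝔮).toSubmodule.map 𝔮.toSubmodule.subtype
  have hR : ∀ a ∈ 𝔮, ∀ r ∈ R, ⁅a, r⁆ ∈ R := by
    rintro a ha _ ⟨r, hr, rfl⟩
    exact ⟨⁅(⟨a, ha⟩ : 𝔮), r⁆, lie_mem_right ℂ 𝔮 _ _ _ hr, rfl⟩
  have hRq : R ≤ 𝔮.toSubmodule := by
    rintro _ ⟨r, -, rfl⟩
    exact r.2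
  -- the subalgebra `𝔟 + rad 𝔮` is solvable: modulo `rad 𝔮`, it is an image of `𝔟`
  let H : LieSubalgebra ℂ L :=
    { toSubmodule := 𝔟.toSubmodule ⊔ R
      lie_mem' := by
        intro a c ha hc
        obtain ⟨b, hb, r, hr, rfl⟩ := Submodule.mem_sup.1 ha
        obtain ⟨b', hb', r', hr', rfl⟩ := Submodule.mem_sup.1 hc
        rw [add_lie, lie_add, lie_add, add_assoc]
        refine Submodule.add_mem_sup (𝔟.lie_mem hb hb') (R.add_mem (hR _ (hle hb) _ hr')
          (R.add_mem ?_ (hR _ (hRq hr) _ hr')))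
        rw [← lie_skew]
        exact R.neg_mem (hR _ (hle hb') _ hr) }
  have hHq : H ≤ 𝔮 := sup_le (a := 𝔟.toSubmodule) hle hRq
  have hbH : 𝔟 ≤ H := le_sup_left (a := 𝔟.toSubmodule)
  let π : 𝔮 →ₗ⁅ℂ⁆ 𝔮 ⧸ LieAlgebra.radical ℂ 𝔮 :=
    { (LieSubmodule.Quotient.mk' (LieAlgebra.radical ℂ 𝔮) : 𝔮 →ₗ[ℂ] _) with map_lie' := rfl }
  have hπ : ∀ y : 𝔮, π y = 0 ↔ y ∈ LieAlgebra.radical ℂ 𝔮 := fun y =>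
    LieSubmodule.Quotient.mk_eq_zero'
  let g := π.comp (LieSubalgebra.inclusion hle)
  have hb : LieAlgebra.IsSolvable 𝔟 := h.prop
  let f : H →ₗ⁅ℂ⁆ g.range :=
    { toFun := fun y => ⟨π ⟨y, hHq y.2⟩, by
        obtain ⟨b, hb, r, ⟨r', hr', hrr⟩, hy⟩ := Submodule.mem_sup.1 y.2
        refine ⟨⟨b, hb⟩, ?_⟩
        rw [← sub_eq_zero]
        refine (map_sub π _ _).symm.trans ((hπ _).2 ?_)
        have : (⟨b, hle hb⟩ - ⟨y, hHq y.2⟩ : 𝔮) = - r' := Subtype.ext (by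
          change b - (y : L) = - (r' : L)
          rw [← hy, ← hrr]
          exact sub_add_cancel_left _ _)
        change (⟨b, hle hb⟩ - ⟨y, hHq y.2⟩ : 𝔮) ∈ _
        rw [this]
        exact neg_mem hr'⟩
      map_add' := fun y z => Subtype.ext (map_add π (⟨y, hHq y.2⟩ : 𝔮) ⟨z, hHq z.2⟩)
      map_smul' := fun c y => Subtype.ext (map_smul π c (⟨y, hHq y.2⟩ : 𝔮))
      map_lie' := fun {y z} =>
        Subtype.ext (LieHom.map_lie π ⟨y, hHq y.2⟩ ⟨z, hHq z.2⟩) }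
  have hf : ∀ y : f.ker, (⟨(y : H), hHq (y : H).2⟩ : 𝔮) ∈ LieAlgebra.radical ℂ 𝔮 := fun y =>
    (hπ _).1 (congrArg Subtype.val (LieHom.mem_ker.1 y.2))
  let i : f.ker →ₗ⁅ℂ⁆ LieAlgebra.radical ℂ 𝔮 :=
    { toFun := fun y => ⟨⟨(y : H), hHq (y : H).2⟩, hf y⟩
      map_add' := fun y z => rfl
      map_smul' := fun c y => rfl
      map_lie' := rfl }
  have hi : Function.Injective i := fun y z hyz => Subtype.ext (Subtype.ext
    (congrArg (fun t : LieAlgebra.radical ℂ 𝔮 => ((t : 𝔮) : L)) hyz))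
  have hker : LieAlgebra.IsSolvable f.ker := hi.lieAlgebra_isSolvable
  have hH : LieAlgebra.IsSolvable H := isSolvable_of_hom f
  exact h.le_of_ge hH hbH (le_sup_right (a := 𝔟.toSubmodule) ⟨x, hx, rfl⟩)

end Borel

/-! ### Adjoints and orthogonal projections -/

section Hermitian

variable {V : Type*} [AddCommGroup V] [Module ℂ V] (c : InnerProductSpace.Core ℂ V)

/-- `A` and `A'` are adjoint with respect to the Hermitian form `c`. -/
def IsAdjoint (A A' : Module.End ℂ V) : Prop := ∀ x y, c.inner (A x) y = c.inner x (A' y)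

variable {c}

theorem inner_sub_right (x y z : V) : c.inner x (y - z) = c.inner x y - c.inner x z := by
  let _ := @InnerProductSpace.Core.toNormedAddCommGroup ℂ V _ _ _ c
  let _ := InnerProductSpace.ofCore c.toCore
  exact _root_.inner_sub_right (𝕜 := ℂ) x y z

theorem inner_zero_right (x : V) : c.inner x 0 = 0 := by
  simpa using inner_sub_right (c := c) x 0 0

/-- The Frobenius norm is definite. -/
theorem IsAdjoint.eq_zero_of_trace [FiniteDimensional ℂ V] {A A' : Module.End ℂ V}
    (h : IsAdjoint c A A') (ht : LinearMap.trace ℂ V (A' * A) = 0) : A = 0 := by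
  let _ := @InnerProductSpace.Core.toNormedAddCommGroup ℂ V _ _ _ c
  let _ := InnerProductSpace.ofCore c.toCore
  let b := stdOrthonormalBasis ℂ V
  rw [LinearMap.trace_eq_sum_inner _ b] at ht
  have h1 : ∀ i, inner ℂ (b i) ((A' * A) (b i)) = ((‖A (b i)‖ ^ 2 : ℝ) : ℂ) := fun i => by
    have h2 := inner_self_eq_norm_sq_to_K (𝕜 := ℂ) (A (b i))
    rw [Complex.ofReal_pow]
    exact (h (b i) (A (b i))).symm.trans h2
  simp_rw [h1] at ht
  rw [← Complex.ofReal_sum, Complex.ofReal_eq_zero,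
    Finset.sum_eq_zero_iff_of_nonneg fun i _ => sq_nonneg _] at ht
  refine b.toBasis.ext fun i => ?_
  have h3 := ht i (Finset.mem_univ i)
  rw [b.coe_toBasis, LinearMap.zero_apply]
  exact norm_eq_zero.1 (pow_eq_zero_iff two_ne_zero |>.1 h3)

variable (c) in
/-- `P` is the orthogonal projection to `S`. -/
structure IsOrthogonalProjection (S : Submodule ℂ V) (P : Module.End ℂ V) : Prop where
  mem : ∀ x, P x ∈ S
  inner_eq_zero : ∀ s ∈ S, ∀ x, c.inner s (x - P x) = 0

variable (c) in
theorem exists_isOrthogonalProjection [FiniteDimensional ℂ V] (S : Submodule ℂ V) :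
    ∃ P, IsOrthogonalProjection c S P := by
  let _ := @InnerProductSpace.Core.toNormedAddCommGroup ℂ V _ _ _ c
  let _ := InnerProductSpace.ofCore c.toCore
  refine ⟨(S.starProjection : V →ₗ[ℂ] V), fun x => S.starProjection_apply_mem x, fun s hs x => ?_⟩
  exact (Submodule.mem_orthogonal S _).1 (S.sub_starProjection_mem_orthogonal x) s hs

namespace IsOrthogonalProjection

variable {S T : Submodule ℂ V} {P Q : Module.End ℂ V}

/-- The characterization of the orthogonal projection of `x`. -/
theorem apply_eq (h : IsOrthogonalProjection c S P) {x y : V} (hy : y ∈ S)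
    (hxy : ∀ s ∈ S, c.inner s (x - y) = 0) : P x = y := by
  have h1 := h.inner_eq_zero _ (S.sub_mem (h.mem x) hy) x
  have h2 := hxy _ (S.sub_mem (h.mem x) hy)
  refine sub_eq_zero.1 (c.definite _ ?_)
  rw [show P x - y = (x - y) - (x - P x) by abel, inner_sub_right]
  rw [show (x - y) - (x - P x) = P x - y by abel, h1, h2, sub_zero]

theorem apply_eq_self (h : IsOrthogonalProjection c S P) {x : V} (hx : x ∈ S) : P x = x :=
  h.apply_eq hx fun s _ => by rw [sub_self, inner_zero_right]

/-- The projection commutes with an operator `A` if `A` and its adjoint preserve the subspace. -/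
theorem comm (h : IsOrthogonalProjection c S P) {A A' : Module.End ℂ V} (hA : IsAdjoint c A' A)
    (hS : ∀ s ∈ S, A s ∈ S) (hS' : ∀ s ∈ S, A' s ∈ S) (x : V) : P (A x) = A (P x) :=
  h.apply_eq (hS _ (h.mem x)) fun s hs => by
    rw [← map_sub, ← hA]
    exact h.inner_eq_zero _ (hS' s hs) x

theorem apply_apply_of_le (hP : IsOrthogonalProjection c S P) (hQ : IsOrthogonalProjection c T Q)
    (h : S ≤ T) (x : V) : P (Q x) = P x :=
  hP.apply_eq (hP.mem x) fun s hs => by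
    rw [show Q x - P x = (x - P x) - (x - Q x) by abel, inner_sub_right, hP.inner_eq_zero s hs,
      hQ.inner_eq_zero s (h hs), sub_zero]

end IsOrthogonalProjection

end Hermitian

section AdEnd

variable {L : Type*} [LieRing L] [LieAlgebra ℂ L]

theorem adEnd_zero_left : adEnd (0 : L) = 0 := LinearMap.ext fun z => zero_lie z

theorem adEnd_add_left (x y : L) : adEnd (x + y) = adEnd x + adEnd y :=
  LinearMap.ext fun z => add_lie x y z

/-- The bracket in the complexification. The notation `⁅_, _⁆` for elements of the tensor product
would denote the action of the Lie algebra `ℂ ⊗ 𝔤₀` on the module `ℂ ⊗ 𝔤₀`; `adEnd` denotes the bracket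
of the Lie algebra. -/
theorem adEnd_tmul {𝔤₀ : Type*} [LieRing 𝔤₀] [LieAlgebra ℝ 𝔤₀] (a b : ℂ) (x y : 𝔤₀) :
    adEnd (a ⊗ₜ x : Complexification 𝔤₀) (b ⊗ₜ y : Complexification 𝔤₀) = (a * b) ⊗ₜ[ℝ] ⁅x, y⁆ :=
  LieAlgebra.ExtendScalars.bracket_tmul ..

theorem exists_eq_tmul_add_tmul {𝔤₀ : Type*} [LieRing 𝔤₀] [LieAlgebra ℝ 𝔤₀]
    (z : Complexification 𝔤₀) :
    ∃ a b : 𝔤₀, z = (1 : ℂ) ⊗ₜ[ℝ] a + Complex.I ⊗ₜ[ℝ] b := by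
  induction z using TensorProduct.induction_on with
  | zero => exact ⟨0, 0, by simp⟩
  | add x y h₁ h₂ =>
    obtain ⟨a, b, rfl⟩ := h₁
    obtain ⟨a', b', rfl⟩ := h₂
    exact ⟨a + a', b + b', by rw [TensorProduct.tmul_add, TensorProduct.tmul_add]; abel⟩
  | tmul c x =>
    refine ⟨c.re • x, c.im • x, ?_⟩
    rw [← TensorProduct.smul_tmul, ← TensorProduct.smul_tmul, ← TensorProduct.add_tmul,
      Complex.real_smul, Complex.real_smul, mul_one, Complex.re_add_im]

end AdEnd

namespace ReductivePair

variable {E : Type*} [NormedAddCommGroup E] [NormedSpace ℝ E] [FiniteDimensional ℝ E]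
  {K : Type*} [TopologicalSpace K] [ChartedSpace E K] [Group K]
  [LieGroup 𝓘(ℝ, E) ((⊤ : ℕ∞) : WithTop ℕ∞) K] [IsTopologicalGroup K] [CompactSpace K]
  [T2Space K] {𝔤₀ : Type u} [LieRing 𝔤₀] [LieAlgebra ℝ 𝔤₀] (R : ReductivePair E 𝔤₀ K)

/-! ### The Hermitian form of a reductive pair -/

theorem B_θ_comm (x y : 𝔤₀) : R.B (R.θ x) y = R.B (R.θ y) x := by
  rw [← R.B_θ, R.θ_θ, R.B_symm]

/-- The form `-B(θ x, y)` on `𝔤₀` is positive definite. -/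
theorem B_θ_self_neg {x : 𝔤₀} (hx : x ≠ 0) : R.B (R.θ x) x < 0 := by
  set p := x + R.θ x with hp
  set m := x - R.θ x with hm
  have hθp : R.θ p = p := by rw [hp, map_add, R.θ_θ, add_comm]
  have hθm : R.θ m = - m := by rw [hm, map_sub, R.θ_θ, neg_sub]
  have key : 4 * R.B (R.θ x) x = R.B p p - R.B m m := by
    simp only [hp, hm, map_add, map_sub, LinearMap.add_apply, LinearMap.sub_apply]
    rw [R.B_symm x (R.θ x)]
    ring
  have h1 : R.B p p ≤ 0 := by
    by_cases h : p = 0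
    · rw [h, map_zero]
    · exact (R.B_neg p hθp h).le
  have h2 : 0 ≤ R.B m m := by
    by_cases h : m = 0
    · rw [h, map_zero]
    · exact (R.B_pos m hθm h).le
  by_cases h : p = 0
  · have hm0 : m ≠ 0 := fun h' => hx (by
      have : (2 : ℝ) • x = p + m := by rw [hp, hm]; module
      rw [h, h', add_zero] at this
      exact (smul_eq_zero.1 this).resolve_left two_ne_zero)
    have := R.B_pos m hθm hm0
    linarith
  · have := R.B_neg p hθp h
    linarith

theorem θ_Ad_of_fixed (k : K) {x : 𝔤₀} (hx : R.θ x = x) : R.θ (R.Ad k x) = R.Ad k x := by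
  obtain ⟨v, rfl⟩ := (R.θ_eq_iff x).1 hx
  exact (R.θ_eq_iff _).2 ⟨_, (R.Ad_ι k v).symm⟩

/-- `Ad k` preserves the `-1`-eigenspace of `θ`, the orthogonal complement of the `1`-eigenspace;
so it commutes with `θ`. -/
theorem θ_Ad (k : K) (x : 𝔤₀) : R.θ (R.Ad k x) = R.Ad k (R.θ x) := by
  have hneg : ∀ m, R.θ m = - m → R.θ (R.Ad k m) = - R.Ad k m := by
    intro m hm
    -- the component of `Ad k m` in the `1`-eigenspace
    set w := R.Ad k m + R.θ (R.Ad k m) with hw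
    have hθw : R.θ w = w := by rw [hw, map_add, R.θ_θ, add_comm]
    have hθw' := R.θ_Ad_of_fixed k⁻¹ hθw
    have hk : R.Ad k (R.Ad k⁻¹ w) = w := by
      rw [← Module.End.mul_apply, ← map_mul, mul_inv_cancel, map_one, Module.End.one_apply]
    have h1 : R.B (R.Ad k m) w = 0 := by
      have h2 := R.B_Ad k m (R.Ad k⁻¹ w)
      have h3 := R.B_θ m (R.Ad k⁻¹ w)
      rw [hk] at h2
      rw [hm, hθw', map_neg, LinearMap.neg_apply] at h3
      linarith
    have h2 : R.B (R.θ (R.Ad k m)) w = 0 := by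
      have h3 := R.B_θ (R.Ad k m) w
      rw [hθw] at h3
      rw [h3, h1]
    have h3 : R.B w w = 0 := by
      conv_lhs => rw [hw]
      rw [map_add, ← hw, R.B_symm w, R.B_symm w, h1, h2, add_zero]
    have h4 : w = 0 := by
      by_contra h
      exact (R.B_neg w hθw h).ne h3
    exact eq_neg_of_add_eq_zero_right h4
  have hp := R.θ_Ad_of_fixed k (x := x + R.θ x) (by rw [map_add, R.θ_θ, add_comm])
  have hm := hneg (x - R.θ x) (by rw [map_sub, R.θ_θ, neg_sub])
  simp only [map_add, map_sub] at hp hm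
  have h5 : (2 : ℝ) • R.θ (R.Ad k x) = (2 : ℝ) • R.Ad k (R.θ x) := by
    have := congrArg₂ (fun a b : 𝔤₀ => a + b) hp hm
    beta_reduce at this
    calc (2 : ℝ) • R.θ (R.Ad k x) = (R.θ (R.Ad k x) + R.θ (R.Ad k (R.θ x)))
          + (R.θ (R.Ad k x) - R.θ (R.Ad k (R.θ x))) := by module
      _ = _ := by rw [this]; module
  exact smul_right_injective _ (two_ne_zero (α := ℝ)) h5

/-- The conjugate linear extension of `θ` to the complexification. -/
def τ : Complexification 𝔤₀ →ₗ[ℝ] Complexification 𝔤₀ :=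
  TensorProduct.map (Complex.conjAe : ℂ →ₗ[ℝ] ℂ) (R.θ : 𝔤₀ →ₗ[ℝ] 𝔤₀)

theorem τ_tmul (a : ℂ) (x : 𝔤₀) : R.τ (a ⊗ₜ x) = (starRingEnd ℂ a) ⊗ₜ[ℝ] R.θ x := rfl

theorem τ_smul (a : ℂ) (x : Complexification 𝔤₀) : R.τ (a • x) = starRingEnd ℂ a • R.τ x := by
  induction x using TensorProduct.induction_on with
  | zero => simp
  | add x y h₁ h₂ => rw [smul_add, map_add, h₁, h₂, map_add, smul_add]
  | tmul b x => rw [TensorProduct.smul_tmul', τ_tmul, τ_tmul, TensorProduct.smul_tmul',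
      smul_eq_mul, smul_eq_mul, map_mul]

theorem τ_τ (x : Complexification 𝔤₀) : R.τ (R.τ x) = x := by
  induction x using TensorProduct.induction_on with
  | zero => simp
  | add x y h₁ h₂ => rw [map_add, map_add, h₁, h₂]
  | tmul b x => rw [τ_tmul, τ_tmul, R.θ_θ, Complex.conj_conj]

theorem τ_lie (x y : Complexification 𝔤₀) : R.τ (adEnd x y) = adEnd (R.τ x) (R.τ y) := by
  induction x using TensorProduct.induction_on with
  | zero => simp only [adEnd_zero_left, map_zero, LinearMap.zero_apply]
  | add x z h₁ h₂ =>
    simp only [adEnd_add_left, map_add, LinearMap.add_apply, h₁, h₂]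
  | tmul a x =>
    induction y using TensorProduct.induction_on with
    | zero => simp only [map_zero]
    | add y z h₁ h₂ => simp only [map_add, h₁, h₂]
    | tmul b y =>
      rw [adEnd_tmul, τ_tmul, τ_tmul, τ_tmul, adEnd_tmul, map_mul, LieHom.map_lie]

theorem τ_AdC (k : K) (x : Complexification 𝔤₀) : R.τ (R.AdC k x) = R.AdC k (R.τ x) := by
  induction x using TensorProduct.induction_on with
  | zero => simp
  | add x y h₁ h₂ => rw [map_add, map_add, h₁, h₂, map_add, map_add]
  | tmul b x => rw [AdC_tmul, τ_tmul, τ_tmul, AdC_tmul, R.θ_Ad]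

/-- The complex bilinear extension of `B`. -/
def BC : LinearMap.BilinForm ℂ (Complexification 𝔤₀) := LinearMap.BilinForm.baseChange ℂ R.B

theorem BC_tmul (a b : ℂ) (x y : 𝔤₀) : R.BC (a ⊗ₜ x) (b ⊗ₜ y) = (R.B x y) • (a * b) := rfl

theorem BC_symm (x y : Complexification 𝔤₀) : R.BC x y = R.BC y x := by
  induction x using TensorProduct.induction_on with
  | zero => simp
  | add x z h₁ h₂ => rw [map_add, LinearMap.add_apply, h₁, h₂, map_add]
  | tmul a x =>
    induction y using TensorProduct.induction_on with
    | zero => simp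
    | add y z h₁ h₂ => rw [map_add, h₁, h₂, map_add, LinearMap.add_apply]
    | tmul b y => rw [BC_tmul, BC_tmul, R.B_symm, mul_comm]

theorem BC_τ (x y : Complexification 𝔤₀) :
    R.BC (R.τ x) (R.τ y) = starRingEnd ℂ (R.BC x y) := by
  induction x using TensorProduct.induction_on with
  | zero => simp
  | add x z h₁ h₂ => simp only [map_add, LinearMap.add_apply, h₁, h₂]
  | tmul a x =>
    induction y using TensorProduct.induction_on with
    | zero => simp
    | add y z h₁ h₂ => simp only [map_add, h₁, h₂]
    | tmul b y =>
      rw [τ_tmul, τ_tmul, BC_tmul, BC_tmul, R.B_θ, Complex.real_smul, Complex.real_smul, map_mul,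
        map_mul, Complex.conj_ofReal]

theorem BC_lie (x y z : Complexification 𝔤₀) : R.BC (adEnd x y) z = - R.BC y (adEnd x z) := by
  induction x using TensorProduct.induction_on with
  | zero => simp only [adEnd_zero_left, map_zero, LinearMap.zero_apply, neg_zero]
  | add x x' h₁ h₂ =>
    simp only [adEnd_add_left, map_add, LinearMap.add_apply, h₁, h₂, neg_add]
  | tmul a x =>
    induction y using TensorProduct.induction_on with
    | zero => simp only [map_zero, LinearMap.zero_apply, neg_zero]
    | add y y' h₁ h₂ => simp only [map_add, LinearMap.add_apply, h₁, h₂, neg_add]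
    | tmul b y =>
      induction z using TensorProduct.induction_on with
      | zero => simp only [map_zero, neg_zero]
      | add z z' h₁ h₂ => simp only [map_add, h₁, h₂, neg_add]
      | tmul d z =>
        rw [adEnd_tmul, adEnd_tmul, BC_tmul, BC_tmul, R.B_lie, neg_smul, mul_comm a b, mul_assoc]

theorem BC_AdC (k : K) (x y : Complexification 𝔤₀) : R.BC (R.AdC k x) (R.AdC k y) = R.BC x y := by
  induction x using TensorProduct.induction_on with
  | zero => simp
  | add x z h₁ h₂ => simp only [map_add, LinearMap.add_apply, h₁, h₂]
  | tmul a x =>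
    induction y using TensorProduct.induction_on with
    | zero => simp
    | add y z h₁ h₂ => simp only [map_add, h₁, h₂]
    | tmul b y => rw [AdC_tmul, AdC_tmul, BC_tmul, BC_tmul, R.B_Ad]

theorem BC_τ_self (a b : 𝔤₀) :
    - R.BC (R.τ ((1 : ℂ) ⊗ₜ[ℝ] a + Complex.I ⊗ₜ[ℝ] b)) ((1 : ℂ) ⊗ₜ[ℝ] a + Complex.I ⊗ₜ[ℝ] b)
      = ((- R.B (R.θ a) a - R.B (R.θ b) b : ℝ) : ℂ) := by
  simp only [map_add, LinearMap.add_apply, τ_tmul, BC_tmul, map_one, Complex.conj_I,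
    R.B_θ_comm b a, Complex.real_smul]
  push_cast
  linear_combination (R.B (R.θ b) b : ℂ) * Complex.I_mul_I

/-- The positive definite Hermitian form `-B(τ x, y)`. -/
@[reducible]
def herm : InnerProductSpace.Core ℂ (Complexification 𝔤₀) where
  inner x y := - R.BC (R.τ x) y
  conj_inner_symm x y := by
    rw [map_neg, ← R.BC_τ, R.τ_τ, R.BC_symm]
  re_inner_nonneg z := by
    obtain ⟨a, b, rfl⟩ := exists_eq_tmul_add_tmul z
    rw [BC_τ_self]
    have h : ∀ x, R.B (R.θ x) x ≤ 0 := fun x => by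
      by_cases hx : x = 0
      · rw [hx, map_zero]
      · exact (R.B_θ_self_neg hx).le
    have ha := h a
    have hb := h b
    change 0 ≤ - R.B (R.θ a) a - R.B (R.θ b) b
    linarith
  add_left x y z := by rw [map_add, map_add, LinearMap.add_apply, neg_add]
  smul_left x y a := by rw [τ_smul, map_smul, LinearMap.smul_apply, smul_eq_mul, mul_neg]
  definite z hz := by
    obtain ⟨a, b, rfl⟩ := exists_eq_tmul_add_tmul z
    have hz : - R.BC (R.τ _) _ = 0 := hz
    rw [BC_τ_self, Complex.ofReal_eq_zero] at hz
    have h : ∀ x, R.B (R.θ x) x ≤ 0 := fun x => by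
      by_cases hx : x = 0
      · rw [hx, map_zero]
      · exact (R.B_θ_self_neg hx).le
    have ha := h a
    have hb := h b
    have ha' : a = 0 := by
      by_contra h0
      have := R.B_θ_self_neg h0
      linarith
    have hb' : b = 0 := by
      by_contra h0
      have := R.B_θ_self_neg h0
      linarith
    rw [ha', hb', TensorProduct.tmul_zero, TensorProduct.tmul_zero, add_zero]

theorem isAdjoint_adEnd (x : Complexification 𝔤₀) :
    IsAdjoint R.herm (adEnd x) (-adEnd (R.τ x)) := fun y z => by
  change - R.BC _ _ = - R.BC _ (- adEnd (R.τ x) z)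
  rw [τ_lie, BC_lie, map_neg]

theorem herm_AdC (k : K) (x y : Complexification 𝔤₀) :
    R.herm.inner (R.AdC k x) (R.AdC k y) = R.herm.inner x y := by
  change - R.BC _ _ = - R.BC _ _
  rw [τ_AdC, BC_AdC]

theorem isAdjoint_AdC (k : K) : IsAdjoint R.herm (R.AdC k) (R.AdC k⁻¹) := fun y z => by
  have h : R.AdC k (R.AdC k⁻¹ z) = z := by
    rw [← Module.End.mul_apply, ← map_mul, mul_inv_cancel, map_one, Module.End.one_apply]
  conv_lhs => rw [← h]
  exact R.herm_AdC k _ _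

end ReductivePair

/-! ### Nilpotent radicals of parabolic subalgebras -/

section Radical

variable {𝔤 : Type u} [LieRing 𝔤] [LieAlgebra ℂ 𝔤] [FiniteDimensional ℂ 𝔤]
  {c : InnerProductSpace.Core ℂ 𝔤} {τ : 𝔤 → 𝔤}

theorem mem_span_lie_of_mem_nilRadical {𝔮 : LieSubalgebra ℂ 𝔤} {u : 𝔤} (hu : u ∈ nilRadical 𝔮) :
    u ∈ Submodule.span ℂ {z | ∃ x y : 𝔤, ⁅x, y⁆ = z} := by
  obtain ⟨h, hu⟩ := mem_nilRadical.1 hu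
  have hle : (⁅(⊤ : LieIdeal ℂ 𝔮), LieAlgebra.radical ℂ 𝔮⁆ : LieIdeal ℂ 𝔮).toSubmodule
      ≤ (Submodule.span ℂ {z | ∃ x y : 𝔤, ⁅x, y⁆ = z}).comap 𝔮.toSubmodule.subtype := by
    rw [LieSubmodule.lieIdeal_oper_eq_linear_span', Submodule.span_le]
    rintro _ ⟨x, -, y, -, rfl⟩
    exact Submodule.subset_span ⟨(x : 𝔤), (y : 𝔤), rfl⟩
  exact hle hu

/-- A central element which is a sum of brackets vanishes: the center is orthogonal to all
brackets. -/
theorem eq_zero_of_adEnd_eq_zero (hτ : ∀ x, IsAdjoint c (adEnd x) (-adEnd (τ x))) {u : 𝔤}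
    (hu : u ∈ Submodule.span ℂ {z | ∃ x y : 𝔤, ⁅x, y⁆ = z}) (h0 : adEnd u = 0) : u = 0 := by
  refine c.definite u ?_
  suffices h : ∀ z ∈ Submodule.span ℂ {z | ∃ x y : 𝔤, ⁅x, y⁆ = z}, c.inner z u = 0 from h u hu
  intro z hz
  induction hz using Submodule.span_induction with
  | mem z hz =>
    obtain ⟨x, y, rfl⟩ := hz
    refine (hτ x y u).trans ?_
    have h1 : (-adEnd (τ x)) u = 0 := by
      change -⁅τ x, u⁆ = 0
      rw [lie_skew]
      exact LinearMap.congr_fun h0 (τ x)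
    rw [h1, inner_zero_right]
  | zero => rw [← c.conj_inner_symm, inner_zero_right, map_zero]
  | add x y _ _ hx hy => rw [c.add_left, hx, hy, add_zero]
  | smul a x _ hx => rw [c.smul_left, hx, mul_zero]

theorem trace_adEnd_mul_eq_zero {𝔮 : LieSubalgebra ℂ 𝔤} {u x : 𝔤} (hu : u ∈ nilRadical 𝔮)
    (hx : x ∈ 𝔮) : LinearMap.trace ℂ 𝔤 (adEnd u * adEnd x) = 0 := by
  obtain ⟨h, hu⟩ := mem_nilRadical.1 hu
  exact trace_toEnd_mul_eq_zero (M := 𝔤) hu ⟨x, hx⟩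

/-- The form `tr(ad x · ad (τ y))` is the negative of the Frobenius inner product of `ad x` and
`ad y`. -/
theorem adEnd_eq_zero_of_trace (hτ : ∀ x, IsAdjoint c (adEnd x) (-adEnd (τ x))) {z : 𝔤}
    (h : LinearMap.trace ℂ 𝔤 (adEnd z * adEnd (τ z)) = 0) : adEnd z = 0 := by
  refine (hτ z).eq_zero_of_trace ?_
  rw [neg_mul, map_neg, LinearMap.trace_mul_comm, h, neg_zero]

/-- The nilpotent radical of `𝔮` contains no nonzero `z` with `τ z ∈ 𝔮`. -/
theorem eq_zero_of_mem_nilRadical (hτ : ∀ x, IsAdjoint c (adEnd x) (-adEnd (τ x)))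
    {𝔮 : LieSubalgebra ℂ 𝔤} {z : 𝔤} (hz : z ∈ nilRadical 𝔮) (hz' : τ z ∈ 𝔮) : z = 0 :=
  eq_zero_of_adEnd_eq_zero hτ (mem_span_lie_of_mem_nilRadical hz)
    (adEnd_eq_zero_of_trace hτ (trace_adEnd_mul_eq_zero hz hz'))

/-- The nilpotent radical of `𝔮` is contained in that of a smaller parabolic subalgebra `𝔭`. It is
contained in a Borel subalgebra of `𝔭`, and its component in a Levi factor `𝔪` of `𝔭` is orthogonal
to `𝔭` for the trace form. -/
theorem nilRadical_le_nilRadical (hτ : ∀ x, IsAdjoint c (adEnd x) (-adEnd (τ x)))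
    {𝔭 𝔮 : LieSubalgebra ℂ 𝔤} (hpar : IsParabolic 𝔭) (hle : 𝔭 ≤ 𝔮) {𝔪 : Submodule ℂ 𝔤}
    (h𝔪 : ∀ x ∈ 𝔪, τ x ∈ 𝔭) (hsup : 𝔭.toSubmodule ≤ 𝔪 ⊔ (nilRadical 𝔭).toSubmodule) {u : 𝔤}
    (hu : u ∈ nilRadical 𝔮) : u ∈ nilRadical 𝔭 := by
  obtain ⟨𝔟, hb, hmax⟩ := hpar
  obtain ⟨h, hu'⟩ := mem_nilRadical.1 hu
  have hup : u ∈ 𝔭 := hb (mem_of_mem_radical hmax (hb.trans hle) (x := ⟨u, h⟩)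
    (LieSubmodule.lie_le_right _ _ hu'))
  obtain ⟨z, hz, n, hn, rfl⟩ := Submodule.mem_sup.1 (hsup hup)
  have hn : n ∈ nilRadical 𝔭 := hn
  have h1 := trace_adEnd_mul_eq_zero hu (hle (h𝔪 z hz))
  rw [adEnd_add_left, add_mul, map_add, trace_adEnd_mul_eq_zero hn (h𝔪 z hz), add_zero] at h1
  have h2 : z ∈ Submodule.span ℂ {z | ∃ x y : 𝔤, ⁅x, y⁆ = z} := by
    have := Submodule.sub_mem _ (mem_span_lie_of_mem_nilRadical hu)
      (mem_span_lie_of_mem_nilRadical hn)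
    rwa [add_sub_cancel_right] at this
  rw [eq_zero_of_adEnd_eq_zero hτ h2 (adEnd_eq_zero_of_trace hτ h1), zero_add]
  exact hn

end Radical

/-! ### The filtration of a module by iterated brackets -/

section Filtration

variable {𝔤 : Type u} [LieRing 𝔤] [LieAlgebra ℂ 𝔤] (N U : Submodule ℂ 𝔤)

/-- The subspaces `U`, `[N, U]`, `[N, [N, U]]`, … -/
def bracketSeries : ℕ → Submodule ℂ 𝔤
  | 0 => U
  | i + 1 => Submodule.span ℂ {z | ∃ x ∈ N, ∃ y ∈ bracketSeries i, ⁅x, y⁆ = z}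

variable {N U}

theorem lie_mem_bracketSeries {i : ℕ} {x y : 𝔤} (hx : x ∈ N) (hy : y ∈ bracketSeries N U i) :
    ⁅x, y⁆ ∈ bracketSeries N U (i + 1) :=
  Submodule.subset_span ⟨x, hx, y, hy, rfl⟩

theorem bracketSeries_antitone (h : ∀ x ∈ N, ∀ y ∈ U, ⁅x, y⁆ ∈ U) :
    Antitone (bracketSeries N U) := by
  refine antitone_nat_of_succ_le fun i => ?_
  induction i with
  | zero =>
    refine Submodule.span_le.2 ?_
    rintro _ ⟨x, hx, y, hy, rfl⟩
    exact h x hx y hy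
  | succ i ih =>
    refine Submodule.span_le.2 ?_
    rintro _ ⟨x, hx, y, hy, rfl⟩
    exact lie_mem_bracketSeries hx (ih hy)

theorem derivation_mem_bracketSeries {A : Module.End ℂ 𝔤}
    (hA : ∀ x y, A ⁅x, y⁆ = ⁅A x, y⁆ + ⁅x, A y⁆) (hN : ∀ x ∈ N, A x ∈ N) (hU : ∀ x ∈ U, A x ∈ U)
    (i : ℕ) : ∀ y ∈ bracketSeries N U i, A y ∈ bracketSeries N U i := by
  induction i with
  | zero => exact hU
  | succ i ih =>
    suffices h : bracketSeries N U (i + 1) ≤ (bracketSeries N U (i + 1)).comap A from h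
    refine Submodule.span_le.2 ?_
    rintro _ ⟨x, hx, y, hy, rfl⟩
    change A ⁅x, y⁆ ∈ bracketSeries N U (i + 1)
    rw [hA]
    exact add_mem (lie_mem_bracketSeries (hN x hx) hy) (lie_mem_bracketSeries hx (ih y hy))

theorem hom_mem_bracketSeries {A : Module.End ℂ 𝔤} (hA : ∀ x y, A ⁅x, y⁆ = ⁅A x, A y⁆)
    (hN : ∀ x ∈ N, A x ∈ N) (hU : ∀ x ∈ U, A x ∈ U) (i : ℕ) :
    ∀ y ∈ bracketSeries N U i, A y ∈ bracketSeries N U i := by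
  induction i with
  | zero => exact hU
  | succ i ih =>
    suffices h : bracketSeries N U (i + 1) ≤ (bracketSeries N U (i + 1)).comap A from h
    refine Submodule.span_le.2 ?_
    rintro _ ⟨x, hx, y, hy, rfl⟩
    change A ⁅x, y⁆ ∈ bracketSeries N U (i + 1)
    rw [hA]
    exact lie_mem_bracketSeries (hN x hx) (ih y hy)

/-- The nilpotent radical of `𝔭` acts nilpotently on `𝔤`. -/
theorem exists_bracketSeries_eq_bot [FiniteDimensional ℂ 𝔤] {𝔭 : LieSubalgebra ℂ 𝔤}
    (hN : ∀ x ∈ N, x ∈ nilRadical 𝔭) : ∃ k, bracketSeries N U k = ⊥ := by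
  obtain ⟨k, hk⟩ := exists_lcs_eq_bot 𝔭 𝔤
  refine ⟨k, ?_⟩
  suffices key : ∀ i, ∀ y ∈ bracketSeries N U i,
      y ∈ (⁅(⊤ : LieIdeal ℂ 𝔭), LieAlgebra.radical ℂ 𝔭⁆ : LieIdeal ℂ 𝔭).lcs 𝔤 i by
    refine eq_bot_iff.2 fun y hy => ?_
    have := key k y hy
    rwa [hk, LieSubmodule.mem_bot] at this
  intro i
  induction i with
  | zero => exact fun y _ => LieSubmodule.mem_top y
  | succ i ih =>
    suffices h : bracketSeries N U (i + 1) ≤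
        ((⁅(⊤ : LieIdeal ℂ 𝔭), LieAlgebra.radical ℂ 𝔭⁆ : LieIdeal ℂ 𝔭).lcs 𝔤 (i + 1)).toSubmodule
      from h
    refine Submodule.span_le.2 ?_
    rintro _ ⟨x, hx, y, hy, rfl⟩
    obtain ⟨h, hx⟩ := mem_nilRadical.1 (hN x hx)
    rw [LieIdeal.lcs_succ]
    exact LieSubmodule.lie_mem_lie (x := (⟨x, h⟩ : 𝔭)) hx (ih y hy)

end Filtration

/-! ### The grading of a filtered space -/

section Grading

variable {W : Type u} [AddCommGroup W] [Module ℂ W] [FiniteDimensional ℂ W]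

/-- A descending chain of commuting projections `p 0 = 1, p 1, …, p N = 0` has a basis of joint
eigenvectors; a basis vector `e k` in the image of `p d` and in the kernel of `p (d + 1)` has the
degree `d`. -/
theorem exists_basis_of_projections (p : ℕ → Module.End ℂ W) {N : ℕ} (h0 : p 0 = 1) (hN : p N = 0)
    (hp : ∀ i j, i ≤ j → ∀ v, p i (p j v) = p j v) (hp' : ∀ i j, i ≤ j → ∀ v, p j (p i v) = p j v) :
    ∃ (ι : Type u) (_ : Finite ι) (e : Module.Basis ι ℂ W) (deg : ι → ℕ),
      (∀ k, p (deg k) (e k) = e k) ∧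
      (∀ k, (∑ i ∈ Finset.range N, p (i + 1)) (e k) = (deg k : ℂ) • e k) ∧
      ∀ d y, p (d + 1) y = y → ∀ j, deg j ≤ d → e.repr y j = 0 := by
  classical
  let S : Set W := {v | ∃ d, p d v = v ∧ p (d + 1) v = 0}
  have hS : ⊤ ≤ Submodule.span ℂ S := by
    intro v _
    have h1 : ∑ d ∈ Finset.range N, (p d v - p (d + 1) v) = v := by
      rw [Finset.sum_range_sub' fun d => p d v, h0, hN, LinearMap.zero_apply, sub_zero,
        Module.End.one_apply]
    rw [← h1]
    refine Submodule.sum_mem _ fun d _ => Submodule.subset_span ⟨d, ?_, ?_⟩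
    · rw [map_sub, hp d d le_rfl, hp d (d + 1) (Nat.le_succ d)]
    · rw [map_sub, hp' d (d + 1) (Nat.le_succ d), hp _ _ le_rfl, sub_self]
  let e := Module.Basis.ofSpan hS
  have he : ∀ k, e k ∈ S := fun k => Module.Basis.ofSpan_subset hS ⟨k, rfl⟩
  choose deg hdeg hdeg' using he
  have h1 : ∀ k j, j ≤ deg k → p j (e k) = e k := fun k j hj => by
    rw [← hdeg k, hp j _ hj]
  have h2 : ∀ k j, deg k < j → p j (e k) = 0 := fun k j hj => by
    rw [← hp' (deg k + 1) j hj, hdeg', map_zero]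
  have hlt : ∀ k, deg k < N := fun k => by
    by_contra h
    refine e.ne_zero k ?_
    rw [← h1 k N (not_lt.1 h), hN, LinearMap.zero_apply]
  refine ⟨(linearIndepOn_empty ℂ id).extend (Set.empty_subset S), Module.Finite.finite_basis e, e,
    deg, hdeg, fun k => ?_, fun d y hy j hj => ?_⟩
  · rw [LinearMap.sum_apply, ← Finset.sum_range_add_sum_Ico _ (hlt k).le,
      Finset.sum_congr rfl fun i hi => h1 k (i + 1) (Finset.mem_range.1 hi),
      Finset.sum_eq_zero fun i hi => h2 k (i + 1) (Nat.lt_succ_of_le (Finset.mem_Ico.1 hi).1),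
      add_zero, Finset.sum_const, Finset.card_range, Nat.cast_smul_eq_nsmul]
  · have h3 : e.coord j ∘ₗ p (d + 1) = 0 := e.ext fun k => by
      rw [LinearMap.comp_apply, LinearMap.zero_apply]
      by_cases hk : deg k ≤ d
      · rw [h2 k _ (Nat.lt_succ_of_le hk), map_zero]
      · rw [h1 k _ (not_le.1 hk), Module.Basis.coord_apply, Module.Basis.repr_self,
          Finsupp.single_eq_of_ne]
        rintro rfl
        exact hk hj
    rw [← hy]
    exact LinearMap.congr_fun h3 y

end Grading

/-! ### The grading of the nilpotent radical -/

theorem IsAdjoint.symm {V : Type*} [AddCommGroup V] [Module ℂ V] {c : InnerProductSpace.Core ℂ V}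
    {A A' : Module.End ℂ V} (h : IsAdjoint c A A') : IsAdjoint c A' A := fun x y => by
  rw [← c.conj_inner_symm, ← h, c.conj_inner_symm]

section Tower

variable {𝔩 : Type u} {M : Type*} {𝔤 : Type u} {K : Type*} {𝔪 : Type*} {J : Type*}
  [LieRing 𝔩] [LieAlgebra ℂ 𝔩] [Group M] [TopologicalSpace M] [IsTopologicalGroup M]
  [LieRing 𝔤] [LieAlgebra ℂ 𝔤] [Group K] [TopologicalSpace K] [IsTopologicalGroup K]
  [LieRing 𝔪] [LieAlgebra ℂ 𝔪] [Group J] [TopologicalSpace J] [IsTopologicalGroup J]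
  [FiniteDimensional ℂ 𝔤] [FiniteDimensional ℂ 𝔩]
  {P : LiePair 𝔤 K} {P₁ : LiePair 𝔩 M} {P₂ : LiePair 𝔪 J}

/-- The filtration of the nilpotent algebra `𝔲` of `D` by the iterated brackets with the nilpotent
algebra `𝔫` of `D'` is the filtration of a grading, which is given by the eigenspaces of an
endomorphism of the `(𝔪, J)`-module `𝔲`: the orthogonal projections to the steps of the filtration
commute with the actions of `𝔪` and `J`, as these are closed under adjoints. -/
theorem CohDatum.exists_grading (D : CohDatum P₁ P) (D' : CohDatum P₂ P₁)
    {c : InnerProductSpace.Core ℂ 𝔤} {τ : 𝔤 → 𝔤}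
    (hτ : ∀ x, IsAdjoint c (adEnd x) (-adEnd (τ x)))
    (hτ' : ∀ z, ∃ z', D.φ (D'.φ z') = τ (D.φ (D'.φ z)))
    (hK : ∀ k, IsAdjoint c (P.Ad k) (P.Ad k⁻¹)) {𝔭 : LieSubalgebra ℂ 𝔤}
    (h𝔭 : ∀ x ∈ D'.𝔲, D.φ x ∈ nilRadical 𝔭) :
    ∃ (E : HCHom (D'.restrict D.nil) (D'.restrict D.nil)) (ι : Type u) (_ : Finite ι)
      (e : Module.Basis ι ℂ D.nil) (deg : ι → ℕ),
      (∀ i, CohDatum.endRestrict E (e i) = (deg i : ℂ) • e i) ∧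
      ∀ y ∈ D'.𝔲, ∀ i j, deg j ≤ deg i → e.repr (D.nil.rep y (e i)) j = 0 := by
  let N : Submodule ℂ 𝔤 := D'.𝔲.toSubmodule.map (D.φ : 𝔩 →ₗ[ℂ] 𝔤)
  have hN : ∀ x ∈ D'.𝔲, D.φ x ∈ N := fun x hx => ⟨x, hx, rfl⟩
  have hNU : ∀ x ∈ N, ∀ y ∈ D.𝔲.toSubmodule, ⁅x, y⁆ ∈ D.𝔲.toSubmodule := by
    rintro _ ⟨x, -, rfl⟩ y hy
    exact D.lie_mem x y hy
  let S := bracketSeries N D.𝔲.toSubmodule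
  have hS : Antitone S := bracketSeries_antitone hNU
  obtain ⟨k, hk⟩ := exists_bracketSeries_eq_bot (N := N) (U := D.𝔲.toSubmodule) (𝔭 := 𝔭) (by
    rintro _ ⟨x, hx, rfl⟩
    exact h𝔭 x hx)
  have hS𝔪 : ∀ z i, ∀ y ∈ S i, ⁅D.φ (D'.φ z), y⁆ ∈ S i := fun z =>
    derivation_mem_bracketSeries (A := adEnd (D.φ (D'.φ z))) (fun x y => leibniz_lie _ x y)
      (by
        rintro _ ⟨x, hx, rfl⟩
        exact ⟨⁅D'.φ z, x⁆, D'.lie_mem z x hx, LieHom.map_lie D.φ _ _⟩)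
      (fun x hx => D.lie_mem (D'.φ z) x hx)
  have hSJ : ∀ m i, ∀ y ∈ S i, P.Ad (D.ψ (D'.ψ m)) y ∈ S i := fun m =>
    hom_mem_bracketSeries (fun x y => P.Ad_lie _ x y)
      (by
        rintro _ ⟨x, hx, rfl⟩
        exact ⟨P₁.Ad (D'.ψ m) x, D'.Ad_mem m x hx, D.φ_Ad _ _⟩)
      (fun x hx => D.Ad_mem (D'.ψ m) x hx)
  choose pr hpr using fun i => exists_isOrthogonalProjection c (S i)
  have hmem : ∀ i x, pr i x ∈ D.𝔲.toSubmodule := fun i x => hS (Nat.zero_le i) ((hpr i).mem x)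
  let p : ℕ → Module.End ℂ D.𝔲 := fun i => (pr i).restrict fun x _ => hmem i x
  have hp𝔪 : ∀ z i v, p i (D.adRep (D'.φ z) v) = D.adRep (D'.φ z) (p i v) := fun z i v => by
    refine Subtype.ext ((hpr i).comm (A := adEnd (D.φ (D'.φ z))) (hτ _).symm (hS𝔪 z i)
      (fun s hs => ?_) v)
    obtain ⟨z', hz'⟩ := hτ' z
    rw [← hz']
    exact neg_mem (hS𝔪 z' i s hs)
  have hpJ : ∀ m i v, p i (D.adAct (D'.ψ m) v) = D.adAct (D'.ψ m) (p i v) := fun m i v => by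
    refine Subtype.ext ((hpr i).comm (hK _).symm (hSJ m i) (fun s hs => ?_) v)
    rw [← map_inv, ← map_inv]
    exact hSJ m⁻¹ i s hs
  obtain ⟨ι, hι, e, deg, h1, h2, h3⟩ := exists_basis_of_projections p (N := k)
    (LinearMap.ext fun v => Subtype.ext ((hpr 0).apply_eq_self v.2))
    (LinearMap.ext fun v => Subtype.ext ((Submodule.mem_bot ℂ).1 (hk ▸ (hpr k).mem (v : 𝔤))))
    (fun i j hij v => Subtype.ext ((hpr i).apply_eq_self (hS hij ((hpr j).mem _))))
    (fun i j hij v => Subtype.ext ((hpr j).apply_apply_of_le (hpr i) (hS hij) _))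
  have hsum : ∀ A : Module.End ℂ D.𝔲, (∀ i v, p i (A v) = A (p i v)) → ∀ v,
      (∑ i ∈ Finset.range k, p (i + 1)) (A v) = A ((∑ i ∈ Finset.range k, p (i + 1)) v) := by
    intro A hA v
    rw [LinearMap.sum_apply, LinearMap.sum_apply, map_sum]
    exact Finset.sum_congr rfl fun i _ => hA _ v
  -- the sum of the projections to the steps `i ≥ 1` has the eigenvalue `d` in degree `d`
  refine ⟨⟨∑ i ∈ Finset.range k, p (i + 1), fun z v => ?_, fun m v => ?_⟩, ι, hι, e, deg, h2,
    fun y hy i j hij => ?_⟩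
  · exact hsum _ (hp𝔪 z) v
  · exact hsum _ (hpJ m) v
  · refine h3 (deg i) _ (Subtype.ext ((hpr _).apply_eq_self ?_)) j hij
    have h4 : pr (deg i) (e i : D.𝔲) = (e i : D.𝔲) := congrArg Subtype.val (h1 i)
    exact lie_mem_bracketSeries (hN y hy)
      ((congrArg (fun x => x ∈ S (deg i)) h4).mp ((hpr _).mem _))

end Tower

namespace ReductivePair

variable {E : Type*} [NormedAddCommGroup E] [NormedSpace ℝ E] [FiniteDimensional ℝ E]
  {K : Type*} [TopologicalSpace K] [ChartedSpace E K] [Group K]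
  [LieGroup 𝓘(ℝ, E) ((⊤ : ℕ∞) : WithTop ℕ∞) K] [IsTopologicalGroup K] [CompactSpace K]
  [T2Space K] {𝔤₀ : Type u} [LieRing 𝔤₀] [LieAlgebra ℝ 𝔤₀] [FiniteDimensional ℝ 𝔤₀]
  (R : ReductivePair E 𝔤₀ K) {𝔮 𝔭 : LieSubalgebra ℂ (Complexification 𝔤₀)}

/-! ### Towers of germane parabolic subalgebras -/

theorem τ_mem_levi {z : Complexification 𝔤₀} (hz : z ∈ R.levi 𝔮) : R.τ z ∈ R.levi 𝔮 := by
  replace hz : z ∈ (R.levi₀ 𝔮).toSubmodule.baseChange ℂ := hz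
  rw [Submodule.baseChange_eq_span] at hz
  induction hz using Submodule.span_induction with
  | mem z hz =>
    obtain ⟨x, hx, rfl⟩ := hz
    have : R.τ ((1 : ℂ) ⊗ₜ[ℝ] x) = (1 : ℂ) ⊗ₜ[ℝ] R.θ x := by rw [τ_tmul, map_one]
    refine this ▸ tmul_mem_complexify (𝔩₀ := R.levi₀ 𝔮) ⟨hx.2, ?_⟩
    rw [R.θ_θ]
    exact hx.1
  | zero => rw [map_zero]; exact zero_mem _
  | add x y _ _ hx hy => rw [map_add]; exact add_mem hx hy
  | smul a x _ hx => rw [τ_smul]; exact (R.levi 𝔮).smul_mem _ hx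

variable {R}

/-- A germane parabolic subalgebra is the sum of its Levi factor and its nilpotent radical. -/
theorem IsGermane.le_sup (h : R.IsGermane 𝔮) :
    𝔮.toSubmodule ≤ (R.levi 𝔮).toSubmodule ⊔ (nilRadical 𝔮).toSubmodule := by
  obtain ⟨-, 𝔩₀, hθ, -, hsup⟩ := h
  have hle : ∀ x ∈ 𝔩₀, (1 : ℂ) ⊗ₜ[ℝ] x ∈ 𝔮 := fun x hx =>
    hsup.le (Submodule.mem_sup_left (tmul_mem_complexify hx))
  rw [← hsup]
  refine sup_le_sup_right (fun z hz => ?_) _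
  exact complexify_le (S := (R.levi 𝔮).toSubmodule) (fun x hx =>
    tmul_mem_complexify (𝔩₀ := R.levi₀ 𝔮) ⟨hle x hx, hle _ (hθ x hx)⟩) hz

/-- The nilpotent radical of `𝔭` is the semidirect product of `𝔫 ∩ 𝔩` and the nilpotent radical of
`𝔮`. -/
theorem isTower (hq : R.IsGermane 𝔮) (hp : R.IsGermane 𝔭) (hpq : 𝔭 ≤ 𝔮)
    (hML : R.leviGroup 𝔭 ≤ R.leviGroup 𝔮) :
    CohDatum.IsTower (R.datum 𝔮) (R.relDatum hpq hML) (R.datum 𝔭) := by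
  have hnil : ∀ y ∈ nilRadical 𝔮, y ∈ nilRadical 𝔭 := fun y hy =>
    nilRadical_le_nilRadical R.isAdjoint_adEnd hp.1 hpq
      (fun x hx => R.levi_le (R.τ_mem_levi hx)) hp.le_sup hy
  refine ⟨fun _ => rfl, fun _ => rfl, fun x hx => hx, hnil, fun z hz => ?_, fun x _ hx => ?_⟩
  · obtain ⟨x, hx, y, hy, h⟩ := Submodule.mem_sup.1 (hq.le_sup (hpq (mem_nilRadical.1 hz).1))
    have hz : z ∈ nilRadical 𝔭 := hz
    have hxn : x ∈ nilRadical 𝔭 := by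
      rw [eq_sub_of_add_eq h]
      exact sub_mem hz (hnil y hy)
    exact ⟨⟨x, hx⟩, hxn, y, hy, h.symm⟩
  · exact Subtype.ext (eq_zero_of_mem_nilRadical R.isAdjoint_adEnd hx
      (R.levi_le (R.τ_mem_levi x.2)))

end ReductivePair

end RelChar

end

theorem proposition1p6 {E : Type*} [NormedAddCommGroup E] [NormedSpace ℝ E]
    [FiniteDimensional ℝ E] {K : Type*} [TopologicalSpace K] [ChartedSpace E K] [Group K]
    [LieGroup 𝓘(ℝ, E) ((⊤ : ℕ∞) : WithTop ℕ∞) K] [IsTopologicalGroup K] [CompactSpace K]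
    [T2Space K] {𝔤₀ : Type u} [LieRing 𝔤₀] [LieAlgebra ℝ 𝔤₀] [FiniteDimensional ℝ 𝔤₀]
    (R : RelChar.ReductivePair E 𝔤₀ K)
    {𝔮 𝔭 : LieSubalgebra ℂ (RelChar.Complexification 𝔤₀)}
    (hq : R.IsGermane 𝔮) (hp : R.IsGermane 𝔭)
    (hpq : 𝔭 ≤ 𝔮) (hML : R.leviGroup 𝔭 ≤ R.leviGroup 𝔮)
    (catG : RelChar.HCModule.{u} R.pair → Prop)
    (catL : RelChar.HCModule.{u} (R.leviPair 𝔮) → Prop)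
    (catM : RelChar.HCModule.{u} (R.leviPair 𝔭) → Prop)
    (h : RelChar.IsAdmissiblePair (R.datum 𝔮) catG catL)
    (h' : RelChar.IsAdmissiblePair (R.relDatum hpq hML) catL catM)
    (h'' : RelChar.IsAdmissiblePair (R.datum 𝔭) catG catM)
    (KG : AddSubgroup (RelChar.GrothendieckGroup catG))
    (KL : AddSubgroup (RelChar.GrothendieckGroup catL))
    (KM : AddSubgroup (RelChar.GrothendieckGroup catM))
    (Q : RelChar.IsAdmissibleQuadruple h KG KL)
    (Q' : RelChar.IsAdmissibleQuadruple h' KL KM)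
    (Q'' : RelChar.IsAdmissibleQuadruple h'' KG KM) :
    ∃ e : Q.CharGroup →+ Q''.CharGroup,
      RelChar.IsNaturalExtension Q Q' Q'' e ∧
      (∀ e' : Q.CharGroup →+ Q''.CharGroup, RelChar.IsNaturalExtension Q Q' Q'' e' → e' = e) ∧
      ∀ X : KG, Q''.char X = e (Q.char X) := by
  obtain ⟨E, ι, _, e, deg, hE, hσ⟩ := (R.datum 𝔮).exists_grading (R.relDatum hpq hML)
    R.isAdjoint_adEnd (fun z => ⟨⟨R.τ z, R.τ_mem_levi z.2⟩, rfl⟩) R.isAdjoint_AdC (𝔭 := 𝔭)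
    fun _ hx => hx
  exact (RelChar.ReductivePair.isTower hq hp hpq hML).existsUnique_isNaturalExtension hE hσ Q Q' Q''
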